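/- Let $k$ be an algebraically closed field of characteristic $p$, where $p=0$ or $p\ge 7$. Let $\mathcal A_5$ be the alternating group on five letters, with generators $x_2,x_3,x_5$ satisfying $x_2^2=x_3^3=x_5^5=x_2x_3x_5=1$, and let $\iota$ denote any automorphism of order $2$ of $\mathcal A_5$ such that $\iota(x_2),\iota(x_3),\iota(x_5)$ are conjugate to $x_2,x_3,x_5^2$ respectively. For $m\ge 4$ let $G=PSO_{2m}(k)=SO_{2m}(k)/\{\pm1\}$, the simple adjoint algebraic group of type $D_m$ over $k$. A homomorphism $\psi:\mathcal A_5\to G$ is called regular if $Z_G(\psi(\mathcal A_5))/Z_G$ is finite; homomorphisms are considered up to $G$-conjugacy. A ${}_{235}$-triple is a triple $(C_2,C_3,C_5)$ of conjugacy classes of $G$ such that $g_n^n=1$ for $g_n\in C_n$ ($n=2,3,5$). It is called regular if $\nu(G)-\sum_{n=2,3,5}\nu(Z_G^0(g_n))=r(G)$, where $\nu$ is half the number of roots and $r$ is the rank. Its type is $(X_2,X_3,X_5)$, where $X_n$ is the type of the root system of $Z^0_G(g_n)$. The homomorphism $\psi$ gives rise to the triple of conjugacy classes of $\psi(x_2),\psi(x_3),\psi(x_5)$.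 The automorphism $\iota$ acts on homomorphisms by $\psi\mapsto\psi\circ\iota$ and on triples by $(C_2,C_3,C_5)\mapsto(C_2,C_3,\{g^2: g\in C_5\})$. We say that $\psi$ comes from an orthogonal representation $d_1+\dots+d_s$ if it is the composition of a homomorphism $\mathcal A_5\to SO_{2m}(k)$ with $SO_{2m}(k)\to G$ and the resulting $2m$-dimensional representation of $\mathcal A_5$ is a direct sum of irreducible representations of degrees $d_1,\dots,d_s$. (a) If $m=4$, then $G$ has exactly four regular ${}_{235}$-triples: two of type $(A_1^4,A_1^3,A_1)$, interchanged by $\iota$, and two of type $(A_1^4,A_2,A_1)$, interchanged by $\iota$. Correspondingly there are exactly four regular homomorphisms $\mathcal A_5\to G$ up to conjugacy, one giving rise to each regular triple: those for the first two triples come from orthogonal representations $1+3+4$ and are interchanged by $\iota$; those for the last two come from orthogonal representations $3+5$ and are interchanged by $\iota$. (b) If $m=5$, then $G$ has exactly one regular ${}_{235}$-triple; it has type $(A_3A_1^2,A_2A_1^2,A_1^2)$. There are exactly two regular homomorphisms up to conjugacy (both giving rise to this triple); one comes from an orthogonal representation $3+3+4$, the other from an orthogonal representation $1+4+5$. (c)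 If $m=6$, then $G$ has exactly three regular ${}_{235}$-triples: one of type $(A_3^2,A_3A_1^2,A_1^4)$ and two of type $(A_3^2,A_3A_1^2,A_2A_1)$, interchanged by $\iota$. Correspondingly there are exactly three regular homomorphisms up to conjugacy, one giving rise to each regular triple: the one for the first triple comes from an orthogonal representation $1+3+3+5$; those for the other two come from orthogonal representations $3+4+5$ and are interchanged by $\iota$. (d) If $m=8$, then $G$ has exactly one regular ${}_{235}$-triple; it has type $(D_4^2,A_4A_3,A_2^2A_1^2)$. There is exactly one regular homomorphism up to conjugacy (giving rise to this triple); it comes from an orthogonal representation $1+3+3+4+5$. (e) If $m=7$ or $m\ge 9$, then $G$ has no regular ${}_{235}$-triples and there are no regular homomorphisms $\mathcal A_5\to G$. In all cases every regular homomorphism $\mathcal A_5\to G$ comes from a homomorphism $\mathcal A_5\to SO_{2m}(k)$. -/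

import Mathlib

open Matrix

noncomputable section

/-! ### Linear algebraic groups: Lie algebra, tori, roots

Throughout, a linear algebraic group over an algebraically closed field `k` is a Zariski closed
subgroup of `GL_n(k)`. -/

section AlgebraicGroups

variable {k : Type*} [Field k] {n : ℕ}

/-- The Lie algebra of a Zariski closed subgroup `H` of `GL_n(k)`: the matrices `X` that are
annihilated by the differentials at `1` of all polynomials vanishing on `H`, that is, the tangent
space at `1`. It depends only on the identity component of `H`. -/
def lieAlg (H : Subgroup (GL (Fin n) k)) : Submodule k (Matrix (Fin n) (Fin n) k) where
  carrier := {X | ∀ P : MvPolynomial (Fin n × Fin n) k,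
    (∀ h ∈ H, MvPolynomial.eval (fun e => (h : Matrix (Fin n) (Fin n) k) e.1 e.2) P = 0) →
    ∑ e : Fin n × Fin n, MvPolynomial.eval
      (fun e => (1 : Matrix (Fin n) (Fin n) k) e.1 e.2) (MvPolynomial.pderiv e P) * X e.1 e.2 = 0}
  zero_mem' := by intro P _; simp
  add_mem' := by
    intro X Y hX hY P hP
    simp only [Matrix.add_apply, mul_add, Finset.sum_add_distrib, hX P hP, hY P hP, add_zero]
  smul_mem' := by
    intro c X hX P hP
    have h := congrArg (fun z => c * z) (hX P hP)
    simp only [Finset.mul_sum, mul_zero] at h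
    rw [← h]
    refine Finset.sum_congr rfl fun e _ => ?_
    simp only [Matrix.smul_apply, smul_eq_mul]
    ring

/-- A torus in `GL_n(k)`: the image of a homomorphism of algebraic groups `(kˣ)^r → GL_n(k)`
(a group homomorphism whose matrix entries are Laurent polynomials in the coordinates). -/
def IsTorus (T : Subgroup (GL (Fin n) k)) : Prop :=
  ∃ (r : ℕ) (f : (Fin r → kˣ) →* GL (Fin n) k),
    (∀ i j, ∃ c : (Fin r → ℤ) →₀ k, ∀ s : Fin r → kˣ,
      (f s : Matrix (Fin n) (Fin n) k) i j =
        c.sum fun a x => x * ∏ l, ((s l ^ a l : kˣ) : k)) ∧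
    T = f.range

/-- `T` is a maximal torus of `H`. Since tori are connected, the maximal tori of `H` are those of
its identity component. -/
def IsMaximalTorusOf (T H : Subgroup (GL (Fin n) k)) : Prop :=
  Maximal (fun S => IsTorus S ∧ S ≤ H) T

/-- A choice of maximal torus of `H` (all of them are conjugate under the identity component). -/
def maxTorus (H : Subgroup (GL (Fin n) k)) : Subgroup (GL (Fin n) k) :=
  Classical.epsilon fun T => IsMaximalTorusOf T H

/-- The characters of `T`, written additively. -/
abbrev Characters (T : Subgroup (GL (Fin n) k)) : Type _ := Additive (T →* kˣ)

/-- The roots of the identity component of `H` with respect to its chosen maximal torus `T`: the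
nontrivial characters of `T` that occur in the adjoint action of `T` on the Lie algebra of `H`. -/
def rootSet (H : Subgroup (GL (Fin n) k)) : Set (Characters (maxTorus H)) :=
  {χ | χ ≠ 0 ∧ ∃ X ∈ lieAlg H, X ≠ 0 ∧ ∀ t : maxTorus H,
    ((t : GL (Fin n) k) : Matrix (Fin n) (Fin n) k) * X *
      (((t : GL (Fin n) k)⁻¹ : GL (Fin n) k) : Matrix (Fin n) (Fin n) k) =
      ((χ.toMul t : kˣ) : k) • X}

/-- The rank of `H`: the dimension of a maximal torus. -/
def algRank (H : Subgroup (GL (Fin n) k)) : ℕ := Module.finrank k (lieAlg (maxTorus H))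

end AlgebraicGroups

/-! ### Root systems up to isomorphism -/

/-- Isomorphism of root systems: an isomorphism of root lattices taking roots to roots. -/
def RootIso {X Y : Type*} [AddCommGroup X] [AddCommGroup Y] (Φ : Set X) (Ψ : Set Y) : Prop :=
  ∃ f : AddSubgroup.closure Φ ≃+ AddSubgroup.closure Ψ, ∀ x : AddSubgroup.closure Φ, (x : X) ∈ Φ ↔ (f x : Y) ∈ Ψ

/-- The root system of type `A_r`. -/
def rootsA (r : ℕ) : Set (Fin (r + 1) → ℤ) :=
  {x | ∃ i j, i ≠ j ∧ x = Pi.single i 1 - Pi.single j 1}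

/-- The root system of type `D_r`. -/
def rootsD (r : ℕ) : Set (Fin r → ℤ) :=
  {x | ∃ i j, i ≠ j ∧ ∃ a b : ℤˣ, x = Pi.single i (a : ℤ) + Pi.single j (b : ℤ)}

/-- The direct sum of two root systems. -/
def rootSum {X Y : Type*} [AddCommGroup X] [AddCommGroup Y] (Φ : Set X) (Ψ : Set Y) :
    Set (X × Y) :=
  {z | (z.1 ∈ Φ ∧ z.2 = 0) ∨ (z.1 = 0 ∧ z.2 ∈ Ψ)}

infixr:65 " ⊞ " => rootSum

/-! ### The alternating group `𝒜₅` -/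

/-- The alternating group on five letters. -/
abbrev Alt5 : Type := alternatingGroup (Fin 5)

/-- The generator `x₂` of order `2`. -/
def x2 : Alt5 := ⟨Equiv.swap 0 1 * Equiv.swap 2 3, Equiv.Perm.mem_alternatingGroup.2 (by decide)⟩

/-- The generator `x₃` of order `3`. -/
def x3 : Alt5 := ⟨Equiv.swap 0 2 * Equiv.swap 2 4, Equiv.Perm.mem_alternatingGroup.2 (by decide)⟩

/-- The generator `x₅` of order `5`. -/
def x5 : Alt5 := (x2 * x3)⁻¹

theorem alt5_relations : x2 ^ 2 = 1 ∧ x3 ^ 3 = 1 ∧ x5 ^ 5 = 1 ∧ x2 * x3 * x5 = 1 :=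
  ⟨Subtype.ext (by decide), Subtype.ext (by decide), Subtype.ext (by decide), mul_inv_cancel _⟩

/-- The outer involutions `ι` of `𝒜₅`: they fix the classes of `x₂`, `x₃` and take `x₅` into the
class of `x₅²`. -/
def IsIota (ι : MulAut Alt5) : Prop :=
  orderOf ι = 2 ∧ IsConj (ι x2) x2 ∧ IsConj (ι x3) x3 ∧ IsConj (ι x5) (x5 ^ 2)

/-! ### The adjoint group of type `D_m` -/

section TypeD

variable (m : ℕ) (k : Type*) [Field k]

/-- The group `SO_{2m}(k)`. -/
abbrev SO2 : Type _ := Matrix.specialOrthogonalGroup (Fin (2 * m)) k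

/-- The adjoint group of type `D_m`: the quotient of `SO_{2m}(k)` by its centre. -/
abbrev PSO : Type _ := SO2 m k ⧸ Subgroup.center (SO2 m k)

/-- The natural homomorphism `SO_{2m}(k) → PSO_{2m}(k)`. -/
abbrev proj : SO2 m k →* PSO m k := QuotientGroup.mk' (Subgroup.center (SO2 m k))

/-- The inclusion of `SO_{2m}(k)` into `GL_{2m}(k)`. -/
def soToGL : SO2 m k →* GL (Fin (2 * m)) k :=
  MonoidHom.toHomUnits (Matrix.specialOrthogonalGroup (Fin (2 * m)) k).subtype

variable {m k}

/-- The inverse image in `SO_{2m}(k) ⊆ GL_{2m}(k)` of a subgroup `H` of `PSO_{2m}(k)`. The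
projection `SO_{2m} → PSO_{2m}` is a central isogeny with kernel `{±1}`, of order invertible in
`k`, so `H` and its inverse image have the same root system and the same rank. -/
def preimageGL (H : Subgroup (PSO m k)) : Subgroup (GL (Fin (2 * m)) k) :=
  (H.comap (proj m k)).map (soToGL m k)

/-- The number `ν` of positive roots (half the number of roots) of the identity component of a
closed subgroup of `PSO_{2m}(k)`. -/
def nu (H : Subgroup (PSO m k)) : ℕ := (rootSet (preimageGL H)).ncard / 2

/-- The centralizer `Z_G(g)` of an element of `G = PSO_{2m}(k)`. -/
abbrev cent (g : PSO m k) : Subgroup (PSO m k) := Subgroup.centralizer {g}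

variable (m k) in
/-- A triple `(C₂, C₃, C₅)` of conjugacy classes of `G = PSO_{2m}(k)`. -/
@[ext]
structure ClassTriple where
  C2 : ConjClasses (PSO m k)
  C3 : ConjClasses (PSO m k)
  C5 : ConjClasses (PSO m k)

/-- A `235`-triple: elements of `C_n` satisfy `g ^ n = 1`. -/
def ClassTriple.Is235 (C : ClassTriple m k) : Prop :=
  (∀ g ∈ C.C2.carrier, g ^ 2 = 1) ∧ (∀ g ∈ C.C3.carrier, g ^ 3 = 1) ∧
    (∀ g ∈ C.C5.carrier, g ^ 5 = 1)

/-- A regular `235`-triple: `ν(G) - ∑ ν(Z_G⁰(g_n)) = r(G)` (the group `G = PSO_{2m}(k)` is adjoint,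
so that `G = G_ad`). -/
def ClassTriple.IsRegular (C : ClassTriple m k) : Prop :=
  C.Is235 ∧ ∀ g₂ ∈ C.C2.carrier, ∀ g₃ ∈ C.C3.carrier, ∀ g₅ ∈ C.C5.carrier,
    (nu (⊤ : Subgroup (PSO m k)) : ℤ) - (nu (cent g₂) + nu (cent g₃) + nu (cent g₅)) =
      algRank (preimageGL (⊤ : Subgroup (PSO m k)))

/-- The triple has type `(Φ₂, Φ₃, Φ₅)`: the root system of `Z_G⁰(g_n)` is isomorphic to `Φ_n`. -/
def ClassTriple.HasType {X₂ X₃ X₅ : Type*} [AddCommGroup X₂] [AddCommGroup X₃] [AddCommGroup X₅]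
    (C : ClassTriple m k) (Φ₂ : Set X₂) (Φ₃ : Set X₃) (Φ₅ : Set X₅) : Prop :=
  (∀ g ∈ C.C2.carrier, RootIso (rootSet (preimageGL (cent g))) Φ₂) ∧
  (∀ g ∈ C.C3.carrier, RootIso (rootSet (preimageGL (cent g))) Φ₃) ∧
  (∀ g ∈ C.C5.carrier, RootIso (rootSet (preimageGL (cent g))) Φ₅)

/-- `C'` is the `ι`-twist `(C₂, C₃, {g² : g ∈ C₅})` of `C`. -/
def ClassTriple.IsTwist (C C' : ClassTriple m k) : Prop :=
  C'.C2 = C.C2 ∧ C'.C3 = C.C3 ∧ C'.C5.carrier = (fun g => g ^ 2) '' C.C5.carrier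

/-- The list `C` consists of distinct triples, and they are all the regular `235`-triples. -/
def AllRegularTriples {d : ℕ} (C : Fin d → ClassTriple m k) : Prop :=
  Function.Injective C ∧ ∀ C' : ClassTriple m k, C'.IsRegular ↔ ∃ i, C' = C i

/-- A homomorphism `ψ : 𝒜₅ → G` is regular if `Z_G(ψ(𝒜₅)) / Z_G` is finite. -/
def IsRegularHom {G : Type*} [Group G] (ψ : Alt5 →* G) : Prop :=
  Finite (Subgroup.centralizer (ψ.range : Set G) ⧸
    (Subgroup.center G).subgroupOf (Subgroup.centralizer (ψ.range : Set G)))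

/-- Conjugacy of homomorphisms under the target group. -/
def ConjHom {G : Type*} [Group G] (ψ ψ' : Alt5 →* G) : Prop :=
  ∃ g : G, ∀ x, ψ' x = g * ψ x * g⁻¹

/-- The list `ψ` consists of pairwise non-conjugate homomorphisms and is a complete list of
representatives of the conjugacy classes of regular homomorphisms `𝒜₅ → G`. -/
def AllRegularHoms {G : Type*} [Group G] {d : ℕ} (ψ : Fin d → (Alt5 →* G)) : Prop :=
  (∀ i j, ConjHom (ψ i) (ψ j) → i = j) ∧ ∀ ψ' : Alt5 →* G, IsRegularHom ψ' ↔ ∃ i, ConjHom (ψ i) ψ'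

/-- The triple of conjugacy classes of `ψ(x₂), ψ(x₃), ψ(x₅)`. -/
def tripleOf (ψ : Alt5 →* PSO m k) : ClassTriple m k :=
  ⟨ConjClasses.mk (ψ x2), ConjClasses.mk (ψ x3), ConjClasses.mk (ψ x5)⟩

/-- The two homomorphisms are interchanged, up to conjugacy, by the twist `ψ ↦ ψ ∘ ι`. -/
def HomsInterchanged {G : Type*} [Group G] (ψ ψ' : Alt5 →* G) : Prop :=
  ∀ ι : MulAut Alt5, IsIota ι →
    ConjHom (ψ.comp ι.toMonoidHom) ψ' ∧ ConjHom (ψ'.comp ι.toMonoidHom) ψ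

/-- The two triples are interchanged by `ι`. -/
def TriplesInterchanged (C C' : ClassTriple m k) : Prop := C.IsTwist C' ∧ C'.IsTwist C

/-- The `2m`-dimensional representation afforded by a homomorphism `𝒜₅ → SO_{2m}(k)`. -/
def orthRep (ρ : Alt5 →* SO2 m k) : Representation k Alt5 (Fin (2 * m) → k) :=
  (Matrix.toLinAlgEquiv' : Matrix (Fin (2 * m)) (Fin (2 * m)) k ≃ₐ[k] _).toMonoidHom.comp
    ((Matrix.specialOrthogonalGroup (Fin (2 * m)) k).subtype.comp ρ)

/-- The representation `σ` is the direct sum of irreducible subrepresentations whose dimensions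
form the list `d`. -/
def DecomposesAs {V : Type*} [AddCommGroup V] [Module k V] (σ : Representation k Alt5 V)
    (d : List ℕ) : Prop :=
  ∃ W : Fin d.length → Subrepresentation σ,
    DirectSum.IsInternal (fun i => (W i).toSubmodule) ∧
    ∀ i, (W i).toRepresentation.IsIrreducible ∧ Module.finrank k (W i).toSubmodule = d.get i

/-- `ψ` comes from an orthogonal representation of `𝒜₅` which decomposes into irreducibles of the
dimensions `d`. -/
def ComesFrom (ψ : Alt5 →* PSO m k) (d : List ℕ) : Prop :=
  ∃ ρ : Alt5 →* SO2 m k, ψ = (proj m k).comp ρ ∧ DecomposesAs (orthRep ρ) d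

end TypeD

end

/-!
# Regular homomorphisms from the alternating group on five letters to `PSO_{2m}`

Both the regular triples and the regular homomorphisms are controlled by the eigenvalues of lifts of
`x₂`, `x₃`, `x₅` to `SO_{2m}`. A lift of an element of order `2`, `3`, `5` has a *hyperbolic* eigenbasis
(`exists_isHyp_isEig`), and the multiplicities of its eigenvalues form a datum
`(a, b; a', b'; a'', b'', c'')` (`IsType2`, `IsType3`, `IsType5`). The chosen maximal torus of a
centralizer in `PSO_{2m}` is the diagonal torus of such a basis (`exists_maxTorus_eq`), so its root system
and its number of roots can be read off from the datum (`rootIso_rootSet`). The equation that defines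
regular triples becomes an equation between the quadratic functions `count2`, `count3`, `count5`. The sum
of these functions is always at least the required value, with equality only for the ten data of
`IsRegularData`, for which `m` is `4`, `5`, `6` or `8` (`count_solutions`). This classifies the regular
triples (`exists_data_of_isRegular`, `HasData.isRegular_iff`).

A regular homomorphism has no invariants in the Lie algebra of skew-symmetric matrices, since the Cayley
transform of an invariant gives infinitely many elements of the centralizer (`not_isRegularHom_of_skew`).
Scott's lemma (`scott_le`) for the adjoint representation then bounds the sum of the same quadratic
functions from above by the value that it must be at least, so that the triple of a regular homomorphism
is regular (`exists_data_of_isRegularHom`). In particular `x₂` lifts to an involution, and after a change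
of sign the lifts satisfy the defining relations of `𝒜₅`, so that every regular homomorphism comes from
`SO_{2m}` (`exists_hom_of_relations`, `exists_lift_of_isRegularHom`).

Conversely, let `1`, `3`, `3'`, `4`, `5` be the irreducible representations of `𝒜₅`; they are orthogonal
and have distinct characters (`exists_irreps`). An orthogonal sum of distinct ones among them is a regular
homomorphism, as its centralizer acts by signs on the summands (`Decomposition.isRegularHom`). Its datum is
regular, hence determined by the traces of the generators (`HasTraces.unique`). For each of the ten data
exactly one such sum occurs. It is the only regular homomorphism with this datum: applied to the space of
matrices `Hom(V, V')`, Scott's lemma gives at least `a' + a''` independent intertwiners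
(`le_finrank_intertwiners`), which is the number of summands; each summand occurs at most once in a regular
`V'` (`OrthIrrep.finrank_intertwiners_le_one`), so that all of them occur and `V` and `V'` are isometric
(`Decomposition.exists_conj`). The determinant of an isometry can be corrected on a summand of odd degree.

The datum of a triple is unique up to the exchange of `a` and `b`, which replaces the lift of the involution
by its negative; this is why for `m = 5` two homomorphisms share one triple. The automorphism `ι` exchanges
`b''` and `c''`.
-/

/-! ### The centre of the special orthogonal group -/

section Centre

variable {k : Type*} [Field k] {n : ℕ}

theorem so_mul_transpose (g : Matrix.specialOrthogonalGroup (Fin n) k) :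
    (g : Matrix (Fin n) (Fin n) k) * (g : Matrix (Fin n) (Fin n) k)ᵀ = 1 :=
  (Matrix.mem_orthogonalGroup_iff (Fin n) k).1 (Matrix.mem_specialOrthogonalGroup_iff.1 g.2).1

theorem so_transpose_mul (g : Matrix.specialOrthogonalGroup (Fin n) k) :
    (g : Matrix (Fin n) (Fin n) k)ᵀ * (g : Matrix (Fin n) (Fin n) k) = 1 :=
  mul_eq_one_comm.1 (so_mul_transpose g)

theorem so_det (g : Matrix.specialOrthogonalGroup (Fin n) k) :
    (g : Matrix (Fin n) (Fin n) k).det = 1 :=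
  (Matrix.mem_specialOrthogonalGroup_iff.1 g.2).2

theorem so_coe_inv (g : Matrix.specialOrthogonalGroup (Fin n) k) :
    ((g⁻¹ : Matrix.specialOrthogonalGroup (Fin n) k) : Matrix (Fin n) (Fin n) k) =
      (g : Matrix (Fin n) (Fin n) k)ᵀ := by
  have h : (g : Matrix (Fin n) (Fin n) k) *
      ((g⁻¹ : Matrix.specialOrthogonalGroup (Fin n) k) : Matrix (Fin n) (Fin n) k) = 1 := by
    rw [← Submonoid.coe_mul, mul_inv_cancel, Submonoid.coe_one]
  calc _ = (g : Matrix (Fin n) (Fin n) k)ᵀ * (g : Matrix (Fin n) (Fin n) k) *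
      ((g⁻¹ : Matrix.specialOrthogonalGroup (Fin n) k) : Matrix (Fin n) (Fin n) k) := by
        rw [so_transpose_mul, one_mul]
    _ = _ := by rw [mul_assoc, h, mul_one]

/-- The element of `SO_n` with a given matrix. -/
def mkSO (M : Matrix (Fin n) (Fin n) k) (h : M * Mᵀ = 1) (hd : M.det = 1) :
    Matrix.specialOrthogonalGroup (Fin n) k :=
  ⟨M, Matrix.mem_specialOrthogonalGroup_iff.2 ⟨(Matrix.mem_orthogonalGroup_iff (Fin n) k).2 h, hd⟩⟩

@[simp] theorem coe_mkSO (M : Matrix (Fin n) (Fin n) k) (h : M * Mᵀ = 1) (hd : M.det = 1) :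
    ((mkSO M h hd : Matrix.specialOrthogonalGroup (Fin n) k) : Matrix (Fin n) (Fin n) k) = M := rfl

theorem commute_mul_self_of_sign {R : Type*} [Ring R] {h g : R}
    (hg : h * g = g * h ∨ h * g = -(g * h)) : h * (g * g) = (g * g) * h := by
  rcases hg with hg | hg
  · rw [← mul_assoc, hg, mul_assoc, hg, mul_assoc]
  · rw [← mul_assoc, hg, neg_mul, mul_assoc, hg, mul_neg, neg_neg, mul_assoc]

/-- The signed permutation matrix with signs `d` and permutation `σ`. -/
def signedPerm (d : Fin n → k) (σ : Equiv.Perm (Fin n)) : Matrix (Fin n) (Fin n) k :=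
  diagonal d * σ.permMatrix k

theorem signedPerm_apply (d : Fin n → k) (σ : Equiv.Perm (Fin n)) (a b : Fin n) :
    signedPerm d σ a b = if σ a = b then d a else 0 := by
  simp [signedPerm, Matrix.diagonal_mul, Equiv.Perm.permMatrix, PEquiv.toMatrix_apply]

theorem signedPerm_mul_transpose (d : Fin n → k) (σ : Equiv.Perm (Fin n)) (hd : ∀ i, d i * d i = 1) :
    signedPerm d σ * (signedPerm d σ)ᵀ = 1 := by
  ext a b
  rw [Matrix.mul_apply, Matrix.one_apply]
  simp only [Matrix.transpose_apply, signedPerm_apply, mul_ite, ite_mul, zero_mul, mul_zero]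
  rw [Finset.sum_eq_single (σ a)]
  · by_cases h : a = b
    · subst h; simp [hd]
    · have : σ b ≠ σ a := fun h' => h (σ.injective h').symm
      simp [h, this]
  · intro c _ hc
    simp [Ne.symm hc]
  · simp

theorem signedPerm_mul_self_apply (d : Fin n → k) (σ : Equiv.Perm (Fin n)) (a b : Fin n) :
    (signedPerm d σ * signedPerm d σ) a b = if σ (σ a) = b then d a * d (σ a) else 0 := by
  rw [Matrix.mul_apply, Finset.sum_eq_single (σ a)]
  · simp [signedPerm_apply]
  · intro c _ hc
    simp [signedPerm_apply, Ne.symm hc]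
  · simp

theorem det_signedPerm (d : Fin n → k) (σ : Equiv.Perm (Fin n)) :
    (signedPerm d σ).det = (∏ i, d i) * ((Equiv.Perm.sign σ : ℤ) : k) := by
  rw [signedPerm, Matrix.det_mul, Matrix.det_diagonal, Matrix.det_permutation]

/-- A matrix that commutes up to sign with all of `SO_n`, `n ≥ 3`, is scalar: it commutes with the
squares in `SO_n`, among which are the diagonal matrices with two entries `-1` and the
permutation matrices of `3`-cycles. -/
theorem scalar_of_commute_up_to_sign (h2 : (2 : k) ≠ 0) (hn : 3 ≤ n) (h : Matrix (Fin n) (Fin n) k)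
    (hh : ∀ g : Matrix.specialOrthogonalGroup (Fin n) k,
      h * (g : Matrix (Fin n) (Fin n) k) = (g : Matrix (Fin n) (Fin n) k) * h ∨
      h * (g : Matrix (Fin n) (Fin n) k) = -((g : Matrix (Fin n) (Fin n) k) * h)) :
    ∃ c : k, h = c • (1 : Matrix (Fin n) (Fin n) k) := by
  have third : ∀ a b : Fin n, ∃ c, c ≠ a ∧ c ≠ b := by
    intro a b
    obtain ⟨c, hc⟩ := Finset.exists_mem_notMem_of_card_lt_card (s := {a, b})
      (t := (Finset.univ : Finset (Fin n))) (by
        have := Finset.card_le_two (a := a) (b := b)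
        simp only [Finset.card_univ, Fintype.card_fin]; omega)
    simp only [Finset.mem_univ, Finset.mem_insert, Finset.mem_singleton, not_or, true_and] at hc
    exact ⟨c, hc⟩
  have offdiag : ∀ a b, a ≠ b → h a b = 0 := by
    intro a b hab
    obtain ⟨c, hca, hcb⟩ := third a b
    -- the square of this signed transposition of `a` and `c` is diagonal, with the entry `-1` at
    -- `a` and `c` only
    let d : Fin n → k := Function.update 1 a (-1)
    let σ := Equiv.swap a c
    have hd : ∀ i, d i * d i = 1 := by
      intro i
      by_cases hi : i = a <;> simp [d, hi]
    have hdet : (signedPerm d σ).det = 1 := by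
      rw [det_signedPerm, Equiv.Perm.sign_swap (Ne.symm hca), Finset.prod_update_of_mem (Finset.mem_univ a)]
      simp
    have hc := commute_mul_self_of_sign (hh (mkSO _ (signedPerm_mul_transpose d σ hd) hdet))
    simp only [coe_mkSO] at hc
    have hD : signedPerm d σ * signedPerm d σ = diagonal fun i => d i * d (σ i) := by
      ext i j
      rw [signedPerm_mul_self_apply, Matrix.diagonal_apply, Equiv.swap_apply_self]
    rw [hD] at hc
    have := congrFun (congrFun hc a) b
    rw [Matrix.mul_diagonal, Matrix.diagonal_mul] at this
    have e1 : d a * d (σ a) = -1 := by simp [d, σ, hca]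
    have e2 : d b * d (σ b) = 1 := by
      simp [d, σ, Equiv.swap_apply_of_ne_of_ne (Ne.symm hab) (Ne.symm hcb), Ne.symm hab]
    rw [e1, e2] at this
    have h3 : 2 * h a b = 0 := by linear_combination this
    exact (mul_eq_zero.1 h3).resolve_left h2
  have diag : ∀ a b, h a a = h b b := by
    intro a b
    by_cases hab : a = b
    · rw [hab]
    obtain ⟨c, hca, hcb⟩ := third a b
    -- a `3`-cycle is the square of its inverse
    let σ : Equiv.Perm (Fin n) := Equiv.swap c b * Equiv.swap a b
    have hs : Equiv.Perm.sign σ = 1 := by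
      simp [σ, Equiv.Perm.sign_swap hab, Equiv.Perm.sign_swap hcb]
    have hdet : (signedPerm (1 : Fin n → k) σ).det = 1 := by
      rw [det_signedPerm, hs]; simp
    have hc := commute_mul_self_of_sign (hh (mkSO _ (signedPerm_mul_transpose 1 σ (by simp)) hdet))
    simp only [coe_mkSO] at hc
    have hσ : σ (σ a) = b := by
      simp only [σ, Equiv.Perm.mul_apply, Equiv.swap_apply_left, Equiv.swap_apply_right]
      rw [Equiv.swap_apply_of_ne_of_ne hca hcb, Equiv.swap_apply_left]
    have := congrFun (congrFun hc a) b
    rw [Matrix.mul_apply, Matrix.mul_apply, Finset.sum_eq_single a, Finset.sum_eq_single b] at this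
    · simpa [signedPerm_mul_self_apply, hσ] using this
    · intro i _ hi
      rw [offdiag i b hi, mul_zero]
    · simp
    · intro i _ hi
      rw [offdiag a i (Ne.symm hi), zero_mul]
    · simp
  refine ⟨h ⟨0, by omega⟩ ⟨0, by omega⟩, ?_⟩
  ext a b
  by_cases hab : a = b
  · subst hab; simpa using diag a _
  · simp [offdiag a b hab, hab]

theorem scalar_of_mem_so {g : Matrix.specialOrthogonalGroup (Fin n) k} (hn : 0 < n) {c : k}
    (h : (g : Matrix (Fin n) (Fin n) k) = c • (1 : Matrix (Fin n) (Fin n) k)) :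
    (g : Matrix (Fin n) (Fin n) k) = 1 ∨ (g : Matrix (Fin n) (Fin n) k) = -1 := by
  have h1 := so_mul_transpose g
  rw [h] at h1
  have h2 := congrFun (congrFun h1 ⟨0, hn⟩) ⟨0, hn⟩
  simp only [transpose_smul, transpose_one, Matrix.mul_smul, mul_one,
    Matrix.smul_apply, Matrix.one_apply_eq, smul_eq_mul] at h2
  rcases mul_self_eq_one_iff.1 h2 with rfl | rfl
  · left; rw [h, one_smul]
  · right; rw [h, neg_smul, one_smul]

theorem mem_center_so_iff (h2 : (2 : k) ≠ 0) (hn : 3 ≤ n)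
    (g : Matrix.specialOrthogonalGroup (Fin n) k) :
    g ∈ Subgroup.center (Matrix.specialOrthogonalGroup (Fin n) k) ↔
      (g : Matrix (Fin n) (Fin n) k) = 1 ∨ (g : Matrix (Fin n) (Fin n) k) = -1 := by
  constructor
  · intro hg
    obtain ⟨c, hc⟩ := scalar_of_commute_up_to_sign h2 hn (g : Matrix (Fin n) (Fin n) k) fun x => by
      left
      rw [← Submonoid.coe_mul, ← Submonoid.coe_mul, Subgroup.mem_center_iff.1 hg x]
    exact scalar_of_mem_so (by omega) hc
  · rintro (h | h)
    · rw [Subgroup.mem_center_iff]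
      intro x
      apply Subtype.ext
      rw [Submonoid.coe_mul, Submonoid.coe_mul, h, one_mul, mul_one]
    · rw [Subgroup.mem_center_iff]
      intro x
      apply Subtype.ext
      rw [Submonoid.coe_mul, Submonoid.coe_mul, h, neg_mul, mul_neg, one_mul, mul_one]

end Centre

/-! ### The projection from `SO_{2m}` to `PSO_{2m}` -/

section Projection

variable {k : Type*} [Field k] {m : ℕ}

theorem proj_surjective : Function.Surjective (proj m k) := QuotientGroup.mk'_surjective _

theorem proj_eq_proj_iff (h2 : (2 : k) ≠ 0) (hm : 2 ≤ m) (g h : SO2 m k) :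
    proj m k g = proj m k h ↔
      (h : Matrix (Fin (2 * m)) (Fin (2 * m)) k) = g ∨
      (h : Matrix (Fin (2 * m)) (Fin (2 * m)) k) = -(g : Matrix (Fin (2 * m)) (Fin (2 * m)) k) := by
  rw [QuotientGroup.mk'_apply, QuotientGroup.mk'_apply, QuotientGroup.eq,
    mem_center_so_iff h2 (by omega)]
  have key : (h : Matrix (Fin (2 * m)) (Fin (2 * m)) k) =
      (g : Matrix (Fin (2 * m)) (Fin (2 * m)) k) * ((g⁻¹ * h : SO2 m k) : Matrix _ _ k) := by
    rw [← Submonoid.coe_mul, mul_inv_cancel_left]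
  constructor
  · rintro (e | e)
    · left; rw [key, e, mul_one]
    · right; rw [key, e, mul_neg, mul_one]
  · rw [Submonoid.coe_mul, so_coe_inv]
    rintro (e | e)
    · left; rw [e, so_transpose_mul]
    · right; rw [e, mul_neg, so_transpose_mul]

theorem proj_eq_one_iff (h2 : (2 : k) ≠ 0) (hm : 2 ≤ m) (g : SO2 m k) :
    proj m k g = 1 ↔ (g : Matrix (Fin (2 * m)) (Fin (2 * m)) k) = 1 ∨
      (g : Matrix (Fin (2 * m)) (Fin (2 * m)) k) = -1 := by
  rw [← mem_center_so_iff h2 (by omega)]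
  exact QuotientGroup.eq_one_iff g

theorem proj_commute_iff (h2 : (2 : k) ≠ 0) (hm : 2 ≤ m) (g h : SO2 m k) :
    proj m k h * proj m k g = proj m k g * proj m k h ↔
      (h : Matrix (Fin (2 * m)) (Fin (2 * m)) k) * g = (g : Matrix (Fin (2 * m)) (Fin (2 * m)) k) * h ∨
      (h : Matrix (Fin (2 * m)) (Fin (2 * m)) k) * g =
        -((g : Matrix (Fin (2 * m)) (Fin (2 * m)) k) * h) := by
  rw [← map_mul, ← map_mul, eq_comm, proj_eq_proj_iff h2 hm]
  rfl

/-- The element `-1` of `SO_{2m}`. -/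
def negOneSO : SO2 m k := mkSO (-1) (by simp) (by rw [Matrix.det_neg]; simp)

theorem coe_negOneSO_mul (g : SO2 m k) :
    ((negOneSO * g : SO2 m k) : Matrix (Fin (2 * m)) (Fin (2 * m)) k) = -(g : Matrix _ _ k) := by
  rw [Submonoid.coe_mul]; simp [negOneSO]

theorem proj_negOneSO_mul (h2 : (2 : k) ≠ 0) (hm : 2 ≤ m) (g : SO2 m k) :
    proj m k (negOneSO * g) = proj m k g := by
  rw [proj_eq_proj_iff h2 hm, coe_negOneSO_mul, neg_neg]
  exact Or.inr rfl

/-- The adjoint group has trivial centre. -/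
theorem center_pso_eq_bot (h2 : (2 : k) ≠ 0) (hm : 2 ≤ m) : Subgroup.center (PSO m k) = ⊥ := by
  rw [eq_bot_iff]
  intro x hx
  obtain ⟨h, rfl⟩ := proj_surjective x
  rw [Subgroup.mem_bot, proj_eq_one_iff h2 hm]
  obtain ⟨c, hc⟩ := scalar_of_commute_up_to_sign h2 (by omega) (h : Matrix _ _ k) fun g =>
    (proj_commute_iff h2 hm g h).1 (Subgroup.mem_center_iff.1 hx (proj m k g)).symm
  exact scalar_of_mem_so (by omega) hc

theorem isRegularHom_iff_finite (h2 : (2 : k) ≠ 0) (hm : 2 ≤ m) (ψ : Alt5 →* PSO m k) :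
    IsRegularHom ψ ↔ Finite (Subgroup.centralizer (ψ.range : Set (PSO m k))) := by
  unfold IsRegularHom
  rw [center_pso_eq_bot h2 hm, Subgroup.bot_subgroupOf]
  exact (QuotientGroup.quotientBot (G := Subgroup.centralizer (ψ.range : Set (PSO m k)))).toEquiv.finite_iff

end Projection

/-! ### The Lie algebra of a matrix group -/

section LieAlgebra

variable {k : Type*} [Field k] {n : ℕ}

/-- Taylor expansion of a polynomial over the dual numbers. -/
theorem aeval_dualNumber {σ : Type*} [Fintype σ] (p x : σ → k) (Q : MvPolynomial σ k) :
    MvPolynomial.aeval (fun e => (TrivSqZeroExt.inl (p e) + TrivSqZeroExt.inr (x e) : DualNumber k)) Q =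
      TrivSqZeroExt.inl (MvPolynomial.eval p Q) +
        TrivSqZeroExt.inr (∑ e, MvPolynomial.eval p (MvPolynomial.pderiv e Q) * x e) := by
  classical
  induction Q using MvPolynomial.induction_on with
  | C a =>
    simp only [MvPolynomial.aeval_C, MvPolynomial.eval_C, MvPolynomial.pderiv_C, map_zero, zero_mul,
      Finset.sum_const_zero, TrivSqZeroExt.inr_zero, add_zero]
    rfl
  | add P Q hP hQ =>
    rw [map_add, hP, hQ]
    simp only [map_add, add_mul, Finset.sum_add_distrib, TrivSqZeroExt.inl_add, TrivSqZeroExt.inr_add]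
    abel
  | mul_X P i hP =>
    rw [map_mul, hP, MvPolynomial.aeval_X]
    ext
    · simp
    · simp only [TrivSqZeroExt.snd_mul, TrivSqZeroExt.fst_add, TrivSqZeroExt.fst_inl,
        TrivSqZeroExt.fst_inr, TrivSqZeroExt.snd_add, TrivSqZeroExt.snd_inl, TrivSqZeroExt.snd_inr,
        MvPolynomial.pderiv_mul, MvPolynomial.pderiv_X, map_add, map_mul, MvPolynomial.eval_X, add_mul,
        Finset.sum_add_distrib, zero_add, add_zero, smul_eq_mul, MulOpposite.smul_eq_mul_unop,
        MulOpposite.unop_op]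
      have e1 : ∑ e, MvPolynomial.eval p P *
          MvPolynomial.eval p (Pi.single (M := fun _ => MvPolynomial σ k) e 1 i) * x e =
          MvPolynomial.eval p P * x i := by
        rw [Finset.sum_eq_single i]
        · simp
        · intro e _ he
          simp [he]
        · simp
      rw [Finset.sum_mul, e1, zero_mul, zero_mul, add_zero, zero_add, add_comm]
      congr 1
      refine Finset.sum_congr rfl fun e _ => ?_
      ring

/-- Curves through the identity of `H` have their velocity in the Lie algebra. The curve is a
matrix `M` over a ring `R` of functions on a set `S` of parameters, and its velocity is read off
over the dual numbers. -/
theorem mem_lieAlg_of_curve {H : Subgroup (GL (Fin n) k)} {X : Matrix (Fin n) (Fin n) k}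
    {R S : Type*} [CommRing R] [Algebra k R] (ev : S → (R →ₐ[k] k))
    (hev : ∀ r : R, (∀ s, ev s r = 0) → r = 0) (τ : R →ₐ[k] DualNumber k)
    (M : Matrix (Fin n) (Fin n) R)
    (hM : ∀ s, ∃ h ∈ H, (h : Matrix (Fin n) (Fin n) k) = M.map (ev s))
    (hτ : ∀ i j, τ (M i j) = TrivSqZeroExt.inl ((1 : Matrix (Fin n) (Fin n) k) i j) +
      TrivSqZeroExt.inr (X i j)) : X ∈ lieAlg H := by
  intro Q hQ
  have h0 : MvPolynomial.aeval (fun e : Fin n × Fin n => M e.1 e.2) Q = 0 := by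
    apply hev
    intro s
    obtain ⟨h, hh, e⟩ := hM s
    rw [← hQ h hh, e, ← MvPolynomial.coe_aeval_eq_eval]
    exact MvPolynomial.comp_aeval_apply (f := fun e : Fin n × Fin n => M e.1 e.2) (ev s) Q
  -- an equation `Q` of `H` vanishes on the curve, hence at its dual number point; compare the
  -- coefficients of `ε`
  have h1 := MvPolynomial.comp_aeval_apply (f := fun e : Fin n × Fin n => M e.1 e.2) τ Q
  rw [h0, map_zero] at h1
  simp only [hτ] at h1
  rw [aeval_dualNumber (fun e : Fin n × Fin n => (1 : Matrix (Fin n) (Fin n) k) e.1 e.2)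
    (fun e => X e.1 e.2) Q] at h1
  have h2 := congrArg TrivSqZeroExt.snd h1
  simpa using h2.symm

/-- If the line `1 + tX` lies in `H`, then `X` lies in the Lie algebra of `H`. -/
theorem mem_lieAlg_of_line [Infinite k] {H : Subgroup (GL (Fin n) k)} {X : Matrix (Fin n) (Fin n) k}
    (hX : ∀ t : k, ∃ h ∈ H, (h : Matrix (Fin n) (Fin n) k) = 1 + t • X) : X ∈ lieAlg H := by
  refine mem_lieAlg_of_curve (R := Polynomial k) (S := k) (fun t => Polynomial.aeval t) ?_
    (Polynomial.aeval DualNumber.eps) (1 + (Polynomial.X : Polynomial k) • X.map Polynomial.C) ?_ ?_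
  · intro r hr
    exact Polynomial.funext fun t => by simpa [Polynomial.coe_aeval_eq_eval] using hr t
  · intro t
    obtain ⟨h, hh, e⟩ := hX t
    refine ⟨h, hh, ?_⟩
    rw [e]
    ext i j
    simp only [Matrix.add_apply, Matrix.smul_apply, Matrix.map_apply, Matrix.one_apply, smul_eq_mul,
      map_add, map_mul, Polynomial.aeval_X, Polynomial.aeval_C, Algebra.algebraMap_self,
      RingHom.id_apply]
    split_ifs <;> simp
  · intro i j
    have hC (c : k) : Polynomial.aeval (DualNumber.eps : DualNumber k) (Polynomial.C c) =
        TrivSqZeroExt.inl c := by rw [Polynomial.aeval_C]; rfl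
    by_cases hij : i = j
    · subst hij; ext <;> simp [hC]
    · ext <;> simp [hij, hC]

/-- A Laurent polynomial over an infinite field that vanishes at all units is zero. -/
theorem laurent_eq_zero_of_eval [Infinite k] (r : LaurentPolynomial k)
    (hr : ∀ s : kˣ, LaurentPolynomial.eval₂ (RingHom.id k) s r = 0) : r = 0 := by
  obtain ⟨N, q, hq⟩ := LaurentPolynomial.exists_T_pow r
  have hq0 : q * Polynomial.X = 0 := by
    refine Polynomial.funext fun t => ?_
    by_cases ht : t = 0
    · simp [ht]
    · have h1 := congrArg (LaurentPolynomial.eval₂ (RingHom.id k) (Units.mk0 t ht)) hq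
      rw [map_mul, hr, zero_mul, LaurentPolynomial.eval₂_toLaurent] at h1
      rw [Polynomial.eval_mul, Polynomial.eval_zero]
      have : Polynomial.eval t q = 0 := by simpa [Polynomial.eval₂_id] using h1
      rw [this, zero_mul]
  have hq1 : q = 0 := (mul_eq_zero.1 hq0).resolve_right Polynomial.X_ne_zero
  rw [hq1, map_zero] at hq
  exact ((LaurentPolynomial.isUnit_T (R := k) N).mul_left_eq_zero).1 hq.symm

/-- If `1 + (t - 1) E + (t⁻¹ - 1) F` lies in `H` for all `t ≠ 0`, then `E - F` lies in the Lie algebra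
of `H`. -/
theorem mem_lieAlg_of_oneParam [Infinite k] {H : Subgroup (GL (Fin n) k)}
    {E F : Matrix (Fin n) (Fin n) k}
    (hX : ∀ t : kˣ, ∃ h ∈ H, (h : Matrix (Fin n) (Fin n) k) =
      1 + ((t : k) - 1) • E + (((t⁻¹ : kˣ) : k) - 1) • F) : E - F ∈ lieAlg H := by
  have he : (DualNumber.eps : DualNumber k) * DualNumber.eps = 0 := DualNumber.eps_mul_eps
  -- the velocity at `t = 1` is read off at the unit `1 + ε` of the dual numbers
  let u : (DualNumber k)ˣ := ⟨1 + DualNumber.eps, 1 - DualNumber.eps,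
    by linear_combination -he, by linear_combination -he⟩
  let ev (s : kˣ) : LaurentPolynomial k →ₐ[k] k :=
    { LaurentPolynomial.eval₂ (RingHom.id k) s with
      commutes' := fun r => LaurentPolynomial.eval₂_C (RingHom.id k) s r }
  let τ : LaurentPolynomial k →ₐ[k] DualNumber k :=
    { LaurentPolynomial.eval₂ (algebraMap k (DualNumber k)) u with
      commutes' := fun r => LaurentPolynomial.eval₂_C (algebraMap k (DualNumber k)) u r }
  have evC (s : kˣ) (c : k) : ev s (LaurentPolynomial.C c) = c :=
    LaurentPolynomial.eval₂_C (RingHom.id k) s c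
  have evT (s : kˣ) (c : ℤ) : ev s (LaurentPolynomial.T c) = ((s ^ c : kˣ) : k) :=
    LaurentPolynomial.eval₂_T (RingHom.id k) s c
  have τC (c : k) : τ (LaurentPolynomial.C c) = TrivSqZeroExt.inl c :=
    LaurentPolynomial.eval₂_C (algebraMap k (DualNumber k)) u c
  have τT (c : ℤ) : τ (LaurentPolynomial.T c) = ((u ^ c : (DualNumber k)ˣ) : DualNumber k) :=
    LaurentPolynomial.eval₂_T (algebraMap k (DualNumber k)) u c
  refine mem_lieAlg_of_curve (R := LaurentPolynomial k) (S := kˣ) ev ?_ τ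
    (1 + (LaurentPolynomial.T 1 - 1 : LaurentPolynomial k) • E.map LaurentPolynomial.C +
      (LaurentPolynomial.T (-1) - 1 : LaurentPolynomial k) • F.map LaurentPolynomial.C) ?_ ?_
  · intro r hr
    exact laurent_eq_zero_of_eval r hr
  · intro t
    obtain ⟨h, hh, e⟩ := hX t
    refine ⟨h, hh, ?_⟩
    rw [e]
    ext i j
    by_cases hij : i = j <;> simp [hij, evC, evT]
  · intro i j
    have hu : ((u⁻¹ : (DualNumber k)ˣ) : DualNumber k) = 1 - DualNumber.eps := rfl
    have hu' : (u : DualNumber k) = 1 + DualNumber.eps := rfl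
    clear_value τ ev u
    by_cases hij : i = j
    · subst hij; ext <;> simp [τC, τT, hu, hu', sub_eq_add_neg]
    · ext <;> simp [hij, τC, τT, hu, hu', sub_eq_add_neg]

/-- Equations of a group hold to first order on its Lie algebra. -/
theorem aeval_eq_zero_of_mem_lieAlg {H : Subgroup (GL (Fin n) k)} {X : Matrix (Fin n) (Fin n) k}
    (hX : X ∈ lieAlg H) (Q : MvPolynomial (Fin n × Fin n) k)
    (hQ : ∀ h ∈ H, MvPolynomial.eval (fun e => (h : Matrix (Fin n) (Fin n) k) e.1 e.2) Q = 0) :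
    MvPolynomial.aeval (fun e : Fin n × Fin n =>
      (TrivSqZeroExt.inl ((1 : Matrix (Fin n) (Fin n) k) e.1 e.2) +
        TrivSqZeroExt.inr (X e.1 e.2) : DualNumber k)) Q = 0 := by
  have h1 := hQ 1 H.one_mem
  rw [Units.val_one] at h1
  rw [aeval_dualNumber (fun e : Fin n × Fin n => (1 : Matrix (Fin n) (Fin n) k) e.1 e.2)
    (fun e => X e.1 e.2) Q, hX Q hQ, h1]
  simp

/-- The product of two linear equations, one of which fails at the identity, cuts out the other one in
the Lie algebra. -/
theorem lieAlg_linear_of_mul {H : Subgroup (GL (Fin n) k)} {X : Matrix (Fin n) (Fin n) k}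
    (hX : X ∈ lieAlg H) (f g : Matrix (Fin n) (Fin n) k →ₗ[k] k)
    (hfg : ∀ h ∈ H, f (h : Matrix (Fin n) (Fin n) k) * g (h : Matrix (Fin n) (Fin n) k) = 0)
    (hf : f 1 = 0) (hg : g 1 ≠ 0) : f X = 0 := by
  let P (f : Matrix (Fin n) (Fin n) k →ₗ[k] k) : MvPolynomial (Fin n × Fin n) k :=
    ∑ e : Fin n × Fin n, MvPolynomial.C (f (Matrix.single e.1 e.2 1)) * MvPolynomial.X e
  have hsum (f : Matrix (Fin n) (Fin n) k →ₗ[k] k) (Y : Matrix (Fin n) (Fin n) k) :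
      f Y = ∑ e : Fin n × Fin n, f (Matrix.single e.1 e.2 1) * Y e.1 e.2 := by
    conv_lhs => rw [Matrix.matrix_eq_sum_single Y]
    rw [map_sum, Fintype.sum_prod_type]
    refine Finset.sum_congr rfl fun i _ => ?_
    rw [map_sum]
    refine Finset.sum_congr rfl fun j _ => ?_
    rw [← mul_one (Y i j), ← smul_eq_mul, ← Matrix.smul_single, map_smul, smul_eq_mul, smul_eq_mul,
      mul_one, mul_comm]
  have hP (f : Matrix (Fin n) (Fin n) k →ₗ[k] k) (Y : Matrix (Fin n) (Fin n) k) :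
      MvPolynomial.eval (fun e => Y e.1 e.2) (P f) = f Y := by
    rw [hsum f Y]
    simp [P]
  have h0 := aeval_eq_zero_of_mem_lieAlg hX (P f * P g) fun h hh => by
    rw [map_mul, hP, hP]; exact hfg h hh
  have ha (f : Matrix (Fin n) (Fin n) k →ₗ[k] k) : MvPolynomial.aeval (fun e : Fin n × Fin n =>
      (TrivSqZeroExt.inl ((1 : Matrix (Fin n) (Fin n) k) e.1 e.2) +
        TrivSqZeroExt.inr (X e.1 e.2) : DualNumber k)) (P f) =
      TrivSqZeroExt.inl (f 1) + TrivSqZeroExt.inr (f X) := by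
    rw [hsum f 1, hsum f X]
    simp only [P, map_sum, map_mul, MvPolynomial.aeval_C, MvPolynomial.aeval_X]
    ext
    · simp [TrivSqZeroExt.algebraMap_eq_inl, TrivSqZeroExt.fst_sum]
    · simp [TrivSqZeroExt.algebraMap_eq_inl, TrivSqZeroExt.snd_sum]
  rw [map_mul, ha, ha, hf] at h0
  have := congrArg TrivSqZeroExt.snd h0
  simp only [TrivSqZeroExt.inl_zero, zero_add, TrivSqZeroExt.snd_mul, TrivSqZeroExt.fst_inr,
    TrivSqZeroExt.snd_add, zero_smul, TrivSqZeroExt.fst_add, TrivSqZeroExt.fst_inl, add_zero,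
    TrivSqZeroExt.snd_inr, MulOpposite.smul_eq_mul_unop, MulOpposite.unop_op,
    TrivSqZeroExt.snd_zero] at this
  exact (mul_eq_zero.1 this).resolve_right hg

/-- The Lie algebra of a group of orthogonal matrices consists of skew-symmetric matrices. -/
theorem transpose_eq_neg_of_mem_lieAlg {H : Subgroup (GL (Fin n) k)} {X : Matrix (Fin n) (Fin n) k}
    (hX : X ∈ lieAlg H)
    (hH : ∀ h ∈ H, (h : Matrix (Fin n) (Fin n) k) * (h : Matrix (Fin n) (Fin n) k)ᵀ = 1) :
    Xᵀ = -X := by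
  ext i j
  have h0 := aeval_eq_zero_of_mem_lieAlg hX
    (∑ l, MvPolynomial.X (i, l) * MvPolynomial.X (j, l) -
      MvPolynomial.C ((1 : Matrix (Fin n) (Fin n) k) i j)) fun h hh => by
    have := congrFun (congrFun (hH h hh) i) j
    rw [Matrix.mul_apply] at this
    simpa [sub_eq_zero] using this
  have := congrArg TrivSqZeroExt.snd h0
  simp only [map_sub, map_sum, map_mul, MvPolynomial.aeval_X, MvPolynomial.aeval_C,
    TrivSqZeroExt.algebraMap_eq_inl, TrivSqZeroExt.snd_sub, TrivSqZeroExt.snd_sum,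
    TrivSqZeroExt.snd_mul, TrivSqZeroExt.snd_add, TrivSqZeroExt.snd_inl, TrivSqZeroExt.snd_inr,
    TrivSqZeroExt.fst_add, TrivSqZeroExt.fst_inl, TrivSqZeroExt.fst_inr, MulOpposite.smul_eq_mul_unop,
    MulOpposite.unop_op, TrivSqZeroExt.snd_zero, smul_eq_mul, add_zero, zero_add, sub_zero,
    Matrix.one_apply, ite_mul, mul_ite, one_mul, mul_one, zero_mul, mul_zero, Finset.sum_add_distrib,
    Finset.sum_ite_eq, Finset.mem_univ, if_true] at this
  rw [Matrix.transpose_apply, Matrix.neg_apply]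
  linear_combination this

end LieAlgebra

/-! ### Hyperbolic bases of common eigenvectors -/

section Hyperbolic

variable {k : Type*} [Field k] {n : ℕ} {I : Type*}

/-- A hyperbolic family in `k ^ n` with its standard symmetric form: the vectors `v (inl i)` and
`v (inr i)` are isotropic, paired with each other, and orthogonal to the other ones. -/
def IsHyp [DecidableEq I] (v : I ⊕ I → Fin n → k) : Prop :=
  ∀ a b, v a ⬝ᵥ v b = if b = a.swap then 1 else 0

theorem dotProduct_mulVec_of_orthogonal {A : Matrix (Fin n) (Fin n) k} (hA : Aᵀ * A = 1)
    (x y : Fin n → k) : (A *ᵥ x) ⬝ᵥ (A *ᵥ y) = x ⬝ᵥ y := by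
  rw [Matrix.dotProduct_mulVec, ← Matrix.mulVec_transpose, Matrix.mulVec_mulVec, hA, Matrix.one_mulVec]

theorem mul_mul_dotProduct_of_eigen {A : Matrix (Fin n) (Fin n) k} (hA : Aᵀ * A = 1)
    {x y : Fin n → k} {c d : k} (hx : A *ᵥ x = c • x) (hy : A *ᵥ y = d • y) :
    c * d * (x ⬝ᵥ y) = x ⬝ᵥ y := by
  have h := dotProduct_mulVec_of_orthogonal hA x y
  rw [hx, hy, smul_dotProduct, dotProduct_smul, smul_eq_mul, smul_eq_mul] at h
  rw [mul_assoc, h]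

theorem mul_eq_one_of_eigen {A : Matrix (Fin n) (Fin n) k} (hA : Aᵀ * A = 1)
    {x y : Fin n → k} {c d : k} (hx : A *ᵥ x = c • x) (hy : A *ᵥ y = d • y) (hxy : x ⬝ᵥ y ≠ 0) :
    c * d = 1 :=
  mul_right_cancel₀ hxy (by rw [mul_mul_dotProduct_of_eigen hA hx hy, one_mul])

/-- A common eigenvector of a family of matrices. -/
def IsEig {S : Type*} (A : S → Matrix (Fin n) (Fin n) k) (x : Fin n → k) : Prop :=
  ∃ χ : S → k, ∀ s, A s *ᵥ x = χ s • x

section Projection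

variable [Fintype I] [DecidableEq I]

/-- The projection onto the orthogonal complement of a hyperbolic family. -/
def hypProj (v : I ⊕ I → Fin n → k) (x : Fin n → k) : Fin n → k :=
  x - ∑ b, (v b.swap ⬝ᵥ x) • v b

theorem dotProduct_hypProj {v : I ⊕ I → Fin n → k} (hv : IsHyp v) (x : Fin n → k) (a : I ⊕ I) :
    v a ⬝ᵥ hypProj v x = 0 := by
  rw [hypProj, dotProduct_sub, dotProduct_sum, Finset.sum_eq_single a.swap]
  · rw [dotProduct_smul, hv, Sum.swap_swap]
    simp
  · intro b _ hb
    rw [dotProduct_smul, hv, if_neg hb, smul_zero]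
  · simp

omit [DecidableEq I] in
/-- The projection does not change products with vectors of the complement. -/
theorem dotProduct_hypProj_of_orthogonal (v : I ⊕ I → Fin n → k) {w : Fin n → k}
    (hw : ∀ a, v a ⬝ᵥ w = 0) (x : Fin n → k) : w ⬝ᵥ hypProj v x = w ⬝ᵥ x := by
  rw [hypProj, dotProduct_sub, dotProduct_sum, Finset.sum_eq_zero, sub_zero]
  intro b _
  rw [dotProduct_smul, dotProduct_comm w, hw, smul_zero]

/-- The projection maps an eigenvector of an orthogonal matrix to one with the same eigenvalue, if
the family consists of eigenvectors. -/
theorem mulVec_hypProj {v : I ⊕ I → Fin n → k} (hv : IsHyp v) {A : Matrix (Fin n) (Fin n) k}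
    (hA : Aᵀ * A = 1) {χ : I ⊕ I → k} (hχ : ∀ b, A *ᵥ v b = χ b • v b) {x : Fin n → k} {c : k}
    (hx : A *ᵥ x = c • x) : A *ᵥ hypProj v x = c • hypProj v x := by
  rw [hypProj, Matrix.mulVec_sub, hx, smul_sub, Matrix.mulVec_sum, Finset.smul_sum]
  congr 1
  refine Finset.sum_congr rfl fun b _ => ?_
  rw [Matrix.mulVec_smul, hχ, smul_smul, smul_smul]
  by_cases h : v b.swap ⬝ᵥ x = 0
  · rw [h, zero_mul, mul_zero]
  · have h1 := mul_eq_one_of_eigen hA (hχ b.swap) hx h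
    have h2 := mul_eq_one_of_eigen hA (hχ b.swap) (hχ b) (by rw [hv, Sum.swap_swap]; simp)
    have h3 : χ b.swap ≠ 0 := left_ne_zero_of_mul_eq_one h1
    rw [mul_left_cancel₀ h3 (h2.trans h1.symm), mul_comm]

theorem isEig_hypProj {S : Type*} {A : S → Matrix (Fin n) (Fin n) k} (hA : ∀ s, (A s)ᵀ * A s = 1)
    {v : I ⊕ I → Fin n → k} (hv : IsHyp v) (hvA : ∀ b, IsEig A (v b)) {x : Fin n → k}
    (hx : IsEig A x) : IsEig A (hypProj v x) := by
  choose χ hχ using hvA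
  obtain ⟨c, hc⟩ := hx
  exact ⟨c, fun s => mulVec_hypProj hv (hA s) (fun b => hχ b s) (hc s)⟩

end Projection

theorem IsHyp.cons {r : ℕ} {v : Fin r ⊕ Fin r → Fin n → k} (hv : IsHyp v) {x y : Fin n → k}
    (hx : ∀ a, v a ⬝ᵥ x = 0) (hy : ∀ a, v a ⬝ᵥ y = 0) (hxx : x ⬝ᵥ x = 0) (hyy : y ⬝ᵥ y = 0)
    (hxy : x ⬝ᵥ y = 1) :
    IsHyp (I := Fin (r + 1)) (Sum.elim (Fin.cons x fun i => v (Sum.inl i))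
      (Fin.cons y fun i => v (Sum.inr i))) := by
  have hx' := fun a => (dotProduct_comm x (v a)).trans (hx a)
  have hy' := fun a => (dotProduct_comm y (v a)).trans (hy a)
  have hyx := (dotProduct_comm y x).trans hxy
  have h0 : ∀ i : Fin r, ¬ (0 = i.succ) := fun i h => Fin.succ_ne_zero i h.symm
  rintro (a | a) (b | b) <;> refine Fin.cases ?_ (fun a => ?_) a <;> refine Fin.cases ?_ (fun b => ?_) b <;>
    simp [hx, hy, hx', hy', hxx, hyy, hxy, hyx, hv _ _, h0, Fin.succ_ne_zero]

/-- Isotropic partners: two common eigenvectors that are not orthogonal, one of them isotropic, span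
a hyperbolic plane with a basis of common eigenvectors. -/
theorem exists_isotropic_partner {S : Type*} {A : S → Matrix (Fin n) (Fin n) k}
    (hA : ∀ s, (A s)ᵀ * A s = 1) (h2 : (2 : k) ≠ 0) {x y : Fin n → k} (hx : IsEig A x) (hy : IsEig A y)
    (hxx : x ⬝ᵥ x = 0) (hxy : x ⬝ᵥ y ≠ 0) :
    ∃ c d : k, IsEig A (c • y + d • x) ∧ x ⬝ᵥ (c • y + d • x) = 1 ∧
      (c • y + d • x) ⬝ᵥ (c • y + d • x) = 0 := by
  obtain ⟨χ, hχ⟩ := hx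
  obtain ⟨η, hη⟩ := hy
  refine ⟨(x ⬝ᵥ y)⁻¹, -(y ⬝ᵥ y) / (2 * (x ⬝ᵥ y) ^ 2), ?_, ?_, ?_⟩
  · by_cases hyy : y ⬝ᵥ y = 0
    · refine ⟨η, fun s => ?_⟩
      rw [hyy, neg_zero, zero_div, zero_smul, add_zero, Matrix.mulVec_smul, hη, smul_comm]
    · refine ⟨η, fun s => ?_⟩
      have h1 := mul_eq_one_of_eigen (hA s) (hχ s) (hη s) hxy
      have h2 := mul_eq_one_of_eigen (hA s) (hη s) (hη s) hyy
      have h3 : χ s = η s := mul_right_cancel₀ (right_ne_zero_of_mul_eq_one h1) (h1.trans h2.symm)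
      rw [Matrix.mulVec_add, Matrix.mulVec_smul, Matrix.mulVec_smul, hη, hχ, h3, smul_add,
        smul_comm (η s), smul_comm (η s)]
  · rw [dotProduct_add, dotProduct_smul, dotProduct_smul, hxx, smul_zero, add_zero, smul_eq_mul,
      inv_mul_cancel₀ hxy]
  · simp only [dotProduct_add, add_dotProduct, dotProduct_smul, smul_dotProduct, hxx, smul_eq_mul,
      dotProduct_comm y x]
    field_simp
    ring

/-- Fewer than `n` linear conditions on `k ^ n` have a nonzero solution. -/
theorem exists_ne_zero_forall_dotProduct_eq_zero {J : Type*} [Fintype J] (hJ : Fintype.card J < n)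
    (u : J → Fin n → k) : ∃ w : Fin n → k, w ≠ 0 ∧ ∀ j, u j ⬝ᵥ w = 0 := by
  have h := LinearMap.ker_ne_bot_of_finrank_lt (f := Matrix.mulVecLin (Matrix.of u)) (by simpa using hJ)
  obtain ⟨w, hw, hw0⟩ := Submodule.exists_mem_ne_zero_of_ne_bot h
  exact ⟨w, hw0, fun j => congrFun (LinearMap.mem_ker.1 hw) j⟩

/-- The Gram–Schmidt step preserves common eigenvectors: the coefficient vanishes unless the
characters agree. -/
theorem isEig_sub_smul {S : Type*} {A : S → Matrix (Fin n) (Fin n) k} (hA : ∀ s, (A s)ᵀ * A s = 1)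
    {x y : Fin n → k} (hx : IsEig A x) (hy : IsEig A y) (hyy : y ⬝ᵥ y ≠ 0) :
    IsEig A (x - ((y ⬝ᵥ x) / (y ⬝ᵥ y)) • y) := by
  obtain ⟨χ, hχ⟩ := hx
  obtain ⟨η, hη⟩ := hy
  refine ⟨χ, fun s => ?_⟩
  rw [Matrix.mulVec_sub, Matrix.mulVec_smul, hχ, hη, smul_sub]
  by_cases hxy : y ⬝ᵥ x = 0
  · simp [hxy]
  · have h1 := mul_eq_one_of_eigen (hA s) (hη s) (hχ s) hxy
    have h2 := mul_eq_one_of_eigen (hA s) (hη s) (hη s) hyy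
    have h3 : χ s = η s := mul_left_cancel₀ (left_ne_zero_of_mul_eq_one h2) (h1.trans h2.symm)
    rw [h3, smul_comm]

theorem dotProduct_sub_smul_self {x y : Fin n → k} (hyy : y ⬝ᵥ y ≠ 0) :
    y ⬝ᵥ (x - ((y ⬝ᵥ x) / (y ⬝ᵥ y)) • y) = 0 := by
  rw [dotProduct_sub, dotProduct_smul, smul_eq_mul, div_mul_cancel₀ _ hyy, sub_self]

/-- The determinant is the product of the eigenvalues over an eigenbasis `u` with dual basis `w`. -/
theorem det_of_eigenbasis {J : Type*} [Fintype J] [DecidableEq J] (hJ : Fintype.card J = n)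
    {A : Matrix (Fin n) (Fin n) k} (u w : J → Fin n → k) (μ : J → k)
    (huw : ∀ i j, w i ⬝ᵥ u j = if i = j then 1 else 0) (hu : ∀ j, A *ᵥ u j = μ j • u j) :
    A.det = ∏ j, μ j := by
  have h1 : Matrix.of w * (Matrix.of u)ᵀ = 1 := by
    ext i j
    rw [Matrix.one_apply, ← huw i j]
    rfl
  have h2 : (Matrix.of u)ᵀ * Matrix.of w = 1 :=
    (Matrix.mul_eq_one_comm_of_card_eq _ _ _ (by simpa using hJ)).1 h1
  have h3 : A * (Matrix.of u)ᵀ = (Matrix.of u)ᵀ * diagonal μ := by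
    ext i j
    rw [Matrix.mul_diagonal]
    have := congrFun (hu j) i
    rw [Pi.smul_apply, smul_eq_mul, mul_comm] at this
    exact this
  rw [← Matrix.det_diagonal, ← Matrix.det_conj_of_mul_eq_one (M := Matrix.of w) (M' := (Matrix.of u)ᵀ)
    h1 h2, Matrix.mul_assoc, h3, ← Matrix.mul_assoc, h1, Matrix.one_mul]

/-- A commuting family of orthogonal matrices on `k ^ (2m)` whose common eigenvectors span has a
hyperbolic basis of common eigenvectors, provided that its self-inverse characters are trivial on
all members but one, and that one has determinant `1`. The last condition excludes an orthogonal
sum of hyperbolic planes and of two lines on which that member acts by `1` and `-1`. -/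
theorem exists_isHyp_isEig [IsAlgClosed k] (h2 : (2 : k) ≠ 0) {m : ℕ} {S : Type*}
    (A : S → Matrix (Fin (2 * m)) (Fin (2 * m)) k) (hA : ∀ s, (A s)ᵀ * A s = 1)
    (hspan : ∀ w, (∀ x, IsEig A x → w ⬝ᵥ x = 0) → w = 0) (s₀ : S) (hdet : (A s₀).det = 1)
    (htriv : ∀ x (χ : S → k), x ≠ 0 → (∀ s, A s *ᵥ x = χ s • x) → (∀ s, χ s * χ s = 1) → ∀ s, s ≠ s₀ → χ s = 1) :
    ∃ v : Fin m ⊕ Fin m → Fin (2 * m) → k, IsHyp v ∧ ∀ b, IsEig A (v b) := by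
  suffices H : ∀ r ≤ m, ∃ v : Fin r ⊕ Fin r → Fin (2 * m) → k, IsHyp v ∧ ∀ b, IsEig A (v b) from H m le_rfl
  intro r
  induction r with
  | zero => exact fun _ => ⟨fun b => isEmptyElim b, fun b => isEmptyElim b, fun b => isEmptyElim b⟩
  | succ r ih =>
    intro hr
    obtain ⟨v, hv, hvA⟩ := ih (by omega)
    -- an isotropic common eigenvector in the complement, with a partner, extends the family
    have extend : ∀ x y, IsEig A x → IsEig A y → (∀ a, v a ⬝ᵥ x = 0) → (∀ a, v a ⬝ᵥ y = 0) →
        x ⬝ᵥ x = 0 → x ⬝ᵥ y ≠ 0 → ∃ v : Fin (r + 1) ⊕ Fin (r + 1) → Fin (2 * m) → k,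
          IsHyp v ∧ ∀ b, IsEig A (v b) := by
      intro x y hx hy hvx hvy hxx hxy
      obtain ⟨c, d, h1, h3, h4⟩ := exists_isotropic_partner hA h2 hx hy hxx hxy
      refine ⟨_, hv.cons hvx (y := c • y + d • x) (fun a => ?_) hxx h4 h3, ?_⟩
      · rw [dotProduct_add, dotProduct_smul, dotProduct_smul, hvx, hvy, smul_zero, smul_zero, add_zero]
      · rintro (b | b) <;> refine Fin.cases ?_ (fun b => ?_) b
        · exact hx
        · exact hvA _
        · exact h1
        · exact hvA _
    -- every nonzero vector of the complement is non-orthogonal to some common eigenvector in it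
    have partner : ∀ w, (∀ a, v a ⬝ᵥ w = 0) → w ≠ 0 → ∃ y, IsEig A y ∧ (∀ a, v a ⬝ᵥ y = 0) ∧
        w ⬝ᵥ y ≠ 0 := by
      intro w hw hw0
      by_contra hcon
      push Not at hcon
      refine hw0 (hspan w fun x hx => ?_)
      rw [← dotProduct_hypProj_of_orthogonal v hw x]
      exact hcon _ (isEig_hypProj hA hv hvA hx) (dotProduct_hypProj hv x)
    -- otherwise the complement of `v` is anisotropic on common eigenvectors
    by_contra hno
    have aniso : ∀ x, IsEig A x → (∀ a, v a ⬝ᵥ x = 0) → x ≠ 0 → x ⬝ᵥ x ≠ 0 := by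
      intro x hx hvx hx0 hxx
      obtain ⟨y, hy, hvy, hxy⟩ := partner x hvx hx0
      exact hno (extend x y hx hy hvx hvy hxx hxy)
    have sq : ∀ x (χ : S → k), (∀ s, A s *ᵥ x = χ s • x) → (∀ a, v a ⬝ᵥ x = 0) → x ≠ 0 → ∀ s, χ s * χ s = 1 := by
      intro x χ hx hvx hx0 s
      exact mul_eq_one_of_eigen (hA s) (hx s) (hx s) (aniso x ⟨χ, hx⟩ hvx hx0)
    -- orthogonal common eigenvectors in the complement have different characters, so that the
    -- signs at `s₀` differ
    have diff : ∀ x y (χ η : S → k), (∀ s, A s *ᵥ x = χ s • x) → (∀ s, A s *ᵥ y = η s • y) →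
        (∀ a, v a ⬝ᵥ x = 0) → (∀ a, v a ⬝ᵥ y = 0) → x ≠ 0 → y ≠ 0 → x ⬝ᵥ y = 0 → χ s₀ ≠ η s₀ := by
      intro x y χ η hx hy hvx hvy hx0 hy0 hxy he
      have hχη : ∀ s, χ s = η s := by
        intro s
        by_cases hs : s = s₀
        · rw [hs, he]
        · rw [htriv x χ hx0 hx (sq x χ hx hvx hx0) s hs, htriv y η hy0 hy (sq y η hy hvy hy0) s hs]
      have hyy := aniso y ⟨η, hy⟩ hvy hy0
      have hxx := aniso x ⟨χ, hx⟩ hvx hx0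
      -- if the characters agree, some combination `x + c y` is an isotropic common eigenvector
      obtain ⟨c, hc⟩ := IsAlgClosed.exists_pow_nat_eq (-(x ⬝ᵥ x) / (y ⬝ᵥ y)) (n := 2) (by norm_num)
      have hz : (x + c • y) ⬝ᵥ (x + c • y) = 0 := by
        simp only [dotProduct_add, add_dotProduct, dotProduct_smul, smul_dotProduct, hxy,
          dotProduct_comm y x, smul_eq_mul, mul_zero, add_zero, zero_add]
        rw [← mul_assoc, ← pow_two, hc]
        field_simp
        ring
      refine aniso (x + c • y) ⟨χ, fun s => ?_⟩ (fun a => ?_) (fun h0 => ?_) hz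
      · rw [Matrix.mulVec_add, Matrix.mulVec_smul, hx, hy, hχη, smul_add, smul_comm]
      · rw [dotProduct_add, dotProduct_smul, hvx, hvy, smul_zero, add_zero]
      · have : x ⬝ᵥ (x + c • y) = 0 := by rw [h0, dotProduct_zero]
        rw [dotProduct_add, dotProduct_smul, hxy, smul_zero, add_zero] at this
        exact hxx this
    -- orthogonal common eigenvectors `y` and `z` in the complement
    obtain ⟨w₁, hw₁, hvw₁⟩ := exists_ne_zero_forall_dotProduct_eq_zero (by simp; omega) v
    obtain ⟨y, hyA, hvy, hwy⟩ := partner w₁ hvw₁ hw₁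
    have hy0 : y ≠ 0 := by rintro rfl; simp at hwy
    have hyy := aniso y hyA hvy hy0
    obtain ⟨w₂, hw₂, hvw₂⟩ := exists_ne_zero_forall_dotProduct_eq_zero
      (by simp; omega) (fun o : Option (Fin r ⊕ Fin r) => o.elim y v)
    obtain ⟨z', hzA', hvz', hwz'⟩ := partner w₂ (fun a => hvw₂ (some a)) hw₂
    obtain ⟨z, hzA, hvz, hyz, hz0⟩ : ∃ z, IsEig A z ∧ (∀ a, v a ⬝ᵥ z = 0) ∧ y ⬝ᵥ z = 0 ∧ z ≠ 0 := by
      refine ⟨_, isEig_sub_smul hA hzA' hyA hyy, fun a => ?_, dotProduct_sub_smul_self hyy, fun h0 => ?_⟩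
      · rw [dotProduct_sub, dotProduct_smul, hvz', hvy, smul_zero, sub_zero]
      · have h3 : w₂ ⬝ᵥ (z' - ((y ⬝ᵥ z') / (y ⬝ᵥ y)) • y) = 0 := by rw [h0, dotProduct_zero]
        rw [dotProduct_sub, dotProduct_smul, dotProduct_comm w₂ y, show y ⬝ᵥ w₂ = 0 from hvw₂ none,
          smul_zero, sub_zero] at h3
        exact hwz' h3
    have hzz := aniso z hzA hvz hz0
    obtain ⟨χ, hχ⟩ := id hyA
    obtain ⟨η, hη⟩ := id hzA
    have hyz' := diff y z χ η hχ hη hvy hvz hy0 hz0 hyz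
    have sqy := sq y χ hχ hvy hy0 s₀
    have sqz := sq z η hη hvz hz0 s₀
    by_cases hlast : r + 1 = m
    · -- the bad case: the determinant of `A s₀` is `-1`
      choose θ hθ using hvA
      let u : (Fin r ⊕ Fin r) ⊕ Fin 2 → Fin (2 * m) → k := Sum.elim v ![y, z]
      let u' : (Fin r ⊕ Fin r) ⊕ Fin 2 → Fin (2 * m) → k :=
        Sum.elim (fun b => v b.swap) ![(y ⬝ᵥ y)⁻¹ • y, (z ⬝ᵥ z)⁻¹ • z]
      let μ : (Fin r ⊕ Fin r) ⊕ Fin 2 → k := Sum.elim (fun b => θ b s₀) ![χ s₀, η s₀]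
      have hvy' := fun a => (dotProduct_comm y (v a)).trans (hvy a)
      have hvz' := fun a => (dotProduct_comm z (v a)).trans (hvz a)
      have hzy := (dotProduct_comm z y).trans hyz
      have hd := det_of_eigenbasis (A := A s₀) (by simp; omega) u u' μ (by
        rintro (a | a) (b | b)
        · simp only [u, u', Sum.elim_inl, hv _ _, Sum.swap_swap, Sum.inl.injEq]
          simp only [eq_comm]
        · fin_cases b <;> simp [u, u', hvy, hvz]
        · fin_cases a <;> simp [u, u', hvy', hvz']
        · fin_cases a <;> fin_cases b <;> simp [u, u', hyz, hzy, hyy, hzz]) (by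
        rintro (a | a)
        · exact hθ a s₀
        · fin_cases a
          · exact hχ s₀
          · exact hη s₀)
      have hpair : ∀ i, θ (Sum.inl i) s₀ * θ (Sum.inr i) s₀ = 1 := fun i =>
        mul_eq_one_of_eigen (hA s₀) (hθ _ s₀) (hθ _ s₀) (by rw [hv]; simp)
      rw [hdet, Fintype.prod_sum_type, Fintype.prod_sum_type] at hd
      simp only [μ, Sum.elim_inl, Sum.elim_inr, ← Finset.prod_mul_distrib, hpair, Finset.prod_const_one,
        one_mul, Fin.prod_univ_two, Matrix.cons_val_zero, Matrix.cons_val_one] at hd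
      exact hyz' (mul_left_cancel₀ (left_ne_zero_of_mul_eq_one sqy) (sqy.trans hd))
    · obtain ⟨w₃, hw₃, hvw₃⟩ := exists_ne_zero_forall_dotProduct_eq_zero
        (by simp; omega) (fun o : Option (Option (Fin r ⊕ Fin r)) => o.elim z fun o => o.elim y v)
      -- a third orthogonal common eigenvector `u`: two of the three signs at `s₀` agree
      obtain ⟨u', huA', hvu', hwu'⟩ := partner w₃ (fun a => hvw₃ (some (some a))) hw₃
      have hwy₃ : w₃ ⬝ᵥ y = 0 := (dotProduct_comm _ _).trans (hvw₃ (some none))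
      have hwz₃ : w₃ ⬝ᵥ z = 0 := (dotProduct_comm _ _).trans (hvw₃ none)
      obtain ⟨u, huA, hvu, hyu, hzu, hu0⟩ : ∃ u, IsEig A u ∧ (∀ a, v a ⬝ᵥ u = 0) ∧ y ⬝ᵥ u = 0 ∧
          z ⬝ᵥ u = 0 ∧ u ≠ 0 := by
        refine ⟨_, isEig_sub_smul hA (isEig_sub_smul hA huA' hyA hyy) hzA hzz, fun a => ?_, ?_,
          dotProduct_sub_smul_self hzz, fun h0 => ?_⟩
        · simp only [dotProduct_sub, dotProduct_smul, hvu', hvy, hvz, smul_zero, sub_zero]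
        · rw [dotProduct_sub, dotProduct_sub_smul_self hyy, dotProduct_smul, hyz, smul_zero, sub_zero]
        · have h3 := congrArg (fun t => w₃ ⬝ᵥ t) h0
          simp only [dotProduct_sub, dotProduct_smul, hwy₃, hwz₃, smul_zero, sub_zero,
            dotProduct_zero] at h3
          exact hwu' h3
      obtain ⟨ζ, hζ⟩ := id huA
      have hyu' := diff y u χ ζ hχ hζ hvy hvu hy0 hu0 hyu
      have hzu' := diff z u η ζ hη hζ hvz hvu hz0 hu0 hzu
      have squ := sq u ζ hζ hvu hu0 s₀
      rcases mul_self_eq_one_iff.1 sqy with h | h <;> rcases mul_self_eq_one_iff.1 sqz with h' | h' <;>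
        rcases mul_self_eq_one_iff.1 squ with h'' | h'' <;>
        first
          | exact hyz' (h.trans h'.symm)
          | exact hyu' (h.trans h''.symm)
          | exact hzu' (h'.trans h''.symm)

end Hyperbolic

/-! ### Weights and characters of split tori -/

section Weights

variable {k : Type*} [Field k]

/-- The weights of a hyperbolic basis: `v (inl i)` has the weight `L i` and `v (inr i)` its inverse. -/
def wt {A I : Type*} [Group A] (L : I → A) : I ⊕ I → A := Sum.elim L fun i => (L i)⁻¹

@[simp] theorem wt_inl {A I : Type*} [Group A] (L : I → A) (i : I) : wt L (Sum.inl i) = L i := rfl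

@[simp] theorem wt_inr {A I : Type*} [Group A] (L : I → A) (i : I) : wt L (Sum.inr i) = (L i)⁻¹ := rfl

theorem wt_swap {A I : Type*} [Group A] (L : I → A) (a : I ⊕ I) : wt L a.swap = (wt L a)⁻¹ := by
  rcases a with i | i <;> simp

theorem eq_zero_of_forall_zpow_eq_one [Infinite k] {d : ℤ} (h : ∀ u : kˣ, u ^ d = 1) : d = 0 := by
  by_contra hd
  have h1 : ∀ u : kˣ, u ^ d.natAbs = 1 := fun u => by
    rcases Int.natAbs_eq d with e | e
    · rw [← zpow_natCast, ← e]; exact h u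
    · have := h u
      rw [e, _root_.zpow_neg, inv_eq_one, zpow_natCast] at this
      exact this
  have hpos : 0 < d.natAbs := Int.natAbs_pos.2 hd
  have h2 : (Polynomial.X ^ d.natAbs - 1 : Polynomial k) * Polynomial.X = 0 := by
    refine Polynomial.funext fun t => ?_
    by_cases ht : t = 0
    · simp [ht]
    · have := congrArg (Units.val) (h1 (Units.mk0 t ht))
      simp only [Units.val_pow_eq_pow_val, Units.val_mk0, Units.val_one] at this
      simp [this]
  rcases mul_eq_zero.1 h2 with h3 | h3
  · exact Polynomial.X_pow_sub_C_ne_zero hpos (1 : k) (by simpa using h3)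
  · exact Polynomial.X_ne_zero h3

/-- The character `s ↦ ∏ s_l ^ (α_l)` of a split torus. -/
def monomialHom (k : Type*) [Field k] {ι : Type*} [Fintype ι] (α : ι → ℤ) : (ι → kˣ) →* kˣ where
  toFun s := ∏ l, s l ^ α l
  map_one' := by simp
  map_mul' s t := by simp [mul_zpow, Finset.prod_mul_distrib]

theorem monomialHom_injective [Infinite k] {ι : Type*} [Fintype ι] :
    Function.Injective (monomialHom k (ι := ι)) := by
  classical
  intro α β h
  funext l
  rw [← sub_eq_zero]
  refine eq_zero_of_forall_zpow_eq_one (k := k) fun u => ?_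
  have key (γ : ι → ℤ) : monomialHom k γ (Pi.mulSingle l u) = u ^ γ l := by
    change ∏ j, (Pi.mulSingle l u : ι → kˣ) j ^ γ j = _
    rw [Finset.prod_eq_single l]
    · simp
    · intro j _ hj; simp [hj]
    · simp
  rw [_root_.zpow_sub, ← key, ← key, h, mul_inv_cancel]

/-- Linear independence of the characters of a split torus. -/
theorem eq_zero_of_sum_monomialHom [Infinite k] {ι : Type*} [Fintype ι] (F : Finset (ι → ℤ))
    (d : (ι → ℤ) → k) (h : ∀ s : ι → kˣ, ∑ α ∈ F, d α * (monomialHom k α s : kˣ) = 0) :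
    ∀ α ∈ F, d α = 0 := by
  have hinj : Function.Injective fun α : ι → ℤ => (Units.coeHom k).comp (monomialHom k α) := by
    intro α β e
    exact monomialHom_injective (MonoidHom.ext fun s => Units.ext (DFunLike.congr_fun e s))
  have hli := (linearIndependent_monoidHom (ι → kˣ) k).comp _ hinj
  refine linearIndependent_iff'.1 hli F d (funext fun s => ?_)
  simpa [Finset.sum_apply] using h s

end Weights

/-! ### Weight decomposition of a torus -/

section Torus

variable {k : Type*} [Field k] {n : ℕ}

/-- A torus is a sum of weight projections: its elements are combinations, with characters of the
parameter group as coefficients, of matrices `C α` with sum `1` whose columns are common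
eigenvectors, and everything commuting with the torus commutes with the `C α`. -/
theorem IsTorus.exists_weights [Infinite k] {r : ℕ} (f : (Fin r → kˣ) →* GL (Fin n) k)
    (hf : ∀ i j, ∃ c : (Fin r → ℤ) →₀ k, ∀ s : Fin r → kˣ,
      (f s : Matrix (Fin n) (Fin n) k) i j = c.sum fun a x => x * ∏ l, ((s l ^ a l : kˣ) : k)) :
    ∃ (F : Finset (Fin r → ℤ)) (C : (Fin r → ℤ) → Matrix (Fin n) (Fin n) k), ∑ α ∈ F, C α = 1 ∧
      (∀ α ∈ F, ∀ s, (f s : Matrix (Fin n) (Fin n) k) * C α = ((monomialHom k α s : kˣ) : k) • C α) ∧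
      ∀ g : Matrix (Fin n) (Fin n) k, (∀ s, (f s : Matrix (Fin n) (Fin n) k) * g = g * f s) →
        ∀ α ∈ F, C α * g = g * C α := by
  classical
  choose c hc using hf
  -- collect the coefficients of each character into a matrix; the characters are linearly
  -- independent
  let F : Finset (Fin r → ℤ) := Finset.univ.biUnion fun e : Fin n × Fin n => (c e.1 e.2).support
  let C : (Fin r → ℤ) → Matrix (Fin n) (Fin n) k := fun α => Matrix.of fun i j => c i j α
  have hfC : ∀ s, (f s : Matrix (Fin n) (Fin n) k) = ∑ α ∈ F, ((monomialHom k α s : kˣ) : k) • C α := by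
    intro s
    ext i j
    rw [hc, Finsupp.sum_of_support_subset (s := F)]
    · simp [C, monomialHom, Matrix.sum_apply, mul_comm, Units.coe_prod]
    · exact fun α hα => Finset.mem_biUnion.2 ⟨(i, j), Finset.mem_univ _, hα⟩
    · simp
  have indep : ∀ D : (Fin r → ℤ) → Matrix (Fin n) (Fin n) k,
      (∀ s, ∑ α ∈ F, ((monomialHom k α s : kˣ) : k) • D α = 0) → ∀ α ∈ F, D α = 0 := by
    intro D hD α hα
    ext i j
    refine eq_zero_of_sum_monomialHom F (fun α => D α i j) (fun s => ?_) α hα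
    have := congrFun (congrFun (hD s) i) j
    simpa [Matrix.sum_apply, mul_comm] using this
  refine ⟨F, C, ?_, ?_, ?_⟩
  · have := hfC 1
    simpa using this.symm
  · intro α hα s
    rw [← sub_eq_zero]
    refine indep (fun α => (f s : Matrix (Fin n) (Fin n) k) * C α - ((monomialHom k α s : kˣ) : k) • C α)
      (fun t => ?_) α hα
    have h1 := hfC (s * t)
    rw [map_mul, Units.val_mul, hfC t, Finset.mul_sum] at h1
    simp only [smul_sub, Finset.sum_sub_distrib]
    rw [sub_eq_zero]
    convert h1 using 2 with β hβ β hβ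
    · rw [Matrix.mul_smul]
    · rw [map_mul, Units.val_mul, smul_smul, mul_comm]
  · intro g hg α hα
    rw [← sub_eq_zero]
    refine indep (fun α => C α * g - g * C α) (fun t => ?_) α hα
    have h1 := hg t
    rw [hfC t, Finset.sum_mul, Finset.mul_sum] at h1
    simp only [smul_sub, Finset.sum_sub_distrib]
    rw [sub_eq_zero]
    convert h1 using 2 with β hβ β hβ
    · rw [Matrix.smul_mul]
    · rw [Matrix.mul_smul]

/-- The eigenvectors of a matrix of finite order prime to the characteristic span. -/
theorem eigenvectors_induction [IsAlgClosed k] {g : Matrix (Fin n) (Fin n) k} {N : ℕ}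
    (hN : (N : k) ≠ 0) (hg : g ^ N = 1) (P : Submodule k (Fin n → k))
    (hP : ∀ x (μ : k), g *ᵥ x = μ • x → x ∈ P) (x : Fin n → k) : x ∈ P := by
  let φ : Module.End k (Fin n → k) := Matrix.toLin' g
  have hss : φ.IsSemisimple := by
    refine Module.End.isSemisimple_of_squarefree_aeval_eq_zero (p := Polynomial.X ^ N - 1) ?_ ?_
    · have := (Polynomial.separable_X_pow_sub_C (1 : k) hN one_ne_zero).squarefree
      simpa using this
    · rw [map_sub, map_pow, Polynomial.aeval_X, map_one, ← Matrix.toLin'_pow, hg, Matrix.toLin'_one]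
      exact sub_self _
  have h := hss.iSup_eigenspace_eq_top
  have hle : (⨆ μ : k, φ.eigenspace μ) ≤ P := iSup_le fun μ y hy =>
    hP y μ (Module.End.mem_eigenspace_iff.1 hy)
  exact hle (h ▸ Submodule.mem_top)

end Torus

/-! ### Hyperbolic eigenbases of an element and a torus -/

section Adapted

variable {k : Type*} [Field k] {n : ℕ} {I : Type*} [DecidableEq I]

/-- A hyperbolic family of eigenvectors of `g`, with eigenvalues `L i` and `(L i)⁻¹`. -/
def Adapted (g : Matrix (Fin n) (Fin n) k) (v : I ⊕ I → Fin n → k) (L : I → kˣ) : Prop :=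
  IsHyp v ∧ ∀ a, g *ᵥ v a = ((wt L a : kˣ) : k) • v a

/-- The eigenvalues on the two vectors of a hyperbolic pair are mutually inverse. -/
theorem exists_units_of_isEig {S : Type*} {A : S → Matrix (Fin n) (Fin n) k} (hA : ∀ s, (A s)ᵀ * A s = 1)
    {v : I ⊕ I → Fin n → k} (hv : IsHyp v) (hvA : ∀ b, IsEig A (v b)) (s : S) :
    ∃ L : I → kˣ, Adapted (A s) v L := by
  choose χ hχ using hvA
  have hp : ∀ i, χ (Sum.inl i) s * χ (Sum.inr i) s = 1 := fun i =>
    mul_eq_one_of_eigen (hA s) (hχ _ s) (hχ _ s) (by rw [hv]; simp)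
  refine ⟨fun i => ⟨χ (Sum.inl i) s, χ (Sum.inr i) s, hp i, (mul_comm _ _).trans (hp i)⟩, hv, ?_⟩
  rintro (i | i)
  · exact hχ _ s
  · exact hχ _ s

/-- An element of `SO_{2m}` of finite order prime to the characteristic and a torus commuting with
it are simultaneously diagonal in some hyperbolic basis. -/
theorem exists_adapted_of_torus [IsAlgClosed k] (h2 : (2 : k) ≠ 0) {m : ℕ}
    {g : Matrix (Fin (2 * m)) (Fin (2 * m)) k} (hg : gᵀ * g = 1) (hdet : g.det = 1) {N : ℕ}
    (hN : (N : k) ≠ 0) (hgN : g ^ N = 1) {T : Subgroup (GL (Fin (2 * m)) k)} (hT : IsTorus T)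
    (hTo : ∀ t ∈ T, (t : Matrix (Fin (2 * m)) (Fin (2 * m)) k)ᵀ * (t : Matrix _ _ k) = 1)
    (hTg : ∀ t ∈ T, (t : Matrix (Fin (2 * m)) (Fin (2 * m)) k) * g = g * (t : Matrix _ _ k)) :
    ∃ (v : Fin m ⊕ Fin m → Fin (2 * m) → k) (L : Fin m → kˣ), Adapted g v L ∧
      ∀ t ∈ T, ∃ s : Fin m → kˣ, Adapted (t : Matrix (Fin (2 * m)) (Fin (2 * m)) k) v s := by
  have : Infinite k := IsAlgClosed.instInfinite
  obtain ⟨r, f, hf, rfl⟩ := hT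
  obtain ⟨F, C, hC1, hfC, hCg⟩ := IsTorus.exists_weights f hf
  let A : Option (Fin r → kˣ) → Matrix (Fin (2 * m)) (Fin (2 * m)) k := fun o => o.elim g fun s => f s
  have hA : ∀ s, (A s)ᵀ * A s = 1 := by
    rintro (_ | s)
    · exact hg
    · exact hTo _ ⟨s, rfl⟩
  have hspan : ∀ w, (∀ x, IsEig A x → w ⬝ᵥ x = 0) → w = 0 := by
    intro w hw
    have key : ∀ α ∈ F, ∀ x, w ⬝ᵥ (C α *ᵥ x) = 0 := by
      intro α hα x
      let P : Submodule k (Fin (2 * m) → k) :=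
        { carrier := {x | w ⬝ᵥ (C α *ᵥ x) = 0}
          zero_mem' := by simp
          add_mem' := fun {a b} ha hb => by
            simp only [Set.mem_ofPred_eq] at ha hb ⊢
            rw [Matrix.mulVec_add, dotProduct_add, ha, hb, add_zero]
          smul_mem' := fun c a ha => by
            simp only [Set.mem_ofPred_eq] at ha ⊢
            rw [Matrix.mulVec_smul, dotProduct_smul, ha, smul_zero] }
      refine eigenvectors_induction hN hgN P (fun x μ hx => hw _ ?_) x
      refine ⟨fun o => o.elim μ fun s => ((monomialHom k α s : kˣ) : k), ?_⟩
      rintro (_ | s)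
      · change g *ᵥ (C α *ᵥ x) = μ • (C α *ᵥ x)
        rw [Matrix.mulVec_mulVec, ← hCg g (fun s => hTg _ ⟨s, rfl⟩) α hα, ← Matrix.mulVec_mulVec, hx,
          Matrix.mulVec_smul]
      · change (f s : Matrix (Fin (2 * m)) (Fin (2 * m)) k) *ᵥ (C α *ᵥ x) = _
        rw [Matrix.mulVec_mulVec, hfC α hα, Matrix.smul_mulVec]
        rfl
    refine dotProduct_eq_zero w fun x => ?_
    rw [← Matrix.one_mulVec x, ← hC1, Matrix.sum_mulVec, dotProduct_sum]
    exact Finset.sum_eq_zero fun α hα => key α hα x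
  obtain ⟨v, hv, hvA⟩ := exists_isHyp_isEig h2 A hA hspan none hdet (by
    -- self-inverse characters are trivial on the divisible group `T`
    rintro x χ hx0 hx hχ (_ | s) hs
    · exact absurd rfl hs
    · choose u hu using fun l => IsAlgClosed.exists_pow_nat_eq ((s l : kˣ) : k) (n := 2) (by norm_num)
      let t : Fin r → kˣ := fun l => Units.mk0 (u l) fun h0 => (s l).ne_zero (by rw [← hu l, h0]; simp)
      have hst : s = t * t := funext fun l => Units.ext (by rw [← hu l, pow_two]; rfl)
      have h1 : A (some s) *ᵥ x = x := by
        have : A (some s) = A (some t) * A (some t) := by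
          change (f s : Matrix (Fin (2 * m)) (Fin (2 * m)) k) = f t * f t
          rw [hst, map_mul, Units.val_mul]
        rw [this, ← Matrix.mulVec_mulVec, hx, Matrix.mulVec_smul, hx, smul_smul, hχ, one_smul]
      rw [hx] at h1
      obtain ⟨i, hi⟩ := Function.ne_iff.1 hx0
      exact mul_right_cancel₀ hi (by rw [one_mul]; exact congrFun h1 i))
  obtain ⟨L, hL⟩ := exists_units_of_isEig hA hv hvA none
  refine ⟨v, L, hL, ?_⟩
  rintro _ ⟨s, rfl⟩
  exact exists_units_of_isEig hA hv hvA (some s)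

end Adapted

/-! ### The base change matrix of a hyperbolic basis -/

section HypMatrix

variable {k : Type*} [Field k] {n : ℕ} {I : Type*} [Fintype I] [DecidableEq I]

/-- The matrix with columns `v a`. -/
def hypMat (v : I ⊕ I → Fin n → k) : Matrix (Fin n) (I ⊕ I) k := (Matrix.of v)ᵀ

/-- The matrix with rows `v a.swap`: the inverse of `hypMat v` for a hyperbolic basis. -/
def hypDual (v : I ⊕ I → Fin n → k) : Matrix (I ⊕ I) (Fin n) k := Matrix.of fun a => v a.swap

omit [Fintype I] in
theorem hypDual_mul_hypMat {v : I ⊕ I → Fin n → k} (hv : IsHyp v) : hypDual v * hypMat v = 1 := by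
  ext a b
  have := hv a.swap b
  rw [Sum.swap_swap] at this
  rw [Matrix.one_apply]
  simp only [eq_comm (a := a)]
  exact this

theorem hypMat_mul_hypDual {v : I ⊕ I → Fin n → k} (hv : IsHyp v) (hI : 2 * Fintype.card I = n) :
    hypMat v * hypDual v = 1 :=
  (Matrix.mul_eq_one_comm_of_card_eq _ _ _ (by simp; omega)).1 (hypDual_mul_hypMat hv)

theorem mul_hypMat {A : Matrix (Fin n) (Fin n) k} {v : I ⊕ I → Fin n → k} {μ : I ⊕ I → k}
    (h : ∀ a, A *ᵥ v a = μ a • v a) : A * hypMat v = hypMat v * diagonal μ := by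
  ext i a
  rw [Matrix.mul_diagonal, mul_comm]
  exact congrFun (h a) i

theorem Adapted.eq_hypMat_mul {g : Matrix (Fin n) (Fin n) k} {v : I ⊕ I → Fin n → k} {L : I → kˣ}
    (h : Adapted g v L) (hI : 2 * Fintype.card I = n) :
    g = hypMat v * diagonal (fun a => ((wt L a : kˣ) : k)) * hypDual v := by
  rw [← mul_hypMat h.2, Matrix.mul_assoc, hypMat_mul_hypDual h.1 hI, Matrix.mul_one]

/-- The element of the standard torus of a hyperbolic basis with parameters `s`. -/
def hypDiag (v : I ⊕ I → Fin n → k) (s : I → kˣ) : Matrix (Fin n) (Fin n) k :=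
  hypMat v * diagonal (fun a => ((wt s a : kˣ) : k)) * hypDual v

theorem adapted_hypDiag {v : I ⊕ I → Fin n → k} (hv : IsHyp v) (s : I → kˣ) :
    Adapted (hypDiag v s) v s := by
  refine ⟨hv, fun a => ?_⟩
  have h : hypDiag v s * hypMat v = hypMat v * diagonal (fun a => ((wt s a : kˣ) : k)) := by
    rw [hypDiag, Matrix.mul_assoc, hypDual_mul_hypMat hv, Matrix.mul_one]
  funext i
  have := congrFun (congrFun h i) a
  rw [Matrix.mul_diagonal, mul_comm] at this
  exact this

omit [Field k] [Fintype I] [DecidableEq I] in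
theorem hypDual_transpose_eq (v : I ⊕ I → Fin n → k) :
    (hypDual v)ᵀ = (hypMat v).submatrix id Sum.swap := rfl

theorem Adapted.mul_transpose {g : Matrix (Fin n) (Fin n) k} {v : I ⊕ I → Fin n → k} {L : I → kˣ}
    (h : Adapted g v L) (hI : 2 * Fintype.card I = n) : g * gᵀ = 1 := by
  have key : gᵀ * hypMat v =
      hypMat v * (diagonal (fun a => ((wt L a.swap : kˣ) : k)) : Matrix (I ⊕ I) (I ⊕ I) k) := by
    have h1 : gᵀ = (hypDual v)ᵀ * diagonal (fun a => ((wt L a : kˣ) : k)) * (hypMat v)ᵀ := by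
      conv_lhs => rw [h.eq_hypMat_mul hI]
      rw [Matrix.transpose_mul, Matrix.transpose_mul, Matrix.diagonal_transpose, ← Matrix.mul_assoc]
    have h2 : (hypMat v)ᵀ * hypMat v = (1 : Matrix (I ⊕ I) (I ⊕ I) k).submatrix Sum.swap id := by
      ext a b
      rw [Matrix.submatrix_apply, Matrix.one_apply]
      simp only [id, eq_comm (a := a.swap)]
      exact h.1 a b
    rw [h1, Matrix.mul_assoc, h2]
    ext i a
    rw [Matrix.mul_apply, Finset.sum_eq_single a.swap]
    · simp [hypDual_transpose_eq, Matrix.mul_diagonal, Matrix.one_apply]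
    · intro b _ hb
      have : ¬ b.swap = a := fun e => hb (by rw [← e, Sum.swap_swap])
      simp [this]
    · simp
  rw [mul_eq_one_comm]
  have : gᵀ * g * hypMat v = hypMat v := by
    rw [Matrix.mul_assoc, mul_hypMat h.2, ← Matrix.mul_assoc, key, Matrix.mul_assoc,
      Matrix.diagonal_mul_diagonal]
    simp [wt_swap]
  calc gᵀ * g = gᵀ * g * (hypMat v * hypDual v) := by rw [hypMat_mul_hypDual h.1 hI, mul_one]
    _ = 1 := by rw [← Matrix.mul_assoc, this, hypMat_mul_hypDual h.1 hI]

theorem IsHyp.det_eq_prod {v : I ⊕ I → Fin n → k} (hv : IsHyp v) (hI : 2 * Fintype.card I = n)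
    {A : Matrix (Fin n) (Fin n) k} {μ : I ⊕ I → k} (h : ∀ a, A *ᵥ v a = μ a • v a) :
    A.det = ∏ a, μ a :=
  det_of_eigenbasis (by simp; omega) v (fun a => v a.swap) μ (fun i j => by
    rw [hv, Sum.swap_swap]; simp only [eq_comm]) h

theorem Adapted.det_eq_one {g : Matrix (Fin n) (Fin n) k} {v : I ⊕ I → Fin n → k} {L : I → kˣ}
    (h : Adapted g v L) (hI : 2 * Fintype.card I = n) : g.det = 1 := by
  rw [h.1.det_eq_prod hI h.2, Fintype.prod_sum_type]
  simp only [wt_inl, wt_inr]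
  rw [← Finset.prod_mul_distrib]
  simp

end HypMatrix

/-! ### Uniqueness of the eigenvalues up to inversion and permutation -/

section Relabel

variable {k : Type*} [Field k] {n : ℕ}

theorem Adapted.comp {I I' : Type*} [DecidableEq I] [DecidableEq I'] {g : Matrix (Fin n) (Fin n) k}
    {v : I ⊕ I → Fin n → k} {L : I → kˣ} (h : Adapted g v L) (τ : I' ⊕ I' ≃ I ⊕ I)
    (hτ : ∀ a, τ a.swap = (τ a).swap) {L' : I' → kˣ} (hL : ∀ a, wt L' a = wt L (τ a)) :
    Adapted g (v ∘ τ) L' := by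
  refine ⟨fun a b => ?_, fun a => ?_⟩
  · rw [Function.comp_apply, Function.comp_apply, h.1, ← hτ]
    simp
  · rw [hL]
    exact h.2 (τ a)

/-- The permutation of `I ⊕ I` that exchanges `inl i` and `inr i` for `i` in `P`. -/
def flipEquiv {I : Type*} (P : I → Prop) [DecidablePred P] : I ⊕ I ≃ I ⊕ I :=
  Function.Involutive.toPerm
    (fun a => if P (Sum.elim id id a) then a.swap else a) (by
      rintro (i | i) <;> by_cases h : P i <;> simp [h])

theorem flipEquiv_apply {I : Type*} (P : I → Prop) [DecidablePred P] (a : I ⊕ I) :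
    flipEquiv P a = if P (Sum.elim id id a) then a.swap else a := rfl

theorem flipEquiv_flipEquiv {I : Type*} (P : I → Prop) [DecidablePred P] (a : I ⊕ I) :
    flipEquiv P (flipEquiv P a) = a :=
  (flipEquiv P).left_inv a

theorem flipEquiv_swap {I : Type*} (P : I → Prop) [DecidablePred P] (a : I ⊕ I) :
    flipEquiv P a.swap = (flipEquiv P a).swap := by
  rcases a with i | i <;> by_cases h : P i <;> simp [flipEquiv_apply, h]

theorem wt_flip {A I : Type*} [Group A] (P : I → Prop) [DecidablePred P] (L : I → A) (a : I ⊕ I) :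
    wt (fun i => if P i then (L i)⁻¹ else L i) a = wt L (flipEquiv P a) := by
  rcases a with i | i <;> by_cases h : P i <;> simp [flipEquiv_apply, h]

theorem exists_equiv_of_map_eq {I I' X : Type*} [Fintype I] [Fintype I'] {f : I → X} {f' : I' → X}
    (h : Multiset.map f Finset.univ.val = Multiset.map f' Finset.univ.val) :
    ∃ σ : I ≃ I', ∀ i, f' (σ i) = f i := by
  classical
  have hc : ∀ x, Fintype.card {i // f i = x} = Fintype.card {i // f' i = x} := by
    intro x
    have := congrArg (Multiset.count x) h
    rw [Multiset.count_map, Multiset.count_map] at this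
    rw [Fintype.card_subtype, Fintype.card_subtype]
    simpa [Finset.card_def, Finset.filter_val, eq_comm] using this
  let σ : I ≃ I' := (Equiv.sigmaFiberEquiv f).symm.trans
    ((Equiv.sigmaCongrRight fun x => Fintype.equivOfCardEq (hc x)).trans (Equiv.sigmaFiberEquiv f'))
  refine ⟨σ, fun i => ?_⟩
  exact (Fintype.equivOfCardEq (hc (f i)) ⟨i, rfl⟩).2

/-- A multiset of group elements is determined by its union with its inverse, once every pair of
mutually inverse elements has a distinguished member and the multiset consists of such members. -/
theorem eq_of_add_map_inv_eq {A : Type*} [Group A] [LinearOrder A] {M M' : Multiset A}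
    (hM : ∀ a ∈ M, a ≤ a⁻¹) (hM' : ∀ a ∈ M', a ≤ a⁻¹)
    (h : M + M.map (fun a => a⁻¹) = M' + M'.map (fun a => a⁻¹)) : M = M' := by
  ext μ
  have hinv : ∀ N : Multiset A, Multiset.count μ (N.map fun a => a⁻¹) = Multiset.count μ⁻¹ N := by
    intro N
    have := Multiset.count_map_eq_count' (fun a : A => a⁻¹) N inv_injective μ⁻¹
    rwa [inv_inv] at this
  have hc := congrArg (Multiset.count μ) h
  rw [Multiset.count_add, Multiset.count_add, hinv, hinv] at hc
  by_cases h1 : μ ≤ μ⁻¹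
  · by_cases h2 : μ = μ⁻¹
    · rw [← h2] at hc; omega
    · have h3 : ∀ N : Multiset A, (∀ a ∈ N, a ≤ a⁻¹) → Multiset.count μ⁻¹ N = 0 := by
        intro N hN
        refine Multiset.count_eq_zero.2 fun hm => h2 (le_antisymm h1 ?_)
        simpa using hN _ hm
      rw [h3 M hM, h3 M' hM'] at hc
      simpa using hc
  · rw [Multiset.count_eq_zero.2 fun hm => h1 (hM _ hm),
      Multiset.count_eq_zero.2 fun hm => h1 (hM' _ hm)]

theorem map_X_sub_C_units {J : Type*} [Fintype J] (f : J → kˣ) :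
    Multiset.map (fun a => Polynomial.X - Polynomial.C ((f a : kˣ) : k)) Finset.univ.val =
      Multiset.map (fun x => Polynomial.X - Polynomial.C x)
        (Multiset.map Units.val (Multiset.map f Finset.univ.val)) := by
  rw [Multiset.map_map, Multiset.map_map]
  rfl

theorem map_wt_univ {A J : Type*} [Group A] [Fintype J] (f : J → A) :
    Multiset.map (wt f) Finset.univ.val =
      Multiset.map f Finset.univ.val + (Multiset.map f Finset.univ.val).map (fun a => a⁻¹) := by
  rw [Multiset.map_map, ← Finset.univ_disjSum_univ, Finset.val_disjSum, Multiset.disjSum,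
    Multiset.map_add, Multiset.map_map, Multiset.map_map]
  rfl

theorem map_wt_flip {A J : Type*} [Group A] [Fintype J] (f : J → A) (Q : J → Prop) [DecidablePred Q] :
    Multiset.map (wt fun i => if Q i then (f i)⁻¹ else f i) Finset.univ.val =
      Multiset.map (wt f) Finset.univ.val := by
  conv_rhs => rw [← Multiset.map_univ_val_equiv (flipEquiv Q), Multiset.map_map]
  exact Multiset.map_congr rfl fun a _ => wt_flip Q f a

variable {I I' : Type*} [Fintype I] [DecidableEq I] [Fintype I'] [DecidableEq I']

/-- The eigenvalues of a hyperbolic eigenbasis are the roots of the characteristic polynomial. -/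
theorem Adapted.map_wt_eq [Infinite k] {g : Matrix (Fin n) (Fin n) k} {v : I ⊕ I → Fin n → k}
    {L : I → kˣ} (h : Adapted g v L) (hI : 2 * Fintype.card I = n) {v' : I' ⊕ I' → Fin n → k}
    {L' : I' → kˣ} (h' : Adapted g v' L') (hI' : 2 * Fintype.card I' = n) :
    Multiset.map (wt L) Finset.univ.val = Multiset.map (wt L') Finset.univ.val := by
  -- both sides are the characteristic polynomial
  have key : ∏ a, (Polynomial.X - Polynomial.C ((wt L a : kˣ) : k)) =
      ∏ a, (Polynomial.X - Polynomial.C ((wt L' a : kˣ) : k)) := by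
    refine Polynomial.funext fun t => ?_
    rw [Polynomial.eval_prod, Polynomial.eval_prod]
    simp only [Polynomial.eval_sub, Polynomial.eval_X, Polynomial.eval_C]
    rw [← h.1.det_eq_prod hI (A := t • 1 - g), ← h'.1.det_eq_prod hI' (A := t • 1 - g)]
    · intro a
      rw [Matrix.sub_mulVec, Matrix.smul_mulVec, Matrix.one_mulVec, h'.2, sub_smul]
    · intro a
      rw [Matrix.sub_mulVec, Matrix.smul_mulVec, Matrix.one_mulVec, h.2, sub_smul]
  have hr := congrArg Polynomial.roots key
  rw [Finset.prod_eq_multiset_prod, Finset.prod_eq_multiset_prod,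
    map_X_sub_C_units, map_X_sub_C_units, Polynomial.roots_multiset_prod_X_sub_C, Polynomial.roots_multiset_prod_X_sub_C] at hr
  exact Multiset.map_injective Units.val_injective hr

/-- The eigenvalues of two hyperbolic eigenbases of the same matrix agree up to inversions and a
permutation. -/
theorem Adapted.exists_relabel [Infinite k] {g : Matrix (Fin n) (Fin n) k} {v : I ⊕ I → Fin n → k}
    {L : I → kˣ} (h : Adapted g v L) (hI : 2 * Fintype.card I = n) {v' : I' ⊕ I' → Fin n → k}
    {L' : I' → kˣ} (h' : Adapted g v' L') (hI' : 2 * Fintype.card I' = n) :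
    ∃ τ : I ⊕ I ≃ I' ⊕ I', (∀ a, τ a.swap = (τ a).swap) ∧ ∀ a, wt L a = wt L' (τ a) := by
  classical
  -- an arbitrary linear order distinguishes one eigenvalue of each pair of mutually inverse ones
  let _ : LinearOrder kˣ := linearOrderOfSTO WellOrderingRel
  let P : I → Prop := fun i => ¬ L i ≤ (L i)⁻¹
  let P' : I' → Prop := fun i => ¬ L' i ≤ (L' i)⁻¹
  let M : I → kˣ := fun i => if P i then (L i)⁻¹ else L i
  let M' : I' → kˣ := fun i => if P' i then (L' i)⁻¹ else L' i
  have hM : Multiset.map M Finset.univ.val = Multiset.map M' Finset.univ.val := by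
    refine eq_of_add_map_inv_eq ?_ ?_ ?_
    · intro a ha
      obtain ⟨i, -, rfl⟩ := Multiset.mem_map.1 ha
      by_cases hi : P i
      · simp only [M, hi, if_true, inv_inv]; exact (not_le.1 hi).le
      · simp only [M, hi, if_false]; exact not_not.1 hi
    · intro a ha
      obtain ⟨i, -, rfl⟩ := Multiset.mem_map.1 ha
      by_cases hi : P' i
      · simp only [M', hi, if_true, inv_inv]; exact (not_le.1 hi).le
      · simp only [M', hi, if_false]; exact not_not.1 hi
    · rw [← map_wt_univ, ← map_wt_univ, map_wt_flip, map_wt_flip]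
      exact h.map_wt_eq hI h' hI'
  obtain ⟨σ, hσ⟩ := exists_equiv_of_map_eq hM
  refine ⟨(flipEquiv P).trans ((Equiv.sumCongr σ σ).trans (flipEquiv P')), fun a => ?_, fun a => ?_⟩
  · rw [Equiv.trans_apply, Equiv.trans_apply, Equiv.trans_apply, Equiv.trans_apply, ← flipEquiv_swap,
      flipEquiv_swap]
    congr 1
    rcases flipEquiv P a with i | i <;> rfl
  · have e1 : wt L a = wt M (flipEquiv P a) := by
      rw [wt_flip, flipEquiv_flipEquiv]
    have e2 : ∀ b, wt M b = wt M' (Equiv.sumCongr σ σ b) := by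
      rintro (i | i)
      · exact (hσ i).symm
      · exact congrArg (fun x => x⁻¹) (hσ i).symm
    rw [e1, e2, Equiv.trans_apply, Equiv.trans_apply]
    exact wt_flip P' L' _

end Relabel

/-! ### Conjugacy of elements with the same eigenvalues -/

section Conjugacy

variable {k : Type*} [Field k] {n : ℕ} {I : Type*} [Fintype I] [DecidableEq I]

/-- The matrix that maps one hyperbolic basis to another is orthogonal. -/
theorem hypMat_mul_hypDual_orthogonal {v v' : I ⊕ I → Fin n → k} (hv : IsHyp v) (hv' : IsHyp v')
    (hI : 2 * Fintype.card I = n) :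
    (hypMat v' * hypDual v) * (hypMat v' * hypDual v)ᵀ = 1 := by
  have h1 : hypDual v * (hypDual v)ᵀ = (1 : Matrix (I ⊕ I) (I ⊕ I) k).submatrix id Sum.swap := by
    ext a b
    rw [Matrix.submatrix_apply, Matrix.one_apply]
    have := hv a.swap b.swap
    rw [Sum.swap_swap] at this
    simp only [id, eq_comm (a := a)]
    exact this
  have h2 : (1 : Matrix (I ⊕ I) (I ⊕ I) k).submatrix id Sum.swap * (hypMat v')ᵀ = hypDual v' := by
    ext a i
    rw [Matrix.mul_apply, Finset.sum_eq_single a.swap]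
    · simp [hypDual, hypMat, Matrix.one_apply]
    · intro b _ hb
      have : ¬ a = b.swap := fun e => hb (by rw [e, Sum.swap_swap])
      simp [this]
    · simp
  rw [Matrix.transpose_mul, Matrix.mul_assoc, ← Matrix.mul_assoc (hypDual v), h1, h2,
    hypMat_mul_hypDual hv' hI]

theorem Adapted.hypMat_mul_hypDual_mul {g g' : Matrix (Fin n) (Fin n) k} {v v' : I ⊕ I → Fin n → k}
    {L : I → kˣ} (h : Adapted g v L) (h' : Adapted g' v' L) (hI : 2 * Fintype.card I = n) :
    (hypMat v' * hypDual v) * g = g' * (hypMat v' * hypDual v) := by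
  rw [h.eq_hypMat_mul hI, h'.eq_hypMat_mul hI]
  have e1 := hypDual_mul_hypMat h.1
  have e2 := hypDual_mul_hypMat h'.1
  calc _ = hypMat v' * (hypDual v * hypMat v) *
        (diagonal (fun a => ((wt L a : kˣ) : k)) : Matrix (I ⊕ I) (I ⊕ I) k) * hypDual v := by
        simp only [Matrix.mul_assoc]
    _ = hypMat v' * (diagonal (fun a => ((wt L a : kˣ) : k)) : Matrix (I ⊕ I) (I ⊕ I) k) *
        (hypDual v' * hypMat v') * hypDual v := by
        rw [e1, e2, Matrix.mul_one, Matrix.mul_one]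
    _ = _ := by simp only [Matrix.mul_assoc]

/-- The exchange of two vectors of a hyperbolic pair changes the sign of the determinant. -/
theorem hypMat_comp_flip_mul_det {v v' : I ⊕ I → Fin n → k} (hv : IsHyp v)
    (hI : 2 * Fintype.card I = n) (i : I) :
    (hypMat (v' ∘ Equiv.swap (Sum.inl i) (Sum.inr i)) * hypDual v).det =
      -(hypMat v' * hypDual v).det := by
  have h1 : hypMat (v' ∘ Equiv.swap (Sum.inl i) (Sum.inr i)) =
      hypMat v' * (Equiv.swap (Sum.inl i) (Sum.inr i)).permMatrix k := by
    ext a b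
    rw [Matrix.mul_apply, Finset.sum_eq_single (Equiv.swap (Sum.inl i) (Sum.inr i) b)]
    · simp [hypMat, Equiv.Perm.permMatrix, PEquiv.toMatrix_apply]
    · intro c _ hc
      have : ¬ Equiv.swap (Sum.inl i) (Sum.inr i) c = b := fun e => hc (by
        rw [← e, Equiv.swap_apply_self])
      simp [Equiv.Perm.permMatrix, PEquiv.toMatrix_apply, this]
    · simp
  have h2 : hypMat v' * (Equiv.swap (Sum.inl i) (Sum.inr i)).permMatrix k * hypDual v =
      (hypMat v' * hypDual v) *
        (hypMat v * (Equiv.swap (Sum.inl i) (Sum.inr i)).permMatrix k * hypDual v) := by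
    have e1 := hypDual_mul_hypMat hv
    conv_lhs => rw [← Matrix.mul_one (hypMat v'), ← e1]
    simp only [Matrix.mul_assoc]
  rw [h1, h2, Matrix.det_mul, Matrix.det_conj_of_mul_eq_one (hypMat_mul_hypDual hv hI)
    (hypDual_mul_hypMat hv), Matrix.det_permutation, Equiv.Perm.sign_swap Sum.inl_ne_inr]
  simp

/-- Elements of `SO_{2m}` with the same eigenvalues, one of which is `1` or `-1`, are conjugate in
`SO_{2m}`: the exchange of two vectors of a hyperbolic pair in an eigenspace corrects the
determinant of a conjugating orthogonal matrix. -/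
theorem Adapted.exists_so_conj {m : ℕ} {g g' : SO2 m k} {v v' : I ⊕ I → Fin (2 * m) → k} {L : I → kˣ}
    (h : Adapted (g : Matrix (Fin (2 * m)) (Fin (2 * m)) k) v L)
    (h' : Adapted (g' : Matrix (Fin (2 * m)) (Fin (2 * m)) k) v' L) (hI : Fintype.card I = m)
    (i : I) (hi : L i = (L i)⁻¹) : IsConj g g' := by
  have hI2 : 2 * Fintype.card I = 2 * m := by rw [hI]
  have finish : ∀ w : I ⊕ I → Fin (2 * m) → k, Adapted (g' : Matrix (Fin (2 * m)) (Fin (2 * m)) k) w L →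
      (hypMat w * hypDual v).det = 1 → IsConj g g' := by
    intro w hw hd
    rw [isConj_iff]
    refine ⟨mkSO _ (hypMat_mul_hypDual_orthogonal h.1 hw.1 hI2) hd, ?_⟩
    rw [mul_inv_eq_iff_eq_mul]
    exact Subtype.ext (h.hypMat_mul_hypDual_mul hw hI2)
  have hdet : (hypMat v' * hypDual v).det = 1 ∨ (hypMat v' * hypDual v).det = -1 := by
    have h1 := congrArg Matrix.det (hypMat_mul_hypDual_orthogonal h.1 h'.1 hI2)
    rw [Matrix.det_mul, Matrix.det_transpose, Matrix.det_one] at h1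
    exact mul_self_eq_one_iff.1 h1
  rcases hdet with hd | hd
  · exact finish v' h' hd
  · refine finish (v' ∘ Equiv.swap (Sum.inl i) (Sum.inr i)) (h'.comp _ ?_ ?_) ?_
    · rintro (j | j) <;> by_cases hj : j = i <;>
        simp [Equiv.swap_apply_def, hj]
    · rintro (j | j) <;> by_cases hj : j = i <;>
        simp [Equiv.swap_apply_def, hj, ← hi]
    · rw [hypMat_comp_flip_mul_det h.1 hI2, hd, neg_neg]

omit [Fintype I] in
theorem IsHyp.mulVec {v : I ⊕ I → Fin n → k} (hv : IsHyp v) {h : Matrix (Fin n) (Fin n) k}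
    (hh : hᵀ * h = 1) : IsHyp fun a => h *ᵥ v a := fun a b => by
  rw [dotProduct_mulVec_of_orthogonal hh, hv]

theorem isTorus_bot : IsTorus (⊥ : Subgroup (GL (Fin n) k)) := by
  refine ⟨0, 1, fun i j => ⟨Finsupp.single 0 ((1 : Matrix (Fin n) (Fin n) k) i j), fun s => ?_⟩, ?_⟩
  · simp
  · rw [MonoidHom.range_one]

/-- An element of `SO_{2m}` of finite order prime to the characteristic has a hyperbolic
eigenbasis. -/
theorem exists_adapted [IsAlgClosed k] (h2 : (2 : k) ≠ 0) {m : ℕ} (g : SO2 m k) {N : ℕ}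
    (hN : (N : k) ≠ 0) (hgN : (g : Matrix (Fin (2 * m)) (Fin (2 * m)) k) ^ N = 1) :
    ∃ (v : Fin m ⊕ Fin m → Fin (2 * m) → k) (L : Fin m → kˣ),
      Adapted (g : Matrix (Fin (2 * m)) (Fin (2 * m)) k) v L := by
  obtain ⟨v, L, h, -⟩ := exists_adapted_of_torus h2 (so_transpose_mul g) (so_det g) hN hgN isTorus_bot
    (fun t ht => by rw [Subgroup.mem_bot.1 ht]; simp) (fun t ht => by rw [Subgroup.mem_bot.1 ht]; simp)
  exact ⟨v, L, h⟩

end Conjugacy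

/-! ### The standard torus of a hyperbolic basis -/

section StandardTorus

variable {k : Type*} [Field k] {n : ℕ} {I : Type*} [Fintype I] [DecidableEq I]

theorem hypDiag_mul {v : I ⊕ I → Fin n → k} (hv : IsHyp v) (s t : I → kˣ) :
    hypDiag v (s * t) = hypDiag v s * hypDiag v t := by
  have e := hypDual_mul_hypMat hv
  have h : (diagonal (fun a => ((wt (s * t) a : kˣ) : k)) : Matrix (I ⊕ I) (I ⊕ I) k) =
      diagonal (fun a => ((wt s a : kˣ) : k)) * diagonal (fun a => ((wt t a : kˣ) : k)) := by
    rw [Matrix.diagonal_mul_diagonal]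
    congr 1
    funext a
    rcases a with i | i <;> simp [mul_comm]
  rw [hypDiag, h]
  conv_lhs => rw [← Matrix.mul_one (diagonal fun a => ((wt s a : kˣ) : k)), ← e]
  simp only [hypDiag, Matrix.mul_assoc]

theorem hypDiag_one {v : I ⊕ I → Fin n → k} (hv : IsHyp v) (hI : 2 * Fintype.card I = n) :
    hypDiag v 1 = 1 := by
  have h : (diagonal (fun a => ((wt (1 : I → kˣ) a : kˣ) : k)) : Matrix (I ⊕ I) (I ⊕ I) k) = 1 := by
    rw [← Matrix.diagonal_one]
    congr 1
    funext a
    rcases a with i | i <;> simp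
  rw [hypDiag, h, Matrix.mul_one, hypMat_mul_hypDual hv hI]

/-- The standard torus of a hyperbolic basis, as a homomorphism from the group of parameters. -/
def hypTorus {v : I ⊕ I → Fin n → k} (hv : IsHyp v) (hI : 2 * Fintype.card I = n) :
    (I → kˣ) →* GL (Fin n) k :=
  MonoidHom.toHomUnits
    { toFun := hypDiag v
      map_one' := hypDiag_one hv hI
      map_mul' := hypDiag_mul hv }

@[simp] theorem coe_hypTorus {v : I ⊕ I → Fin n → k} (hv : IsHyp v) (hI : 2 * Fintype.card I = n)
    (s : I → kˣ) : (hypTorus hv hI s : Matrix (Fin n) (Fin n) k) = hypDiag v s := rfl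

omit [Fintype I] in
theorem IsHyp.ne_zero {v : I ⊕ I → Fin n → k} (hv : IsHyp v) (a : I ⊕ I) : v a ≠ 0 := by
  intro h
  have := hv a a.swap
  rw [h] at this
  simp at this

omit [Fintype I] in
theorem Adapted.wt_unique {g : Matrix (Fin n) (Fin n) k} {v : I ⊕ I → Fin n → k} {L L' : I → kˣ}
    (h : Adapted g v L) (h' : Adapted g v L') : L = L' := by
  funext i
  obtain ⟨j, hj⟩ := Function.ne_iff.1 (h.1.ne_zero (Sum.inl i))
  have := (h.2 (Sum.inl i)).symm.trans (h'.2 (Sum.inl i))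
  exact Units.ext (mul_right_cancel₀ hj (congrFun this j))

theorem hypTorus_injective {v : I ⊕ I → Fin n → k} (hv : IsHyp v) (hI : 2 * Fintype.card I = n) :
    Function.Injective (hypTorus hv hI) := fun s t h => by
  have h1 := congrArg Units.val h
  rw [coe_hypTorus, coe_hypTorus] at h1
  exact (adapted_hypDiag hv s).wt_unique (h1 ▸ adapted_hypDiag hv t)

/-- The weight `± ε_i` of the vector `v a` of a hyperbolic basis, as an element of `ℤ ^ I`. -/
def wtVec (a : I ⊕ I) : I → ℤ := Sum.elim (fun i => Pi.single i 1) (fun i => -Pi.single i 1) a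

theorem monomialHom_neg {ι : Type*} [Fintype ι] (α : ι → ℤ) (s : ι → kˣ) :
    monomialHom k (-α) s = (monomialHom k α s)⁻¹ := by
  change ∏ l, s l ^ (-α) l = (∏ l, s l ^ α l)⁻¹
  rw [← Finset.prod_inv_distrib]
  refine Finset.prod_congr rfl fun l _ => ?_
  rw [Pi.neg_apply, _root_.zpow_neg]

theorem monomialHom_add {ι : Type*} [Fintype ι] (α β : ι → ℤ) (s : ι → kˣ) :
    monomialHom k (α + β) s = monomialHom k α s * monomialHom k β s := by
  change ∏ l, s l ^ (α + β) l = (∏ l, s l ^ α l) * ∏ l, s l ^ β l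
  rw [← Finset.prod_mul_distrib]
  refine Finset.prod_congr rfl fun l _ => ?_
  rw [Pi.add_apply, _root_.zpow_add]

theorem monomialHom_wtVec (a : I ⊕ I) (s : I → kˣ) : monomialHom k (wtVec a) s = wt s a := by
  have key (i : I) : monomialHom k (Pi.single i 1) s = s i := by
    change ∏ l, s l ^ (Pi.single i 1 : I → ℤ) l = s i
    rw [Finset.prod_eq_single i]
    · simp
    · intro j _ hj; simp [hj]
    · simp
  rcases a with i | i
  · exact key i
  · change monomialHom k (-Pi.single i 1) s = _
    rw [monomialHom_neg, key]
    rfl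

theorem isTorus_range_hypTorus {v : I ⊕ I → Fin n → k} (hv : IsHyp v) (hI : 2 * Fintype.card I = n) :
    IsTorus (hypTorus hv hI).range := by
  let e := Fintype.equivFin I
  let φ : (Fin (Fintype.card I) → kˣ) →* (I → kˣ) :=
    { toFun := fun s i => s (e i), map_one' := rfl, map_mul' := fun _ _ => rfl }
  have hφ : Function.Surjective φ := fun s => ⟨fun j => s (e.symm j), by funext i; simp [φ]⟩
  refine ⟨Fintype.card I, (hypTorus hv hI).comp φ, fun i j => ?_, ?_⟩
  · refine ⟨∑ a, Finsupp.single (fun l => wtVec a (e.symm l)) (hypMat v i a * hypDual v a j), fun s => ?_⟩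
    rw [← Finsupp.sum_finsetSum_index (by simp) (by intros; ring)]
    rw [MonoidHom.comp_apply, coe_hypTorus, hypDiag, Matrix.mul_apply]
    refine Finset.sum_congr rfl fun a _ => ?_
    rw [Finsupp.sum_single_index (by simp), Matrix.mul_diagonal, ← monomialHom_wtVec]
    have : ((monomialHom k (wtVec a) (φ s) : kˣ) : k) = ∏ l, ((s l ^ wtVec a (e.symm l) : kˣ) : k) := by
      change ((∏ i, φ s i ^ wtVec a i : kˣ) : k) = _
      rw [Units.coe_prod]
      exact Fintype.prod_equiv e _ _ fun i => by simp [φ]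
    rw [this]
    ring
  · rw [MonoidHom.range_comp, MonoidHom.range_eq_top.2 hφ, MonoidHom.range_eq_map]

theorem Adapted.mem_range_hypTorus {v : I ⊕ I → Fin n → k} (hv : IsHyp v) (hI : 2 * Fintype.card I = n)
    {t : GL (Fin n) k} {s : I → kˣ} (h : Adapted (t : Matrix (Fin n) (Fin n) k) v s) :
    t ∈ (hypTorus hv hI).range :=
  ⟨s, Units.ext (h.eq_hypMat_mul hI).symm⟩

theorem Adapted.dotProduct_mulVec {g : Matrix (Fin n) (Fin n) k} {v : I ⊕ I → Fin n → k} {L : I → kˣ}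
    (h : Adapted g v L) (hI : 2 * Fintype.card I = n) (a : I ⊕ I) (w : Fin n → k) :
    v a.swap ⬝ᵥ (g *ᵥ w) = ((wt L a : kˣ) : k) * (v a.swap ⬝ᵥ w) := by
  have h1 := dotProduct_mulVec_of_orthogonal (mul_eq_one_comm.1 (h.mul_transpose hI)) (v a.swap) w
  rw [h.2, wt_swap, smul_dotProduct, smul_eq_mul, Units.val_inv_eq_inv_val,
    inv_mul_eq_iff_eq_mul₀ (Units.ne_zero _)] at h1
  exact h1

theorem IsHyp.ext_vec {v : I ⊕ I → Fin n → k} (hv : IsHyp v) (hI : 2 * Fintype.card I = n)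
    {x : Fin n → k} (h : ∀ a, v a ⬝ᵥ x = 0) : x = 0 := by
  have h1 : hypDual v *ᵥ x = 0 := funext fun a => h a.swap
  rw [← Matrix.one_mulVec x, ← hypMat_mul_hypDual hv hI, ← Matrix.mulVec_mulVec, h1, Matrix.mulVec_zero]

theorem IsHyp.ext_matrix {v : I ⊕ I → Fin n → k} (hv : IsHyp v) (hI : 2 * Fintype.card I = n)
    {X : Matrix (Fin n) (Fin n) k} (h : ∀ a b, v a ⬝ᵥ (X *ᵥ v b) = 0) : X = 0 := by
  have h1 : X * hypMat v = 0 := by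
    ext i b
    exact congrFun (hv.ext_vec hI fun a => h a b) i
  rw [← Matrix.mul_one X, ← hypMat_mul_hypDual hv hI, ← Matrix.mul_assoc, h1, Matrix.zero_mul]

omit [Fintype I] in
theorem wtVec_injective : Function.Injective (wtVec : I ⊕ I → I → ℤ) := by
  rintro (i | i) (j | j) h <;>
  · have h3 := congrFun h i
    simp only [wtVec, Sum.elim_inl, Sum.elim_inr, Pi.neg_apply, Pi.single_apply, if_true] at h3
    split_ifs at h3 with hij
    all_goals first
      | omega
      | rw [hij]

theorem exists_wt_ne [Infinite k] {a b : I ⊕ I} (hab : a ≠ b) : ∃ s : I → kˣ, wt s a ≠ wt s b := by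
  by_contra hcon
  push Not at hcon
  refine hab (wtVec_injective (monomialHom_injective (k := k) (MonoidHom.ext fun s => ?_)))
  rw [monomialHom_wtVec, monomialHom_wtVec, hcon]

/-- What commutes with the standard torus is diagonal. -/
theorem eq_zero_of_commute_hypDiag [Infinite k] {v : I ⊕ I → Fin n → k} (hv : IsHyp v)
    (hI : 2 * Fintype.card I = n) {X : Matrix (Fin n) (Fin n) k}
    (h : ∀ s, hypDiag v s * X = X * hypDiag v s) {a b : I ⊕ I} (hab : a ≠ b) :
    v a.swap ⬝ᵥ (X *ᵥ v b) = 0 := by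
  obtain ⟨s, hs⟩ := exists_wt_ne (k := k) hab
  have hs' := adapted_hypDiag hv s
  have h1 := hs'.dotProduct_mulVec hI a (X *ᵥ v b)
  rw [Matrix.mulVec_mulVec, h, ← Matrix.mulVec_mulVec, hs'.2, Matrix.mulVec_smul, dotProduct_smul,
    smul_eq_mul] at h1
  by_contra h0
  exact hs (Units.ext (mul_right_cancel₀ h0 h1).symm)

end StandardTorus

/-! ### Maximal tori of centralizers -/

section MaximalTorus

variable {k : Type*} [Field k] {m : ℕ}

@[simp] theorem coe_soToGL (h : SO2 m k) :
    (soToGL m k h : Matrix (Fin (2 * m)) (Fin (2 * m)) k) = h.1 := rfl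

/-- Elements centralize the image of `g` in `PSO_{2m}` if and only if they commute with `g` up to
sign. -/
theorem mem_preimageGL_cent (h2 : (2 : k) ≠ 0) (hm : 2 ≤ m) (g : SO2 m k) (x : GL (Fin (2 * m)) k) :
    x ∈ preimageGL (cent (proj m k g)) ↔ ∃ h : SO2 m k, x.1 = h.1 ∧
      (h.1 * g.1 = g.1 * h.1 ∨
        h.1 * g.1 = -(g.1 * h.1)) := by
  simp only [preimageGL, Subgroup.mem_map, Subgroup.mem_comap, Subgroup.mem_centralizer_singleton_iff]
  constructor
  · rintro ⟨h, hh, rfl⟩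
    exact ⟨h, rfl, (proj_commute_iff h2 hm g h).1 hh⟩
  · rintro ⟨h, hx, hh⟩
    exact ⟨h, (proj_commute_iff h2 hm g h).2 hh, Units.ext hx.symm⟩

/-- The Lie algebra of the centralizer of `g` in `PSO_{2m}` consists of skew-symmetric matrices
commuting with `g`: the elements of the centralizer that anticommute with `g` form a component away
from the identity. -/
theorem lieAlg_preimageGL (h2 : (2 : k) ≠ 0) (hm : 2 ≤ m) (g : SO2 m k)
    {X : Matrix (Fin (2 * m)) (Fin (2 * m)) k} (hX : X ∈ lieAlg (preimageGL (cent (proj m k g)))) :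
    Xᵀ = -X ∧ X * g.1 = g.1 * X := by
  refine ⟨transpose_eq_neg_of_mem_lieAlg hX fun x hx => ?_, ?_⟩
  · obtain ⟨h, e, -⟩ := (mem_preimageGL_cent h2 hm g x).1 hx
    rw [e, so_mul_transpose]
  · have hg0 : g.1 ≠ 0 := by
      intro h0
      have h1 := so_det g
      have : Nonempty (Fin (2 * m)) := ⟨⟨0, by omega⟩⟩
      rw [h0, Matrix.det_zero] at h1
      exact zero_ne_one h1
    obtain ⟨i', j', hij⟩ : ∃ i j, g.1 i j ≠ 0 := by
      by_contra hcon
      push Not at hcon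
      exact hg0 (Matrix.ext hcon)
    let c (ε : k) (i j : Fin (2 * m)) : Matrix (Fin (2 * m)) (Fin (2 * m)) k →ₗ[k] k :=
      { toFun := fun Y => (Y * g.1) i j - ε * (g.1 * Y) i j
        map_add' := fun Y Z => by simp only [add_mul, mul_add, Matrix.add_apply]; ring
        map_smul' := fun r Y => by
          simp only [Matrix.smul_mul, Matrix.mul_smul, Matrix.smul_apply, smul_eq_mul,
            RingHom.id_apply]
          ring }
    have hc (ε : k) (i j : Fin (2 * m)) (Y : Matrix (Fin (2 * m)) (Fin (2 * m)) k) :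
      c ε i j Y = (Y * g.1) i j - ε * (g.1 * Y) i j := rfl
    ext i j
    -- one of the two equations `hg = gh` and `hg = -gh` holds on the group, and the second fails at
    -- `1` in an entry
    have := lieAlg_linear_of_mul hX (c 1 i j) (c (-1) i' j') (fun x hx => ?_) ?_ ?_
    · rw [hc, one_mul, sub_eq_zero] at this
      exact this
    · obtain ⟨h, e, hh⟩ := (mem_preimageGL_cent h2 hm g x).1 hx
      rw [hc, hc, e]
      rcases hh with hh | hh <;> rw [hh] <;> simp
    · rw [hc, one_mul, mul_one, one_mul, sub_self]
    · rw [hc, one_mul, mul_one, neg_one_mul, sub_neg_eq_add, ← two_mul]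
      exact mul_ne_zero h2 hij

/-- A torus in the centralizer of `g` in `PSO_{2m}` is orthogonal and commutes with `g` itself, not
only up to sign. -/
theorem torus_le_preimageGL [IsAlgClosed k] (h2 : (2 : k) ≠ 0) (hm : 2 ≤ m) (g : SO2 m k)
    {T : Subgroup (GL (Fin (2 * m)) k)} (hT : IsTorus T) (hTH : T ≤ preimageGL (cent (proj m k g))) :
    (∀ t ∈ T, t.1ᵀ * t.1 = 1) ∧
    ∀ t ∈ T, t.1 * g.1 = g.1 * t.1 := by
  constructor
  · intro t ht
    obtain ⟨h, e, -⟩ := (mem_preimageGL_cent h2 hm g t).1 (hTH ht)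
    rw [e, so_transpose_mul]
  · obtain ⟨r, f, hf, rfl⟩ := hT
    rintro _ ⟨s, rfl⟩
    -- every element of a torus is a square, so that the sign is trivial
    choose u hu using fun l => IsAlgClosed.exists_pow_nat_eq ((s l : kˣ) : k) (n := 2) (by norm_num)
    let t : Fin r → kˣ := fun l => Units.mk0 (u l) fun h0 => (s l).ne_zero (by rw [← hu l, h0]; simp)
    have hst : s = t * t := funext fun l => Units.ext (by rw [← hu l, pow_two]; rfl)
    obtain ⟨h, e, hh⟩ := (mem_preimageGL_cent h2 hm g (f t)).1 (hTH ⟨t, rfl⟩)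
    rw [hst, map_mul, Units.val_mul, e]
    rcases hh with hh | hh
    · rw [mul_assoc, hh, ← mul_assoc, hh, mul_assoc]
    · rw [mul_assoc, hh, mul_neg, ← mul_assoc, hh, neg_mul, neg_neg, mul_assoc]

variable {I : Type*} [Fintype I] [DecidableEq I]

theorem range_hypTorus_le (h2 : (2 : k) ≠ 0) (hm : 2 ≤ m) (g : SO2 m k) {v : I ⊕ I → Fin (2 * m) → k}
    {L : I → kˣ} (h : Adapted g.1 v L)
    (hI : 2 * Fintype.card I = 2 * m) :
    (hypTorus h.1 hI).range ≤ preimageGL (cent (proj m k g)) := by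
  rintro _ ⟨s, rfl⟩
  have hs := adapted_hypDiag h.1 s
  refine (mem_preimageGL_cent h2 hm g _).2 ⟨mkSO _ (hs.mul_transpose hI) (hs.det_eq_one hI), rfl, Or.inl ?_⟩
  have hgL : g.1 = hypDiag v L := h.eq_hypMat_mul hI
  rw [coe_mkSO, hgL, ← hypDiag_mul h.1, ← hypDiag_mul h.1, mul_comm s L]

/-- The standard torus of a hyperbolic eigenbasis of `g` is a maximal torus of the centralizer: what
commutes with it is diagonal in that basis. -/
theorem isMaximalTorusOf_range_hypTorus [IsAlgClosed k] (h2 : (2 : k) ≠ 0) (hm : 2 ≤ m) (g : SO2 m k)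
    {v : I ⊕ I → Fin (2 * m) → k} {L : I → kˣ}
    (h : Adapted g.1 v L) (hI : 2 * Fintype.card I = 2 * m) :
    IsMaximalTorusOf (hypTorus h.1 hI).range (preimageGL (cent (proj m k g))) := by
  have : Infinite k := IsAlgClosed.instInfinite
  refine ⟨⟨isTorus_range_hypTorus h.1 hI, range_hypTorus_le h2 hm g h hI⟩, ?_⟩
  rintro S ⟨hS, hSH⟩ hle t ht
  have hort := (torus_le_preimageGL h2 hm g hS hSH).1 t ht
  -- a larger torus is commutative, hence commutes with the standard torus
  have hcomm : ∀ s, hypDiag v s * t.1 = t.1 * hypDiag v s := by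
    intro s
    have hs : hypTorus h.1 hI s ∈ S := hle ⟨s, rfl⟩
    obtain ⟨r, f, -, rfl⟩ := hS
    obtain ⟨x, hx⟩ := hs
    obtain ⟨y, hy⟩ := ht
    have : f x * f y = f y * f x := by rw [← map_mul, mul_comm x y, map_mul]
    rw [hx, hy] at this
    exact congrArg Units.val this
  have heig : ∀ b, t.1 *ᵥ v b =
      (v b.swap ⬝ᵥ (t.1 *ᵥ v b)) • v b := by
    intro b
    rw [← sub_eq_zero]
    refine h.1.ext_vec hI fun a => ?_
    rw [dotProduct_sub, dotProduct_smul, h.1]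
    by_cases hab : b = a.swap
    · subst hab; simp
    · rw [if_neg hab, smul_zero, sub_zero]
      have := eq_zero_of_commute_hypDiag h.1 hI hcomm (Ne.symm hab)
      rwa [Sum.swap_swap] at this
  obtain ⟨s, hs⟩ := exists_units_of_isEig (S := Unit) (A := fun _ => t.1)
    (fun _ => hort) h.1 (fun b => ⟨fun _ => _, fun _ => heig b⟩) ()
  exact hs.mem_range_hypTorus h.1 hI

/-- The chosen maximal torus of the centralizer of `g` is the standard torus of a hyperbolic
eigenbasis of `g`, which may be labelled as any given one. -/
theorem exists_maxTorus_eq [IsAlgClosed k] (h2 : (2 : k) ≠ 0) (hm : 2 ≤ m) (g : SO2 m k)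
    {N : ℕ} (hN : (N : k) ≠ 0) (hgN : g.1 ^ N = 1)
    {v₀ : I ⊕ I → Fin (2 * m) → k} {L : I → kˣ}
    (h₀ : Adapted g.1 v₀ L) (hI : 2 * Fintype.card I = 2 * m) :
    ∃ (v : I ⊕ I → Fin (2 * m) → k) (h : Adapted g.1 v L),
      maxTorus (preimageGL (cent (proj m k g))) = (hypTorus h.1 hI).range := by
  have : Infinite k := IsAlgClosed.instInfinite
  -- the existence of a maximal torus makes the choice of `maxTorus` meaningful
  have hT : IsMaximalTorusOf (maxTorus (preimageGL (cent (proj m k g)))) (preimageGL (cent (proj m k g))) :=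
    Classical.epsilon_spec (p := fun T => IsMaximalTorusOf T (preimageGL (cent (proj m k g))))
      ⟨_, isMaximalTorusOf_range_hypTorus h2 hm g h₀ hI⟩
  set T := maxTorus (preimageGL (cent (proj m k g)))
  obtain ⟨hTo, hTg⟩ := torus_le_preimageGL h2 hm g hT.1.1 hT.1.2
  obtain ⟨v', L', h', hTv⟩ := exists_adapted_of_torus h2 (so_transpose_mul g) (so_det g) hN hgN hT.1.1
    hTo hTg
  obtain ⟨τ, hτ, hL⟩ := h₀.exists_relabel hI h' (by simp)
  have h := h'.comp τ hτ hL
  refine ⟨v' ∘ τ, h, le_antisymm ?_ ?_⟩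
  · intro t ht
    obtain ⟨s, hs⟩ := hTv t ht
    refine (hs.comp τ hτ (L' := fun i => wt s (τ (Sum.inl i))) ?_).mem_range_hypTorus h.1 hI
    rintro (i | i)
    · rfl
    · rw [wt_inr, ← wt_swap, ← hτ]
      rfl
  · refine hT.2 ⟨isTorus_range_hypTorus h.1 hI, range_hypTorus_le h2 hm g h hI⟩ ?_
    intro t ht
    obtain ⟨s, hs⟩ := hTv t ht
    refine (hs.comp τ hτ (L' := fun i => wt s (τ (Sum.inl i))) ?_).mem_range_hypTorus h.1 hI
    rintro (i | i)
    · rfl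
    · rw [wt_inr, ← wt_swap, ← hτ]
      rfl

end MaximalTorus

/-! ### Isomorphisms of root systems -/

section RootIso

theorem RootIso.symm {X Y : Type*} [AddCommGroup X] [AddCommGroup Y] {Φ : Set X} {Ψ : Set Y}
    (h : RootIso Φ Ψ) : RootIso Ψ Φ := by
  obtain ⟨f, hf⟩ := h
  exact ⟨f.symm, fun y => by rw [hf, AddEquiv.apply_symm_apply]⟩

theorem RootIso.trans {X Y Z : Type*} [AddCommGroup X] [AddCommGroup Y] [AddCommGroup Z] {Φ : Set X}
    {Ψ : Set Y} {Θ : Set Z} (h : RootIso Φ Ψ) (h' : RootIso Ψ Θ) : RootIso Φ Θ := by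
  obtain ⟨f, hf⟩ := h
  obtain ⟨g, hg⟩ := h'
  exact ⟨f.trans g, fun x => by rw [hf, hg, AddEquiv.trans_apply]⟩

theorem rootIso_image {X Y : Type*} [AddCommGroup X] [AddCommGroup Y] {f : X → Y}
    (hf : Function.Injective f) (hadd : ∀ x y, f (x + y) = f x + f y) (Φ : Set X) :
    RootIso Φ (f '' Φ) := by
  obtain ⟨g, rfl⟩ : ∃ g : X →+ Y, ⇑g = f := ⟨AddMonoidHom.mk' f hadd, rfl⟩
  refine ⟨((AddSubgroup.closure Φ).equivMapOfInjective g hf).trans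
    (AddEquiv.addSubgroupCongr (AddMonoidHom.map_closure g Φ)), fun x => ?_⟩
  have : ((((AddSubgroup.closure Φ).equivMapOfInjective g hf).trans
      (AddEquiv.addSubgroupCongr (AddMonoidHom.map_closure g Φ)) x : AddSubgroup.closure (g '' Φ)) : Y) =
      g x := rfl
  rw [this]
  exact (hf.mem_set_image).symm

end RootIso

/-! ### Root systems of centralizers -/

section Roots

variable {k : Type*} [Field k] {n : ℕ} {I : Type*} [DecidableEq I]

/-- The roots of the centralizer of an element with a hyperbolic eigenbasis with eigenvalues `L`: the
differences of the weights of vectors in the same eigenspace. -/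
def rootsOf {A : Type*} [Group A] (L : I → A) : Set (I → ℤ) :=
  {x | ∃ a b : I ⊕ I, a ≠ b ∧ a ≠ b.swap ∧ wt L a = wt L b ∧ x = wtVec a - wtVec b}

/-- The root vector `v a ∧ v b` of the orthogonal Lie algebra. -/
def wedge (x y : Fin n → k) : Matrix (Fin n) (Fin n) k := vecMulVec x y - vecMulVec y x

theorem wedge_transpose (x y : Fin n → k) : (wedge x y)ᵀ = -wedge x y := by
  rw [wedge, Matrix.transpose_sub, Matrix.transpose_vecMulVec, Matrix.transpose_vecMulVec, neg_sub]

theorem wedge_mulVec (x y z : Fin n → k) : wedge x y *ᵥ z = (y ⬝ᵥ z) • x - (x ⬝ᵥ z) • y := by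
  rw [wedge, Matrix.sub_mulVec, Matrix.vecMulVec_mulVec, Matrix.vecMulVec_mulVec]
  simp [op_smul_eq_smul]

theorem mul_wedge_mul_transpose (A : Matrix (Fin n) (Fin n) k) (x y : Fin n → k) :
    A * wedge x y * Aᵀ = wedge (A *ᵥ x) (A *ᵥ y) := by
  simp only [wedge, mul_sub, sub_mul, Matrix.mul_vecMulVec, Matrix.vecMulVec_mul,
    Matrix.vecMul_transpose]

theorem wedge_smul_smul (c d : k) (x y : Fin n → k) : wedge (c • x) (d • y) = (c * d) • wedge x y := by
  rw [wedge, wedge, Matrix.smul_vecMulVec, Matrix.vecMulVec_smul, Matrix.smul_vecMulVec,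
    Matrix.vecMulVec_smul, smul_smul, smul_smul, smul_sub, mul_comm d c]

theorem wedge_mul_self {x y : Fin n → k} (hx : x ⬝ᵥ x = 0) (hy : y ⬝ᵥ y = 0) (hxy : x ⬝ᵥ y = 0) :
    wedge x y * wedge x y = 0 := by
  refine Matrix.ext_of_mulVec_single fun i => ?_
  rw [← Matrix.mulVec_mulVec, wedge_mulVec, wedge_mulVec, Matrix.zero_mulVec]
  simp [hx, hy, hxy, dotProduct_comm y x]

/-- `1 + X` is in the special orthogonal group for a skew-symmetric `X` of square zero: it is the
square of the orthogonal matrix `1 + X / 2`. -/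
theorem det_one_add_of_sq_zero (h2 : (2 : k) ≠ 0) {X : Matrix (Fin n) (Fin n) k} (hX : Xᵀ = -X)
    (hXX : X * X = 0) : (1 + X).det = 1 ∧ (1 + X) * (1 + X)ᵀ = 1 := by
  have orth : ∀ c : k, (1 + c • X) * (1 + c • X)ᵀ = 1 := by
    intro c
    rw [Matrix.transpose_add, Matrix.transpose_smul, hX, Matrix.transpose_one]
    simp [mul_add, add_mul, hXX]
  have hsq : (1 + X) = (1 + (2⁻¹ : k) • X) * (1 + (2⁻¹ : k) • X) := by
    have : (2⁻¹ : k) + 2⁻¹ = 1 := by field_simp; norm_num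
    simp only [mul_add, add_mul, one_mul, mul_one, Matrix.smul_mul, Matrix.mul_smul, hXX, smul_zero,
      add_zero]
    rw [add_assoc, ← add_smul, this, one_smul]
  constructor
  · rw [hsq, Matrix.det_mul]
    have := congrArg Matrix.det (orth 2⁻¹)
    rwa [Matrix.det_mul, Matrix.det_transpose, Matrix.det_one] at this
  · simpa using orth 1

variable {m : ℕ}

/-- The root vectors lie in the Lie algebra of the centralizer, as the velocities of the unipotent
lines `1 + tX`. -/
theorem wedge_mem_lieAlg [Infinite k] (h2 : (2 : k) ≠ 0) (hm : 2 ≤ m) (g : SO2 m k)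
    {v : I ⊕ I → Fin (2 * m) → k} {L : I → kˣ} (h : Adapted g.1 v L) {a b : I ⊕ I} (hab : a ≠ b)
    (hab' : a ≠ b.swap) (hL : wt L a = wt L b) :
    wedge (v a) (v b.swap) ∈ lieAlg (preimageGL (cent (proj m k g))) := by
  have hba : b.swap ≠ b := by rcases b with i | i <;> simp
  have haa : a ≠ a.swap := by rcases a with i | i <;> simp
  have hX := wedge_transpose (v a) (v b.swap)
  have hXX : wedge (v a) (v b.swap) * wedge (v a) (v b.swap) = 0 :=
    wedge_mul_self (by rw [h.1, if_neg haa]) (by rw [h.1, Sum.swap_swap, if_neg hba])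
      (by rw [h.1, if_neg fun e => hab (Sum.swap_leftInverse.injective e).symm])
  have hg : g.1 * wedge (v a) (v b.swap) * g.1ᵀ = wedge (v a) (v b.swap) := by
    rw [mul_wedge_mul_transpose, h.2, h.2, wedge_smul_smul, wt_swap, hL, Units.mul_inv, one_smul]
  have hg' : g.1 * wedge (v a) (v b.swap) = wedge (v a) (v b.swap) * g.1 := by
    conv_rhs => rw [← hg]
    rw [mul_assoc, so_transpose_mul, mul_one]
  refine mem_lieAlg_of_line fun t => ?_
  obtain ⟨hd, ho⟩ := det_one_add_of_sq_zero h2 (X := t • wedge (v a) (v b.swap))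
    (by rw [Matrix.transpose_smul, hX, smul_neg]) (by rw [Matrix.smul_mul, Matrix.mul_smul, hXX, smul_zero, smul_zero])
  refine ⟨soToGL m k (mkSO _ ho hd), (mem_preimageGL_cent h2 hm g _).2 ⟨_, rfl, Or.inl ?_⟩, rfl⟩
  rw [coe_mkSO, add_mul, mul_add, one_mul, mul_one, Matrix.smul_mul, Matrix.mul_smul, hg']

theorem Adapted.wedge {g : Matrix (Fin n) (Fin n) k} {v : I ⊕ I → Fin n → k} {L : I → kˣ}
    (h : Adapted g v L) (a b : I ⊕ I) :
    g * wedge (v a) (v b) * gᵀ = ((wt L a * wt L b : kˣ) : k) • wedge (v a) (v b) := by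
  rw [mul_wedge_mul_transpose, h.2, h.2, wedge_smul_smul, Units.val_mul]

/-- The chosen maximal torus of the centralizer, described by coordinates in `(kˣ)^I`. -/
theorem exists_maxTorus_coordinates [Fintype I] [IsAlgClosed k] (h2 : (2 : k) ≠ 0) (hm : 2 ≤ m) (g : SO2 m k)
    {N : ℕ} (hN : (N : k) ≠ 0) (hgN : g.1 ^ N = 1) {v₀ : I ⊕ I → Fin (2 * m) → k} {L : I → kˣ}
    (h₀ : Adapted g.1 v₀ L) (hI : 2 * Fintype.card I = 2 * m) :
    ∃ v : I ⊕ I → Fin (2 * m) → k, Adapted g.1 v L ∧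
      ∃ e : maxTorus (preimageGL (cent (proj m k g))) ≃* (I → kˣ),
      ∀ t : maxTorus (preimageGL (cent (proj m k g))),
        Adapted ((t : GL (Fin (2 * m)) k) : Matrix (Fin (2 * m)) (Fin (2 * m)) k) v (e t) := by
  have : Infinite k := IsAlgClosed.instInfinite
  obtain ⟨v, h, hT⟩ := exists_maxTorus_eq h2 hm g hN hgN h₀ hI
  refine ⟨v, h, (MulEquiv.subgroupCongr hT).trans
    (MonoidHom.ofInjective (hypTorus_injective h.1 hI)).symm, fun t => ?_⟩
  have h1 := MulEquiv.apply_symm_apply (MonoidHom.ofInjective (hypTorus_injective h.1 hI))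
    (MulEquiv.subgroupCongr hT t)
  have h3 := congrArg (fun x : (hypTorus h.1 hI).range =>
    ((x : GL (Fin (2 * m)) k) : Matrix (Fin (2 * m)) (Fin (2 * m)) k)) h1
  have h4 := adapted_hypDiag h.1 ((MonoidHom.ofInjective (hypTorus_injective h.1 hI)).symm
    (MulEquiv.subgroupCongr hT t))
  exact (show _ = ((t : GL (Fin (2 * m)) k) : Matrix (Fin (2 * m)) (Fin (2 * m)) k) from h3) ▸ h4

/-- The root system of the centralizer in `PSO_{2m}` of the image of `g`, in terms of the eigenvalues
of `g`. -/
theorem rootIso_rootSet [Fintype I] [IsAlgClosed k] (h2 : (2 : k) ≠ 0) (hm : 2 ≤ m) (g : SO2 m k)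
    {N : ℕ} (hN : (N : k) ≠ 0) (hgN : g.1 ^ N = 1) {v₀ : I ⊕ I → Fin (2 * m) → k} {L : I → kˣ}
    (h₀ : Adapted g.1 v₀ L) (hI : 2 * Fintype.card I = 2 * m) :
    RootIso (rootSet (preimageGL (cent (proj m k g)))) (rootsOf L) ∧
      (rootSet (preimageGL (cent (proj m k g)))).ncard = (rootsOf L).ncard := by
  have : Infinite k := IsAlgClosed.instInfinite
  obtain ⟨v, h, e, hadapt⟩ := exists_maxTorus_coordinates h2 hm g hN hgN h₀ hI
  have hmem : ∀ a b : I ⊕ I, a ≠ b → a ≠ b.swap → wt L a = wt L b →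
      wedge (v a) (v b.swap) ∈ lieAlg (preimageGL (cent (proj m k g))) :=
    fun a b => wedge_mem_lieAlg h2 hm g h
  have hlie : ∀ X ∈ lieAlg (preimageGL (cent (proj m k g))), _ :=
    fun X hX => lieAlg_preimageGL h2 hm g hX
  generalize preimageGL (cent (proj m k g)) = H at e hadapt hmem hlie ⊢
  have hinv : ∀ t : maxTorus H,
      (((t : GL (Fin (2 * m)) k)⁻¹ : GL (Fin (2 * m)) k) : Matrix (Fin (2 * m)) (Fin (2 * m)) k) =
      ((t : GL (Fin (2 * m)) k) : Matrix (Fin (2 * m)) (Fin (2 * m)) k)ᵀ := by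
    intro t
    have h1 := mul_eq_one_comm.1 ((hadapt t).mul_transpose hI)
    calc _ = ((t : GL (Fin (2 * m)) k) : Matrix (Fin (2 * m)) (Fin (2 * m)) k)ᵀ * (t : GL (Fin (2 * m)) k) *
          (((t : GL (Fin (2 * m)) k)⁻¹ : GL (Fin (2 * m)) k) : Matrix (Fin (2 * m)) (Fin (2 * m)) k) := by
          rw [h1, one_mul]
      _ = _ := by rw [mul_assoc, Units.mul_inv, mul_one]
  -- integral vectors as characters of the maximal torus
  obtain ⟨Ψ, hΨ⟩ : ∃ Ψ : (I → ℤ) →+ Characters (maxTorus H), ∀ x t,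
      (Ψ x).toMul t = monomialHom k x (e t) :=
    ⟨{ toFun := fun x => Additive.ofMul ((monomialHom k x).comp e.toMonoidHom)
       map_zero' := by
        have : monomialHom k (0 : I → ℤ) = 1 := by ext s; simp [monomialHom]
        rw [this]; rfl
       map_add' := fun x y => by
        rw [← ofMul_mul]
        congr 1
        exact MonoidHom.ext fun s => monomialHom_add x y _ }, fun _ _ => rfl⟩
  have hΨinj : Function.Injective Ψ := by
    intro x y hxy
    refine monomialHom_injective (k := k) (MonoidHom.ext fun s => ?_)
    have := hΨ x (e.symm s)
    rw [hxy, hΨ, MulEquiv.apply_symm_apply] at this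
    exact this.symm
  have hwt : ∀ a b t, (Ψ (wtVec a - wtVec b)).toMul t = wt (e t) a * (wt (e t) b)⁻¹ := by
    intro a b t
    rw [hΨ, sub_eq_add_neg, monomialHom_add, monomialHom_neg, monomialHom_wtVec, monomialHom_wtVec]
  have hΨadd : ∀ x y, Ψ (x + y) = Ψ x + Ψ y := fun x y => map_add Ψ x y
  have himage : rootSet H = Ψ '' rootsOf L := by
    ext χ
    constructor
    · rintro ⟨hχ0, X, hX, hX0, hXt⟩
      obtain ⟨hXT, hXg⟩ := hlie X hX
      -- a root vector has a nonzero matrix coefficient, which determines its weight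
      obtain ⟨a, b, hab⟩ : ∃ a b : I ⊕ I, v a.swap ⬝ᵥ (X *ᵥ v b) ≠ 0 := by
        by_contra hcon
        push Not at hcon
        refine hX0 (h.1.ext_matrix hI fun a b => ?_)
        have := hcon a.swap b
        rwa [Sum.swap_swap] at this
      have hval : ∀ t, (χ.toMul t : kˣ) = wt (e t) a * (wt (e t) b)⁻¹ := by
        intro t
        have h1 := hXt t
        have h3 : ((t : GL (Fin (2 * m)) k) : Matrix (Fin (2 * m)) (Fin (2 * m)) k) * X =
            ((χ.toMul t : kˣ) : k) • (X * ((t : GL (Fin (2 * m)) k) : Matrix (Fin (2 * m)) (Fin (2 * m)) k)) := by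
          rw [← Matrix.smul_mul, ← h1, mul_assoc, Units.inv_mul, mul_one]
        have h4 := (hadapt t).dotProduct_mulVec hI a (X *ᵥ v b)
        rw [Matrix.mulVec_mulVec, h3, Matrix.smul_mulVec, ← Matrix.mulVec_mulVec, (hadapt t).2,
          Matrix.mulVec_smul, dotProduct_smul, dotProduct_smul, smul_eq_mul, smul_eq_mul, ← mul_assoc] at h4
        have h5 := mul_right_cancel₀ hab h4
        rw [← Units.val_mul] at h5
        rw [eq_mul_inv_iff_mul_eq]
        exact Units.ext h5
      refine ⟨wtVec a - wtVec b, ⟨a, b, ?_, ?_, ?_, rfl⟩, ?_⟩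
      · rintro rfl
        refine hχ0 ?_
        have : χ.toMul = 1 := MonoidHom.ext fun t => by rw [hval, mul_inv_cancel]; rfl
        exact this
      · rintro rfl
        -- skew-symmetry excludes a nonzero coefficient at `(b.swap, b)`
        rw [Sum.swap_swap] at hab
        have h1 : v b ⬝ᵥ (X *ᵥ v b) = -(v b ⬝ᵥ (X *ᵥ v b)) := by
          conv_lhs => rw [Matrix.dotProduct_mulVec, ← Matrix.mulVec_transpose, hXT, Matrix.neg_mulVec,
            neg_dotProduct, dotProduct_comm]
        refine hab ((mul_eq_zero.1 (?_ : 2 * (v b ⬝ᵥ (X *ᵥ v b)) = 0)).resolve_left h2)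
        linear_combination h1
      · have h4 := h.dotProduct_mulVec hI a (X *ᵥ v b)
        rw [Matrix.mulVec_mulVec, ← hXg, ← Matrix.mulVec_mulVec, h.2, Matrix.mulVec_smul, dotProduct_smul,
          smul_eq_mul] at h4
        exact (Units.ext (mul_right_cancel₀ hab h4)).symm
      · have : (Ψ (wtVec a - wtVec b)).toMul = χ.toMul := MonoidHom.ext fun t => by rw [hwt, hval]
        exact this
    · rintro ⟨x, ⟨a, b, hab, hab', hL, rfl⟩, rfl⟩
      refine ⟨?_, wedge (v a) (v b.swap), hmem a b hab hab' hL, ?_, ?_⟩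
      · intro h0
        rw [← map_zero Ψ] at h0
        exact hab (wtVec_injective (sub_eq_zero.1 (hΨinj h0)))
      · intro h0
        have h1 := wedge_mulVec (v a) (v b.swap) (v b)
        have hba' : b ≠ a.swap := fun e => hab' (by rw [e, Sum.swap_swap])
        rw [h0, Matrix.zero_mulVec, h.1, h.1, Sum.swap_swap, if_pos rfl, if_neg hba', one_smul,
          zero_smul, sub_zero] at h1
        exact h.1.ne_zero a h1.symm
      · intro t
        rw [hinv, (hadapt t).wedge, hwt, wt_swap]
  refine ⟨RootIso.symm ?_, ?_⟩
  · have := rootIso_image hΨinj hΨadd (rootsOf L)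
    rwa [← himage] at this
  · have := Set.ncard_image_of_injective (rootsOf L) hΨinj
    rwa [← himage] at this

end Roots

/-! ### The rank of centralizers -/

section Rank

variable {k : Type*} [Field k] {n : ℕ} {I : Type*} [Fintype I] [DecidableEq I]

/-- The one-parameter subgroups of the standard torus. -/
theorem IsHyp.one_add_mem_torus {v : I ⊕ I → Fin n → k} (hv : IsHyp v) (hI : 2 * Fintype.card I = n)
    (i : I) (t : kˣ) :
    1 + ((t : k) - 1) • vecMulVec (v (Sum.inl i)) (v (Sum.inr i)) +
      (((t⁻¹ : kˣ) : k) - 1) • vecMulVec (v (Sum.inr i)) (v (Sum.inl i)) =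
      hypDiag v (Pi.mulSingle i t) := by
  refine sub_eq_zero.1 (hv.ext_matrix hI fun a b => ?_)
  rw [Matrix.sub_mulVec, (adapted_hypDiag hv _).2]
  simp only [Matrix.add_mulVec, Matrix.smul_mulVec, Matrix.one_mulVec, Matrix.vecMulVec_mulVec, hv _ b,
    dotProduct_sub, dotProduct_add, dotProduct_smul, smul_eq_mul, op_smul_eq_smul, hv a]
  rcases a with a | a <;> rcases b with b | b <;>
    simp [Pi.mulSingle_apply] <;> split_ifs <;> simp_all

theorem wedge_mem_lieAlg_torus [Infinite k] {v : I ⊕ I → Fin n → k} (hv : IsHyp v)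
    (hI : 2 * Fintype.card I = n) (i : I) :
    wedge (v (Sum.inl i)) (v (Sum.inr i)) ∈ lieAlg (hypTorus hv hI).range :=
  mem_lieAlg_of_oneParam fun t => ⟨_, ⟨Pi.mulSingle i t, rfl⟩, (hv.one_add_mem_torus hI i t).symm⟩

/-- The Lie algebra of the standard torus has the basis `v (inl i) ∧ v (inr i)`. -/
theorem finrank_lieAlg_torus [Infinite k] {v : I ⊕ I → Fin n → k} (hv : IsHyp v)
    (hI : 2 * Fintype.card I = n) :
    Module.finrank k (lieAlg (hypTorus hv hI).range) = Fintype.card I := by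
  -- the diagonal coefficients; the others vanish for a matrix commuting with the torus
  let φ : lieAlg (hypTorus hv hI).range →ₗ[k] (I → k) :=
    { toFun := fun X i => v (Sum.inr i) ⬝ᵥ (X.1 *ᵥ v (Sum.inl i))
      map_add' := fun X Y => by
        funext i
        simp [Matrix.add_mulVec]
      map_smul' := fun c X => by
        funext i
        simp [Matrix.smul_mulVec] }
  have hφ : ∀ X i, φ X i = v (Sum.inr i) ⬝ᵥ (X.1 *ᵥ v (Sum.inl i)) := fun _ _ => rfl
  have hbij : Function.Bijective φ := by
    constructor
    · rw [injective_iff_map_eq_zero]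
      intro X hX
      have hXT : X.1ᵀ = -X.1 := by
        refine transpose_eq_neg_of_mem_lieAlg X.2 ?_
        rintro _ ⟨s, rfl⟩
        exact (adapted_hypDiag hv s).mul_transpose hI
      have hcomm : ∀ s, hypDiag v s * X.1 = X.1 * hypDiag v s := by
        intro s
        ext i j
        rw [← sub_eq_zero]
        -- the second factor, a diagonal entry, only serves not to vanish at `1`
        refine lieAlg_linear_of_mul X.2
          { toFun := fun Y => (hypDiag v s * Y) i j - (Y * hypDiag v s) i j
            map_add' := fun Y Z => by simp [mul_add, add_mul]; ring
            map_smul' := fun c Y => by simp [mul_sub] }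
          { toFun := fun Y => Y i i, map_add' := fun _ _ => rfl, map_smul' := fun _ _ => rfl } ?_ ?_ ?_
        · rintro _ ⟨t, rfl⟩
          have : hypDiag v s * hypDiag v t = hypDiag v t * hypDiag v s := by
            rw [← hypDiag_mul hv, ← hypDiag_mul hv, mul_comm s t]
          simp [this]
        · simp
        · change (1 : Matrix (Fin n) (Fin n) k) i i ≠ 0
          rw [Matrix.one_apply_eq]
          exact one_ne_zero
      refine Subtype.ext (hv.ext_matrix hI fun a b => ?_)
      have hinl : ∀ i, v (Sum.inr i) ⬝ᵥ (X.1 *ᵥ v (Sum.inl i)) = 0 := fun i => congrFun hX i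
      by_cases hab : a.swap = b
      · subst hab
        rcases a with i | i
        · have h1 := hinl i
          rw [Matrix.dotProduct_mulVec, ← Matrix.mulVec_transpose, hXT, Matrix.neg_mulVec,
            neg_dotProduct, neg_eq_zero, dotProduct_comm] at h1
          exact h1
        · exact hinl i
      · have := eq_zero_of_commute_hypDiag hv hI hcomm hab
        rwa [Sum.swap_swap] at this
    · intro c
      refine ⟨⟨∑ i, c i • wedge (v (Sum.inl i)) (v (Sum.inr i)),
        Submodule.sum_mem _ fun i _ => Submodule.smul_mem _ _ (wedge_mem_lieAlg_torus hv hI i)⟩, ?_⟩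
      funext j
      rw [hφ]
      simp only [Matrix.sum_mulVec, dotProduct_sum, Matrix.smul_mulVec, wedge_mulVec, dotProduct_smul,
        dotProduct_sub, hv _ _]
      simp
  rw [(LinearEquiv.ofBijective φ hbij).finrank_eq, Module.finrank_fintype_fun_eq_card]

variable {m : ℕ}

theorem cent_one : cent (1 : PSO m k) = ⊤ := by
  rw [cent, Subgroup.centralizer_eq_top_iff_subset, Set.singleton_subset_iff]
  exact Subgroup.one_mem _

/-- The centralizer of a semisimple element has the same rank as the whole group. -/
theorem algRank_eq [IsAlgClosed k] (h2 : (2 : k) ≠ 0) (hm : 2 ≤ m) (g : SO2 m k)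
    {N : ℕ} (hN : (N : k) ≠ 0) (hgN : g.1 ^ N = 1) {v₀ : I ⊕ I → Fin (2 * m) → k} {L : I → kˣ}
    (h₀ : Adapted g.1 v₀ L) (hI : 2 * Fintype.card I = 2 * m) :
    algRank (preimageGL (cent (proj m k g))) = m := by
  have : Infinite k := IsAlgClosed.instInfinite
  obtain ⟨v, h, hT⟩ := exists_maxTorus_eq h2 hm g hN hgN h₀ hI
  rw [algRank, hT, finrank_lieAlg_torus h.1 hI]
  omega

end Rank

/-! ### Sums of root systems -/

section RootSum

variable {X Y Z X' Y' : Type*} [AddCommGroup X] [AddCommGroup Y] [AddCommGroup Z] [AddCommGroup X']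
  [AddCommGroup Y']

theorem RootIso.refl (Φ : Set X) : RootIso Φ Φ := ⟨AddEquiv.refl _, fun _ => Iff.rfl⟩

/-- The root lattice of a sum is the product of the root lattices. -/
theorem closure_rootSum (Φ : Set X) (Ψ : Set Y) :
    AddSubgroup.closure (Φ ⊞ Ψ) = (AddSubgroup.closure Φ).prod (AddSubgroup.closure Ψ) := by
  apply le_antisymm
  · rw [AddSubgroup.closure_le]
    rintro ⟨x, y⟩ (⟨h, h0⟩ | ⟨h0, h⟩)
    · exact ⟨AddSubgroup.subset_closure h, by rw [show y = 0 from h0]; exact zero_mem _⟩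
    · exact ⟨by rw [show x = 0 from h0]; exact zero_mem _, AddSubgroup.subset_closure h⟩
  · rintro ⟨x, y⟩ ⟨hx, hy⟩
    have h1 : (AddMonoidHom.inl X Y) x ∈ AddSubgroup.closure (Φ ⊞ Ψ) := by
      have := AddSubgroup.mem_map_of_mem (AddMonoidHom.inl X Y) hx
      rw [AddMonoidHom.map_closure] at this
      refine AddSubgroup.closure_mono ?_ this
      rintro _ ⟨z, hz, rfl⟩
      exact Or.inl ⟨hz, rfl⟩
    have h2 : (AddMonoidHom.inr X Y) y ∈ AddSubgroup.closure (Φ ⊞ Ψ) := by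
      have := AddSubgroup.mem_map_of_mem (AddMonoidHom.inr X Y) hy
      rw [AddMonoidHom.map_closure] at this
      refine AddSubgroup.closure_mono ?_ this
      rintro _ ⟨z, hz, rfl⟩
      exact Or.inr ⟨rfl, hz⟩
    have := add_mem h1 h2
    simpa using this

theorem RootIso.rootSum {Φ : Set X} {Ψ : Set Y} {Φ' : Set X'} {Ψ' : Set Y'} (h : RootIso Φ Φ')
    (h' : RootIso Ψ Ψ') : RootIso (Φ ⊞ Ψ) (Φ' ⊞ Ψ') := by
  obtain ⟨f, hf⟩ := h
  obtain ⟨g, hg⟩ := h'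
  refine ⟨(AddEquiv.addSubgroupCongr (closure_rootSum Φ Ψ)).trans
    ((AddSubgroup.prodEquiv _ _).trans ((f.prodCongr g).trans ((AddSubgroup.prodEquiv _ _).symm.trans
      (AddEquiv.addSubgroupCongr (closure_rootSum Φ' Ψ')).symm))), ?_⟩
  rintro ⟨⟨x, y⟩, hz⟩
  obtain ⟨hx, hy⟩ := (closure_rootSum Φ Ψ ▸ hz : (x, y) ∈ (AddSubgroup.closure Φ).prod _)
  change (x ∈ Φ ∧ y = 0) ∨ (x = 0 ∧ y ∈ Ψ) ↔ ((f ⟨x, hx⟩ : X') ∈ Φ' ∧ (g ⟨y, hy⟩ : Y') = 0) ∨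
    ((f ⟨x, hx⟩ : X') = 0 ∧ (g ⟨y, hy⟩ : Y') ∈ Ψ')
  have hf0 : (f ⟨x, hx⟩ : X') = 0 ↔ x = 0 := by
    rw [ZeroMemClass.coe_eq_zero, map_eq_zero_iff f f.injective, ← ZeroMemClass.coe_eq_zero]
  have hg0 : (g ⟨y, hy⟩ : Y') = 0 ↔ y = 0 := by
    rw [ZeroMemClass.coe_eq_zero, map_eq_zero_iff g g.injective, ← ZeroMemClass.coe_eq_zero]
  rw [← hf, ← hg, hf0, hg0]

theorem rootSum_comm (Φ : Set X) (Ψ : Set Y) : RootIso (Φ ⊞ Ψ) (Ψ ⊞ Φ) := by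
  have h := rootIso_image (Prod.swap_injective : Function.Injective (Prod.swap : X × Y → Y × X))
    (fun _ _ => rfl) (Φ ⊞ Ψ)
  have e : Prod.swap '' (Φ ⊞ Ψ) = Ψ ⊞ Φ := by
    rw [Set.image_swap_eq_preimage_swap]
    ext ⟨y, x⟩
    exact ⟨fun h => h.symm.imp And.symm And.symm, fun h => h.symm.imp And.symm And.symm⟩
  rwa [e] at h

theorem rootSum_assoc (Φ : Set X) (Ψ : Set Y) (Θ : Set Z) : RootIso ((Φ ⊞ Ψ) ⊞ Θ) (Φ ⊞ Ψ ⊞ Θ) := by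
  have h := rootIso_image (Equiv.prodAssoc X Y Z).injective (fun _ _ => rfl) ((Φ ⊞ Ψ) ⊞ Θ)
  have e : Equiv.prodAssoc X Y Z '' ((Φ ⊞ Ψ) ⊞ Θ) = Φ ⊞ Ψ ⊞ Θ := by
    rw [Equiv.image_eq_preimage_symm]
    ext ⟨x, y, z⟩
    simp only [_root_.rootSum, Set.mem_preimage, Equiv.prodAssoc_symm_apply, Set.mem_ofPred_eq,
      Prod.mk_eq_zero]
    tauto
  rwa [e] at h

theorem rootSum_empty (Ψ : Set Y) : RootIso ((∅ : Set X) ⊞ Ψ) Ψ := by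
  have h := rootIso_image (f := fun y : Y => ((0, y) : X × Y)) (fun _ _ h => congrArg Prod.snd h)
    (fun _ _ => Prod.ext (add_zero 0).symm rfl) Ψ
  have e : (fun y : Y => ((0, y) : X × Y)) '' Ψ = (∅ : Set X) ⊞ Ψ := by
    ext ⟨x, y⟩
    simp only [_root_.rootSum, Set.mem_image, Set.mem_ofPred_eq, Set.mem_empty_iff_false, Prod.mk.injEq]
    constructor
    · rintro ⟨z, hz, rfl, rfl⟩; exact Or.inr ⟨rfl, hz⟩
    · rintro (⟨h, -⟩ | ⟨rfl, hy⟩)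
      · exact h.elim
      · exact ⟨y, hy, rfl, rfl⟩
  rw [e] at h
  exact h.symm

theorem rootSum_empty_right (Φ : Set X) : RootIso (Φ ⊞ (∅ : Set Y)) Φ :=
  (rootSum_comm _ _).trans (rootSum_empty _)

/-- A sum of root systems has as many roots as the summands together. -/
theorem ncard_rootSum {Φ : Set X} {Ψ : Set Y} (hΦ : Φ.Finite) (hΨ : Ψ.Finite) (h0 : (0 : X) ∉ Φ) :
    (Φ ⊞ Ψ).ncard = Φ.ncard + Ψ.ncard := by
  have e : (Φ ⊞ Ψ) = (fun x : X => ((x, 0) : X × Y)) '' Φ ∪ (fun y : Y => ((0, y) : X × Y)) '' Ψ := by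
    ext ⟨x, y⟩
    simp only [_root_.rootSum, Set.mem_union, Set.mem_image, Set.mem_ofPred_eq, Prod.mk.injEq]
    constructor
    · rintro (⟨h, rfl⟩ | ⟨rfl, h⟩)
      · exact Or.inl ⟨x, h, rfl, rfl⟩
      · exact Or.inr ⟨y, h, rfl, rfl⟩
    · rintro (⟨z, h, rfl, rfl⟩ | ⟨z, h, rfl, rfl⟩)
      · exact Or.inl ⟨h, rfl⟩
      · exact Or.inr ⟨rfl, h⟩
  rw [e, Set.ncard_union_eq ?_ (hΦ.image _) (hΨ.image _), Set.ncard_image_of_injective, Set.ncard_image_of_injective]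
  · exact fun _ _ h => congrArg Prod.snd h
  · exact fun _ _ h => congrArg Prod.fst h
  · rw [Set.disjoint_left]
    rintro _ ⟨x, hx, rfl⟩ ⟨y, hy, h⟩
    rw [show x = 0 from (congrArg Prod.fst h).symm] at hx
    exact h0 hx

end RootSum

/-! ### Classical root systems and their cardinalities -/

section Classical

/-- The root system of `GL_b`, of type `A_{b-1}`. -/
def rootsGL (b : ℕ) : Set (Fin b → ℤ) :=
  {x | ∃ i j, i ≠ j ∧ x = Pi.single i 1 - Pi.single j 1}

theorem rootsGL_succ (r : ℕ) : rootsGL (r + 1) = rootsA r := rfl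

theorem rootsGL_one : rootsGL 1 = ∅ := by
  ext x
  simp only [rootsGL, Set.mem_ofPred_eq, Set.mem_empty_iff_false, iff_false]
  rintro ⟨i, j, h, -⟩
  exact h (Subsingleton.elim i j)

theorem rootsD_one : rootsD 1 = ∅ := by
  ext x
  simp only [rootsD, Set.mem_ofPred_eq, Set.mem_empty_iff_false, iff_false]
  rintro ⟨i, j, h, -⟩
  exact h (Subsingleton.elim i j)

theorem zero_notMem_rootsGL (b : ℕ) : 0 ∉ rootsGL b := by
  rintro ⟨i, j, h, e⟩
  have := congrFun e i
  simp [h] at this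

theorem zero_notMem_rootsD (b : ℕ) : 0 ∉ rootsD b := by
  rintro ⟨i, j, h, u, v, e⟩
  have := congrFun e i
  simp only [Pi.zero_apply, Pi.add_apply, Pi.single_eq_same, Pi.single_eq_of_ne h, add_zero] at this
  exact u.ne_zero this.symm

theorem card_filter_lt (r : ℕ) :
    2 * (Finset.univ.filter fun p : Fin r × Fin r => p.1 < p.2).card = r * (r - 1) := by
  have h1 : (Finset.univ.filter fun p : Fin r × Fin r => p.1 < p.2).card =
      (Finset.univ.filter fun p : Fin r × Fin r => p.2 < p.1).card := by
    refine Finset.card_equiv (Equiv.prodComm _ _) fun p => ?_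
    simp
  have h2 : (Finset.univ.filter fun p : Fin r × Fin r => p.1 < p.2).card +
      (Finset.univ.filter fun p : Fin r × Fin r => p.2 < p.1).card = (Finset.univ : Finset (Fin r)).offDiag.card := by
    rw [← Finset.card_union_of_disjoint]
    · congr 1
      ext p
      simp [lt_or_lt_iff_ne]
    · rw [Finset.disjoint_filter]
      exact fun p _ h => h.not_gt
  rw [Finset.offDiag_card, Finset.card_univ, Fintype.card_fin] at h2
  rw [Nat.mul_sub_one]
  omega

theorem rootsGL_eq_image (b : ℕ) : rootsGL b =
    ((Finset.univ : Finset (Fin b)).offDiag.image fun p =>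
      (Pi.single p.1 1 - Pi.single p.2 1 : Fin b → ℤ) : Finset (Fin b → ℤ)) := by
  ext x
  simp only [rootsGL, Set.mem_ofPred_eq, Finset.coe_image, Set.mem_image, Finset.mem_coe, Finset.mem_offDiag,
    Finset.mem_univ, true_and, Prod.exists]
  exact ⟨fun ⟨i, j, h, e⟩ => ⟨i, j, h, e.symm⟩, fun ⟨i, j, h, e⟩ => ⟨i, j, h, e.symm⟩⟩

theorem ncard_rootsGL (b : ℕ) : (rootsGL b).ncard = b * (b - 1) := by
  rw [rootsGL_eq_image, Set.ncard_coe_finset, Finset.card_image_of_injOn, Finset.offDiag_card,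
    Finset.card_univ, Fintype.card_fin, Nat.mul_sub_one]
  rintro ⟨i, j⟩ hij ⟨i', j'⟩ hij' h
  simp only [Finset.mem_coe, Finset.mem_offDiag, Finset.mem_univ, true_and] at hij hij'
  have h1 := congrFun h i
  have h2 := congrFun h j
  simp only [Pi.sub_apply, Pi.single_apply, if_true, if_neg hij, if_neg (Ne.symm hij)] at h1 h2
  have e1 : i = i' := by
    by_contra hne
    rw [if_neg hne] at h1
    split_ifs at h1 <;> omega
  have e2 : j = j' := by
    by_contra hne
    rw [if_neg hne] at h2
    split_ifs at h2 <;> omega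
  rw [e1, e2]

theorem rootsD_eq_image (r : ℕ) : rootsD r =
    (((Finset.univ.filter fun p : Fin r × Fin r => p.1 < p.2) ×ˢ (Finset.univ : Finset (ℤˣ × ℤˣ))).image
      fun q => (Pi.single q.1.1 (q.2.1 : ℤ) + Pi.single q.1.2 (q.2.2 : ℤ) : Fin r → ℤ) :
        Finset (Fin r → ℤ)) := by
  ext x
  simp only [rootsD, Set.mem_ofPred_eq, Finset.coe_image, Set.mem_image, Finset.mem_coe, Finset.mem_product,
    Finset.mem_filter, Finset.mem_univ, true_and, and_true, Prod.exists]
  constructor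
  · rintro ⟨i, j, h, a, b, e⟩
    rcases lt_or_gt_of_ne h with h | h
    · exact ⟨i, j, a, b, h, e.symm⟩
    · exact ⟨j, i, b, a, h, by rw [e, add_comm]⟩
  · rintro ⟨i, j, a, b, h, e⟩
    exact ⟨i, j, h.ne, a, b, e.symm⟩

theorem ncard_rootsD (r : ℕ) : (rootsD r).ncard = 2 * (r * (r - 1)) := by
  rw [rootsD_eq_image, Set.ncard_coe_finset, Finset.card_image_of_injOn, Finset.card_product,
    ← card_filter_lt]
  · have : (Finset.univ : Finset (ℤˣ × ℤˣ)).card = 4 := rfl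
    rw [this]; ring
  rintro ⟨⟨i, j⟩, a, b⟩ hij ⟨⟨i', j'⟩, a', b'⟩ hij' h
  simp only [Finset.mem_coe, Finset.mem_product, Finset.mem_filter, Finset.mem_univ, true_and, and_true] at hij hij'
  have hi := congrFun h i
  have hj := congrFun h j
  have hi' := congrFun h i'
  have ne := hij.ne
  have ne' := hij'.ne
  simp only [Pi.add_apply, Pi.single_apply, if_true, if_neg ne, if_neg ne.symm, if_neg ne',
    add_zero, zero_add] at hi hj hi'
  have ha := a.ne_zero
  have hb := b.ne_zero
  have ha' := a'.ne_zero
  have e1 : i = i' := by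
    by_contra hne
    rw [if_neg hne] at hi
    rw [if_neg (Ne.symm hne)] at hi'
    split_ifs at hi hi' with h1 h2
    · rw [← h1, h2] at hij'
      exact lt_asymm hij hij'
    all_goals omega
  subst e1
  rw [if_pos rfl, if_neg ne, add_zero] at hi'
  rw [if_neg ne.symm, zero_add] at hj
  have e2 : j = j' := by
    by_contra hne
    rw [if_neg hne] at hj
    exact hb hj
  subst e2
  rw [if_pos rfl] at hj
  rw [Units.ext hi', Units.ext hj]

theorem finite_rootsD (r : ℕ) : (rootsD r).Finite := by
  rw [rootsD_eq_image]; exact Finset.finite_toSet _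

theorem finite_rootsGL (r : ℕ) : (rootsGL r).Finite := by
  rw [rootsGL_eq_image]; exact Finset.finite_toSet _

/-- Root systems that agree after an injective linear map and a rescaling by `2`. -/
theorem rootIso_of_double {X Y : Type*} [AddCommGroup X] [AddCommGroup Y] [IsAddTorsionFree Y] {f : X → Y}
    (hf : Function.Injective f) (hadd : ∀ x y, f (x + y) = f x + f y) {Φ : Set X} {Ψ : Set Y}
    (h : f '' Φ = (fun y => 2 • y) '' Ψ) : RootIso Φ Ψ := by
  have h1 := rootIso_image hf hadd Φ
  rw [h] at h1
  exact h1.trans (rootIso_image (nsmul_right_injective two_ne_zero) (fun x y => smul_add 2 x y) Ψ).symm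

/-- `D₂ = A₁ + A₁`, by the coordinates `x₀ + x₁` and `x₀ - x₁`. -/
theorem rootIso_D2 : RootIso (rootsD 2) (rootsA 1 ⊞ rootsA 1) := by
  refine rootIso_of_double (f := fun x : Fin 2 → ℤ => ((![x 0 + x 1, -(x 0 + x 1)], ![x 0 - x 1, -(x 0 - x 1)]) :
    (Fin 2 → ℤ) × (Fin 2 → ℤ))) ?_ ?_ ?_
  · intro x y h
    have h1 := congrFun (congrArg Prod.fst h) 0
    have h2 := congrFun (congrArg Prod.snd h) 0
    simp at h1 h2
    funext i
    fin_cases i <;> simp <;> omega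
  · intro x y
    refine Prod.ext ?_ ?_ <;> funext i <;> fin_cases i <;> simp <;> ring
  · have hA : rootsA 1 = {![1, -1], ![-1, 1]} := by
      rw [← rootsGL_succ, rootsGL_eq_image,
        show ((Finset.univ : Finset (Fin (1 + 1))).offDiag.image fun p =>
          (Pi.single p.1 1 - Pi.single p.2 1 : Fin (1 + 1) → ℤ)) = {![1, -1], ![-1, 1]} by decide]
      simp
    have hD : rootsD 2 = {![1, 1], ![1, -1], ![-1, 1], ![-1, -1]} := by
      rw [rootsD_eq_image, show (((Finset.univ.filter fun p : Fin 2 × Fin 2 => p.1 < p.2) ×ˢ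
        (Finset.univ : Finset (ℤˣ × ℤˣ))).image fun q => (Pi.single q.1.1 (q.2.1 : ℤ) +
          Pi.single q.1.2 (q.2.2 : ℤ) : Fin 2 → ℤ)) = {![1, 1], ![1, -1], ![-1, 1], ![-1, -1]} by decide]
      simp
    have hS : (rootsA 1 ⊞ rootsA 1) = {(![1, -1], 0), (![-1, 1], 0), (0, ![1, -1]), (0, ![-1, 1])} := by
      rw [hA]
      ext ⟨x, y⟩
      simp only [rootSum, Set.mem_ofPred_eq, Set.mem_insert_iff, Set.mem_singleton_iff, Prod.mk.injEq]
      tauto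
    rw [hS, hD]
    simp only [Set.image_insert_eq, Set.image_singleton]
    have h0 : (![0, 0] : Fin 2 → ℤ) = 0 := by decide
    ext x
    simp [h0]
    tauto

/-- `D₃ = A₃`, by the weights of a half-spin representation, doubled to be integral. -/
theorem rootIso_D3 : RootIso (rootsD 3) (rootsA 3) := by
  refine rootIso_of_double (f := fun x : Fin 3 → ℤ => ![x 0 + x 1 + x 2, x 0 - x 1 - x 2,
    -x 0 + x 1 - x 2, -x 0 - x 1 + x 2]) ?_ ?_ ?_
  · intro x y h
    have h0 := congrFun h 0
    have h1 := congrFun h 1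
    have h2 := congrFun h 2
    simp at h0 h1 h2
    funext i
    fin_cases i <;> simp <;> omega
  · intro x y
    funext i
    fin_cases i <;> simp <;> ring
  · rw [← rootsGL_succ, rootsGL_eq_image, rootsD_eq_image, ← Finset.coe_image, ← Finset.coe_image]
    congr 1
    decide +kernel

end Classical

/-! ### Roots of centralizers in terms of multiplicities -/

section Labels

variable {A : Type*} [Group A]

theorem wtVec_map_inl {I₁ I₂ : Type*} [DecidableEq I₁] [DecidableEq I₂] (a : I₁ ⊕ I₁) :
    (fun i => wtVec (Sum.map Sum.inl Sum.inl a : (I₁ ⊕ I₂) ⊕ (I₁ ⊕ I₂)) (Sum.inl i)) = wtVec a ∧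
    (fun i => wtVec (Sum.map Sum.inl Sum.inl a : (I₁ ⊕ I₂) ⊕ (I₁ ⊕ I₂)) (Sum.inr i)) = 0 := by
  rcases a with a | a <;> constructor <;> funext i <;> simp [wtVec, Pi.single_apply]

theorem wtVec_map_inr {I₁ I₂ : Type*} [DecidableEq I₁] [DecidableEq I₂] (a : I₂ ⊕ I₂) :
    (fun i => wtVec (Sum.map Sum.inr Sum.inr a : (I₁ ⊕ I₂) ⊕ (I₁ ⊕ I₂)) (Sum.inl i)) = 0 ∧
    (fun i => wtVec (Sum.map Sum.inr Sum.inr a : (I₁ ⊕ I₂) ⊕ (I₁ ⊕ I₂)) (Sum.inr i)) = wtVec a := by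
  rcases a with a | a <;> constructor <;> funext i <;> simp [wtVec, Pi.single_apply]

theorem wt_map_inl {I₁ I₂ : Type*} (L₁ : I₁ → A) (L₂ : I₂ → A) (a : I₁ ⊕ I₁) :
    wt (Sum.elim L₁ L₂) (Sum.map Sum.inl Sum.inl a) = wt L₁ a := by
  rcases a with a | a <;> rfl

theorem wt_map_inr {I₁ I₂ : Type*} (L₁ : I₁ → A) (L₂ : I₂ → A) (a : I₂ ⊕ I₂) :
    wt (Sum.elim L₁ L₂) (Sum.map Sum.inr Sum.inr a) = wt L₂ a := by
  rcases a with a | a <;> rfl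

theorem sum_cases {I₁ I₂ : Type*} (a : (I₁ ⊕ I₂) ⊕ (I₁ ⊕ I₂)) :
    (∃ b, a = Sum.map Sum.inl Sum.inl b) ∨ ∃ b, a = Sum.map Sum.inr Sum.inr b := by
  rcases a with (a | a) | (a | a)
  · exact Or.inl ⟨Sum.inl a, rfl⟩
  · exact Or.inr ⟨Sum.inl a, rfl⟩
  · exact Or.inl ⟨Sum.inr a, rfl⟩
  · exact Or.inr ⟨Sum.inr a, rfl⟩

theorem sum_map_swap {X Y : Type*} (f : X → Y) (a : X ⊕ X) :
    Sum.map f f a.swap = (Sum.map f f a).swap := by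
  rcases a with a | a <;> rfl

/-- Splitting an integral vector into its two blocks of coordinates. -/
def splitSum {I₁ I₂ : Type*} (x : I₁ ⊕ I₂ → ℤ) : (I₁ → ℤ) × (I₂ → ℤ) :=
  (fun i => x (Sum.inl i), fun i => x (Sum.inr i))

variable {I₁ I₂ : Type*} [DecidableEq I₁] [DecidableEq I₂]

/-- The root system of two families of eigenvalues without a common member is the sum of the two
root systems. -/
theorem image_rootsOf_sumElim (L₁ : I₁ → A) (L₂ : I₂ → A) (h : ∀ a b, wt L₁ a ≠ wt L₂ b) :
    splitSum '' rootsOf (Sum.elim L₁ L₂) = rootSum (rootsOf L₁) (rootsOf L₂) := by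
  have hinl : Function.Injective (Sum.map Sum.inl Sum.inl : I₁ ⊕ I₁ → (I₁ ⊕ I₂) ⊕ (I₁ ⊕ I₂)) :=
    Sum.map_injective.2 ⟨Sum.inl_injective, Sum.inl_injective⟩
  have hinr : Function.Injective (Sum.map Sum.inr Sum.inr : I₂ ⊕ I₂ → (I₁ ⊕ I₂) ⊕ (I₁ ⊕ I₂)) :=
    Sum.map_injective.2 ⟨Sum.inr_injective, Sum.inr_injective⟩
  have key₁ : ∀ a b : I₁ ⊕ I₁, splitSum (wtVec (Sum.map Sum.inl Sum.inl a : (I₁ ⊕ I₂) ⊕ (I₁ ⊕ I₂)) -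
      wtVec (Sum.map Sum.inl Sum.inl b)) = (wtVec a - wtVec b, 0) := by
    intro a b
    refine Prod.ext ?_ ?_
    · exact congrArg₂ (· - ·) (wtVec_map_inl a).1 (wtVec_map_inl b).1
    · exact (congrArg₂ (· - ·) (wtVec_map_inl a).2 (wtVec_map_inl b).2).trans (sub_zero 0)
  have key₂ : ∀ a b : I₂ ⊕ I₂, splitSum (wtVec (Sum.map Sum.inr Sum.inr a : (I₁ ⊕ I₂) ⊕ (I₁ ⊕ I₂)) -
      wtVec (Sum.map Sum.inr Sum.inr b)) = (0, wtVec a - wtVec b) := by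
    intro a b
    refine Prod.ext ?_ ?_
    · exact (congrArg₂ (· - ·) (wtVec_map_inr a).1 (wtVec_map_inr b).1).trans (sub_zero 0)
    · exact congrArg₂ (· - ·) (wtVec_map_inr a).2 (wtVec_map_inr b).2
  ext z
  constructor
  · rintro ⟨x, ⟨a, b, hab, hab', hL, rfl⟩, rfl⟩
    rcases sum_cases a with ⟨a, rfl⟩ | ⟨a, rfl⟩ <;> rcases sum_cases b with ⟨b, rfl⟩ | ⟨b, rfl⟩
    · rw [wt_map_inl, wt_map_inl] at hL
      rw [← sum_map_swap] at hab'
      exact Or.inl (key₁ a b ▸ ⟨⟨a, b, fun e => hab (e ▸ rfl), fun e => hab' (e ▸ rfl), hL, rfl⟩, rfl⟩)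
    · rw [wt_map_inl, wt_map_inr] at hL
      exact (h a b hL).elim
    · rw [wt_map_inl, wt_map_inr] at hL
      exact (h b a hL.symm).elim
    · rw [wt_map_inr, wt_map_inr] at hL
      rw [← sum_map_swap] at hab'
      exact Or.inr (key₂ a b ▸ ⟨rfl, ⟨a, b, fun e => hab (e ▸ rfl), fun e => hab' (e ▸ rfl), hL, rfl⟩⟩)
  · obtain ⟨z₁, z₂⟩ := z
    rintro (⟨⟨a, b, hab, hab', hL, e⟩, h0⟩ | ⟨h0, ⟨a, b, hab, hab', hL, e⟩⟩)
    · refine ⟨_, ⟨Sum.map Sum.inl Sum.inl a, Sum.map Sum.inl Sum.inl b, hinl.ne hab, ?_, ?_, rfl⟩, ?_⟩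
      · rw [← sum_map_swap]; exact hinl.ne hab'
      · rw [wt_map_inl, wt_map_inl, hL]
      · exact (key₁ a b).trans (Prod.ext e.symm h0.symm)
    · refine ⟨_, ⟨Sum.map Sum.inr Sum.inr a, Sum.map Sum.inr Sum.inr b, hinr.ne hab, ?_, ?_, rfl⟩, ?_⟩
      · rw [← sum_map_swap]; exact hinr.ne hab'
      · rw [wt_map_inr, wt_map_inr, hL]
      · exact (key₂ a b).trans (Prod.ext h0.symm e.symm)

theorem splitSum_injective {I₁ I₂ : Type*} :
    Function.Injective (splitSum : (I₁ ⊕ I₂ → ℤ) → (I₁ → ℤ) × (I₂ → ℤ)) := by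
  intro x y e
  funext i
  rcases i with i | i
  · exact congrFun (congrArg Prod.fst e) i
  · exact congrFun (congrArg Prod.snd e) i

theorem rootIso_rootsOf_sumElim (L₁ : I₁ → A) (L₂ : I₂ → A) (h : ∀ a b, wt L₁ a ≠ wt L₂ b) :
    RootIso (rootsOf (Sum.elim L₁ L₂)) (rootSum (rootsOf L₁) (rootsOf L₂)) := by
  rw [← image_rootsOf_sumElim L₁ L₂ h]
  exact rootIso_image splitSum_injective (fun _ _ => rfl) _

theorem ncard_rootsOf_sumElim (L₁ : I₁ → A) (L₂ : I₂ → A) (h : ∀ a b, wt L₁ a ≠ wt L₂ b) :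
    (rootsOf (Sum.elim L₁ L₂)).ncard = (rootSum (rootsOf L₁) (rootsOf L₂)).ncard := by
  rw [← image_rootsOf_sumElim L₁ L₂ h, Set.ncard_image_of_injective _ splitSum_injective]

theorem wt_const {I : Type*} (c : A) (a : I ⊕ I) :
    wt (fun _ => c) a = c ∨ wt (fun _ => c) a = c⁻¹ := by
  rcases a with a | a
  · exact Or.inl rfl
  · exact Or.inr rfl

/-- An eigenvalue `c ≠ c⁻¹` of multiplicity `b` contributes a factor `GL_b` to the centralizer. -/
theorem rootsOf_const_of_ne {b : ℕ} {c : A} (hc : c ≠ c⁻¹) : rootsOf (fun _ : Fin b => c) = rootsGL b := by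
  ext x
  constructor
  · rintro ⟨a, a', hne, hne', hL, rfl⟩
    rcases a with i | i <;> rcases a' with j | j
    · exact ⟨i, j, fun e => hne (e ▸ rfl), rfl⟩
    · exact (hc hL).elim
    · exact (hc hL.symm).elim
    · refine ⟨j, i, fun e => hne (e ▸ rfl), ?_⟩
      simp only [wtVec, Sum.elim_inr]
      abel
  · rintro ⟨i, j, hne, rfl⟩
    exact ⟨Sum.inl i, Sum.inl j, fun e => hne (Sum.inl_injective e), by simp, rfl, rfl⟩

/-- An eigenvalue `c = c⁻¹` of multiplicity `2b` contributes a factor `SO_{2b}` to the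
centralizer. -/
theorem rootsOf_const_of_eq {b : ℕ} {c : A} (hc : c = c⁻¹) : rootsOf (fun _ : Fin b => c) = rootsD b := by
  ext x
  constructor
  · rintro ⟨a, a', hne, hne', hL, rfl⟩
    rcases a with i | i <;> rcases a' with j | j
    · exact ⟨i, j, fun e => hne (e ▸ rfl), 1, -1, by simp [wtVec, sub_eq_add_neg, Pi.single_neg]⟩
    · exact ⟨i, j, fun e => hne' (e ▸ rfl), 1, 1, by simp [wtVec]⟩
    · exact ⟨i, j, fun e => hne' (e ▸ rfl), -1, -1, by simp [wtVec, sub_eq_add_neg, Pi.single_neg]⟩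
    · exact ⟨i, j, fun e => hne (e ▸ rfl), -1, 1, by simp [wtVec, Pi.single_neg]⟩
  · rintro ⟨i, j, hne, u, v, rfl⟩
    have hw : ∀ a : Fin b ⊕ Fin b, wt (fun _ => c) a = c := fun a => (wt_const c a).elim id fun e => e.trans hc.symm
    have hs : ∀ (i : Fin b) (u : ℤˣ), ∃ a : Fin b ⊕ Fin b, Sum.elim id id a = i ∧ wtVec a = Pi.single i (u : ℤ) := by
      intro i u
      rcases Int.units_eq_one_or u with rfl | rfl
      · exact ⟨Sum.inl i, rfl, rfl⟩
      · exact ⟨Sum.inr i, rfl, by simp [wtVec, Pi.single_neg]⟩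
    obtain ⟨a, ha, hau⟩ := hs i u
    obtain ⟨a', ha', hau'⟩ := hs j (-v)
    refine ⟨a, a', ?_, ?_, by rw [hw, hw], ?_⟩
    · rintro rfl
      exact hne (ha.symm.trans ha')
    · rintro rfl
      refine hne (ha.symm.trans (Eq.trans ?_ ha'))
      rcases a' with a' | a' <;> rfl
    · rw [hau, hau', Units.val_neg, Pi.single_neg, sub_neg_eq_add]

end Labels

/-! ### Eigenvalues of elements of orders `2`, `3` and `5` -/

section EigenvalueData

variable {k : Type*} [Field k] {n : ℕ}

theorem Adapted.pow {I : Type*} [DecidableEq I] {g : Matrix (Fin n) (Fin n) k} {v : I ⊕ I → Fin n → k} {L : I → kˣ}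
    (h : Adapted g v L) (N : ℕ) : Adapted (g ^ N) v (fun i => L i ^ N) := by
  refine ⟨h.1, fun a => ?_⟩
  have hw : wt (fun i => L i ^ N) a = wt L a ^ N := by
    rcases a with a | a
    · rfl
    · exact (inv_pow (L a) N).symm
  rw [hw]
  induction N with
  | zero => simp
  | succ N ih =>
    have hw' : wt (fun i => L i ^ N) a = wt L a ^ N := by
      rcases a with a | a
      · rfl
      · exact (inv_pow (L a) N).symm
    rw [_root_.pow_succ', ← Matrix.mulVec_mulVec, ih hw', Matrix.mulVec_smul, h.2, smul_smul, ← Units.val_mul,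
      ← _root_.pow_succ]

theorem Adapted.congr_eq {I : Type*} [Fintype I] [DecidableEq I] {g g' : Matrix (Fin n) (Fin n) k}
    {v : I ⊕ I → Fin n → k} {L : I → kˣ} (h : Adapted g v L) (h' : Adapted g' v L)
    (hI : 2 * Fintype.card I = n) : g = g' :=
  (h.eq_hypMat_mul hI).trans (h'.eq_hypMat_mul hI).symm

theorem IsHyp.adapted_one {I : Type*} [DecidableEq I] {v : I ⊕ I → Fin n → k} (hv : IsHyp v) :
    Adapted (1 : Matrix (Fin n) (Fin n) k) v (fun _ => 1) := by
  refine ⟨hv, fun a => ?_⟩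
  rcases a with a | a <;> simp

theorem Adapted.pow_eq_one_iff {I : Type*} [Fintype I] [DecidableEq I] {g : Matrix (Fin n) (Fin n) k}
    {v : I ⊕ I → Fin n → k} {L : I → kˣ} (h : Adapted g v L) (hI : 2 * Fintype.card I = n) (N : ℕ) :
    g ^ N = 1 ↔ ∀ i, L i ^ N = 1 := by
  constructor
  · intro hN i
    have h1 := h.pow N
    rw [hN] at h1
    exact congrFun (h1.wt_unique h.1.adapted_one) i
  · intro hN
    have h1 := h.pow N
    rw [show (fun i => L i ^ N) = fun _ => 1 from funext hN] at h1
    exact h1.congr_eq h.1.adapted_one hI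

/-- Eigenvalues can be permuted and inverted by a change of the hyperbolic eigenbasis. -/
theorem Adapted.relabel {I I' : Type*} [DecidableEq I] [DecidableEq I'] {g : Matrix (Fin n) (Fin n) k}
    {v : I ⊕ I → Fin n → k} {L : I → kˣ} (h : Adapted g v L) (e : I' ≃ I) (L' : I' → kˣ)
    (hL : ∀ i, L' i = L (e i) ∨ L' i = (L (e i))⁻¹) : ∃ v', Adapted g v' L' := by
  classical
  have h1 : Adapted g (v ∘ Equiv.sumCongr e e) (fun i => L (e i)) :=
    h.comp (Equiv.sumCongr e e) (fun a => sum_map_swap e a)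
      (fun a => by rcases a with a | a <;> rfl)
  refine ⟨_, h1.comp (flipEquiv fun i => L' i ≠ L (e i)) (flipEquiv_swap _) (L' := L') fun a => ?_⟩
  rw [← wt_flip]
  congr 1
  funext i
  by_cases hi : L' i = L (e i)
  · simp [hi]
  · simpa [hi] using (hL i).resolve_left hi

/-- Splitting of a finite index set according to whether `κ` has the value `c`. -/
theorem exists_equiv_sum {I A : Type*} [Fintype I] (κ : I → A) (c : A) :
    ∃ (a b : ℕ) (e : Fin a ⊕ Fin b ≃ I), (∀ x, κ (e (Sum.inl x)) = c) ∧ ∀ x, κ (e (Sum.inr x)) ≠ c := by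
  classical
  let f := Fintype.equivFin {i // κ i = c}
  let f' := Fintype.equivFin {i // ¬ κ i = c}
  exact ⟨_, _, (Equiv.sumCongr f.symm f'.symm).trans (Equiv.sumCompl fun i => κ i = c),
    fun x => (f.symm x).2, fun x => (f'.symm x).2⟩

variable (k) in
/-- The eigenvalues of an element of order `2`: `1` and `-1`, with multiplicities `2a` and `2b`. -/
def label2 (a b : ℕ) : Fin a ⊕ Fin b → kˣ := Sum.elim (fun _ => 1) (fun _ => -1)

/-- The eigenvalues of an element of order `3`: `1` with multiplicity `2a`, and `ω`, `ω⁻¹` with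
multiplicity `b`. -/
def label3 (ω : kˣ) (a b : ℕ) : Fin a ⊕ Fin b → kˣ := Sum.elim (fun _ => 1) (fun _ => ω)

/-- The eigenvalues of an element of order `5`: `1` with multiplicity `2a`, then `ζ`, `ζ⁻¹` with
multiplicity `b` and `ζ²`, `ζ⁻²` with multiplicity `c`. -/
def label5 (ζ : kˣ) (a b c : ℕ) : Fin a ⊕ (Fin b ⊕ Fin c) → kˣ :=
  Sum.elim (fun _ => 1) (Sum.elim (fun _ => ζ) (fun _ => ζ ^ 2))

theorem ne_inv_of_isPrimitiveRoot {ζ : kˣ} {N : ℕ} (h : IsPrimitiveRoot ζ N) (hN : 2 < N) : ζ ≠ ζ⁻¹ := by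
  intro e
  have h1 : ζ ^ 2 = 1 := by rw [pow_two]; nth_rewrite 2 [e]; exact mul_inv_cancel ζ
  exact absurd (Nat.le_of_dvd two_pos (h.dvd_of_pow_eq_one 2 h1)) (by omega)

theorem label5_facts {ζ : kˣ} (h : IsPrimitiveRoot ζ 5) :
    (1 ≠ ζ ∧ 1 ≠ ζ⁻¹ ∧ 1 ≠ ζ ^ 2 ∧ 1 ≠ (ζ ^ 2)⁻¹) ∧ (ζ ≠ ζ⁻¹ ∧ ζ ≠ ζ ^ 2 ∧ ζ ≠ (ζ ^ 2)⁻¹ ∧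
      ζ⁻¹ ≠ ζ ^ 2 ∧ ζ⁻¹ ≠ (ζ ^ 2)⁻¹) ∧ ζ ^ 2 ≠ (ζ ^ 2)⁻¹ := by
  have key : ∀ N : ℕ, ¬ 5 ∣ N → ζ ^ N ≠ 1 := fun N hN e => hN (h.dvd_of_pow_eq_one N e)
  have k1 := key 1 (by decide)
  have k2 := key 2 (by decide)
  have k3 := key 3 (by decide)
  have k4 := key 4 (by decide)
  rw [pow_one] at k1
  refine ⟨⟨k1.symm, fun e => k1 ?_, k2.symm, fun e => k2 ?_⟩, ⟨fun e => k2 ?_, fun e => k1 ?_, fun e => k3 ?_,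
    fun e => k3 ?_, fun e => k1 ?_⟩, fun e => k4 ?_⟩
  · exact inv_eq_one.1 e.symm
  · exact inv_eq_one.1 e.symm
  · rw [pow_two]; exact mul_eq_one_iff_eq_inv.2 e
  · rw [pow_two] at e; exact (left_eq_mul.1 e)
  · rw [_root_.pow_succ']; exact mul_eq_one_iff_eq_inv.2 e
  · rw [_root_.pow_succ']; rw [← e, mul_inv_cancel]
  · rw [_root_.inv_inj, pow_two] at e; exact (left_eq_mul.1 e)
  · rw [show 4 = 2 + 2 from rfl, pow_add]; exact mul_eq_one_iff_eq_inv.2 e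

theorem one_ne_neg_one_units (h2 : (2 : k) ≠ 0) : (1 : kˣ) ≠ -1 := by
  intro e
  have := congrArg Units.val e
  rw [Units.val_neg, Units.val_one] at this
  apply h2
  linear_combination this

theorem wt_label2_ne (h2 : (2 : k) ≠ 0) {a b : ℕ} (x : Fin a ⊕ Fin a) (y : Fin b ⊕ Fin b) :
    wt (fun _ => (1 : kˣ)) x ≠ wt (fun _ => (-1 : kˣ)) y := by
  have := one_ne_neg_one_units h2
  rcases wt_const (1 : kˣ) x with e | e <;> rcases wt_const (-1 : kˣ) y with e' | e' <;> rw [e, e'] <;> simpa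

theorem wt_label3_ne {ω : kˣ} (hω : IsPrimitiveRoot ω 3) {a b : ℕ} (x : Fin a ⊕ Fin a) (y : Fin b ⊕ Fin b) :
    wt (fun _ => (1 : kˣ)) x ≠ wt (fun _ => ω) y := by
  have : 1 ≠ ω := (hω.ne_one (by decide)).symm
  rcases wt_const (1 : kˣ) x with e | e <;> rcases wt_const ω y with e' | e' <;> rw [e, e'] <;>
    simpa [eq_comm]

theorem wt_label5_ne {ζ : kˣ} (hζ : IsPrimitiveRoot ζ 5) (a b c : ℕ) :
    (∀ (x : Fin a ⊕ Fin a) (y : (Fin b ⊕ Fin c) ⊕ (Fin b ⊕ Fin c)), wt (fun _ => (1 : kˣ)) x ≠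
      wt (Sum.elim (fun _ => ζ) (fun _ => ζ ^ 2)) y) ∧
    ∀ (x : Fin b ⊕ Fin b) (y : Fin c ⊕ Fin c), wt (fun _ => ζ) x ≠ wt (fun _ => ζ ^ 2) y := by
  obtain ⟨⟨f1, f2, f3, f4⟩, ⟨f5, f6, f7, f8, f9⟩, f10⟩ := label5_facts hζ
  constructor
  · intro x y
    have e : wt (fun _ => (1 : kˣ)) x = 1 := (wt_const (1 : kˣ) x).elim id fun e => e.trans inv_one
    rw [e]
    rcases y with (y | y) | (y | y) <;> assumption
  · intro x y
    rcases wt_const ζ x with e | e <;> rcases wt_const (ζ ^ 2) y with e' | e' <;> rw [e, e'] <;> assumption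

theorem rootIso_label2 (h2 : (2 : k) ≠ 0) (a b : ℕ) :
    RootIso (rootsOf (label2 k a b)) (rootSum (rootsD a) (rootsD b)) ∧
    (rootsOf (label2 k a b)).ncard = 2 * (a * (a - 1)) + 2 * (b * (b - 1)) := by
  have h := wt_label2_ne h2 (a := a) (b := b)
  have e1 : rootsOf (fun _ : Fin a => (1 : kˣ)) = rootsD a := rootsOf_const_of_eq (by simp)
  have e2 : rootsOf (fun _ : Fin b => (-1 : kˣ)) = rootsD b := rootsOf_const_of_eq (by simp)
  have r := rootIso_rootsOf_sumElim _ _ h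
  have r' := ncard_rootsOf_sumElim _ _ h
  rw [e1, e2] at r r'
  refine ⟨r, r'.trans ?_⟩
  rw [ncard_rootSum (finite_rootsD _) (finite_rootsD _) (zero_notMem_rootsD _), ncard_rootsD, ncard_rootsD]

theorem rootIso_label3 {ω : kˣ} (hω : IsPrimitiveRoot ω 3) (a b : ℕ) :
    RootIso (rootsOf (label3 ω a b)) (rootSum (rootsD a) (rootsGL b)) ∧
    (rootsOf (label3 ω a b)).ncard = 2 * (a * (a - 1)) + b * (b - 1) := by
  have h := wt_label3_ne hω (a := a) (b := b)
  have e1 : rootsOf (fun _ : Fin a => (1 : kˣ)) = rootsD a := rootsOf_const_of_eq (by simp)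
  have e2 : rootsOf (fun _ : Fin b => ω) = rootsGL b :=
    rootsOf_const_of_ne (ne_inv_of_isPrimitiveRoot hω (by decide))
  have r := rootIso_rootsOf_sumElim _ _ h
  have r' := ncard_rootsOf_sumElim _ _ h
  rw [e1, e2] at r r'
  refine ⟨r, r'.trans ?_⟩
  rw [ncard_rootSum (finite_rootsD _) (finite_rootsGL _) (zero_notMem_rootsD _), ncard_rootsD, ncard_rootsGL]

theorem rootIso_label5 {ζ : kˣ} (hζ : IsPrimitiveRoot ζ 5) (a b c : ℕ) :
    RootIso (rootsOf (label5 ζ a b c)) (rootSum (rootsD a) (rootSum (rootsGL b) (rootsGL c))) ∧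
    (rootsOf (label5 ζ a b c)).ncard = 2 * (a * (a - 1)) + (b * (b - 1) + c * (c - 1)) := by
  obtain ⟨h, h'⟩ := wt_label5_ne hζ a b c
  have e1 : rootsOf (fun _ : Fin a => (1 : kˣ)) = rootsD a := rootsOf_const_of_eq (by simp)
  have e2 : rootsOf (fun _ : Fin b => ζ) = rootsGL b := rootsOf_const_of_ne (label5_facts hζ).2.1.1
  have e3 : rootsOf (fun _ : Fin c => ζ ^ 2) = rootsGL c := rootsOf_const_of_ne (label5_facts hζ).2.2
  have s := rootIso_rootsOf_sumElim _ _ h'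
  have s' := ncard_rootsOf_sumElim _ _ h'
  have r := rootIso_rootsOf_sumElim _ _ h
  have r' := ncard_rootsOf_sumElim _ _ h
  rw [e2, e3] at s s'
  rw [e1] at r r'
  have hfin : (rootsOf (Sum.elim (fun _ : Fin b => ζ) (fun _ : Fin c => ζ ^ 2))).Finite := by
    refine Set.Finite.subset (Set.finite_range fun p : ((Fin b ⊕ Fin c) ⊕ (Fin b ⊕ Fin c)) ×
      ((Fin b ⊕ Fin c) ⊕ (Fin b ⊕ Fin c)) => wtVec p.1 - wtVec p.2) ?_
    rintro _ ⟨a, b, -, -, -, rfl⟩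
    exact ⟨(a, b), rfl⟩
  refine ⟨r.trans ((RootIso.refl _).rootSum s), r'.trans ?_⟩
  rw [ncard_rootSum (finite_rootsD _) hfin (zero_notMem_rootsD _), s',
    ncard_rootSum (finite_rootsGL _) (finite_rootsGL _) (zero_notMem_rootsGL _),
    ncard_rootsD, ncard_rootsGL, ncard_rootsGL]

variable {m : ℕ}

/-- `g` has the eigenvalues `label2 k a b`. -/
def IsType2 (g : SO2 m k) (a b : ℕ) : Prop := a + b = m ∧ ∃ v, Adapted g.1 v (label2 k a b)

/-- `g` has the eigenvalues `label3 ω a b`. -/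
def IsType3 (ω : kˣ) (g : SO2 m k) (a b : ℕ) : Prop := a + b = m ∧ ∃ v, Adapted g.1 v (label3 ω a b)

/-- `g` has the eigenvalues `label5 ζ a b c`. -/
def IsType5 (ζ : kˣ) (g : SO2 m k) (a b c : ℕ) : Prop :=
  a + (b + c) = m ∧ ∃ v, Adapted g.1 v (label5 ζ a b c)

theorem exists_pow_eq {ζ x : kˣ} {N : ℕ} [NeZero N] (hζ : IsPrimitiveRoot ζ N) (hx : x ^ N = 1) :
    ∃ j < N, ζ ^ j = x := by
  obtain ⟨j, hj, hj'⟩ := (IsPrimitiveRoot.coe_units_iff.2 hζ).eq_pow_of_pow_eq_one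
    (show (x : k) ^ N = 1 by rw [← Units.val_pow_eq_pow_val, hx, Units.val_one])
  exact ⟨j, hj, Units.ext (by rw [Units.val_pow_eq_pow_val, hj'])⟩

/-- Every involution of `SO_{2m}` has a type. -/
theorem exists_isType2 [IsAlgClosed k] (h2 : (2 : k) ≠ 0) (g : SO2 m k) (hg : g.1 ^ 2 = 1) :
    ∃ a b, IsType2 g a b := by
  obtain ⟨v, L, h⟩ := exists_adapted h2 g (N := 2) (by exact_mod_cast h2) hg
  have hL := (h.pow_eq_one_iff (by simp) 2).1 hg
  obtain ⟨a, b, e, ha, hb⟩ := exists_equiv_sum L 1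
  refine ⟨a, b, by simpa using Fintype.card_congr e, h.relabel e _ fun i => Or.inl ?_⟩
  rcases i with i | i
  · exact (ha i).symm
  · have h1 := hL (e (Sum.inr i))
    have h3 : ((L (e (Sum.inr i)) : kˣ) : k) * ((L (e (Sum.inr i)) : kˣ) : k) = 1 := by
      rw [← Units.val_mul, ← pow_two, h1, Units.val_one]
    rcases mul_self_eq_one_iff.1 h3 with h4 | h4
    · exact (hb i (Units.ext h4)).elim
    · refine (Units.ext ?_).symm
      rw [h4]; rfl

/-- Every element of `SO_{2m}` with cube `1` has a type: of each pair `ω`, `ω⁻¹` of eigenvalues, the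
first is chosen. -/
theorem exists_isType3 [IsAlgClosed k] (h2 : (2 : k) ≠ 0) (h3 : (3 : k) ≠ 0) {ω : kˣ}
    (hω : IsPrimitiveRoot ω 3) (g : SO2 m k) (hg : g.1 ^ 3 = 1) : ∃ a b, IsType3 ω g a b := by
  obtain ⟨v, L, h⟩ := exists_adapted h2 g (N := 3) (by exact_mod_cast h3) hg
  have hL := (h.pow_eq_one_iff (by simp) 3).1 hg
  obtain ⟨a, b, e, ha, hb⟩ := exists_equiv_sum L 1
  refine ⟨a, b, by simpa using Fintype.card_congr e, h.relabel e _ fun i => ?_⟩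
  rcases i with i | i
  · exact Or.inl (ha i).symm
  · have h1 := hL (e (Sum.inr i))
    obtain ⟨j, hj, hj'⟩ := exists_pow_eq hω h1
    have h0 := hb i
    rw [← hj'] at h0 ⊢
    interval_cases j
    · exact (h0 (pow_zero ω)).elim
    · exact Or.inl (pow_one ω).symm
    · refine Or.inr (eq_inv_of_mul_eq_one_left ?_)
      change ω * ω ^ 2 = 1
      rw [← _root_.pow_succ']
      exact hω.pow_eq_one

/-- Every element of `SO_{2m}` with fifth power `1` has a type: of each pair of mutually inverse
eigenvalues, the one among `1`, `ζ`, `ζ²` is chosen. -/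
theorem exists_isType5 [IsAlgClosed k] (h2 : (2 : k) ≠ 0) (h5 : (5 : k) ≠ 0) {ζ : kˣ}
    (hζ : IsPrimitiveRoot ζ 5) (g : SO2 m k) (hg : g.1 ^ 5 = 1) : ∃ a b c, IsType5 ζ g a b c := by
  obtain ⟨v, L, h⟩ := exists_adapted h2 g (N := 5) (by exact_mod_cast h5) hg
  have hL := (h.pow_eq_one_iff (by simp) 5).1 hg
  obtain ⟨a, r, e, ha, hr⟩ := exists_equiv_sum L 1
  obtain ⟨b, c, e', hb, hc⟩ := exists_equiv_sum
    (fun i => L (e (Sum.inr i)) = ζ ∨ L (e (Sum.inr i)) = ζ⁻¹) True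
  refine ⟨a, b, c, ?_, h.relabel ((Equiv.sumCongr (Equiv.refl _) e').trans e) _ fun i => ?_⟩
  · have h1 := Fintype.card_congr e
    have h2 := Fintype.card_congr e'
    simp only [Fintype.card_sum, Fintype.card_fin] at h1 h2
    omega
  have h55 := hζ.pow_eq_one
  rcases i with i | i | i
  · exact Or.inl (ha i).symm
  · rcases of_eq_true (hb i) with h1 | h1
    · exact Or.inl h1.symm
    · exact Or.inr (inv_eq_iff_eq_inv.1 h1.symm)
  · have hne := fun h' => hc i (eq_true h')
    have h0 := hr (e' (Sum.inr i))
    obtain ⟨j, hj, hj'⟩ := exists_pow_eq hζ (hL (e (Sum.inr (e' (Sum.inr i)))))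
    change ζ ^ 2 = L (e (Sum.inr (e' (Sum.inr i)))) ∨ ζ ^ 2 = (L (e (Sum.inr (e' (Sum.inr i)))))⁻¹
    rw [← hj'] at h0 hne ⊢
    interval_cases j
    · exact (h0 (pow_zero ζ)).elim
    · exact (hne (Or.inl (pow_one ζ))).elim
    · exact Or.inl rfl
    · refine Or.inr (eq_inv_of_mul_eq_one_left ?_)
      rw [← pow_add]
      exact h55
    · refine (hne (Or.inr (eq_inv_of_mul_eq_one_left ?_))).elim
      rw [← _root_.pow_succ]
      exact h55

theorem IsType2.sq {g : SO2 m k} {a b : ℕ} (h : IsType2 g a b) : g.1 ^ 2 = 1 := by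
  obtain ⟨hab, v, h⟩ := h
  refine (h.pow_eq_one_iff (by simp [hab]) 2).2 ?_
  rintro (i | i)
  · exact one_pow 2
  · exact neg_one_sq

theorem IsType3.pow {ω : kˣ} (hω : IsPrimitiveRoot ω 3) {g : SO2 m k} {a b : ℕ} (h : IsType3 ω g a b) :
    g.1 ^ 3 = 1 := by
  obtain ⟨hab, v, h⟩ := h
  refine (h.pow_eq_one_iff (by simp [hab]) 3).2 ?_
  rintro (i | i)
  · exact one_pow 3
  · exact hω.pow_eq_one

theorem IsType5.pow {ζ : kˣ} (hζ : IsPrimitiveRoot ζ 5) {g : SO2 m k} {a b c : ℕ}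
    (h : IsType5 ζ g a b c) : g.1 ^ 5 = 1 := by
  obtain ⟨hab, v, h⟩ := h
  refine (h.pow_eq_one_iff (by simp [hab]) 5).2 ?_
  rintro (i | i | i)
  · exact one_pow 5
  · exact hζ.pow_eq_one
  · change (ζ ^ 2) ^ 5 = 1
    rw [← pow_mul, mul_comm 2 5, pow_mul, hζ.pow_eq_one, one_pow]

/-- Squaring interchanges the multiplicities of `ζ^{±1}` and `ζ^{±2}`. -/
theorem IsType5.sq {ζ : kˣ} (hζ : IsPrimitiveRoot ζ 5) {g : SO2 m k} {a b c : ℕ}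
    (h : IsType5 ζ g a b c) : IsType5 ζ (g ^ 2) a c b := by
  obtain ⟨hab, v, h⟩ := h
  refine ⟨by omega, (h.pow 2).relabel (Equiv.sumCongr (Equiv.refl _) (Equiv.sumComm _ _)) _ ?_⟩
  rintro (i | i | i)
  · exact Or.inl (one_pow 2).symm
  · refine Or.inr (eq_inv_of_mul_eq_one_left ?_)
    change ζ * (ζ ^ 2) ^ 2 = 1
    rw [← pow_mul, ← _root_.pow_succ']
    exact hζ.pow_eq_one
  · exact Or.inl rfl

end EigenvalueData

/-! ### Minimal root counts -/

section Arithmetic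

/-- The number of roots of the centralizer of an element of order `2` with multiplicities `a`, `b`. -/
def count2 (a b : ℕ) : ℕ := 2 * (a * (a - 1)) + 2 * (b * (b - 1))

/-- The number of roots of the centralizer of an element of order `3` with multiplicities `a`, `b`. -/
def count3 (a b : ℕ) : ℕ := 2 * (a * (a - 1)) + b * (b - 1)

/-- The number of roots of the centralizer of an element of order `5` with multiplicities `a`, `b`, `c`. -/
def count5 (a b c : ℕ) : ℕ := 2 * (a * (a - 1)) + (b * (b - 1) + c * (c - 1))

/-- The minimal values of the three root counts for small `m`. -/
def minCount : ℕ → ℕ × ℕ × ℕ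
  | 4 => (8, 6, 2)
  | 5 => (16, 10, 4)
  | 6 => (24, 16, 8)
  | 7 => (36, 24, 12)
  | 8 => (48, 32, 16)
  | _ => (0, 0, 0)

/-- For `m ≤ 8`, the minimum of `count2` and the places where it is attained. -/
theorem minCount_le_count2 (m : ℕ) (hm : m < 9) (hm' : 4 ≤ m) (a b : ℕ) (h : a + b = m) :
    (minCount m).1 ≤ count2 a b ∧ (m ≠ 7 → count2 a b = (minCount m).1 →
      (m, a, b) ∈ [(4, 2, 2), (5, 3, 2), (5, 2, 3), (6, 3, 3), (8, 4, 4)]) := by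
  have key : ∀ m a b : Fin 9, 4 ≤ m.1 → a.1 + b.1 = m.1 → (minCount m.1).1 ≤ count2 a.1 b.1 ∧
      (m.1 ≠ 7 → count2 a.1 b.1 = (minCount m.1).1 →
      (m.1, a.1, b.1) ∈ [(4, 2, 2), (5, 3, 2), (5, 2, 3), (6, 3, 3), (8, 4, 4)]) := by
    decide +kernel
  exact key ⟨m, hm⟩ ⟨a, by omega⟩ ⟨b, by omega⟩ hm' h

/-- An element of square `-1` has more than the minimal number of roots. -/
theorem minCount_lt (m : ℕ) (hm : m < 9) (hm' : 4 ≤ m) : (minCount m).1 < m * (m - 1) := by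
  interval_cases m <;> simp [minCount]

/-- For `m ≤ 8`, the minimum of `count3` and the places where it is attained. -/
theorem minCount_le_count3 (m : ℕ) (hm : m < 9) (hm' : 4 ≤ m) (a b : ℕ) (h : a + b = m) :
    (minCount m).2.1 ≤ count3 a b ∧ (m ≠ 7 → count3 a b = (minCount m).2.1 →
      (m, a, b) ∈ [(4, 1, 3), (4, 2, 2), (5, 2, 3), (6, 2, 4), (8, 3, 5)]) := by
  have key : ∀ m a b : Fin 9, 4 ≤ m.1 → a.1 + b.1 = m.1 → (minCount m.1).2.1 ≤ count3 a.1 b.1 ∧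
      (m.1 ≠ 7 → count3 a.1 b.1 = (minCount m.1).2.1 →
      (m.1, a.1, b.1) ∈ [(4, 1, 3), (4, 2, 2), (5, 2, 3), (6, 2, 4), (8, 3, 5)]) := by
    decide +kernel
  exact key ⟨m, hm⟩ ⟨a, by omega⟩ ⟨b, by omega⟩ hm' h

/-- For `m ≤ 8`, the minimum of `count5` and the places where it is attained. -/
theorem minCount_le_count5 (m : ℕ) (hm : m < 9) (hm' : 4 ≤ m) (a b c : ℕ) (h : a + (b + c) = m) :
    (minCount m).2.2 ≤ count5 a b c ∧ (m ≠ 7 → count5 a b c = (minCount m).2.2 →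
      (m, a, b, c) ∈ [(4, 1, 1, 2), (4, 1, 2, 1), (5, 1, 2, 2), (6, 2, 2, 2), (6, 1, 3, 2), (6, 1, 2, 3),
        (8, 2, 3, 3)]) := by
  have key : ∀ m a b c : Fin 9, 4 ≤ m.1 → a.1 + (b.1 + c.1) = m.1 → (minCount m.1).2.2 ≤ count5 a.1 b.1 c.1 ∧
      (m.1 ≠ 7 → count5 a.1 b.1 c.1 = (minCount m.1).2.2 →
      (m.1, a.1, b.1, c.1) ∈ [(4, 1, 1, 2), (4, 1, 2, 1), (5, 1, 2, 2), (6, 2, 2, 2), (6, 1, 3, 2), (6, 1, 2, 3),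
        (8, 2, 3, 3)]) := by
    decide +kernel
  exact key ⟨m, hm⟩ ⟨a, by omega⟩ ⟨b, by omega⟩ ⟨c, by omega⟩ hm' h

theorem cast_mul_pred (a : ℕ) : ((a * (a - 1) : ℕ) : ℤ) = a * a - a := by
  rcases a with _ | a
  · simp
  · push_cast [Nat.add_sub_cancel]; ring

/-- A lower bound for `count2`, from `(a - b)² ≥ 0`. -/
theorem le_count2 {m a b : ℕ} (h : a + b = m) : (m * m - 2 * m : ℤ) ≤ count2 a b := by
  have := cast_mul_pred a
  have := cast_mul_pred b
  push_cast [count2] at *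
  subst h
  push_cast
  nlinarith [sq_nonneg ((a : ℤ) - b)]

/-- A lower bound for `count3`, by completing the square: the real minimum is at `a = (2m + 1) /
6`. -/
theorem le_count3 {m a b : ℕ} (h : a + b = m) :
    (12 * (m * m - m) - (2 * m + 1) * (2 * m + 1) : ℤ) ≤ 12 * count3 a b := by
  have := cast_mul_pred a
  have := cast_mul_pred b
  push_cast [count3] at *
  subst h
  push_cast
  nlinarith [sq_nonneg (6 * (a : ℤ) - (2 * (a + b) + 1))]

/-- A lower bound for `count5`, by completing squares: the real minimum is at `b = c` and `a = (m +
1) / 5`. -/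
theorem le_count5 {m a b c : ℕ} (h : a + (b + c) = m) :
    (5 * m * m - 10 * m - (m + 1) * (m + 1) : ℤ) ≤ 10 * count5 a b c := by
  have := cast_mul_pred a
  have := cast_mul_pred b
  have := cast_mul_pred c
  push_cast [count5] at *
  subst h
  push_cast
  nlinarith [sq_nonneg ((b : ℤ) - c), sq_nonneg (5 * (a : ℤ) - (a + (b + c) + 1))]

/-- The data of regular triples: the solutions, for `m ≥ 4`, of the inequality between root counts.
Either all the counts are minimal, or there is no solution. -/
theorem count_solutions {m f a' b' a'' b'' c'' : ℕ} (hm : 4 ≤ m) (hf : (m * m - 2 * m : ℤ) ≤ f)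
    (hf' : m < 9 → (minCount m).1 ≤ f)
    (h3 : a' + b' = m) (h5 : a'' + (b'' + c'') = m)
    (h : f + count3 a' b' + count5 a'' b'' c'' + 4 * m ≤ 2 * m * m) :
    m < 9 ∧ m ≠ 7 ∧ f = (minCount m).1 ∧ count3 a' b' = (minCount m).2.1 ∧
      count5 a'' b'' c'' = (minCount m).2.2 := by
  -- for `m ≥ 9` the lower bounds for the counts add up to more than the upper bound
  have hm9 : m < 9 := by
    by_contra hcon
    have i3 := le_count3 h3
    have i5 := le_count5 h5
    have h' : (f + count3 a' b' + count5 a'' b'' c'' + 4 * m : ℤ) ≤ 2 * m * m := by exact_mod_cast h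
    have : (9 : ℤ) ≤ m := by exact_mod_cast not_lt.1 hcon
    nlinarith
  have i2 := hf' hm9
  have i3 := (minCount_le_count3 m hm9 hm a' b' h3).1
  have i5 := (minCount_le_count5 m hm9 hm a'' b'' c'' h5).1
  clear hf hf' h3 h5
  interval_cases m <;> simp only [minCount] at * <;> omega

end Arithmetic

/-- The primitive roots of unity of orders `3` and `5` used to label eigenvalues, in a field in which
`2`, `3` and `5` are invertible. -/
structure RootsOfUnity (k : Type*) [Field k] where
  two_ne : (2 : k) ≠ 0
  three_ne : (3 : k) ≠ 0
  five_ne : (5 : k) ≠ 0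
  ω : kˣ
  hω : IsPrimitiveRoot ω 3
  ζ : kˣ
  hζ : IsPrimitiveRoot ζ 5

/-! ### Conjugacy classes in `PSO_{2m}` and their lifts -/

section Classes

variable {k : Type*} [Field k] {m : ℕ}

theorem Adapted.of_isConj {I : Type*} [DecidableEq I] {g g' : SO2 m k} (hg : IsConj g g')
    {v : I ⊕ I → Fin (2 * m) → k} {L : I → kˣ} (h : Adapted g.1 v L) : ∃ v', Adapted g'.1 v' L := by
  obtain ⟨c, rfl⟩ := isConj_iff.1 hg
  refine ⟨fun a => c.1 *ᵥ v a, h.1.mulVec (so_transpose_mul c), fun a => ?_⟩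
  change (c.1 * g.1 * (c⁻¹).1) *ᵥ (c.1 *ᵥ v a) = _
  rw [so_coe_inv, Matrix.mulVec_mulVec, Matrix.mul_assoc, so_transpose_mul, Matrix.mul_one,
    ← Matrix.mulVec_mulVec, h.2, Matrix.mulVec_smul]

theorem IsType2.of_isConj {g g' : SO2 m k} (hg : IsConj g g') {a b : ℕ} (h : IsType2 g a b) :
    IsType2 g' a b := ⟨h.1, h.2.choose_spec.of_isConj hg⟩

theorem IsType3.of_isConj {ω : kˣ} {g g' : SO2 m k} (hg : IsConj g g') {a b : ℕ} (h : IsType3 ω g a b) :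
    IsType3 ω g' a b := ⟨h.1, h.2.choose_spec.of_isConj hg⟩

theorem IsType5.of_isConj {ζ : kˣ} {g g' : SO2 m k} (hg : IsConj g g') {a b c : ℕ}
    (h : IsType5 ζ g a b c) : IsType5 ζ g' a b c := ⟨h.1, h.2.choose_spec.of_isConj hg⟩

theorem IsType2.isConj {g g' : SO2 m k} {a b : ℕ} (hm : 0 < m) (h : IsType2 g a b) (h' : IsType2 g' a b) :
    IsConj g g' := by
  obtain ⟨hab, v, h⟩ := h
  obtain ⟨-, v', h'⟩ := h'
  have : Nonempty (Fin a ⊕ Fin b) := by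
    rw [← Fintype.card_pos_iff]; simpa using by omega
  obtain ⟨i⟩ := this
  refine h.exists_so_conj h' (by simpa using hab) i ?_
  rcases i with i | i <;> simp [label2]

theorem IsType3.isConj {ω : kˣ} {g g' : SO2 m k} {a b : ℕ} (ha : 0 < a) (h : IsType3 ω g a b)
    (h' : IsType3 ω g' a b) : IsConj g g' := by
  obtain ⟨hab, v, h⟩ := h
  obtain ⟨-, v', h'⟩ := h'
  exact h.exists_so_conj h' (by simpa using hab) (Sum.inl ⟨0, ha⟩) (by simp [label3])

theorem IsType5.isConj {ζ : kˣ} {g g' : SO2 m k} {a b c : ℕ} (ha : 0 < a) (h : IsType5 ζ g a b c)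
    (h' : IsType5 ζ g' a b c) : IsConj g g' := by
  obtain ⟨hab, v, h⟩ := h
  obtain ⟨-, v', h'⟩ := h'
  exact h.exists_so_conj h' (by simpa using hab) (Sum.inl ⟨0, ha⟩) (by simp [label5])

/-- The negative of an involution of type `(a, b)` has type `(b, a)`. -/
theorem IsType2.neg {g : SO2 m k} {a b : ℕ} (h : IsType2 g a b) : IsType2 (negOneSO * g) b a := by
  obtain ⟨hab, v, h⟩ := h
  have h1 : Adapted (negOneSO * g : SO2 m k).1 v (fun i => -label2 k a b i) := by
    refine ⟨h.1, fun x => ?_⟩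
    have e := coe_negOneSO_mul g
    rw [e, Matrix.neg_mulVec, h.2]
    rcases x with x | x <;> simp
  refine ⟨by omega, h1.relabel (Equiv.sumComm _ _) _ fun i => Or.inl ?_⟩
  rcases i with i | i <;> simp [label2]

theorem sum_wt_const {A : Type*} [Group A] (b : ℕ) (c : A) (F : A → ℕ) :
    ∑ a : Fin b ⊕ Fin b, F (wt (fun _ => c) a) = b * (F c + F c⁻¹) := by
  rw [Fintype.sum_sum_type]
  change (∑ _ : Fin b, F c) + (∑ _ : Fin b, F c⁻¹) = _
  rw [Finset.sum_const, Finset.sum_const, Finset.card_univ, Fintype.card_fin, smul_eq_mul, smul_eq_mul,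
    mul_add]

theorem sum_wt_sumElim {A I₁ I₂ : Type*} [Group A] [Fintype I₁] [Fintype I₂] (L₁ : I₁ → A)
    (L₂ : I₂ → A) (F : A → ℕ) :
    ∑ a, F (wt (Sum.elim L₁ L₂) a) = (∑ a, F (wt L₁ a)) + ∑ a, F (wt L₂ a) := by
  rw [Fintype.sum_sum_type, Fintype.sum_sum_type, Fintype.sum_sum_type, Fintype.sum_sum_type,
    Fintype.sum_sum_type]
  exact add_add_add_comm _ _ _ _

/-- The multiplicity of `x` among the labels and their inverses. -/
def mult {A I : Type*} [Group A] [DecidableEq A] [Fintype I] (L : I → A) (x : A) : ℕ :=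
  ∑ a, if wt L a = x then 1 else 0

theorem mult_const {A : Type*} [Group A] [DecidableEq A] (b : ℕ) (c x : A) :
    mult (fun _ : Fin b => c) x = b * ((if c = x then 1 else 0) + if c⁻¹ = x then 1 else 0) :=
  sum_wt_const b c fun y => if y = x then 1 else 0

theorem mult_sumElim {A I₁ I₂ : Type*} [Group A] [DecidableEq A] [Fintype I₁] [Fintype I₂] (L₁ : I₁ → A)
    (L₂ : I₂ → A) (x : A) : mult (Sum.elim L₁ L₂) x = mult L₁ x + mult L₂ x :=
  sum_wt_sumElim L₁ L₂ fun y => if y = x then 1 else 0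

theorem Adapted.mult_eq [Infinite k] [DecidableEq kˣ] {n : ℕ} {I I' : Type*} [Fintype I] [DecidableEq I] [Fintype I']
    [DecidableEq I'] {g : Matrix (Fin n) (Fin n) k} {v : I ⊕ I → Fin n → k}
    {L : I → kˣ} (h : Adapted g v L) (hI : 2 * Fintype.card I = n) {v' : I' ⊕ I' → Fin n → k}
    {L' : I' → kˣ} (h' : Adapted g v' L') (hI' : 2 * Fintype.card I' = n) (x : kˣ) :
    mult L x = mult L' x := by
  obtain ⟨τ, -, hτ⟩ := h.exists_relabel hI h' hI'
  rw [mult, mult, ← Equiv.sum_comp τ]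
  simp only [hτ]

theorem IsType3.unique [Infinite k] {ω : kˣ} (hω : IsPrimitiveRoot ω 3) {g : SO2 m k} {a b a' b' : ℕ}
    (h : IsType3 ω g a b) (h' : IsType3 ω g a' b') : a = a' ∧ b = b' := by
  classical
  obtain ⟨hab, v, h⟩ := h
  obtain ⟨hab', v', h'⟩ := h'
  have e := h.mult_eq (by simp [hab]) h' (by simp [hab']) 1
  have h1 : ω ≠ 1 := hω.ne_one (by decide)
  rw [label3, mult_sumElim, label3, mult_sumElim, mult_const, mult_const, mult_const, mult_const] at e
  simp [h1] at e
  omega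

theorem IsType5.unique [Infinite k] {ζ : kˣ} (hζ : IsPrimitiveRoot ζ 5) {g : SO2 m k} {a b c a' b' c' : ℕ}
    (h : IsType5 ζ g a b c) (h' : IsType5 ζ g a' b' c') : a = a' ∧ b = b' ∧ c = c' := by
  classical
  obtain ⟨hab, v, h⟩ := h
  obtain ⟨hab', v', h'⟩ := h'
  have e := h.mult_eq (by simp [hab]) h' (by simp [hab']) 1
  have e' := h.mult_eq (by simp [hab]) h' (by simp [hab']) ζ
  obtain ⟨⟨f1, f2, f3, f4⟩, ⟨f5, f6, f7, f8, f9⟩, f10⟩ := label5_facts hζ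
  rw [label5, mult_sumElim, mult_sumElim, label5, mult_sumElim, mult_sumElim, mult_const, mult_const,
    mult_const, mult_const, mult_const, mult_const] at e e'
  rw [if_neg f1.symm, if_neg f2.symm, if_neg f3.symm, if_neg f4.symm] at e
  rw [inv_one, if_neg f1, if_pos rfl, if_neg f5.symm, if_neg f6.symm, if_neg f7.symm] at e'
  simp at e e'
  omega

theorem isConj_proj {g g' : SO2 m k} (h : IsConj g g') : IsConj (proj m k g) (proj m k g') := by
  obtain ⟨c, rfl⟩ := isConj_iff.1 h
  exact isConj_iff.2 ⟨proj m k c, by simp⟩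

theorem exists_isConj_of_isConj_proj {g : SO2 m k} {x : PSO m k} (h : IsConj (proj m k g) x) :
    ∃ g', IsConj g g' ∧ proj m k g' = x := by
  obtain ⟨c, rfl⟩ := isConj_iff.1 h
  obtain ⟨c, rfl⟩ := proj_surjective c
  exact ⟨c * g * c⁻¹, isConj_iff.2 ⟨c, rfl⟩, by simp⟩

theorem SO2.coe_pow (g : SO2 m k) (N : ℕ) : (g ^ N).1 = g.1 ^ N := rfl

/-- Elements of odd order have unique lifts up to conjugacy. -/
theorem isConj_of_isConj_proj (h2 : (2 : k) ≠ 0) (hm : 2 ≤ m) {g g' : SO2 m k} {N : ℕ} (hN : Odd N)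
    (hg : g.1 ^ N = 1) (hg' : g'.1 ^ N = 1) (h : IsConj (proj m k g) (proj m k g')) : IsConj g g' := by
  obtain ⟨x, hx, hx'⟩ := exists_isConj_of_isConj_proj h
  rcases (proj_eq_proj_iff h2 hm x g').1 hx' with e | e
  · rwa [Subtype.ext e]
  · exfalso
    have hxN : x.1 ^ N = 1 := by
      obtain ⟨c, rfl⟩ := isConj_iff.1 hx
      rw [← SO2.coe_pow, conj_pow, show g ^ N = 1 from Subtype.ext hg, mul_one, mul_inv_cancel]
      rfl
    rw [e, hN.neg_pow, hxN] at hg'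
    have i : Fin (2 * m) := ⟨0, by omega⟩
    have := congrFun (congrFun hg' i) i
    rw [Matrix.neg_apply, Matrix.one_apply_eq] at this
    apply h2
    linear_combination -this

/-- Elements of odd order lift to elements of the same order, with a suitable sign. -/
theorem exists_lift_of_odd (h2 : (2 : k) ≠ 0) (hm : 2 ≤ m) {x : PSO m k} {N : ℕ} (hN : Odd N)
    (hx : x ^ N = 1) : ∃ g : SO2 m k, proj m k g = x ∧ g.1 ^ N = 1 := by
  obtain ⟨g, rfl⟩ := proj_surjective x
  rw [← map_pow, proj_eq_one_iff h2 hm] at hx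
  rcases hx with hx | hx
  · exact ⟨g, rfl, hx⟩
  · refine ⟨negOneSO * g, proj_negOneSO_mul h2 hm g, ?_⟩
    rw [coe_negOneSO_mul, hN.neg_pow, ← SO2.coe_pow, hx, neg_neg]

/-- An element of order `4` of `SO_{2m}` with square `-1`, with the eigenvalues `i` and `-i`. -/
def IsType4 (g : SO2 m k) : Prop := ∃ i : kˣ, i ^ 2 = -1 ∧ ∃ v, Adapted g.1 v (fun _ : Fin m => i)

theorem inv_ne_of_sq_eq_neg_one (h2 : (2 : k) ≠ 0) {i : kˣ} (hi : i ^ 2 = -1) : i ≠ i⁻¹ := by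
  intro e
  have h1 : i ^ 2 = 1 := by rw [pow_two]; nth_rewrite 2 [e]; exact mul_inv_cancel i
  exact one_ne_neg_one_units h2 (h1.symm.trans hi)

theorem IsType4.sq {g : SO2 m k} (h : IsType4 g) : g.1 ^ 4 = 1 := by
  obtain ⟨i, hi, v, h⟩ := h
  refine (h.pow_eq_one_iff (by simp) 4).2 fun _ => ?_
  rw [show 4 = 2 * 2 from rfl, pow_mul, hi, neg_one_sq]

variable [IsAlgClosed k]

/-- The centralizer of an involution of type `(a, b)` has type `D_a + D_b`. -/
theorem IsType2.roots (h2 : (2 : k) ≠ 0) (hm : 2 ≤ m) {g : SO2 m k} {a b : ℕ} (h : IsType2 g a b) :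
    RootIso (rootSet (preimageGL (cent (proj m k g)))) (rootSum (rootsD a) (rootsD b)) ∧
      (rootSet (preimageGL (cent (proj m k g)))).ncard = count2 a b := by
  have hs := h.sq
  obtain ⟨hab, v, h⟩ := h
  obtain ⟨h1, h3⟩ := rootIso_rootSet h2 hm g (N := 2) (by exact_mod_cast h2) hs h (by simp [hab])
  obtain ⟨h4, h5⟩ := rootIso_label2 h2 a b
  exact ⟨h1.trans h4, h3.trans h5⟩

/-- The centralizer of an element of order `3` of type `(a, b)` has type `D_a + A_{b-1}`. -/
theorem IsType3.roots (S : RootsOfUnity k) (hm : 2 ≤ m) {g : SO2 m k} {a b : ℕ} (h : IsType3 S.ω g a b) :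
    RootIso (rootSet (preimageGL (cent (proj m k g)))) (rootSum (rootsD a) (rootsGL b)) ∧
      (rootSet (preimageGL (cent (proj m k g)))).ncard = count3 a b := by
  have hs := h.pow S.hω
  obtain ⟨hab, v, h⟩ := h
  obtain ⟨h1, h3⟩ := rootIso_rootSet S.two_ne hm g (N := 3) (by exact_mod_cast S.three_ne) hs h (by simp [hab])
  obtain ⟨h4, h5⟩ := rootIso_label3 S.hω a b
  exact ⟨h1.trans h4, h3.trans h5⟩

/-- The centralizer of an element of order `5` of type `(a, b, c)` has type `D_a + A_{b-1} +
A_{c-1}`. -/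
theorem IsType5.roots (S : RootsOfUnity k) (hm : 2 ≤ m) {g : SO2 m k} {a b c : ℕ}
    (h : IsType5 S.ζ g a b c) :
    RootIso (rootSet (preimageGL (cent (proj m k g)))) (rootSum (rootsD a) (rootSum (rootsGL b) (rootsGL c))) ∧
      (rootSet (preimageGL (cent (proj m k g)))).ncard = count5 a b c := by
  have hs := h.pow S.hζ
  obtain ⟨hab, v, h⟩ := h
  obtain ⟨h1, h3⟩ := rootIso_rootSet S.two_ne hm g (N := 5) (by exact_mod_cast S.five_ne) hs h (by simp [hab])
  obtain ⟨h4, h5⟩ := rootIso_label5 S.hζ a b c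
  exact ⟨h1.trans h4, h3.trans h5⟩

/-- An element of square `-1` has the eigenvalues `i` and `-i`, each of multiplicity `m`. -/
theorem exists_isType4 (h2 : (2 : k) ≠ 0) (g : SO2 m k) (hg : g.1 ^ 2 = -1) : IsType4 g := by
  obtain ⟨v, L, h⟩ := exists_adapted h2 g (N := 4) (by
    rw [show ((4 : ℕ) : k) = 2 * 2 by norm_num]; exact mul_ne_zero h2 h2)
    (by rw [show 4 = 2 * 2 from rfl, pow_mul, hg, neg_one_sq])
  have h1 := h.pow 2
  rw [hg] at h1
  have h3 : Adapted (-1 : Matrix (Fin (2 * m)) (Fin (2 * m)) k) v (fun _ => -1) := by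
    refine ⟨h.1, fun a => ?_⟩
    rw [Matrix.neg_mulVec, Matrix.one_mulVec]
    rcases a with a | a <;> simp
  have hL : ∀ j, L j ^ 2 = -1 := congrFun (h1.wt_unique h3)
  obtain ⟨i, hi⟩ := IsAlgClosed.exists_pow_nat_eq (-1 : k) (n := 2) two_pos
  have hi0 : i ≠ 0 := by rintro rfl; simp at hi
  have hiu : (Units.mk0 i hi0) ^ 2 = -1 := Units.ext (by simpa using hi)
  refine ⟨Units.mk0 i hi0, hiu, h.relabel (Equiv.refl _) _ fun j => ?_⟩
  have h4 : ((L j : kˣ) : k) * (L j : kˣ) = i * i := by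
    have := congrArg Units.val (hL j)
    rw [Units.val_pow_eq_pow_val, Units.val_neg, Units.val_one, ← hi] at this
    rw [← pow_two, this, pow_two]
  rcases mul_self_eq_mul_self_iff.1 h4 with h5 | h5
  · exact Or.inl (Units.ext h5.symm)
  · refine Or.inr (eq_inv_of_mul_eq_one_left (Units.ext ?_))
    simp only [Equiv.refl_apply, Units.val_mul, Units.val_mk0, h5, Units.val_one]
    linear_combination -hi

/-- The centralizer of an element of square `-1` has type `A_{m-1}`. -/
theorem IsType4.ncard (h2 : (2 : k) ≠ 0) (hm : 2 ≤ m) {g : SO2 m k} (h : IsType4 g) :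
    (rootSet (preimageGL (cent (proj m k g)))).ncard = m * (m - 1) := by
  have hs := h.sq
  obtain ⟨i, hi, v, h⟩ := h
  obtain ⟨-, h3⟩ := rootIso_rootSet h2 hm g (N := 4) (by
    rw [show ((4 : ℕ) : k) = 2 * 2 by norm_num]; exact mul_ne_zero h2 h2) hs h (by simp)
  rw [h3, rootsOf_const_of_ne (inv_ne_of_sq_eq_neg_one h2 hi), ncard_rootsGL]

/-- Elements of order `2` of `PSO_{2m}` lift to elements of square `1` or `-1`. -/
theorem exists_lift_sq (h2 : (2 : k) ≠ 0) (hm : 2 ≤ m) {x : PSO m k} (hx : x ^ 2 = 1) :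
    ∃ g : SO2 m k, proj m k g = x ∧ ((∃ a b, IsType2 g a b) ∨ g.1 ^ 2 = -1 ∧ IsType4 g) := by
  obtain ⟨g, rfl⟩ := proj_surjective x
  rw [← map_pow, proj_eq_one_iff h2 hm, SO2.coe_pow] at hx
  rcases hx with hx | hx
  · exact ⟨g, rfl, Or.inl (exists_isType2 h2 g hx)⟩
  · exact ⟨g, rfl, Or.inr ⟨hx, exists_isType4 h2 g hx⟩⟩

/-- The number of roots and the rank of `PSO_{2m}` itself, which is the centralizer of the
identity. -/
theorem ncard_roots_top (h2 : (2 : k) ≠ 0) (hm : 2 ≤ m) :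
    (rootSet (preimageGL (⊤ : Subgroup (PSO m k)))).ncard = 2 * (m * (m - 1)) ∧
      algRank (preimageGL (⊤ : Subgroup (PSO m k))) = m := by
  obtain ⟨v, L, h⟩ := exists_adapted h2 (1 : SO2 m k) (N := 1) (by simp) (one_pow 1)
  have hL : L = fun _ => 1 := h.wt_unique h.1.adapted_one
  rw [← cent_one, ← map_one (proj m k)]
  refine ⟨?_, algRank_eq h2 hm 1 (N := 1) (by simp) (one_pow 1) h (by simp)⟩
  rw [(rootIso_rootSet h2 hm 1 (N := 1) (by simp) (one_pow 1) h (by simp)).2, hL,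
    rootsOf_const_of_eq (by simp), ncard_rootsD]

end Classes

/-! ### Regular triples -/

section Triples

variable {k : Type*} [Field k] {m : ℕ}

/-- The classes of the triple `C` are represented by elements of `SO_{2m}` of the given types. -/
def HasData (S : RootsOfUnity k) (C : ClassTriple m k) (a b a' b' a'' b'' c'' : ℕ) : Prop :=
  ∃ g₂ g₃ g₅ : SO2 m k, IsType2 g₂ a b ∧ IsType3 S.ω g₃ a' b' ∧ IsType5 S.ζ g₅ a'' b'' c'' ∧
    C = ⟨ConjClasses.mk (proj m k g₂), ConjClasses.mk (proj m k g₃), ConjClasses.mk (proj m k g₅)⟩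

theorem exists_of_mem_carrier {g : SO2 m k} {x : PSO m k}
    (h : x ∈ (ConjClasses.mk (proj m k g)).carrier) : ∃ g', IsConj g g' ∧ proj m k g' = x :=
  exists_isConj_of_isConj_proj (ConjClasses.mk_eq_mk_iff_isConj.1 (ConjClasses.mem_carrier_iff_mk_eq.1 h)).symm

theorem mk_proj_eq {g g' : SO2 m k} (h : IsConj g g') :
    ConjClasses.mk (proj m k g) = ConjClasses.mk (proj m k g') :=
  ConjClasses.mk_eq_mk_iff_isConj.2 (isConj_proj h)

variable {S : RootsOfUnity k} {C C' : ClassTriple m k} {a b a' b' a'' b'' c'' : ℕ}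

/-- The exchange of `a` and `b` corresponds to a change of sign of the lift of the involution. -/
theorem HasData.swap (h2m : 2 ≤ m) (h : HasData S C a b a' b' a'' b'' c'') :
    HasData S C b a a' b' a'' b'' c'' := by
  obtain ⟨g₂, g₃, g₅, h₂, h₃, h₅, rfl⟩ := h
  exact ⟨negOneSO * g₂, g₃, g₅, h₂.neg, h₃, h₅, by rw [proj_negOneSO_mul S.two_ne h2m]⟩

/-- Triples with the same data are equal. The conditions provide an eigenvalue `1` or `-1` for each
class. -/
theorem HasData.eq (hm : 0 < m) (h3 : 0 < a') (h5 : 0 < a'') (h : HasData S C a b a' b' a'' b'' c'')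
    (h' : HasData S C' a b a' b' a'' b'' c'') : C = C' := by
  obtain ⟨g₂, g₃, g₅, h₂, h₃, h₅, rfl⟩ := h
  obtain ⟨g₂', g₃', g₅', h₂', h₃', h₅', rfl⟩ := h'
  rw [mk_proj_eq (h₂.isConj hm h₂'), mk_proj_eq (h₃.isConj h3 h₃'), mk_proj_eq (h₅.isConj h5 h₅')]

/-- The data of a triple are unique, but for the exchange of `a` and `b`. -/
theorem HasData.unique [Infinite k] (hm : 2 ≤ m) {x y x' y' x'' y'' z'' : ℕ}
    (h : HasData S C a b a' b' a'' b'' c'') (h' : HasData S C x y x' y' x'' y'' z'') :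
    a' = x' ∧ b' = y' ∧ a'' = x'' ∧ b'' = y'' ∧ c'' = z'' := by
  obtain ⟨g₂, g₃, g₅, h₂, h₃, h₅, rfl⟩ := h
  obtain ⟨g₂', g₃', g₅', h₂', h₃', h₅', e⟩ := h'
  have e3 := ConjClasses.mk_eq_mk_iff_isConj.1 (congrArg ClassTriple.C3 e)
  have e5 := ConjClasses.mk_eq_mk_iff_isConj.1 (congrArg ClassTriple.C5 e)
  have i3 := (h₃.of_isConj (isConj_of_isConj_proj S.two_ne hm (by decide) (h₃.pow S.hω) (h₃'.pow S.hω) e3)).unique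
    S.hω h₃'
  have i5 := (h₅.of_isConj (isConj_of_isConj_proj S.two_ne hm (by decide) (h₅.pow S.hζ) (h₅'.pow S.hζ) e5)).unique
    S.hζ h₅'
  exact ⟨i3.1, i3.2, i5.1, i5.2.1, i5.2.2⟩

theorem carrier_mk_sq {G : Type*} [Group G] (x : G) :
    (ConjClasses.mk (x ^ 2)).carrier = (fun g => g ^ 2) '' (ConjClasses.mk x).carrier := by
  ext y
  simp only [Set.mem_image, ConjClasses.mem_carrier_iff_mk_eq, ConjClasses.mk_eq_mk_iff_isConj]
  constructor
  · intro h
    obtain ⟨c, rfl⟩ := isConj_iff.1 h.symm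
    exact ⟨c * x * c⁻¹, (isConj_iff.2 ⟨c, rfl⟩ : IsConj x _).symm, conj_pow⟩
  · rintro ⟨z, hz, rfl⟩
    exact hz.pow 2

/-- The twist of a triple by `ι` exchanges the multiplicities of `ζ^{±1}` and `ζ^{±2}`. -/
theorem HasData.isTwist (hm : 0 < m) (h3 : 0 < a') (h5 : 0 < a'') (h : HasData S C a b a' b' a'' b'' c'')
    (h' : HasData S C' a b a' b' a'' c'' b'') : C.IsTwist C' := by
  obtain ⟨g₂, g₃, g₅, h₂, h₃, h₅, rfl⟩ := h
  obtain ⟨g₂', g₃', g₅', h₂', h₃', h₅', rfl⟩ := h'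
  refine ⟨mk_proj_eq (h₂'.isConj hm h₂), mk_proj_eq (h₃'.isConj h3 h₃), ?_⟩
  rw [← carrier_mk_sq, ← map_pow, mk_proj_eq ((h₅.sq S.hζ).isConj h5 h₅')]

theorem ClassTriple.HasType.trans {X₂ X₃ X₅ Y₂ Y₃ Y₅ : Type*} [AddCommGroup X₂] [AddCommGroup X₃]
    [AddCommGroup X₅] [AddCommGroup Y₂] [AddCommGroup Y₃] [AddCommGroup Y₅] {Φ₂ : Set X₂} {Φ₃ : Set X₃}
    {Φ₅ : Set X₅} {Ψ₂ : Set Y₂} {Ψ₃ : Set Y₃} {Ψ₅ : Set Y₅} (h : C.HasType Φ₂ Φ₃ Φ₅) (h₂ : RootIso Φ₂ Ψ₂)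
    (h₃ : RootIso Φ₃ Ψ₃) (h₅ : RootIso Φ₅ Ψ₅) : C.HasType Ψ₂ Ψ₃ Ψ₅ :=
  ⟨fun g hg => (h.1 g hg).trans h₂, fun g hg => (h.2.1 g hg).trans h₃, fun g hg => (h.2.2 g hg).trans h₅⟩

variable [IsAlgClosed k]

theorem HasData.hasType (hm : 2 ≤ m) (h : HasData S C a b a' b' a'' b'' c'') :
    C.HasType (rootSum (rootsD a) (rootsD b)) (rootSum (rootsD a') (rootsGL b'))
      (rootSum (rootsD a'') (rootSum (rootsGL b'') (rootsGL c''))) := by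
  obtain ⟨g₂, g₃, g₅, h₂, h₃, h₅, rfl⟩ := h
  refine ⟨fun x hx => ?_, fun x hx => ?_, fun x hx => ?_⟩
  · obtain ⟨g, hg, rfl⟩ := exists_of_mem_carrier hx
    exact ((h₂.of_isConj hg).roots S.two_ne hm).1
  · obtain ⟨g, hg, rfl⟩ := exists_of_mem_carrier hx
    exact ((h₃.of_isConj hg).roots S hm).1
  · obtain ⟨g, hg, rfl⟩ := exists_of_mem_carrier hx
    exact ((h₅.of_isConj hg).roots S hm).1

theorem even_count2 (a b : ℕ) : 2 ∣ count2 a b := by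
  rw [count2]; omega

theorem two_dvd_mul_pred (a : ℕ) : 2 ∣ a * (a - 1) := (Nat.even_mul_pred_self a).two_dvd

theorem even_count3 (a b : ℕ) : 2 ∣ count3 a b := by
  have := two_dvd_mul_pred b
  rw [count3]; omega

theorem even_count5 (a b c : ℕ) : 2 ∣ count5 a b c := by
  have := two_dvd_mul_pred b
  have := two_dvd_mul_pred c
  rw [count5]; omega

/-- The equation defining regular triples, in terms of the numbers of roots of the centralizers. -/
theorem nu_equation_iff (h2 : (2 : k) ≠ 0) (hm : 2 ≤ m) {H₂ H₃ H₅ : Subgroup (PSO m k)} {f₂ f₃ f₅ : ℕ}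
    (h₂ : (rootSet (preimageGL H₂)).ncard = f₂) (h₃ : (rootSet (preimageGL H₃)).ncard = f₃)
    (h₅ : (rootSet (preimageGL H₅)).ncard = f₅) (d₂ : 2 ∣ f₂) (d₃ : 2 ∣ f₃) (d₅ : 2 ∣ f₅) :
    (nu (⊤ : Subgroup (PSO m k)) : ℤ) - (nu H₂ + nu H₃ + nu H₅) =
      algRank (preimageGL (⊤ : Subgroup (PSO m k))) ↔ f₂ + f₃ + f₅ + 4 * m = 2 * m * m := by
  obtain ⟨h0, hr⟩ := ncard_roots_top (k := k) h2 hm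
  rw [hr, nu, nu, nu, nu, h₂, h₃, h₅, h0]
  obtain ⟨c₂, rfl⟩ := d₂
  obtain ⟨c₃, rfl⟩ := d₃
  obtain ⟨c₅, rfl⟩ := d₅
  simp only [Nat.mul_div_cancel_left _ (two_pos)]
  have h1 := cast_mul_pred m
  rw [h1]
  zify
  constructor <;> intro h <;> linarith

/-- Regularity of a triple, expressed by its data. -/
theorem HasData.isRegular_iff (hm : 2 ≤ m) (h : HasData S C a b a' b' a'' b'' c'') :
    C.IsRegular ↔ count2 a b + count3 a' b' + count5 a'' b'' c'' + 4 * m = 2 * m * m := by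
  obtain ⟨g₂, g₃, g₅, h₂, h₃, h₅, rfl⟩ := h
  have key : ∀ g₂' g₃' g₅', IsConj g₂ g₂' → IsConj g₃ g₃' → IsConj g₅ g₅' → _ := fun g₂' g₃' g₅' i₂ i₃ i₅ =>
    nu_equation_iff S.two_ne hm ((h₂.of_isConj i₂).roots S.two_ne hm).2 ((h₃.of_isConj i₃).roots S hm).2
      ((h₅.of_isConj i₅).roots S hm).2 (even_count2 a b) (even_count3 a' b') (even_count5 a'' b'' c'')
  constructor
  · rintro ⟨-, h⟩
    exact (key _ _ _ (IsConj.refl _) (IsConj.refl _) (IsConj.refl _)).1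
      (h _ ConjClasses.mem_carrier_mk _ ConjClasses.mem_carrier_mk _ ConjClasses.mem_carrier_mk)
  · intro h
    refine ⟨⟨fun x hx => ?_, fun x hx => ?_, fun x hx => ?_⟩, fun x₂ hx₂ x₃ hx₃ x₅ hx₅ => ?_⟩
    · obtain ⟨g, hg, rfl⟩ := exists_of_mem_carrier hx
      rw [← map_pow, show g ^ 2 = 1 from Subtype.ext (h₂.of_isConj hg).sq, map_one]
    · obtain ⟨g, hg, rfl⟩ := exists_of_mem_carrier hx
      rw [← map_pow, show g ^ 3 = 1 from Subtype.ext ((h₃.of_isConj hg).pow S.hω), map_one]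
    · obtain ⟨g, hg, rfl⟩ := exists_of_mem_carrier hx
      rw [← map_pow, show g ^ 5 = 1 from Subtype.ext ((h₅.of_isConj hg).pow S.hζ), map_one]
    · obtain ⟨g₂', i₂, rfl⟩ := exists_of_mem_carrier hx₂
      obtain ⟨g₃', i₃, rfl⟩ := exists_of_mem_carrier hx₃
      obtain ⟨g₅', i₅, rfl⟩ := exists_of_mem_carrier hx₅
      exact (key _ _ _ i₂ i₃ i₅).2 h

/-- The possible data of regular triples. -/
def IsRegularData (m a b a' b' a'' b'' c'' : ℕ) : Prop :=
  (m, a, b) ∈ [(4, 2, 2), (5, 3, 2), (5, 2, 3), (6, 3, 3), (8, 4, 4)] ∧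
  (m, a', b') ∈ [(4, 1, 3), (4, 2, 2), (5, 2, 3), (6, 2, 4), (8, 3, 5)] ∧
  (m, a'', b'', c'') ∈ [(4, 1, 1, 2), (4, 1, 2, 1), (5, 1, 2, 2), (6, 2, 2, 2), (6, 1, 3, 2), (6, 1, 2, 3),
    (8, 2, 3, 3)]

theorem IsRegularData.count (h : IsRegularData m a b a' b' a'' b'' c'') :
    count2 a b + count3 a' b' + count5 a'' b'' c'' + 4 * m = 2 * m * m := by
  obtain ⟨h1, h3, h5⟩ := h
  simp only [List.mem_cons, Prod.mk.injEq, List.not_mem_nil, or_false] at h1 h3 h5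
  rcases h1 with ⟨rfl, rfl, rfl⟩ | ⟨rfl, rfl, rfl⟩ | ⟨rfl, rfl, rfl⟩ | ⟨rfl, rfl, rfl⟩ | ⟨rfl, rfl, rfl⟩ <;>
  simp at h3 h5 <;> rcases h3 with h3 | h3 <;> rcases h5 with h5 | h5 | h5 <;>
  simp_all [count2, count3, count5]

/-- The inequality between root counts that holds for regular homomorphisms already forces the data
to be regular. -/
theorem isRegularData_of_le (hm : 4 ≤ m) (h2 : a + b = m) (h3 : a' + b' = m) (h5 : a'' + (b'' + c'') = m)
    (h : count2 a b + count3 a' b' + count5 a'' b'' c'' + 4 * m ≤ 2 * m * m) :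
    IsRegularData m a b a' b' a'' b'' c'' := by
  obtain ⟨hm9, h7, e2, e3, e5⟩ := count_solutions hm (le_count2 h2)
    (fun hm9 => (minCount_le_count2 m hm9 hm a b h2).1) h3 h5 h
  exact ⟨(minCount_le_count2 m hm9 hm a b h2).2 h7 e2, (minCount_le_count3 m hm9 hm a' b' h3).2 h7 e3,
    (minCount_le_count5 m hm9 hm a'' b'' c'' h5).2 h7 e5⟩

/-- An element with square `-1` has too many roots. -/
theorem not_le_of_isType4 (hm : 4 ≤ m) (h3 : a' + b' = m) (h5 : a'' + (b'' + c'') = m) :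
    ¬ m * (m - 1) + count3 a' b' + count5 a'' b'' c'' + 4 * m ≤ 2 * m * m := by
  intro h
  have h1 : (m * m - 2 * m : ℤ) ≤ (m * (m - 1) : ℕ) := by rw [cast_mul_pred]; linarith
  obtain ⟨hm9, -, e, -⟩ := count_solutions hm h1 (fun hm9 => (minCount_lt m hm9 hm).le) h3 h5 h
  exact (minCount_lt m hm9 hm).ne' e

/-- Every regular triple has regular data; its involution lifts to an involution, as elements of
square `-1` have too many roots. -/
theorem exists_data_of_isRegular (S : RootsOfUnity k) (hm : 4 ≤ m) (h : C.IsRegular) :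
    ∃ a b a' b' a'' b'' c'', HasData S C a b a' b' a'' b'' c'' ∧ IsRegularData m a b a' b' a'' b'' c'' := by
  have h2m : 2 ≤ m := by omega
  obtain ⟨x₂, hx₂⟩ := ConjClasses.exists_rep C.C2
  obtain ⟨x₃, hx₃⟩ := ConjClasses.exists_rep C.C3
  obtain ⟨x₅, hx₅⟩ := ConjClasses.exists_rep C.C5
  have m₂ : x₂ ∈ C.C2.carrier := hx₂ ▸ ConjClasses.mem_carrier_mk
  have m₃ : x₃ ∈ C.C3.carrier := hx₃ ▸ ConjClasses.mem_carrier_mk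
  have m₅ : x₅ ∈ C.C5.carrier := hx₅ ▸ ConjClasses.mem_carrier_mk
  obtain ⟨⟨i₂, i₃, i₅⟩, hreg⟩ := h
  have hreg := hreg x₂ m₂ x₃ m₃ x₅ m₅
  obtain ⟨g₂, rfl, hg₂⟩ := exists_lift_sq S.two_ne h2m (i₂ x₂ m₂)
  obtain ⟨g₃, rfl, hg₃⟩ := exists_lift_of_odd S.two_ne h2m (by decide) (i₃ x₃ m₃)
  obtain ⟨g₅, rfl, hg₅⟩ := exists_lift_of_odd S.two_ne h2m (by decide) (i₅ x₅ m₅)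
  obtain ⟨a', b', t₃⟩ := exists_isType3 S.two_ne S.three_ne S.hω g₃ hg₃
  obtain ⟨a'', b'', c'', t₅⟩ := exists_isType5 S.two_ne S.five_ne S.hζ g₅ hg₅
  rcases hg₂ with ⟨a, b, t₂⟩ | ⟨-, t₂⟩
  · have := (nu_equation_iff S.two_ne h2m (t₂.roots S.two_ne h2m).2 (t₃.roots S h2m).2 (t₅.roots S h2m).2
      (even_count2 a b) (even_count3 a' b') (even_count5 a'' b'' c'')).1 hreg
    refine ⟨a, b, a', b', a'', b'', c'', ⟨g₂, g₃, g₅, t₂, t₃, t₅, ?_⟩,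
      isRegularData_of_le hm t₂.1 t₃.1 t₅.1 this.le⟩
    exact ClassTriple.ext hx₂.symm hx₃.symm hx₅.symm
  · have := (nu_equation_iff S.two_ne h2m (t₂.ncard S.two_ne h2m) (t₃.roots S h2m).2 (t₅.roots S h2m).2
      (two_dvd_mul_pred m) (even_count3 a' b') (even_count5 a'' b'' c'')).1 hreg
    exact (not_le_of_isType4 hm t₃.1 t₅.1 this.le).elim

end Triples

/-! ### Scott's lemma -/

section Scott

variable {k : Type*} [Field k] {G : Type*} [Group G] [Finite G] {W : Type*} [AddCommGroup W] [Module k W]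
  [FiniteDimensional k W]

/-- **Scott's lemma** for a group generated by `x` and `y`, of order invertible in `k`: the fixed spaces of
`x`, `y` and `x * y` cannot be too large. The maps `w ↦ ((1-x)w, (1-y)w, (1-xy)w)` and
`(a, b, c) ↦ a + xb - c` form a complex, the kernel of the first being the space of invariants and the
image of the second a complement of it. -/
theorem scott_le (ρ : Representation k G W) {x y : G} (hxy : Subgroup.closure {x, y} = ⊤)
    (hG : (Nat.card G : k) ≠ 0) :
    Module.finrank k (LinearMap.ker (1 - ρ x)) + Module.finrank k (LinearMap.ker (1 - ρ y)) +
      Module.finrank k (LinearMap.ker (1 - ρ (x * y))) ≤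
      Module.finrank k W + 2 * Module.finrank k ρ.invariants := by
  let F (g : G) : W →ₗ[k] W := 1 - ρ g
  have hF : ∀ g w, F g w = w - ρ g w := fun _ _ => rfl
  let R (g : G) : Submodule k W := LinearMap.range (F g)
  let β : W →ₗ[k] R x × R y × R (x * y) :=
    (F x).rangeRestrict.prod ((F y).rangeRestrict.prod (F (x * y)).rangeRestrict)
  let δ : R x × R y × R (x * y) →ₗ[k] W :=
    (R x).subtype.coprod (((ρ x).comp (R y).subtype).coprod (-(R (x * y)).subtype))
  have hδ : ∀ a b c, δ (a, b, c) = a + (ρ x b + -c) := fun _ _ _ => rfl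
  -- the two maps form a complex because `1 - xy = (1 - x) + x (1 - y)`
  have hβδ : LinearMap.range β ≤ LinearMap.ker δ := by
    rintro _ ⟨w, rfl⟩
    rw [LinearMap.mem_ker]
    change F x w + (ρ x (F y w) + -(F (x * y) w)) = 0
    rw [hF, hF, hF, map_sub, map_mul, Module.End.mul_apply]
    abel
  have hker : LinearMap.ker β ≤ ρ.invariants := by
    intro w hw
    have h1 : F x w = 0 := congrArg (fun z => (z.1 : W)) hw
    have h2 : F y w = 0 := congrArg (fun z => (z.2.1 : W)) hw
    intro g
    have hg : g ∈ Subgroup.closure {x, y} := hxy ▸ Subgroup.mem_top g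
    induction hg using Subgroup.closure_induction with
    | mem g hg =>
      rcases hg with rfl | rfl
      · exact (sub_eq_zero.1 h1).symm
      · exact (sub_eq_zero.1 h2).symm
    | one => simp
    | mul a b _ _ ha hb => rw [map_mul, Module.End.mul_apply, hb, ha]
    | inv a _ ha =>
      nth_rewrite 1 [← ha]
      rw [← Module.End.mul_apply, ← map_mul, inv_mul_cancel, map_one, Module.End.one_apply]
  have hrange : ∀ g w, w - ρ g w ∈ LinearMap.range δ := by
    have hx : ∀ w, w - ρ x w ∈ LinearMap.range δ := fun w =>
      ⟨(⟨F x w, w, rfl⟩, 0, 0), by rw [hδ]; simp [hF]⟩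
    have hy : ∀ w, w - ρ y w ∈ LinearMap.range δ := fun w => by
      have h1 : ρ x (w - ρ y w) ∈ LinearMap.range δ :=
        ⟨(0, ⟨F y w, w, rfl⟩, 0), by rw [hδ]; simp [hF]⟩
      have := add_mem h1 (hx (w - ρ y w))
      rwa [add_sub_cancel] at this
    intro g
    have hg : g ∈ Subgroup.closure {x, y} := hxy ▸ Subgroup.mem_top g
    induction hg using Subgroup.closure_induction with
    | mem g hg =>
      rcases hg with rfl | rfl
      · exact hx
      · exact hy
    | one => intro w; simp
    | mul a b _ _ ha hb =>
      intro w
      have := add_mem (ha (ρ b w)) (hb w)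
      rw [map_mul, Module.End.mul_apply]
      rwa [add_comm, sub_add_sub_cancel] at this
    | inv a _ ha =>
      intro w
      have := neg_mem (ha (ρ a⁻¹ w))
      rwa [← Module.End.mul_apply, ← map_mul, mul_inv_cancel, map_one, Module.End.one_apply, neg_sub] at this
  -- every vector is its average plus the average of the `w - g w`
  have hsup : ρ.invariants ⊔ LinearMap.range δ = ⊤ := by
    rw [eq_top_iff]
    rintro w -
    have := Fintype.ofFinite G
    rw [Nat.card_eq_fintype_card] at hG
    have hinv : (Fintype.card G : k)⁻¹ • ∑ g, ρ g w ∈ ρ.invariants := by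
      intro h
      rw [map_smul, map_sum]
      congr 1
      rw [← Equiv.sum_comp (Equiv.mulLeft h) fun g => ρ g w]
      refine Finset.sum_congr rfl fun g _ => ?_
      rw [Equiv.coe_mulLeft, map_mul, Module.End.mul_apply]
    have hr : (Fintype.card G : k)⁻¹ • ∑ g, (w - ρ g w) ∈ LinearMap.range δ :=
      Submodule.smul_mem _ _ (Submodule.sum_mem _ fun g _ => hrange g w)
    have := Submodule.add_mem_sup hinv hr
    rwa [← smul_add, ← Finset.sum_add_distrib, Finset.sum_congr rfl fun g _ => add_sub_cancel (ρ g w) w,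
      Finset.sum_const, Finset.card_univ, ← Nat.cast_smul_eq_nsmul k, smul_smul, inv_mul_cancel₀ hG,
      one_smul] at this
  have e1 := LinearMap.finrank_range_add_finrank_ker β
  have e2 := LinearMap.finrank_range_add_finrank_ker δ
  have e3 := Submodule.finrank_mono hβδ
  have e4 := Submodule.finrank_mono hker
  have e5 := Submodule.finrank_add_le_finrank_add_finrank ρ.invariants (LinearMap.range δ)
  rw [hsup, finrank_top] at e5
  rw [Module.finrank_prod, Module.finrank_prod] at e2
  have ex := LinearMap.finrank_range_add_finrank_ker (F x)
  have ey := LinearMap.finrank_range_add_finrank_ker (F y)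
  have ez := LinearMap.finrank_range_add_finrank_ker (F (x * y))
  change Module.finrank k (LinearMap.ker (F x)) + Module.finrank k (LinearMap.ker (F y)) +
    Module.finrank k (LinearMap.ker (F (x * y))) ≤ _
  change Module.finrank k (LinearMap.range δ) + _ = Module.finrank k (LinearMap.range (F x)) +
    (Module.finrank k (LinearMap.range (F y)) + Module.finrank k (LinearMap.range (F (x * y)))) at e2
  omega

end Scott

/-! ### Pairs of mutually inverse eigenvalues -/

section Counting

variable {A : Type*} [Group A] [DecidableEq A]

/-- The number of pairs of eigenvectors whose eigenvalues multiply to `1`. -/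
def pairCount {I : Type*} [Fintype I] (L : I → A) : ℕ := ∑ b, mult L (wt L b)⁻¹

/-- The number of eigenvalues that are equal to their inverse. -/
def selfCount {I : Type*} [Fintype I] (L : I → A) : ℕ := ∑ a, if wt L a = (wt L a)⁻¹ then 1 else 0

theorem pairCount_const (b : ℕ) (c : A) (h : c ≠ c⁻¹) : pairCount (fun _ : Fin b => c) = 2 * (b * b) ∧
    selfCount (fun _ : Fin b => c) = 0 := by
  have e1 := sum_wt_const b c fun x => mult (fun _ : Fin b => c) x⁻¹
  have e2 := sum_wt_const b c fun x => if x = x⁻¹ then 1 else 0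
  rw [pairCount, selfCount, e1, e2]
  simp only [mult_const, _root_.inv_inv, if_neg h, if_neg h.symm, if_true]
  constructor <;> ring

theorem pairCount_const_self (b : ℕ) (c : A) (h : c = c⁻¹) : pairCount (fun _ : Fin b => c) = 4 * (b * b) ∧
    selfCount (fun _ : Fin b => c) = 2 * b := by
  have e1 := sum_wt_const b c fun x => mult (fun _ : Fin b => c) x⁻¹
  have e2 := sum_wt_const b c fun x => if x = x⁻¹ then 1 else 0
  rw [pairCount, selfCount, e1, e2]
  simp only [mult_const, ← h, if_true]
  constructor <;> ring

/-- The counts are additive over families of eigenvalues without a common member. -/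
theorem counts_sumElim {I₁ I₂ : Type*} [Fintype I₁] [Fintype I₂] (L₁ : I₁ → A) (L₂ : I₂ → A)
    (h : ∀ a b, wt L₁ a ≠ wt L₂ b) : pairCount (Sum.elim L₁ L₂) = pairCount L₁ + pairCount L₂ ∧
      selfCount (Sum.elim L₁ L₂) = selfCount L₁ + selfCount L₂ := by
  have e1 := sum_wt_sumElim L₁ L₂ fun x => mult (Sum.elim L₁ L₂) x⁻¹
  have e2 := sum_wt_sumElim L₁ L₂ fun x => if x = x⁻¹ then 1 else 0
  have h1 : ∀ b, mult L₂ (wt L₁ b)⁻¹ = 0 := fun b => Finset.sum_eq_zero fun a _ => if_neg fun e => by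
    rw [← wt_swap] at e
    exact h _ _ e.symm
  have h2 : ∀ b, mult L₁ (wt L₂ b)⁻¹ = 0 := fun b => Finset.sum_eq_zero fun a _ => if_neg fun e => by
    rw [← wt_swap] at e
    exact h _ _ e
  refine ⟨?_, e2⟩
  rw [pairCount, e1]
  simp only [mult_sumElim, h1, h2, add_zero, zero_add]
  rfl

variable {k : Type*} [Field k] [DecidableEq kˣ]

/-- The counts for `1` and `-1`, of multiplicities `2a` and `2b`. -/
theorem counts_label2 (h2 : (2 : k) ≠ 0) (a b : ℕ) :
    pairCount (label2 k a b) = 2 * count2 a b + 4 * (a + b) ∧ selfCount (label2 k a b) = 2 * (a + b) := by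
  obtain ⟨e1, e2⟩ := counts_sumElim (fun _ : Fin a => (1 : kˣ)) (fun _ : Fin b => (-1 : kˣ)) (wt_label2_ne h2)
  obtain ⟨i1, i2⟩ := pairCount_const_self a (1 : kˣ) inv_one.symm
  obtain ⟨j1, j2⟩ := pairCount_const_self b (-1 : kˣ) (by simp)
  rw [label2, e1, e2, i1, i2, j1, j2]
  have ea := cast_mul_pred a
  have eb := cast_mul_pred b
  zify [count2]
  push_cast at ea eb
  constructor
  · linear_combination (-4) * ea - 4 * eb
  · ring

/-- The counts for `1` and `ω^{±1}`, of multiplicities `2a` and `b`. -/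
theorem counts_label3 {ω : kˣ} (hω : IsPrimitiveRoot ω 3) (a b : ℕ) :
    pairCount (label3 ω a b) = 2 * count3 a b + 4 * a + 2 * b ∧ selfCount (label3 ω a b) = 2 * a := by
  obtain ⟨e1, e2⟩ := counts_sumElim (fun _ : Fin a => (1 : kˣ)) (fun _ : Fin b => ω) (wt_label3_ne hω)
  obtain ⟨i1, i2⟩ := pairCount_const_self a (1 : kˣ) inv_one.symm
  obtain ⟨j1, j2⟩ := pairCount_const b ω (ne_inv_of_isPrimitiveRoot hω (by decide))
  rw [label3, e1, e2, i1, i2, j1, j2]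
  have ea := cast_mul_pred a
  have eb := cast_mul_pred b
  zify [count3]
  push_cast at ea eb
  constructor
  · linear_combination (-4) * ea - 2 * eb
  · ring

/-- The counts for `1`, `ζ^{±1}` and `ζ^{±2}`, of multiplicities `2a`, `b` and `c`. -/
theorem counts_label5 {ζ : kˣ} (hζ : IsPrimitiveRoot ζ 5) (a b c : ℕ) :
    pairCount (label5 ζ a b c) = 2 * count5 a b c + 4 * a + 2 * b + 2 * c ∧
      selfCount (label5 ζ a b c) = 2 * a := by
  obtain ⟨h1, h2⟩ := wt_label5_ne hζ a b c
  obtain ⟨e1, e2⟩ := counts_sumElim (fun _ : Fin a => (1 : kˣ)) _ h1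
  obtain ⟨e3, e4⟩ := counts_sumElim (fun _ : Fin b => ζ) (fun _ : Fin c => ζ ^ 2) h2
  obtain ⟨i1, i2⟩ := pairCount_const_self a (1 : kˣ) inv_one.symm
  obtain ⟨j1, j2⟩ := pairCount_const b ζ (label5_facts hζ).2.1.1
  obtain ⟨l1, l2⟩ := pairCount_const c (ζ ^ 2) (label5_facts hζ).2.2
  rw [label5, e1, e2, e3, e4, i1, i2, j1, j2, l1, l2]
  have ea := cast_mul_pred a
  have eb := cast_mul_pred b
  have ec := cast_mul_pred c
  zify [count5]
  push_cast at ea eb ec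
  constructor
  · linear_combination (-4) * ea - 2 * eb - 2 * ec
  · ring

end Counting

/-! ### Fixed spaces in spaces of matrices -/

section FixedSpaces

variable {k : Type*} [Field k] [DecidableEq kˣ] {n : ℕ} {I : Type*} [Fintype I] [DecidableEq I]

/-- The dimension of the space of invariants `X` with `g' X gᵀ = X`, for `g` and `g'` with the same
eigenvalues. -/
theorem pairCount_le_finrank {g g' : Matrix (Fin n) (Fin n) k} {v v' : I ⊕ I → Fin n → k} {L : I → kˣ}
    (h : Adapted g v L) (h' : Adapted g' v' L) {U : Submodule k (Matrix (Fin n) (Fin n) k)}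
    (hU : ∀ X : Matrix (Fin n) (Fin n) k, g' * X * gᵀ = X → X ∈ U) :
    pairCount L ≤ Module.finrank k U := by
  -- the matrices `v'_a v_bᵀ` with mutually inverse eigenvalues are invariant, and independent by
  -- hyperbolicity
  let P := {p : (I ⊕ I) × (I ⊕ I) // wt L p.1 = (wt L p.2)⁻¹}
  let w : P → U := fun p => ⟨vecMulVec (v' p.1.1) (v p.1.2), hU _ (by
    rw [Matrix.mul_vecMulVec, Matrix.vecMulVec_mul, Matrix.vecMul_transpose, h.2, h'.2,
      Matrix.smul_vecMulVec, Matrix.vecMulVec_smul, smul_smul, ← Units.val_mul, p.2, inv_mul_cancel,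
      Units.val_one, one_smul])⟩
  let φ : (P → k) →ₗ[k] U := Fintype.linearCombination k w
  have hφ : ∀ c, ((φ c : U) : Matrix (Fin n) (Fin n) k) = ∑ p : P, c p • vecMulVec (v' p.1.1) (v p.1.2) :=
    fun c => by simp [φ, w, Fintype.linearCombination_apply]
  have hinj : Function.Injective φ := by
    rw [injective_iff_map_eq_zero]
    intro c hc
    funext q
    have h1 := hφ c
    rw [hc] at h1
    have h2 := congrArg (fun X => v' q.1.1.swap ⬝ᵥ (X *ᵥ v q.1.2.swap)) h1
    simp only [Submodule.coe_zero, Matrix.zero_mulVec, dotProduct_zero, Matrix.sum_mulVec, dotProduct_sum,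
      Matrix.smul_mulVec, Matrix.vecMulVec_mulVec, op_smul_eq_smul, dotProduct_smul, smul_eq_mul, h.1 _ _,
      h'.1 _ _] at h2
    rw [Finset.sum_eq_single q] at h2
    · simpa using h2.symm
    · rintro p - hpq
      by_cases e1 : p.1.1 = q.1.1
      · rw [if_neg (c := q.1.2.swap = p.1.2.swap)]
        · simp
        · intro e2
          exact hpq (Subtype.ext (Prod.ext e1 (Sum.swap_leftInverse.injective e2).symm))
      · rw [if_neg (c := p.1.1 = q.1.1.swap.swap)]
        · simp
        · rwa [Sum.swap_swap]
    · simp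
  have h3 := LinearMap.finrank_le_finrank_of_injective hinj
  rw [Module.finrank_fintype_fun_eq_card] at h3
  refine le_trans (le_of_eq ?_) h3
  rw [Fintype.card_subtype, Finset.card_filter, Fintype.sum_prod_type_right]
  rfl

/-- The dimension of the space of skew-symmetric matrices that are invariant under `g`. -/
theorem pairCount_le_finrank_skew {g : Matrix (Fin n) (Fin n) k} {v : I ⊕ I → Fin n → k} {L : I → kˣ}
    (h : Adapted g v L) {U : Submodule k (Matrix (Fin n) (Fin n) k)}
    (hU : ∀ X : Matrix (Fin n) (Fin n) k, Xᵀ = -X → g * X * gᵀ = X → X ∈ U) :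
    pairCount L ≤ 2 * Module.finrank k U + selfCount L := by
  let e := Fintype.equivFin (I ⊕ I)
  -- the matrices `v_a ∧ v_b` with `a < b` for some order and mutually inverse eigenvalues
  let P := {p : (I ⊕ I) × (I ⊕ I) // e p.1 < e p.2 ∧ wt L p.1 = (wt L p.2)⁻¹}
  let w : P → U := fun p => ⟨wedge (v p.1.1) (v p.1.2), hU _ (wedge_transpose _ _) (by
    rw [h.wedge, p.2.2, inv_mul_cancel, Units.val_one, one_smul])⟩
  let φ : (P → k) →ₗ[k] U := Fintype.linearCombination k w
  have hφ : ∀ c, ((φ c : U) : Matrix (Fin n) (Fin n) k) = ∑ p : P, c p • wedge (v p.1.1) (v p.1.2) :=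
    fun c => by simp [φ, w, Fintype.linearCombination_apply]
  have hinj : Function.Injective φ := by
    rw [injective_iff_map_eq_zero]
    intro c hc
    funext q
    have h1 := hφ c
    rw [hc] at h1
    have h2 := congrArg (fun X => v q.1.1.swap ⬝ᵥ (X *ᵥ v q.1.2.swap)) h1
    simp only [Submodule.coe_zero, Matrix.zero_mulVec, dotProduct_zero, Matrix.sum_mulVec, dotProduct_sum,
      Matrix.smul_mulVec, wedge_mulVec, dotProduct_sub, dotProduct_smul, smul_eq_mul, h.1 _ _, Sum.swap_swap,
      Sum.swap_leftInverse.injective.eq_iff] at h2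
    rw [Finset.sum_eq_single q] at h2
    · rw [if_pos rfl, if_pos rfl, if_neg (c := q.1.2 = q.1.1)] at h2
      · simpa using h2.symm
      · intro e1
        exact q.2.1.ne (congrArg e e1.symm)
    · rintro p - hpq
      have e2 : ¬ (q.1.2 = p.1.1 ∧ p.1.2 = q.1.1) := by
        rintro ⟨e1, e2⟩
        have := p.2.1
        rw [e2, ← e1] at this
        exact lt_asymm this q.2.1
      have e3 : ¬ (q.1.2 = p.1.2 ∧ p.1.1 = q.1.1) := by
        rintro ⟨e1, e2⟩
        exact hpq (Subtype.ext (Prod.ext e2 e1.symm))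
      simp only [← ite_and, ite_mul, one_mul, zero_mul, if_neg e3, if_neg e2]
      simp
    · simp
  have h3 := LinearMap.finrank_le_finrank_of_injective hinj
  rw [Module.finrank_fintype_fun_eq_card] at h3
  -- the pairs `(a, b)` with `a < b`, with `a > b`, and with `a = b`
  have hsum : pairCount L = Fintype.card P + Fintype.card P + selfCount L := by
    have h4 : pairCount L = (Finset.univ.filter fun p : (I ⊕ I) × (I ⊕ I) => wt L p.1 = (wt L p.2)⁻¹).card := by
      rw [Finset.card_filter, Fintype.sum_prod_type_right]; rfl
    have h5 : selfCount L = (Finset.univ.filter fun p : (I ⊕ I) × (I ⊕ I) => p.1 = p.2 ∧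
        wt L p.1 = (wt L p.2)⁻¹).card := by
      rw [selfCount, ← Finset.card_filter (fun a => wt L a = (wt L a)⁻¹)]
      refine Finset.card_bij (fun a _ => (a, a)) (fun a ha => ?_) (fun a _ b _ h => congrArg Prod.fst h) ?_
      · simpa using ha
      · rintro ⟨a, b⟩ hab
        simp only [Finset.mem_filter, Finset.mem_univ, true_and] at hab
        obtain ⟨rfl, hab⟩ := hab
        exact ⟨a, by simpa using hab, rfl⟩
    have h6 : Fintype.card P = (Finset.univ.filter fun p : (I ⊕ I) × (I ⊕ I) => e p.2 < e p.1 ∧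
        wt L p.1 = (wt L p.2)⁻¹).card := by
      rw [Fintype.card_subtype]
      refine Finset.card_equiv (Equiv.prodComm _ _) fun p => ?_
      simp only [Finset.mem_filter, Finset.mem_univ, true_and, Equiv.prodComm_apply, Prod.fst_swap, Prod.snd_swap]
      exact and_congr_right fun _ => ⟨fun h => by rw [h, _root_.inv_inv], fun h => by rw [h, _root_.inv_inv]⟩
    nth_rewrite 2 [h6]
    rw [Fintype.card_subtype, h4, h5, ← Finset.card_union_of_disjoint, ← Finset.card_union_of_disjoint]
    · congr 1
      ext p
      simp only [Finset.mem_filter, Finset.mem_univ, true_and, Finset.mem_union, ← or_and_right]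
      rw [iff_and_self]
      intro _
      rcases lt_trichotomy (e p.1) (e p.2) with h | h | h
      · exact Or.inl (Or.inl h)
      · exact Or.inr (e.injective h)
      · exact Or.inl (Or.inr h)
    · rw [← Finset.filter_or, Finset.disjoint_filter]
      rintro p - (⟨h, -⟩ | ⟨h, -⟩) ⟨h', -⟩ <;> rw [h'] at h <;> exact lt_irrefl _ h
    · rw [Finset.disjoint_filter]
      rintro p - ⟨h, -⟩ ⟨h', -⟩
      exact lt_asymm h h'
  omega

end FixedSpaces

/-! ### Generators of `𝒜₅` -/

section Alt5Group

theorem card_alt5 : Nat.card Alt5 = 60 := by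
  rw [nat_card_alternatingGroup, Nat.card_eq_fintype_card, Fintype.card_fin]
  rfl

/-- The subgroup generated by `x₂` and `x₃` contains elements of orders `2`, `3` and `5`. Its index
is at most `2`, hence `1` since `𝒜₅` is simple. -/
theorem closure_x2_x3 : Subgroup.closure {x2, x3} = (⊤ : Subgroup Alt5) := by
  set H := Subgroup.closure ({x2, x3} : Set Alt5)
  have m2 : x2 ∈ H := Subgroup.subset_closure (Set.mem_insert _ _)
  have m3 : x3 ∈ H := Subgroup.subset_closure (Set.mem_insert_of_mem _ rfl)
  have m5 : x5 ∈ H := inv_mem (mul_mem m2 m3)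
  obtain ⟨r2, r3, r5, -⟩ := alt5_relations
  have hdvd : ∀ {x : Alt5} {p : ℕ} [Fact p.Prime], x ∈ H → x ^ p = 1 → x ≠ 1 → p ∣ Nat.card H := by
    intro x p _ hx hp h1
    rw [← orderOf_eq_prime hp h1]
    exact Subgroup.orderOf_dvd_natCard H hx
  have : Fact (Nat.Prime 5) := ⟨by norm_num⟩
  have d2 := hdvd (p := 2) m2 r2 (by decide)
  have d3 := hdvd (p := 3) m3 r3 (by decide)
  have d5 := hdvd (p := 5) m5 r5 (by decide)
  have hcard := H.card_mul_index
  rw [card_alt5] at hcard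
  have d30 : 30 ∣ Nat.card H := by omega
  have hindex : H.index = 1 ∨ H.index = 2 := by
    obtain ⟨c, hc⟩ := d30
    rw [hc, mul_assoc] at hcard
    have : c * H.index = 2 := by omega
    have h2 : H.index ∣ 2 := ⟨c, by rw [mul_comm, this]⟩
    exact (Nat.dvd_prime Nat.prime_two).1 h2
  rcases hindex with h | h
  · exact Subgroup.index_eq_one.1 h
  · have hn := Subgroup.normal_of_index_eq_two h
    have : IsSimpleGroup Alt5 := alternatingGroup.isSimpleGroup (by simp)
    rcases hn.eq_bot_or_eq_top with h' | h'
    · rw [h'] at d2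
      simp at d2
    · exact h'

theorem alt5_hom_ext {P : Type*} [Monoid P] {f g : Alt5 →* P} (h2 : f x2 = g x2) (h3 : f x3 = g x3) : f = g := by
  refine MonoidHom.eq_of_eqOn_dense closure_x2_x3 ?_
  rintro x (rfl | rfl)
  · exact h2
  · exact h3

end Alt5Group

/-! ### The adjoint representation -/

section Adjoint

variable {k : Type*} [Field k] {n : ℕ}

variable (k n) in
/-- The space of skew-symmetric matrices, the Lie algebra of the orthogonal group. -/
def skew : Submodule k (Matrix (Fin n) (Fin n) k) where
  carrier := {X | Xᵀ = -X}
  zero_mem' := by simp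
  add_mem' := by
    intro X Y hX hY
    change (X + Y)ᵀ = -(X + Y)
    rw [Matrix.transpose_add, show Xᵀ = -X from hX, show Yᵀ = -Y from hY, neg_add]
  smul_mem' := by
    intro c X hX
    change (c • X)ᵀ = -(c • X)
    rw [Matrix.transpose_smul, show Xᵀ = -X from hX, smul_neg]

/-- The diagonal of a skew-symmetric matrix vanishes, and the upper triangle determines the rest. -/
theorem finrank_skew_le (h2 : (2 : k) ≠ 0) : 2 * Module.finrank k (skew k n) ≤ n * (n - 1) := by
  let P := {p : Fin n × Fin n // p.1 < p.2}
  let φ : skew k n →ₗ[k] (P → k) :=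
    { toFun := fun X p => X.1 p.1.1 p.1.2, map_add' := fun _ _ => rfl, map_smul' := fun _ _ => rfl }
  have hinj : Function.Injective φ := by
    rw [injective_iff_map_eq_zero]
    intro X hX
    have h1 : ∀ i j, X.1 j i = -X.1 i j := fun i j => congrFun (congrFun X.2 i) j
    have h3 : ∀ i j, i < j → X.1 i j = 0 := fun i j hij => congrFun hX ⟨(i, j), hij⟩
    refine Subtype.ext (Matrix.ext fun i j => ?_)
    rcases lt_trichotomy i j with h | rfl | h
    · exact h3 i j h
    · have := h1 i i
      refine (mul_eq_zero.1 (?_ : 2 * X.1 i i = 0)).resolve_left h2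
      linear_combination this
    · rw [h1 j i, h3 j i h, neg_zero]; rfl
  have := LinearMap.finrank_le_finrank_of_injective hinj
  rw [Module.finrank_fintype_fun_eq_card, Fintype.card_subtype] at this
  rw [← card_filter_lt]
  omega

/-- The adjoint action of the special orthogonal group on skew-symmetric matrices. -/
def adjointSO : Matrix.specialOrthogonalGroup (Fin n) k →* Module.End k (skew k n) where
  toFun h :=
    { toFun := fun X => ⟨h.1 * X.1 * h.1ᵀ, by
        change (h.1 * X.1 * h.1ᵀ)ᵀ = -(h.1 * X.1 * h.1ᵀ)
        rw [Matrix.transpose_mul, Matrix.transpose_mul, Matrix.transpose_transpose,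
          show X.1ᵀ = -X.1 from X.2, neg_mul, mul_neg, mul_assoc]⟩
      map_add' := fun X Y => Subtype.ext (by simp [mul_add, add_mul])
      map_smul' := fun c X => Subtype.ext (by simp) }
  map_one' := by ext X : 2; simp
  map_mul' g h := by
    ext X : 2
    simp [Matrix.transpose_mul, mul_assoc]

theorem coe_adjointSO (h : Matrix.specialOrthogonalGroup (Fin n) k) (X : skew k n) :
    (adjointSO h X).1 = h.1 * X.1 * h.1ᵀ := rfl

variable {m : ℕ}

/-- The adjoint representation of the adjoint group. -/
theorem exists_adjoint (h2 : (2 : k) ≠ 0) (hm : 2 ≤ m) :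
    ∃ Ad : PSO m k →* Module.End k (skew k (2 * m)), ∀ g, Ad (proj m k g) = adjointSO g := by
  refine ⟨QuotientGroup.lift _ adjointSO fun z hz => ?_, fun g => rfl⟩
  ext X : 2
  rw [coe_adjointSO]
  rcases (mem_center_so_iff h2 (by omega) z).1 hz with e | e <;> rw [e] <;> simp

end Adjoint

/-! ### The Cayley transform -/

section Cayley

variable {k : Type*} [Field k] {m : ℕ}

/-- A nonzero skew-symmetric matrix that commutes with a homomorphism gives, by the Cayley transform, an
infinite family of elements of the centralizer. -/
theorem not_isRegularHom_of_skew [Infinite k] (h2 : (2 : k) ≠ 0) (hm : 2 ≤ m) {ψ : Alt5 →* PSO m k}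
    {X : Matrix (Fin (2 * m)) (Fin (2 * m)) k} (hX : Xᵀ = -X) (hX0 : X ≠ 0)
    (hψ : ∀ x h, proj m k h = ψ x → h.1 * X = X * h.1) : ¬ IsRegularHom ψ := by
  rw [isRegularHom_iff_finite h2 hm]
  intro hfin
  let p : Polynomial k := (1 + (Polynomial.X : Polynomial k) • X.map Polynomial.C).det
  have hp : ∀ t, p.eval t = (1 + t • X).det := by
    intro t
    rw [← Polynomial.coe_evalRingHom, RingHom.map_det]
    congr 1
    ext i j
    simp [Matrix.one_apply, apply_ite, mul_comm t (X i j)]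
  have hp0 : p ≠ 0 := by
    intro h0
    have := hp 0
    rw [h0] at this
    simp at this
  have hinf : {t : k | p.eval t ≠ 0}.Infinite := by
    have : {t : k | p.eval t ≠ 0} = {t : k | p.IsRoot t}ᶜ := rfl
    rw [this]
    exact (Polynomial.finite_setOfPred_isRoot hp0).infinite_compl
  -- the centralizer has a finite preimage in `SO_{2m}`, as the kernel of the projection is `{1,
  -- -1}`
  have hS : {h : SO2 m k | proj m k h ∈ Subgroup.centralizer (ψ.range : Set (PSO m k))}.Finite := by
    refine Set.Finite.preimage' (f := proj m k) (Set.toFinite _) fun b _ => ?_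
    obtain ⟨g, rfl⟩ := proj_surjective b
    refine Set.Finite.subset (Set.toFinite {g, negOneSO * g}) fun h hh => ?_
    rcases (proj_eq_proj_iff h2 hm g h).1 (Set.mem_preimage.1 hh).symm with e | e
    · exact Or.inl (Subtype.ext e)
    · exact Or.inr (Subtype.ext (e.trans (coe_negOneSO_mul g).symm))
  -- the Cayley transform of `t X` is `(1 - tX)(1 + tX)⁻¹ = (Y t)ᵀ (Y t)⁻¹`
  let Y (t : k) : Matrix (Fin (2 * m)) (Fin (2 * m)) k := 1 + t • X
  have hYT : ∀ t, (Y t)ᵀ = 1 - t • X := fun t => by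
    simp [Y, hX, sub_eq_add_neg]
  have hYY : ∀ t, (Y t)ᵀ * Y t = Y t * (Y t)ᵀ := fun t => by
    rw [hYT]
    simp only [Y, mul_add, add_mul, mul_sub, sub_mul, one_mul, mul_one]
    abel
  have hu : ∀ t : {t : k | p.eval t ≠ 0}, IsUnit (Y t.1).det := fun t => by
    have := t.2
    rw [Set.mem_ofPred_eq, hp] at this
    exact this.isUnit
  have horth : ∀ t : {t : k | p.eval t ≠ 0}, ((Y t.1)ᵀ * (Y t.1)⁻¹) * ((Y t.1)ᵀ * (Y t.1)⁻¹)ᵀ = 1 := fun t => by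
    have hu' : IsUnit (Y t.1)ᵀ.det := by rw [Matrix.det_transpose]; exact hu t
    rw [Matrix.transpose_mul, Matrix.transpose_transpose, Matrix.transpose_nonsing_inv]
    calc (Y t.1)ᵀ * (Y t.1)⁻¹ * (((Y t.1)ᵀ)⁻¹ * Y t.1) =
        (Y t.1)ᵀ * (((Y t.1)⁻¹ * ((Y t.1)ᵀ)⁻¹) * Y t.1) := by simp only [mul_assoc]
      _ = (Y t.1)ᵀ * ((((Y t.1)ᵀ)⁻¹ * (Y t.1)⁻¹) * Y t.1) := by
          rw [← Matrix.mul_inv_rev, hYY, Matrix.mul_inv_rev]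
      _ = 1 := by
          rw [mul_assoc, Matrix.nonsing_inv_mul _ (hu t), mul_one, Matrix.mul_nonsing_inv _ hu']
  have hdet : ∀ t : {t : k | p.eval t ≠ 0}, ((Y t.1)ᵀ * (Y t.1)⁻¹).det = 1 := fun t => by
    rw [Matrix.det_mul, Matrix.det_transpose, ← Matrix.det_mul, Matrix.mul_nonsing_inv _ (hu t),
      Matrix.det_one]
  have : Infinite {t : k | p.eval t ≠ 0} := hinf.to_subtype
  refine Set.infinite_of_injective_forall_mem (f := fun t => mkSO _ (horth t) (hdet t)) ?_ (fun t => ?_) hS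
  · intro s t hst
    have h1 : (Y s.1)ᵀ * (Y s.1)⁻¹ = (Y t.1)ᵀ * (Y t.1)⁻¹ := congrArg Subtype.val hst
    -- the Cayley transform determines `t`
    have key : ∀ t : {t : k | p.eval t ≠ 0}, (Y t.1)ᵀ * (Y t.1)⁻¹ = (2 : k) • (Y t.1)⁻¹ - 1 := fun t => by
      rw [← Matrix.mul_nonsing_inv _ (hu t), ← Matrix.one_mul (Y t.1)⁻¹, ← Matrix.smul_mul, Matrix.one_mul,
        ← Matrix.sub_mul, hYT]
      congr 1
      simp only [Y, two_smul]
      abel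
    rw [key, key, sub_left_inj] at h1
    have h3 := congrArg Inv.inv (smul_right_injective _ h2 h1)
    rw [Matrix.nonsing_inv_nonsing_inv _ (hu s), Matrix.nonsing_inv_nonsing_inv _ (hu t)] at h3
    exact Subtype.ext (smul_left_injective k hX0 (add_left_cancel h3))
  · rw [Set.mem_ofPred_eq, Subgroup.mem_centralizer_iff]
    rintro _ ⟨x, rfl⟩
    obtain ⟨h, hh⟩ := proj_surjective (ψ x)
    rw [← hh, ← map_mul, ← map_mul]
    congr 1
    refine Subtype.ext ?_
    change h.1 * ((Y t.1)ᵀ * (Y t.1)⁻¹) = ((Y t.1)ᵀ * (Y t.1)⁻¹) * h.1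
    have c1 : Commute h.1 X := hψ x h hh
    have c2 : Commute h.1 (Y t.1) := (Commute.one_right _).add_right (c1.smul_right _)
    have c3 : Commute h.1 (Y t.1)ᵀ := by rw [hYT]; exact (Commute.one_right _).sub_right (c1.smul_right _)
    have c4 : Commute h.1 (Y t.1)⁻¹ := by
      obtain ⟨u, hu'⟩ := (Matrix.isUnit_iff_isUnit_det _).2 (hu t)
      rw [← hu', ← Matrix.coe_units_inv]
      rw [← hu'] at c2
      exact c2.units_inv_right
    exact (c3.mul_right c4).eq

end Cayley

/-! ### The triple of a regular homomorphism -/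

section RegularHoms

variable {k : Type*} [Field k] {m : ℕ}

theorem card_alt5_ne_zero (S : RootsOfUnity k) : (Nat.card Alt5 : k) ≠ 0 := by
  rw [card_alt5, show ((60 : ℕ) : k) = 2 * 2 * 3 * 5 by norm_num]
  exact mul_ne_zero (mul_ne_zero (mul_ne_zero S.two_ne S.two_ne) S.three_ne) S.five_ne

variable [IsAlgClosed k]

/-- The triple of a regular homomorphism is regular: Scott's lemma for the adjoint representation bounds
the dimensions of the centralizers from above, and the arithmetic of root counts bounds them from below. -/
theorem exists_data_of_isRegularHom (S : RootsOfUnity k) (hm : 4 ≤ m) {ψ : Alt5 →* PSO m k}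
    (hψ : IsRegularHom ψ) :
    ∃ a b a' b' a'' b'' c'', HasData S (tripleOf ψ) a b a' b' a'' b'' c'' ∧
      IsRegularData m a b a' b' a'' b'' c'' := by
  classical
  have h2m : 2 ≤ m := by omega
  have : Infinite k := IsAlgClosed.instInfinite
  obtain ⟨Ad, hAd⟩ := exists_adjoint S.two_ne h2m
  let ρ : Representation k Alt5 (skew k (2 * m)) := Ad.comp ψ
  have hρ : ∀ x h, proj m k h = ψ x → ρ x = adjointSO h := fun x h e => by
    rw [← hAd, e]; rfl
  -- regularity excludes invariants
  have hinv : ρ.invariants = ⊥ := by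
    rw [eq_bot_iff]
    intro X hX
    rw [Submodule.mem_bot]
    by_contra hX0
    refine not_isRegularHom_of_skew S.two_ne h2m X.2 (fun e => hX0 (Subtype.ext e)) (fun x h e => ?_) hψ
    have h1 := congrArg Subtype.val (hX x)
    rw [hρ x h e, coe_adjointSO] at h1
    conv_rhs => rw [← h1]
    rw [mul_assoc, so_transpose_mul, mul_one]
  have hscott := scott_le ρ closure_x2_x3 (card_alt5_ne_zero S)
  have hdim := finrank_skew_le (n := 2 * m) S.two_ne
  rw [hinv, finrank_bot, mul_zero, add_zero] at hscott
  have hdim' : Module.finrank k (skew k (2 * m)) ≤ 2 * m * m - m := by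
    rw [mul_assoc, Nat.mul_sub_one] at hdim
    have := Nat.le_of_mul_le_mul_left hdim two_pos
    rwa [show m * (2 * m) = 2 * m * m by ring] at this
  -- the dimension of the space fixed by an element with given eigenvalues
  have hfix : ∀ {x y : Alt5} {g : SO2 m k} {I : Type} [Fintype I] [DecidableEq I]
      {v : I ⊕ I → Fin (2 * m) → k} {L : I → kˣ}, proj m k g = ψ x → Adapted g.1 v L → y ∈ Subgroup.zpowers x →
      pairCount L ≤ 2 * Module.finrank k (LinearMap.ker (1 - ρ y)) + selfCount L := by
    intro x y g I _ _ v L hx h hy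
    rw [← Submodule.finrank_map_subtype_eq]
    refine pairCount_le_finrank_skew h fun X hX hgX => ⟨⟨X, hX⟩, ?_, rfl⟩
    have h1 : ρ x ⟨X, hX⟩ = ⟨X, hX⟩ := by rw [hρ x g hx]; exact Subtype.ext hgX
    have h3 : ∀ z ∈ Subgroup.zpowers x, ρ z ⟨X, hX⟩ = ⟨X, hX⟩ := by
      intro z hz
      rw [Subgroup.zpowers_eq_closure] at hz
      induction hz using Subgroup.closure_induction with
      | mem z hz => rw [hz]; exact h1
      | one => rw [map_one]; rfl
      | mul a b _ _ ha hb => rw [map_mul, Module.End.mul_apply, hb, ha]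
      | inv a _ ha =>
        nth_rewrite 1 [← ha]
        rw [← Module.End.mul_apply, ← map_mul, inv_mul_cancel, map_one, Module.End.one_apply]
    exact sub_eq_zero.2 (h3 y hy).symm
  obtain ⟨r2, r3, r5, -⟩ := alt5_relations
  obtain ⟨g₂, e₂, hg₂⟩ := exists_lift_sq S.two_ne h2m (x := ψ x2) (by rw [← map_pow, r2, map_one])
  obtain ⟨g₃, e₃, hg₃⟩ := exists_lift_of_odd S.two_ne h2m (x := ψ x3) (N := 3) (by decide)
    (by rw [← map_pow, r3, map_one])
  obtain ⟨g₅, e₅, hg₅⟩ := exists_lift_of_odd S.two_ne h2m (x := ψ x5) (N := 5) (by decide)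
    (by rw [← map_pow, r5, map_one])
  obtain ⟨a', b', t₃⟩ := exists_isType3 S.two_ne S.three_ne S.hω g₃ hg₃
  obtain ⟨a'', b'', c'', t₅⟩ := exists_isType5 S.two_ne S.five_ne S.hζ g₅ hg₅
  obtain ⟨-, v₃, h₃⟩ := id t₃
  obtain ⟨-, v₅, h₅⟩ := id t₅
  have i₃ := hfix e₃ h₃ (Subgroup.mem_zpowers x3)
  have i₅ := hfix e₅ h₅ (y := x2 * x3) (by
    have := inv_mem (Subgroup.mem_zpowers x5)
    rwa [x5, _root_.inv_inv] at this)
  rw [(counts_label3 S.hω a' b').1, (counts_label3 S.hω a' b').2] at i₃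
  rw [(counts_label5 S.hζ a'' b'' c'').1, (counts_label5 S.hζ a'' b'' c'').2] at i₅
  have s₃ := t₃.1
  have s₅ := t₅.1
  have hmm : m ≤ 2 * m * m := by nlinarith
  rcases hg₂ with ⟨a, b, t₂⟩ | ⟨-, t₂⟩
  · obtain ⟨s₂, v₂, h₂⟩ := id t₂
    have i₂ := hfix e₂ h₂ (Subgroup.mem_zpowers x2)
    rw [(counts_label2 S.two_ne a b).1, (counts_label2 S.two_ne a b).2] at i₂
    refine ⟨a, b, a', b', a'', b'', c'', ⟨g₂, g₃, g₅, t₂, t₃, t₅, ?_⟩,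
      isRegularData_of_le hm t₂.1 t₃.1 t₅.1 (by omega)⟩
    rw [e₂, e₃, e₅]
    rfl
  · obtain ⟨i, hi, v₂, h₂⟩ := id t₂
    have i₂ := hfix e₂ h₂ (Subgroup.mem_zpowers x2)
    obtain ⟨p1, p2⟩ := pairCount_const m i (inv_ne_of_sq_eq_neg_one S.two_ne hi)
    rw [p1, p2] at i₂
    refine (not_le_of_isType4 hm t₃.1 t₅.1 ?_).elim
    have : m * (m - 1) + m = m * m := by rw [Nat.mul_sub_one]; have := Nat.le_mul_self m; omega
    omega

end RegularHoms

/-! ### The presentation of `𝒜₅` -/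

section Presentation

variable {P : Type*} [Group P]

/-- The elements of a group generated by `a` and `c` with `a² = c⁵ = (ac)³ = 1`: the cosets of `⟨c⟩` are
those of `1`, of `acʲ`, of `ac²acʲ` and of `ac²ac³a`, as the twelve vertices of the icosahedron. -/
def icosahedralSet (a c : P) : Set P :=
  {x | (∃ i : ℤ, x = c ^ i) ∨ (∃ i j : ℤ, x = c ^ i * a * c ^ j) ∨
    (∃ i j : ℤ, x = c ^ i * (a * c ^ (2 : ℤ) * a) * c ^ j) ∨
    ∃ i : ℤ, x = c ^ i * (a * c ^ (2 : ℤ) * a * c ^ (3 : ℤ) * a)}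

/-- The powers of an element with fifth power `1`. -/
theorem exists_fin_zpow_eq {c : P} (hc : c ^ 5 = 1) (j : ℤ) : ∃ r : Fin 5, c ^ j = c ^ ((r : ℕ) : ℤ) := by
  refine ⟨⟨(j % 5).toNat, by omega⟩, ?_⟩
  have h := Int.emod_add_mul_ediv j 5
  have h1 : ((j % 5).toNat : ℤ) = j % 5 := Int.toNat_of_nonneg (by omega)
  change c ^ j = c ^ ((j % 5).toNat : ℤ)
  rw [h1]
  nth_rewrite 1 [← h]
  rw [_root_.zpow_add, _root_.zpow_mul, show c ^ (5 : ℤ) = 1 by exact_mod_cast hc, _root_.one_zpow, mul_one]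

theorem ncard_icosahedralSet_le {a c : P} (hc : c ^ 5 = 1) :
    (icosahedralSet a c).Finite ∧ (icosahedralSet a c).ncard ≤ 60 := by
  let f : Fin 5 ⊕ (Fin 5 × Fin 5) ⊕ (Fin 5 × Fin 5) ⊕ Fin 5 → P :=
    Sum.elim (fun i => c ^ ((i : ℕ) : ℤ)) (Sum.elim (fun p => c ^ ((p.1 : ℕ) : ℤ) * a * c ^ ((p.2 : ℕ) : ℤ))
      (Sum.elim (fun p => c ^ ((p.1 : ℕ) : ℤ) * (a * c ^ (2 : ℤ) * a) * c ^ ((p.2 : ℕ) : ℤ))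
        fun i => c ^ ((i : ℕ) : ℤ) * (a * c ^ (2 : ℤ) * a * c ^ (3 : ℤ) * a)))
  have hsub : icosahedralSet a c ⊆ Set.range f := by
    rintro x (⟨i, rfl⟩ | ⟨i, j, rfl⟩ | ⟨i, j, rfl⟩ | ⟨i, rfl⟩)
    · obtain ⟨r, hr⟩ := exists_fin_zpow_eq hc i
      exact ⟨Sum.inl r, hr.symm⟩
    · obtain ⟨r, hr⟩ := exists_fin_zpow_eq hc i
      obtain ⟨s, hs⟩ := exists_fin_zpow_eq hc j
      exact ⟨Sum.inr (Sum.inl (r, s)), by rw [hr, hs]; rfl⟩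
    · obtain ⟨r, hr⟩ := exists_fin_zpow_eq hc i
      obtain ⟨s, hs⟩ := exists_fin_zpow_eq hc j
      exact ⟨Sum.inr (Sum.inr (Sum.inl (r, s))), by rw [hr, hs]; rfl⟩
    · obtain ⟨r, hr⟩ := exists_fin_zpow_eq hc i
      exact ⟨Sum.inr (Sum.inr (Sum.inr r)), by rw [hr]; rfl⟩
  refine ⟨(Set.finite_range f).subset hsub, (Set.ncard_le_ncard hsub (Set.finite_range f)).trans ?_⟩
  rw [← Set.image_univ]
  refine (Set.ncard_image_le Set.finite_univ).trans ?_
  rw [Set.ncard_univ, Nat.card_eq_fintype_card]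
  simp

/-- The set of the twelve cosets is stable under right multiplication by the generators. -/
theorem mul_mem_icosahedralSet {a c : P} (ha : a * a = 1) (hc : c ^ 5 = 1) (hac : (a * c) ^ 3 = 1) {x : P}
    (hx : x ∈ icosahedralSet a c) :
    x * a ∈ icosahedralSet a c ∧ ∀ l : ℤ, x * c ^ l ∈ icosahedralSet a c := by
  have ha' : a⁻¹ = a := inv_eq_of_mul_eq_one_left ha
  have haa : ∀ y, a * (a * y) = y := fun y => by rw [← mul_assoc, ha, one_mul]
  have hz : c ^ (5 : ℤ) = 1 := by exact_mod_cast hc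
  -- the relations in the form of rules that rewrite `a cʲ a`, then `d cʲ a`, then `e cʲ`
  have e1 : a * c * a = c⁻¹ * a * c⁻¹ := by
    have h : a * c * a * (c * a * c) = 1 := by
      rw [← hac, _root_.pow_succ, pow_two]
      simp only [mul_assoc]
    have := eq_inv_of_mul_eq_one_left h
    rwa [_root_.mul_inv_rev, _root_.mul_inv_rev, ha', ← mul_assoc] at this
  have e2 : a * c⁻¹ * a = c * a * c := by
    have h := congrArg (fun y => y⁻¹) e1
    simp only [_root_.mul_inv_rev, _root_.inv_inv, ha', ← mul_assoc] at h
    exact h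
  have h3 : c ^ (3 : ℤ) = c⁻¹ * c⁻¹ := by
    have h : c ^ (3 : ℤ) * (c * c) = 1 := by
      rw [← hz]; group
    have := eq_inv_of_mul_eq_one_left h
    rwa [_root_.mul_inv_rev] at this
  have h4 : c ^ (4 : ℤ) = c⁻¹ := eq_inv_of_mul_eq_one_left (by rw [← hz]; group)
  have h2 : c ^ (2 : ℤ) = c * c := _root_.zpow_two c
  -- the representatives of the last two kinds of cosets
  obtain ⟨d, hd⟩ : ∃ d, d = a * c ^ (2 : ℤ) * a := ⟨_, rfl⟩
  obtain ⟨e, he⟩ : ∃ e, e = d * c ^ (3 : ℤ) * a := ⟨_, rfl⟩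
  have hset : icosahedralSet a c = {x | (∃ i : ℤ, x = c ^ i) ∨ (∃ i j : ℤ, x = c ^ i * a * c ^ j) ∨
      (∃ i j : ℤ, x = c ^ i * d * c ^ j) ∨ ∃ i : ℤ, x = c ^ i * e} := by
    rw [he, hd]; rfl
  have e3 : a * c ^ (3 : ℤ) * a = c * d * c := by
    calc a * c ^ (3 : ℤ) * a = (a * c⁻¹ * a) * (a * c⁻¹ * a) := by
          rw [h3]; simp only [mul_assoc, haa]
      _ = _ := by rw [e2, hd, h2]; simp only [mul_assoc]
  have e4 : d * c * a = c⁻¹ * a * (c⁻¹ * c⁻¹) := by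
    calc d * c * a = a * c * (c * (a * c * a)) := by rw [hd, h2]; simp only [mul_assoc]
      _ = a * c * a * c⁻¹ := by
        rw [show c * (a * c * a) = a * c⁻¹ by rw [e1]; simp only [mul_assoc, mul_inv_cancel_left], ← mul_assoc]
      _ = _ := by rw [e1]; simp only [mul_assoc]
  have e5 : d * c⁻¹ * a = c * d * (c * c) := by
    calc d * c⁻¹ * a = a * c ^ (2 : ℤ) * (a * c⁻¹ * a) := by rw [hd]; simp only [mul_assoc]
      _ = a * (c ^ (2 : ℤ) * c ^ (1 : ℤ)) * a * c := by rw [e2, _root_.zpow_one]; simp only [mul_assoc]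
      _ = _ := by rw [← _root_.zpow_add, show (2 : ℤ) + 1 = 3 from rfl, e3]; simp only [mul_assoc]
  have e6 : d * c ^ (2 : ℤ) * a = c⁻¹ * d * c⁻¹ := by
    have h : c⁻¹ * (d * c⁻¹ * a) * a = d * c ^ (2 : ℤ) * a := by
      rw [e5, h2]; simp only [mul_assoc, inv_mul_cancel_left]
    rw [← h]
    simp only [mul_assoc, ha, mul_one]
  have e7 : e * c = c⁻¹ * e := by
    have h : e = c * e * c := by
      calc e = a * c ^ (2 : ℤ) * (a * c ^ (3 : ℤ) * a) := by rw [he, hd]; simp only [mul_assoc]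
        _ = a * (c ^ (2 : ℤ) * c ^ (1 : ℤ)) * d * c := by rw [e3, _root_.zpow_one]; simp only [mul_assoc]
        _ = (a * c ^ (3 : ℤ) * a) * c ^ (2 : ℤ) * a * c := by
          rw [← _root_.zpow_add, show (2 : ℤ) + 1 = 3 from rfl, hd]; simp only [mul_assoc]
        _ = c * (d * (c ^ (1 : ℤ) * c ^ (2 : ℤ)) * a) * c := by rw [e3, _root_.zpow_one]; simp only [mul_assoc]
        _ = c * e * c := by rw [← _root_.zpow_add, show (1 : ℤ) + 2 = 3 from rfl, he]
    nth_rewrite 2 [h]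
    simp only [mul_assoc, inv_mul_cancel_left]
  have e8 : ∀ l : ℤ, e * c ^ l = c ^ (-l) * e := by
    have h : SemiconjBy e c c⁻¹ := e7
    intro l
    have := (h.zpow_right l).eq
    rwa [_root_.inv_zpow, ← _root_.zpow_neg] at this
  rw [hset] at hx ⊢
  have hs1 : ∀ i : ℤ, c ^ (i - 1) = c ^ i * c⁻¹ := fun i => _root_.zpow_sub_one c i
  have ha1 : ∀ i : ℤ, c ^ (i + 1) = c ^ i * c := fun i => _root_.zpow_add_one c i
  have hn1 : c ^ (-1 : ℤ) = c⁻¹ := _root_.zpow_neg_one c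
  rcases hx with ⟨i, rfl⟩ | ⟨i, j, rfl⟩ | ⟨i, j, rfl⟩ | ⟨i, rfl⟩
  · refine ⟨Or.inr (Or.inl ⟨i, 0, by simp⟩), fun l => Or.inl ⟨i + l, (_root_.zpow_add c i l).symm⟩⟩
  · refine ⟨?_, fun l => Or.inr (Or.inl ⟨i, j + l, by rw [_root_.zpow_add]; simp only [mul_assoc]⟩)⟩
    obtain ⟨r, hr⟩ := exists_fin_zpow_eq hc j
    rw [hr]
    have hassoc : ∀ z, c ^ i * a * z * a = c ^ i * (a * z * a) := fun z => by simp only [mul_assoc]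
    rw [hassoc]
    fin_cases r
    · refine Or.inl ⟨i, ?_⟩
      change c ^ i * (a * c ^ (0 : ℤ) * a) = _
      rw [_root_.zpow_zero, mul_one, ha, mul_one]
    · refine Or.inr (Or.inl ⟨i - 1, -1, ?_⟩)
      change c ^ i * (a * c ^ (1 : ℤ) * a) = _
      rw [_root_.zpow_one, e1, hs1, hn1]
      simp only [mul_assoc]
    · refine Or.inr (Or.inr (Or.inl ⟨i, 0, ?_⟩))
      change c ^ i * (a * c ^ (2 : ℤ) * a) = _
      rw [← hd, _root_.zpow_zero, mul_one]
    · refine Or.inr (Or.inr (Or.inl ⟨i + 1, 1, ?_⟩))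
      change c ^ i * (a * c ^ (3 : ℤ) * a) = _
      rw [e3, ha1, _root_.zpow_one]
      simp only [mul_assoc]
    · refine Or.inr (Or.inl ⟨i + 1, 1, ?_⟩)
      change c ^ i * (a * c ^ (4 : ℤ) * a) = _
      rw [h4, e2, ha1, _root_.zpow_one]
      simp only [mul_assoc]
  · refine ⟨?_, fun l => Or.inr (Or.inr (Or.inl ⟨i, j + l, by rw [_root_.zpow_add]; simp only [mul_assoc]⟩))⟩
    obtain ⟨r, hr⟩ := exists_fin_zpow_eq hc j
    rw [hr]
    have hassoc : ∀ z, c ^ i * d * z * a = c ^ i * (d * z * a) := fun z => by simp only [mul_assoc]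
    rw [hassoc]
    fin_cases r
    · refine Or.inr (Or.inl ⟨i, 2, ?_⟩)
      change c ^ i * (d * c ^ (0 : ℤ) * a) = _
      rw [_root_.zpow_zero, mul_one, hd]
      simp only [mul_assoc, ha, mul_one]
    · refine Or.inr (Or.inl ⟨i - 1, -2, ?_⟩)
      change c ^ i * (d * c ^ (1 : ℤ) * a) = _
      rw [_root_.zpow_one, e4, hs1, _root_.zpow_neg, h2, _root_.mul_inv_rev]
      simp only [mul_assoc]
    · refine Or.inr (Or.inr (Or.inl ⟨i - 1, -1, ?_⟩))
      change c ^ i * (d * c ^ (2 : ℤ) * a) = _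
      rw [e6, hs1, hn1]
      simp only [mul_assoc]
    · refine Or.inr (Or.inr (Or.inr ⟨i, ?_⟩))
      change c ^ i * (d * c ^ (3 : ℤ) * a) = _
      rw [he]
    · refine Or.inr (Or.inr (Or.inl ⟨i + 1, 2, ?_⟩))
      change c ^ i * (d * c ^ (4 : ℤ) * a) = _
      rw [h4, e5, ha1, h2]
      simp only [mul_assoc]
  · refine ⟨Or.inr (Or.inr (Or.inl ⟨i, 3, ?_⟩)), fun l => Or.inr (Or.inr (Or.inr ⟨i - l, ?_⟩))⟩
    · rw [he]
      simp only [mul_assoc, ha, mul_one]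
    · rw [mul_assoc, e8, ← mul_assoc, ← _root_.zpow_add, sub_eq_add_neg]

/-- The group with presentation `a² = b³ = (ab)⁵ = 1` is `𝒜₅`. -/
theorem exists_hom_of_relations {a b : P} (ha : a ^ 2 = 1) (hb : b ^ 3 = 1) (hab : (a * b) ^ 5 = 1) :
    ∃ f : Alt5 →* P, f x2 = a ∧ f x3 = b := by
  -- the subgroup of `𝒜₅ × P` that will be the graph of the homomorphism
  let A : Alt5 × P := (x2, a)
  let B : Alt5 × P := (x3, b)
  obtain ⟨r2, r3, r5, -⟩ := alt5_relations
  have r5' : (x2 * x3) ^ 5 = 1 := by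
    rw [x5, _root_.inv_pow, inv_eq_one] at r5
    exact r5
  have hA : A * A = 1 := Prod.ext ((pow_two x2).symm.trans r2) ((pow_two a).symm.trans ha)
  have hB : B ^ 3 = 1 := Prod.ext r3 hb
  have hC : (A * B) ^ 5 = 1 := Prod.ext r5' hab
  have hAC : A * (A * B) = B := by rw [← mul_assoc, hA, one_mul]
  let Γ := Subgroup.closure {A, B}
  -- the coset enumeration bounds the order of the graph by `60`
  have hΓ : (Γ : Set (Alt5 × P)) ⊆ icosahedralSet A (A * B) := by
    have hstep : ∀ x ∈ icosahedralSet A (A * B), x * A ∈ icosahedralSet A (A * B) ∧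
        x * B ∈ icosahedralSet A (A * B) ∧ x * B⁻¹ ∈ icosahedralSet A (A * B) := by
      intro x hx
      have h0 := fun {y} hy => mul_mem_icosahedralSet (x := y) hA hC (by rw [hAC]; exact hB) hy
      obtain ⟨h1, h2⟩ := h0 hx
      refine ⟨h1, ?_, ?_⟩
      · have := (h0 h1).2 1
        rwa [_root_.zpow_one, mul_assoc, hAC] at this
      · have := (h0 (h2 (-1))).1
        rwa [_root_.zpow_neg, _root_.zpow_one, _root_.mul_inv_rev, mul_assoc, mul_assoc, inv_mul_cancel, mul_one] at this
    intro x hx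
    replace hx : x ∈ Subgroup.closure {A, B} := hx
    induction hx using Subgroup.closure_induction_right with
    | one => exact Or.inl ⟨0, (_root_.zpow_zero _).symm⟩
    | mul_right x hx y hy ih =>
      rcases hy with rfl | rfl
      · exact (hstep x ih).1
      · exact (hstep x ih).2.1
    | mul_inv_cancel x hx y hy ih =>
      rcases hy with rfl | rfl
      · rw [inv_eq_of_mul_eq_one_left hA]
        exact (hstep x ih).1
      · exact (hstep x ih).2.2
  obtain ⟨hfin, hcard⟩ := ncard_icosahedralSet_le (a := A) hC
  have : Finite Γ := hfin.subset hΓ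
  have hcardΓ : Nat.card Γ ≤ 60 := (Set.ncard_le_ncard hΓ hfin).trans hcard
  let π : Γ →* Alt5 := (MonoidHom.fst Alt5 P).comp Γ.subtype
  have mA : A ∈ Γ := Subgroup.subset_closure (Set.mem_insert _ _)
  have mB : B ∈ Γ := Subgroup.subset_closure (Set.mem_insert_of_mem _ rfl)
  have hsurj : Function.Surjective π := by
    rw [← MonoidHom.range_eq_top, eq_top_iff, ← closure_x2_x3, Subgroup.closure_le]
    rintro x (rfl | rfl)
    · exact ⟨⟨A, mA⟩, rfl⟩
    · exact ⟨⟨B, mB⟩, rfl⟩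
  -- hence the first projection of the graph is bijective
  have hbij : Function.Bijective π := by
    refine (Nat.bijective_iff_surjective_and_card π).2 ⟨hsurj, le_antisymm ?_ ?_⟩
    · rw [card_alt5]; exact hcardΓ
    · exact Nat.card_le_card_of_surjective π hsurj
  let e := MulEquiv.ofBijective π hbij
  refine ⟨((MonoidHom.snd Alt5 P).comp Γ.subtype).comp e.symm.toMonoidHom, ?_, ?_⟩
  · have : e.symm x2 = ⟨A, mA⟩ := e.symm_apply_eq.2 rfl
    change (e.symm x2).1.2 = a
    rw [this]
  · have : e.symm x3 = ⟨B, mB⟩ := e.symm_apply_eq.2 rfl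
    change (e.symm x3).1.2 = b
    rw [this]

end Presentation

/-! ### Lifting regular homomorphisms to `SO_{2m}` -/

section Lifting

variable {k : Type*} [Field k] [IsAlgClosed k] {m : ℕ}

/-- Every regular homomorphism lifts to `SO_{2m}`: the involution lifts to an involution by the
classification of the data, and its sign can be adjusted to satisfy the relations of `𝒜₅`. -/
theorem exists_lift_of_isRegularHom (S : RootsOfUnity k) (hm : 4 ≤ m) {ψ : Alt5 →* PSO m k}
    (hψ : IsRegularHom ψ) : ∃ ρ : Alt5 →* SO2 m k, ψ = (proj m k).comp ρ := by
  have h2m : 2 ≤ m := by omega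
  obtain ⟨a, b, a', b', a'', b'', c'', ⟨g₂, g₃, g₅, t₂, t₃, t₅, hC⟩, -⟩ := exists_data_of_isRegularHom S hm hψ
  have c2 := ConjClasses.mk_eq_mk_iff_isConj.1 (congrArg ClassTriple.C2 hC)
  have c3 := ConjClasses.mk_eq_mk_iff_isConj.1 (congrArg ClassTriple.C3 hC)
  obtain ⟨y₂, i₂, e₂⟩ := exists_isConj_of_isConj_proj c2.symm
  obtain ⟨y₃, i₃, e₃⟩ := exists_isConj_of_isConj_proj c3.symm
  have s₂ : y₂ ^ 2 = 1 := Subtype.ext (t₂.of_isConj i₂).sq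
  have s₃ : y₃ ^ 3 = 1 := Subtype.ext ((t₃.of_isConj i₃).pow S.hω)
  have r5' : (x2 * x3) ^ 5 = 1 := by
    have r5 := alt5_relations.2.2.1
    rw [x5, _root_.inv_pow, inv_eq_one] at r5
    exact r5
  have hfinish : ∀ z₂ : SO2 m k, proj m k z₂ = ψ x2 → z₂ ^ 2 = 1 → (z₂ * y₃) ^ 5 = 1 →
      ∃ ρ : Alt5 →* SO2 m k, ψ = (proj m k).comp ρ := by
    intro z₂ h1 h2 h5
    obtain ⟨ρ, hρ2, hρ3⟩ := exists_hom_of_relations h2 s₃ h5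
    refine ⟨ρ, alt5_hom_ext ?_ ?_⟩
    · rw [MonoidHom.comp_apply, hρ2, h1]
    · rw [MonoidHom.comp_apply, hρ3, e₃]
  -- the product of the lifts has fifth power `1` or `-1`; in the second case the sign of the lift
  -- of `x₂` is changed
  have h5 : proj m k ((y₂ * y₃) ^ 5) = 1 := by
    rw [map_pow, map_mul, e₂, e₃, ← map_mul, ← map_pow, r5', map_one]
  rcases (proj_eq_one_iff S.two_ne h2m _).1 h5 with h | h
  · exact hfinish y₂ e₂ s₂ (Subtype.ext h)
  · refine hfinish (negOneSO * y₂) ((proj_negOneSO_mul S.two_ne h2m y₂).trans e₂) (Subtype.ext ?_) (Subtype.ext ?_)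
    · rw [SO2.coe_pow, coe_negOneSO_mul, neg_sq, ← SO2.coe_pow, s₂]
    · rw [mul_assoc, SO2.coe_pow, coe_negOneSO_mul, Odd.neg_pow (by decide), ← SO2.coe_pow, h, neg_neg]
      rfl

end Lifting

/-! ### Irreducible orthogonal representations of `𝒜₅` -/

section OrthogonalReps

variable {k : Type*} [Field k]

/-- A homomorphism from `𝒜₅` to a commutative monoid is trivial. -/
theorem alt5_hom_comm {P : Type*} [CommMonoid P] (f : Alt5 →* P) (x : Alt5) : f x = 1 := by
  have h2 : f x2 * f x2 = 1 := by rw [← map_mul, ← pow_two, alt5_relations.1, map_one]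
  have h3 : f x3 * f x3 * f x3 = 1 := by
    rw [← map_mul, ← map_mul, ← pow_two, ← _root_.pow_succ, alt5_relations.2.1, map_one]
  have h5 : (f x2 * f x3) ^ 5 = 1 := by
    rw [← map_mul, ← map_pow, show (x2 * x3) ^ 5 = 1 from by
      have r5 := alt5_relations.2.2.1
      rwa [x5, _root_.inv_pow, inv_eq_one] at r5, map_one]
  -- in a commutative monoid, the relations give `f(x₂) f(x₃)² = 1`, and then `f(x₂) = f(x₃)`
  have e : f x2 * (f x3 * f x3) = 1 := by
    rw [mul_pow] at h5
    calc f x2 * (f x3 * f x3) = (f x2 * f x2) * (f x2 * f x2) * f x2 * ((f x3 * f x3 * f x3) * (f x3 * f x3)) := by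
          rw [h2, h3]; simp
      _ = f x2 ^ 5 * f x3 ^ 5 := by simp only [_root_.pow_succ, _root_.pow_zero, one_mul, mul_assoc]
      _ = 1 := h5
  have e' : f x2 = f x3 := by
    calc f x2 = f x2 * (f x3 * f x3 * f x3) := by rw [h3, mul_one]
      _ = f x2 * (f x3 * f x3) * f x3 := by simp only [mul_assoc]
      _ = f x3 := by rw [e, one_mul]
  have e3 : f x3 = 1 := by
    rw [e', ← mul_assoc, ← e', h2, one_mul] at e
    exact e' ▸ e
  have : f = 1 := alt5_hom_ext (e'.trans e3) e3
  rw [this]; rfl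

/-- Two lifts of the same homomorphism to `SO_{2m}` agree, `𝒜₅` being generated by elements of odd order. -/
theorem lift_unique {m : ℕ} (h2 : (2 : k) ≠ 0) (hm : 2 ≤ m) {ρ ρ' : Alt5 →* SO2 m k}
    (h : (proj m k).comp ρ = (proj m k).comp ρ') : ρ = ρ' := by
  have hodd : ∀ (x : Alt5) (N : ℕ), Odd N → x ^ N = 1 → ρ x = ρ' x := by
    intro x N hN hx
    rcases (proj_eq_proj_iff h2 hm (ρ' x) (ρ x)).1 (DFunLike.congr_fun h x).symm with e | e
    · exact Subtype.ext e
    · exfalso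
      have h1 : (ρ x).1 ^ N = 1 := by rw [← SO2.coe_pow, ← map_pow, hx, map_one]; rfl
      have h3 : (ρ' x).1 ^ N = 1 := by rw [← SO2.coe_pow, ← map_pow, hx, map_one]; rfl
      rw [e, hN.neg_pow, h3] at h1
      have := congrFun (congrFun h1 ⟨0, by omega⟩) ⟨0, by omega⟩
      rw [Matrix.neg_apply, Matrix.one_apply_eq] at this
      exact h2 (by linear_combination -this)
  obtain ⟨-, r3, r5, r⟩ := alt5_relations
  have e3 := hodd x3 3 (by decide) r3
  have e5 := hodd x5 5 (by decide) r5
  refine alt5_hom_ext ?_ e3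
  have : x2 = x5⁻¹ * x3⁻¹ := by
    rw [← _root_.mul_inv_rev]
    exact eq_inv_of_mul_eq_one_left (by rw [← mul_assoc]; exact r)
  rw [this, map_mul, map_mul, map_inv, map_inv, map_inv, map_inv, e3, e5]

variable (k) in
/-- An orthogonal matrix representation of `𝒜₅` of degree `d > 0` with scalar commutant. -/
structure OrthIrrep (d : ℕ) where
  /-- the representing matrices -/
  S : Alt5 →* Matrix (Fin d) (Fin d) k
  orth : ∀ x, S x * (S x)ᵀ = 1
  scalar : ∀ X : Matrix (Fin d) (Fin d) k, (∀ x, S x * X = X * S x) → ∃ c : k, X = c • 1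
  pos : 0 < d

variable {n d e : ℕ}

theorem OrthIrrep.orth' (T : OrthIrrep k d) (x : Alt5) : (T.S x)ᵀ * T.S x = 1 :=
  mul_eq_one_comm.1 (T.orth x)

/-- The intertwining matrices between two matrix representations of `𝒜₅`. -/
def intertwiners (σ : Alt5 →* Matrix (Fin d) (Fin d) k) (ρ : Alt5 →* Matrix (Fin n) (Fin n) k) :
    Submodule k (Matrix (Fin n) (Fin d) k) where
  carrier := {M | ∀ x, ρ x * M = M * σ x}
  zero_mem' := by intro x; simp
  add_mem' := by intro M N hM hN x; rw [Matrix.mul_add, Matrix.add_mul, hM x, hN x]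
  smul_mem' := by intro c M hM x; rw [Matrix.mul_smul, Matrix.smul_mul, hM x]

theorem transpose_mul_of_mem {σ : Alt5 →* Matrix (Fin d) (Fin d) k} {ρ : Alt5 →* Matrix (Fin n) (Fin n) k}
    (hσ : ∀ x, σ x * (σ x)ᵀ = 1) (hρ : ∀ x, ρ x * (ρ x)ᵀ = 1) {M : Matrix (Fin n) (Fin d) k}
    (hM : M ∈ intertwiners σ ρ) : Mᵀ ∈ intertwiners ρ σ := by
  intro x
  have h := congrArg (fun X => (ρ x)ᵀ * X * (σ x)ᵀ) (hM x)
  beta_reduce at h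
  rw [← Matrix.mul_assoc, mul_eq_one_comm.1 (hρ x), Matrix.one_mul, ← Matrix.mul_assoc, Matrix.mul_assoc ((ρ x)ᵀ * M),
    hσ, Matrix.mul_one] at h
  have h' := congrArg Matrix.transpose h
  rw [Matrix.transpose_mul, Matrix.transpose_mul, Matrix.transpose_transpose, Matrix.transpose_transpose] at h'
  exact h'

theorem mul_mem_intertwiners {l : ℕ} {σ : Alt5 →* Matrix (Fin d) (Fin d) k} {ρ : Alt5 →* Matrix (Fin n) (Fin n) k}
    {τ : Alt5 →* Matrix (Fin l) (Fin l) k} {M : Matrix (Fin n) (Fin d) k} {N : Matrix (Fin d) (Fin l) k}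
    (hM : M ∈ intertwiners σ ρ) (hN : N ∈ intertwiners τ σ) : M * N ∈ intertwiners τ ρ := fun x => by
  rw [← Matrix.mul_assoc, hM x, Matrix.mul_assoc, hN x, Matrix.mul_assoc]

/-- Averaging over the group gives intertwiners. -/
theorem sum_mem_intertwiners {σ : Alt5 →* Matrix (Fin d) (Fin d) k} {ρ : Alt5 →* Matrix (Fin n) (Fin n) k}
    (hσ : ∀ x, σ x * (σ x)ᵀ = 1) (E : Matrix (Fin n) (Fin d) k) :
    ∑ x, ρ x * E * (σ x)ᵀ ∈ intertwiners σ ρ := by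
  intro y
  rw [Matrix.mul_sum, Matrix.sum_mul, ← Equiv.sum_comp (Equiv.mulLeft y) fun x => ρ x * E * (σ x)ᵀ * σ y]
  refine Finset.sum_congr rfl fun x _ => ?_
  have h : (σ (y * x))ᵀ * σ y = (σ x)ᵀ := by
    rw [map_mul, Matrix.transpose_mul, Matrix.mul_assoc, mul_eq_one_comm.1 (hσ y), Matrix.mul_one]
  change _ = ρ (y * x) * E * (σ (y * x))ᵀ * σ y
  rw [Matrix.mul_assoc _ _ (σ y), h, map_mul]
  simp only [Matrix.mul_assoc]

/-- If an irreducible orthogonal representation occurs in an orthogonal representation, it occurs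
isometrically. -/
theorem OrthIrrep.exists_isometry [IsAlgClosed k] (h2 : (2 : k) ≠ 0) (hG : (Nat.card Alt5 : k) ≠ 0) (T : OrthIrrep k d)
    {ρ : Alt5 →* Matrix (Fin n) (Fin n) k} (hρ : ∀ x, ρ x * (ρ x)ᵀ = 1) {M : Matrix (Fin n) (Fin d) k}
    (hM : M ∈ intertwiners T.S ρ) (hM0 : M ≠ 0) : ∃ N ∈ intertwiners T.S ρ, Nᵀ * N = 1 := by
  by_contra! hno
  have hsc : ∀ A ∈ intertwiners T.S ρ, ∀ B ∈ intertwiners T.S ρ, ∃ c : k, Aᵀ * B = c • 1 := fun A hA B hB =>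
    T.scalar _ (mul_mem_intertwiners (transpose_mul_of_mem T.orth hρ hA) hB)
  -- the scalar form `NᵀN` vanishes identically, since otherwise `N` could be normalized
  have hnull : ∀ N ∈ intertwiners T.S ρ, Nᵀ * N = 0 := by
    intro N hN
    obtain ⟨c, hc⟩ := hsc N hN N hN
    by_cases hc0 : c = 0
    · rw [hc, hc0, zero_smul]
    · exfalso
      obtain ⟨s, hs⟩ := IsAlgClosed.exists_pow_nat_eq (c⁻¹) (n := 2) two_pos
      refine hno (s • N) (Submodule.smul_mem _ _ hN) ?_
      rw [Matrix.transpose_smul, Matrix.smul_mul, Matrix.mul_smul, hc, smul_smul, smul_smul, ← pow_two, hs,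
        inv_mul_cancel₀ hc0, one_smul]
  -- by polarization, `MᵀN` vanishes for all intertwiners `N`
  have hnull2 : ∀ N ∈ intertwiners T.S ρ, Mᵀ * N = 0 := by
    intro N hN
    obtain ⟨c, hc⟩ := hsc M hM N hN
    have hc' : Nᵀ * M = c • 1 := by
      rw [← Matrix.transpose_transpose (Nᵀ * M), Matrix.transpose_mul, Matrix.transpose_transpose, hc]
      simp
    have h := hnull _ (Submodule.add_mem _ hM hN)
    rw [Matrix.transpose_add, Matrix.add_mul, Matrix.mul_add, Matrix.mul_add, hnull M hM, hnull N hN, hc, hc', zero_add,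
      add_zero, ← two_smul k, smul_smul] at h
    have h0 := congrFun (congrFun h ⟨0, T.pos⟩) ⟨0, T.pos⟩
    rw [Matrix.smul_apply, Matrix.one_apply_eq, smul_eq_mul, mul_one, Matrix.zero_apply] at h0
    rw [hc, (mul_eq_zero.1 h0).resolve_left h2, zero_smul]
  apply hM0
  ext i j
  -- averages of elementary matrices are intertwiners, and the traces recover the entries of `M`
  have h := congrArg Matrix.trace (hnull2 _ (sum_mem_intertwiners (ρ := ρ) T.orth (Matrix.single i j (1 : k))))
  rw [Matrix.mul_sum, Matrix.trace_sum, Matrix.trace_zero] at h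
  have hterm : ∀ x, (Mᵀ * (ρ x * Matrix.single i j (1 : k) * (T.S x)ᵀ)).trace = M i j := by
    intro x
    have hx := (transpose_mul_of_mem T.orth hρ hM) x
    rw [← Matrix.mul_assoc, ← Matrix.mul_assoc, ← hx, Matrix.trace_mul_comm, ← Matrix.mul_assoc, ← Matrix.mul_assoc, T.orth',
      Matrix.one_mul, Matrix.trace_mul_single]
    simp
  rw [Finset.sum_congr rfl fun x _ => hterm x, Finset.sum_const, Finset.card_univ, ← Nat.card_eq_fintype_card,
    nsmul_eq_mul] at h
  exact (mul_eq_zero.1 h).resolve_left hG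

theorem ne_zero_of_transpose_mul_self {N : Matrix (Fin n) (Fin d) k} (hd : 0 < d) (hN : Nᵀ * N = 1) : N ≠ 0 := by
  rintro rfl
  rw [Matrix.mul_zero] at hN
  have := congrFun (congrFun hN ⟨0, hd⟩) ⟨0, hd⟩
  rw [Matrix.one_apply_eq] at this
  exact one_ne_zero this.symm

/-- Irreducible representations with different characters have no nonzero intertwiners. -/
theorem OrthIrrep.intertwiner_eq_zero [IsAlgClosed k] (h2 : (2 : k) ≠ 0) (hG : (Nat.card Alt5 : k) ≠ 0)
    (T : OrthIrrep k d) (T' : OrthIrrep k e) (hne : ∃ x, (T.S x).trace ≠ (T'.S x).trace) {M : Matrix (Fin e) (Fin d) k}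
    (hM : M ∈ intertwiners T.S T'.S) : M = 0 := by
  by_contra hM0
  obtain ⟨N, hN, h1⟩ := T.exists_isometry h2 hG T'.orth hM hM0
  obtain ⟨c, hc⟩ := T'.scalar (N * Nᵀ) (mul_mem_intertwiners hN (transpose_mul_of_mem T.orth T'.orth hN))
  have hc1 : c = 1 := by
    have h : N * Nᵀ * N = c • N := by rw [hc, Matrix.smul_mul, Matrix.one_mul]
    rw [Matrix.mul_assoc, h1, Matrix.mul_one] at h
    have h3 : (1 - c) • N = 0 := by rw [sub_smul, one_smul, ← h, sub_self]
    exact (sub_eq_zero.1 ((smul_eq_zero.1 h3).resolve_right (ne_zero_of_transpose_mul_self T.pos h1))).symm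
  obtain ⟨x, hx⟩ := hne
  apply hx
  calc (T.S x).trace = (T.S x * (Nᵀ * N)).trace := by rw [h1, Matrix.mul_one]
    _ = (N * T.S x * Nᵀ).trace := by rw [← Matrix.mul_assoc, Matrix.trace_mul_comm, ← Matrix.mul_assoc]
    _ = (T'.S x * (N * Nᵀ)).trace := by rw [← hN x, Matrix.mul_assoc]
    _ = (T'.S x).trace := by rw [hc, hc1, one_smul, Matrix.mul_one]

end OrthogonalReps

/-! ### Orthogonal sums -/

section Decompositions

variable {k : Type*} [Field k] {n m d : ℕ}

/-- The matrix representation afforded by a homomorphism to the special orthogonal group. -/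
abbrev matRep (ρ : Alt5 →* SO2 m k) : Alt5 →* Matrix (Fin (2 * m)) (Fin (2 * m)) k :=
  (Matrix.specialOrthogonalGroup (Fin (2 * m)) k).subtype.comp ρ

theorem matRep_orth (ρ : Alt5 →* SO2 m k) (x : Alt5) : matRep ρ x * (matRep ρ x)ᵀ = 1 := so_mul_transpose _

/-- A decomposition of an orthogonal representation as an orthogonal sum of irreducible orthogonal
representations, given by the isometries `N i` onto the summands. -/
structure Decomposition (ρ : Alt5 →* Matrix (Fin n) (Fin n) k) {ι : Type*} [Fintype ι] {d : ι → ℕ}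
    (S : ∀ i, OrthIrrep k (d i)) where
  /-- the isometry onto a summand -/
  N : ∀ i, Matrix (Fin n) (Fin (d i)) k
  mem : ∀ i, N i ∈ intertwiners (S i).S ρ
  self : ∀ i, (N i)ᵀ * N i = 1
  ne : ∀ i j, i ≠ j → (N i)ᵀ * N j = 0
  sum : ∑ i, N i * (N i)ᵀ = 1

variable {ι : Type*} [Fintype ι] {e : ι → ℕ} {S : ∀ i, OrthIrrep k (e i)}

/-- Block diagonal matrices multiply block by block. -/
theorem sum_blocks_mul [DecidableEq ι] {N : ∀ i, Matrix (Fin n) (Fin (e i)) k} (self : ∀ i, (N i)ᵀ * N i = 1)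
    (ne : ∀ i j, i ≠ j → (N i)ᵀ * N j = 0) (A B : ∀ i, Matrix (Fin (e i)) (Fin (e i)) k) :
    (∑ i, N i * A i * (N i)ᵀ) * ∑ i, N i * B i * (N i)ᵀ = ∑ i, N i * (A i * B i) * (N i)ᵀ := by
  rw [Matrix.sum_mul]
  refine Finset.sum_congr rfl fun i _ => ?_
  rw [Matrix.mul_sum, Finset.sum_eq_single i]
  · calc N i * A i * (N i)ᵀ * (N i * B i * (N i)ᵀ) = N i * A i * ((N i)ᵀ * N i) * B i * (N i)ᵀ := by
          simp only [Matrix.mul_assoc]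
      _ = _ := by rw [self, Matrix.mul_one]; simp only [Matrix.mul_assoc]
  · intro j _ hj
    calc N i * A i * (N i)ᵀ * (N j * B j * (N j)ᵀ) = N i * A i * ((N i)ᵀ * N j) * B j * (N j)ᵀ := by
          simp only [Matrix.mul_assoc]
      _ = _ := by rw [ne i j (Ne.symm hj)]; simp
  · simp

/-- The orthogonal sum of irreducible orthogonal representations, as a homomorphism to `SO_{2m}`: the
determinants are `1` since `𝒜₅` is perfect. -/
theorem exists_decomposition (S : ∀ i, OrthIrrep k (e i)) (h : ∑ i, e i = 2 * m) :
    ∃ ρ : Alt5 →* SO2 m k, Nonempty (Decomposition (matRep ρ) S) := by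
  classical
  -- the isometries are the inclusions of consecutive blocks of coordinates
  let E : (Σ i, Fin (e i)) ≃ Fin (2 * m) := Fintype.equivFinOfCardEq (by simp [h])
  let N : ∀ i, Matrix (Fin (2 * m)) (Fin (e i)) k := fun i => Matrix.of fun t r => if E ⟨i, r⟩ = t then 1 else 0
  have hN : ∀ i j r s, ((N i)ᵀ * N j) r s = if E ⟨i, r⟩ = E ⟨j, s⟩ then 1 else 0 := by
    intro i j r s
    rw [Matrix.mul_apply, Finset.sum_eq_single (E ⟨i, r⟩)]
    · simp [N, eq_comm]
    · intro t _ ht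
      simp [N, ht.symm]
    · simp
  have self : ∀ i, (N i)ᵀ * N i = 1 := by
    intro i
    ext r s
    rw [hN, Matrix.one_apply]
    simp
  have ne : ∀ i j, i ≠ j → (N i)ᵀ * N j = 0 := by
    intro i j hij
    ext r s
    rw [hN, if_neg]
    · rfl
    · intro h
      exact hij (congrArg Sigma.fst (E.injective h))
  have sum : ∑ i, N i * (N i)ᵀ = 1 := by
    ext a b
    obtain ⟨⟨i, r⟩, rfl⟩ := E.surjective a
    rw [Matrix.sum_apply, Finset.sum_eq_single i, Matrix.mul_apply, Finset.sum_eq_single r]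
    · simp [N, Matrix.one_apply]
    · intro s _ hs
      simp [N, hs]
    · simp
    · intro j _ hj
      rw [Matrix.mul_apply]
      refine Finset.sum_eq_zero fun s _ => ?_
      simp [N, hj]
    · simp
  let R : Alt5 →* Matrix (Fin (2 * m)) (Fin (2 * m)) k :=
    { toFun := fun x => ∑ i, N i * (S i).S x * (N i)ᵀ
      map_one' := by simpa using sum
      map_mul' := fun x y => by
        rw [sum_blocks_mul self ne]
        simp }
  have hR : ∀ x, R x = ∑ i, N i * (S i).S x * (N i)ᵀ := fun _ => rfl
  have hRT : ∀ x, R x * (R x)ᵀ = 1 := by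
    intro x
    have : (R x)ᵀ = ∑ i, N i * ((S i).S x)ᵀ * (N i)ᵀ := by
      rw [hR, Matrix.transpose_sum]
      simp [Matrix.mul_assoc]
    rw [this, hR, sum_blocks_mul self ne]
    simp only [(S _).orth, Matrix.mul_one, sum]
  have hdet : ∀ x, (R x).det = 1 := fun x => alt5_hom_comm ((Matrix.detMonoidHom).comp R) x
  refine ⟨{ toFun := fun x => mkSO (R x) (hRT x) (hdet x), map_one' := Subtype.ext (map_one R),
            map_mul' := fun x y => Subtype.ext (map_mul R x y) }, ⟨⟨N, fun i x => ?_, self, ne, sum⟩⟩⟩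
  change R x * N i = _
  rw [hR, Matrix.sum_mul, Finset.sum_eq_single i]
  · rw [Matrix.mul_assoc, self, Matrix.mul_one]
  · intro j _ hj
    rw [Matrix.mul_assoc, ne j i hj, Matrix.mul_zero]
  · simp

theorem Decomposition.trace {ρ : Alt5 →* Matrix (Fin n) (Fin n) k} (D : Decomposition ρ S) (x : Alt5) :
    (ρ x).trace = ∑ i, ((S i).S x).trace := by
  rw [← Matrix.mul_one (ρ x), ← D.sum, Matrix.mul_sum, Matrix.trace_sum]
  refine Finset.sum_congr rfl fun i _ => ?_
  rw [← Matrix.mul_assoc, D.mem i x, Matrix.trace_mul_comm, ← Matrix.mul_assoc, D.self, Matrix.one_mul]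

variable [IsAlgClosed k]

/-- An orthogonal sum of distinct irreducible orthogonal representations is regular: its centralizer consists of
elements acting by a sign on each summand. -/
theorem Decomposition.isRegularHom (h2 : (2 : k) ≠ 0) (hm : 2 ≤ m) (hG : (Nat.card Alt5 : k) ≠ 0)
    (hS : ∀ i j, i ≠ j → ∃ x, ((S i).S x).trace ≠ ((S j).S x).trace)
    {ρ : Alt5 →* SO2 m k} (D : Decomposition (matRep ρ) S) : IsRegularHom ((proj m k).comp ρ) := by
  classical
  rw [isRegularHom_iff_finite h2 hm]
  have hmain : ∀ h : SO2 m k, proj m k h ∈ Subgroup.centralizer (((proj m k).comp ρ).range : Set (PSO m k)) →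
      ∃ c : ι → ({1, -1} : Set k), h.1 = ∑ i, (c i : k) • (D.N i * (D.N i)ᵀ) := by
    intro h hh
    -- the conjugate of `ρ` by `h` is another lift, hence equal to `ρ`
    have hcomm : ∀ x, h.1 * matRep ρ x = matRep ρ x * h.1 := by
      have h1 : (proj m k).comp ((MulAut.conj h).toMonoidHom.comp ρ) = (proj m k).comp ρ := by
        ext x
        have := Subgroup.mem_centralizer_iff.1 hh _ ⟨x, rfl⟩
        change proj m k (h * ρ x * h⁻¹) = _
        rw [map_mul, map_mul, ← show proj m k (ρ x) * proj m k h = proj m k h * proj m k (ρ x) from this, map_inv,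
          mul_assoc, mul_inv_cancel, mul_one]
        rfl
      intro x
      have h3 := DFunLike.congr_fun (lift_unique h2 hm h1) x
      exact congrArg Subtype.val (mul_inv_eq_iff_eq_mul.1 (show h * ρ x * h⁻¹ = ρ x from h3))
    have hmem : h.1 ∈ intertwiners (matRep ρ) (matRep ρ) := fun x => (hcomm x).symm
    have hblock : ∀ i j, (D.N j)ᵀ * h.1 * D.N i ∈ intertwiners (S i).S (S j).S := fun i j =>
      mul_mem_intertwiners (mul_mem_intertwiners (transpose_mul_of_mem (S j).orth (matRep_orth ρ) (D.mem j)) hmem) (D.mem i)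
    choose c hc using fun i => (S i).scalar _ (hblock i i)
    have hcol : ∀ i, h.1 * D.N i = c i • D.N i := by
      intro i
      rw [← Matrix.one_mul (h.1 * D.N i), ← D.sum, Matrix.sum_mul, Finset.sum_eq_single i]
      · rw [Matrix.mul_assoc, ← Matrix.mul_assoc (D.N i)ᵀ, hc, Matrix.mul_smul, Matrix.mul_one]
      · intro j _ hj
        rw [Matrix.mul_assoc, ← Matrix.mul_assoc (D.N j)ᵀ, (S i).intertwiner_eq_zero h2 hG (S j) (hS i j hj.symm) (hblock i j), Matrix.mul_zero]
      · simp
    have hsq : ∀ i, c i = 1 ∨ c i = -1 := by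
      intro i
      have h1 : (h.1 * D.N i)ᵀ * (h.1 * D.N i) = 1 := by
        rw [Matrix.transpose_mul, Matrix.mul_assoc, ← Matrix.mul_assoc h.1ᵀ, so_transpose_mul, Matrix.one_mul, D.self]
      rw [hcol, Matrix.transpose_smul, Matrix.smul_mul, Matrix.mul_smul, D.self, smul_smul] at h1
      have h3 := congrFun (congrFun h1 ⟨0, (S i).pos⟩) ⟨0, (S i).pos⟩
      rw [Matrix.smul_apply, Matrix.one_apply_eq, smul_eq_mul, mul_one] at h3
      exact mul_self_eq_one_iff.1 h3
    refine ⟨fun i => ⟨c i, hsq i⟩, ?_⟩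
    rw [← Matrix.mul_one h.1, ← D.sum, Matrix.mul_sum]
    refine Finset.sum_congr rfl fun i _ => ?_
    rw [← Matrix.mul_assoc, hcol, Matrix.smul_mul]
  choose! c hc using hmain
  have hfin : {h : SO2 m k | proj m k h ∈ Subgroup.centralizer (((proj m k).comp ρ).range : Set (PSO m k))}.Finite := by
    refine Set.Finite.of_finite_image (f := c) (Set.toFinite _) ?_
    intro g hg h hh hgh
    exact Subtype.ext ((hc g hg).trans (hgh ▸ (hc h hh).symm))
  refine ((hfin.image (proj m k)).subset fun g hg => ?_).to_subtype
  obtain ⟨h, rfl⟩ := proj_surjective g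
  exact ⟨h, hg, rfl⟩

/-- A subspace that is invariant under an irreducible orthogonal representation is trivial: the average of a
projection onto it is a scalar. -/
theorem OrthIrrep.eq_bot_or_eq_top (hG : (Nat.card Alt5 : k) ≠ 0) (T : OrthIrrep k d) (U : Submodule k (Fin d → k))
    (hU : ∀ x, ∀ v ∈ U, T.S x *ᵥ v ∈ U) : U = ⊥ ∨ U = ⊤ := by
  obtain ⟨p, hp⟩ := U.subtype.exists_leftInverse_of_injective (Submodule.ker_subtype U)
  let P := LinearMap.toMatrix' (U.subtype ∘ₗ p)
  have hP : ∀ v, P *ᵥ v = (p v : Fin d → k) := fun v => by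
    rw [LinearMap.toMatrix'_mulVec]; rfl
  obtain ⟨c, hc⟩ := T.scalar _ (sum_mem_intertwiners (ρ := T.S) T.orth P)
  have hmul : ∀ v, c • v = ∑ x, T.S x *ᵥ (p ((T.S x)ᵀ *ᵥ v) : Fin d → k) := by
    intro v
    have := congrArg (fun X => X *ᵥ v) hc
    beta_reduce at this
    rw [Matrix.smul_mulVec, Matrix.one_mulVec, Matrix.sum_mulVec] at this
    rw [← this]
    refine Finset.sum_congr rfl fun x _ => ?_
    rw [← Matrix.mulVec_mulVec, ← Matrix.mulVec_mulVec, hP]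
  have hT : ∀ x v, v ∈ U → (T.S x)ᵀ *ᵥ v ∈ U := by
    intro x v hv
    have : (T.S x)ᵀ = T.S x⁻¹ := by
      have h1 : T.S x * T.S x⁻¹ = 1 := by rw [← map_mul, mul_inv_cancel, map_one]
      rw [← Matrix.mul_one (T.S x)ᵀ, ← h1, ← Matrix.mul_assoc, T.orth', Matrix.one_mul]
    rw [this]
    exact hU _ _ hv
  rcases eq_or_ne U ⊥ with h | h
  · exact Or.inl h
  · obtain ⟨u, hu, hu0⟩ := U.exists_mem_ne_zero_of_ne_bot h
    have hcard : c • u = (Nat.card Alt5 : k) • u := by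
      have h1 : ∀ x, T.S x *ᵥ (p ((T.S x)ᵀ *ᵥ u) : Fin d → k) = u := fun x => by
        have h3 : p ((T.S x)ᵀ *ᵥ u) = ⟨_, hT x u hu⟩ := LinearMap.congr_fun hp ⟨_, hT x u hu⟩
        rw [h3, Matrix.mulVec_mulVec, T.orth, Matrix.one_mulVec]
      rw [hmul, Finset.sum_congr rfl fun x _ => h1 x, Finset.sum_const, Finset.card_univ, ← Nat.card_eq_fintype_card,
        Nat.cast_smul_eq_nsmul]
    have hc0 : c ≠ 0 := by
      rw [smul_left_injective k hu0 hcard]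
      exact hG
    refine Or.inr (eq_top_iff.2 fun v _ => ?_)
    refine (Submodule.smul_mem_iff U hc0).1 ?_
    rw [hmul]
    exact Submodule.sum_mem _ fun x _ => hU x _ (p _).2

/-- The ranges of the isometries of a decomposition are irreducible subrepresentations with direct
sum `k ^ (2m)`. -/
theorem Decomposition.decomposesAs (hG : (Nat.card Alt5 : k) ≠ 0) {l : List ℕ} {e : Fin l.length → ℕ}
    (he : ∀ i, e i = l.get i) {S : ∀ i, OrthIrrep k (e i)} {ρ : Alt5 →* SO2 m k} (D : Decomposition (matRep ρ) S) :
    DecomposesAs (orthRep ρ) l := by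
  have hrep : ∀ x v, orthRep ρ x v = matRep ρ x *ᵥ v := fun _ _ => rfl
  have hW : ∀ i x v, v ∈ LinearMap.range (D.N i).mulVecLin → orthRep ρ x v ∈ LinearMap.range (D.N i).mulVecLin := by
    rintro i x _ ⟨v, rfl⟩
    rw [hrep, Matrix.mulVecLin_apply, Matrix.mulVec_mulVec, D.mem i x, ← Matrix.mulVec_mulVec]
    exact ⟨_, rfl⟩
  have hinj : ∀ i, Function.Injective (D.N i).mulVecLin := by
    intro i u v huv
    have := congrArg (fun w => (D.N i)ᵀ *ᵥ w) huv
    simpa only [Matrix.mulVecLin_apply, Matrix.mulVec_mulVec, D.self, Matrix.one_mulVec] using this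
  refine ⟨fun i => ⟨LinearMap.range (D.N i).mulVecLin, hW i⟩, ?_, fun i => ⟨?_, ?_⟩⟩
  · rw [DirectSum.isInternal_submodule_iff_iSupIndep_and_iSup_eq_top]
    refine ⟨fun i => ?_, eq_top_iff.2 fun v _ => ?_⟩
    · have hle : ⨆ j, ⨆ (_ : j ≠ i), LinearMap.range (D.N j).mulVecLin ≤ LinearMap.ker (D.N i)ᵀ.mulVecLin := by
        refine iSup₂_le fun j hj => ?_
        rintro _ ⟨v, rfl⟩
        rw [LinearMap.mem_ker, Matrix.mulVecLin_apply, Matrix.mulVecLin_apply, Matrix.mulVec_mulVec, D.ne i j hj.symm,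
          Matrix.zero_mulVec]
      refine Disjoint.mono_right hle (Submodule.disjoint_def.2 ?_)
      rintro _ ⟨v, rfl⟩ hv
      rw [LinearMap.mem_ker, Matrix.mulVecLin_apply, Matrix.mulVecLin_apply, Matrix.mulVec_mulVec, D.self,
        Matrix.one_mulVec] at hv
      rw [hv, map_zero]
    · rw [← Matrix.one_mulVec v, ← D.sum, Matrix.sum_mulVec]
      refine Submodule.sum_mem _ fun i _ => Submodule.mem_iSup_of_mem i ?_
      rw [← Matrix.mulVec_mulVec]
      exact ⟨_, rfl⟩
  · have hfr : Module.finrank k (LinearMap.range (D.N i).mulVecLin) = e i := by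
      rw [LinearMap.finrank_range_of_inj (hinj i), Module.finrank_fin_fun]
    refine { exists_pair_ne := ⟨⊥, ⊤, fun h => ?_⟩, eq_bot_or_eq_top := fun U => ?_ }
    · have h1 : (⊥ : Submodule k (LinearMap.range (D.N i).mulVecLin)) = ⊤ := congrArg Subrepresentation.toSubmodule h
      have h3 := congrArg (fun V : Submodule k (LinearMap.range (D.N i).mulVecLin) => Module.finrank k V) h1
      beta_reduce at h3
      rw [finrank_bot, finrank_top, hfr] at h3
      exact (S i).pos.ne h3
    · let f := (D.N i).mulVecLin.rangeRestrict
      have hf : Function.Surjective f := LinearMap.surjective_rangeRestrict _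
      have hstab : ∀ x, ∀ v ∈ U.toSubmodule.comap f, (S i).S x *ᵥ v ∈ U.toSubmodule.comap f := by
        intro x v hv
        have := U.apply_mem_toSubmodule x hv
        rw [Submodule.mem_comap]
        convert this using 1
        refine Subtype.ext ?_
        change D.N i *ᵥ ((S i).S x *ᵥ v) = matRep ρ x *ᵥ (D.N i *ᵥ v)
        rw [Matrix.mulVec_mulVec, Matrix.mulVec_mulVec, D.mem i x]
      rcases (S i).eq_bot_or_eq_top hG _ hstab with h | h
      · refine Or.inl (Subrepresentation.toSubmodule_injective ?_)
        rw [← Submodule.map_comap_eq_of_surjective hf U.toSubmodule, h, Submodule.map_bot]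
        rfl
      · refine Or.inr (Subrepresentation.toSubmodule_injective ?_)
        rw [← Submodule.map_comap_eq_of_surjective hf U.toSubmodule, h, Submodule.map_top,
          LinearMap.range_eq_top.2 hf]
        rfl
  · exact (LinearMap.finrank_range_of_inj (hinj i)).trans ((Module.finrank_fin_fun k).trans (he i))

end Decompositions

/-! ### Uniqueness of regular homomorphisms with given eigenvalues -/

section Uniqueness

variable {k : Type*} [Field k] [IsAlgClosed k] {n m d : ℕ} {ι : Type*} [Fintype ι] {e : ι → ℕ} {S : ∀ i, OrthIrrep k (e i)}

/-- An irreducible orthogonal representation occurs at most once in an orthogonal representation without invariants in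
the Lie algebra of the orthogonal group: two intertwiners `M` and `N` give the invariant `MNᵀ - NMᵀ`. -/
theorem OrthIrrep.finrank_intertwiners_le_one (h2 : (2 : k) ≠ 0) (hG : (Nat.card Alt5 : k) ≠ 0) (T : OrthIrrep k d)
    {ρ : Alt5 →* Matrix (Fin n) (Fin n) k} (hρ : ∀ x, ρ x * (ρ x)ᵀ = 1)
    (hskew : ∀ X ∈ intertwiners ρ ρ, Xᵀ = -X → X = 0) : Module.finrank k (intertwiners T.S ρ) ≤ 1 := by
  by_cases h : ∃ M ∈ intertwiners T.S ρ, M ≠ 0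
  · obtain ⟨M, hM, hM0⟩ := h
    obtain ⟨N, hN, h1⟩ := T.exists_isometry h2 hG hρ hM hM0
    refine finrank_le_one ⟨N, hN⟩ fun M => ?_
    have hNT := transpose_mul_of_mem T.orth hρ hN
    have hMT := transpose_mul_of_mem T.orth hρ M.2
    have h0 := hskew (M.1 * Nᵀ - N * M.1ᵀ)
      (Submodule.sub_mem _ (mul_mem_intertwiners M.2 hNT) (mul_mem_intertwiners hN hMT))
      (by rw [Matrix.transpose_sub, Matrix.transpose_mul, Matrix.transpose_mul, Matrix.transpose_transpose,
            Matrix.transpose_transpose, neg_sub])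
    obtain ⟨c, hc⟩ := T.scalar _ (mul_mem_intertwiners hMT hN)
    refine ⟨c, Subtype.ext ?_⟩
    change c • N = M.1
    rw [← Matrix.mul_one M.1, ← h1, ← Matrix.mul_assoc, sub_eq_zero.1 h0, Matrix.mul_assoc, hc, Matrix.mul_smul, Matrix.mul_one]
  · push Not at h
    have : intertwiners T.S ρ = ⊥ := eq_bot_iff.2 fun M hM => h M hM
    rw [this, finrank_bot]
    exact zero_le_one

/-- Each summand occurs: composition with the isometries embeds the intertwiners into a product of
spaces of dimension at most `1`, with as many factors as there are summands. -/
theorem Decomposition.exists_isometry (h2 : (2 : k) ≠ 0) (hG : (Nat.card Alt5 : k) ≠ 0)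
    {ρ ρ' : Alt5 →* Matrix (Fin n) (Fin n) k} (hρ' : ∀ x, ρ' x * (ρ' x)ᵀ = 1) (D : Decomposition ρ S)
    (hskew : ∀ X ∈ intertwiners ρ' ρ', Xᵀ = -X → X = 0) (hdim : Fintype.card ι ≤ Module.finrank k (intertwiners ρ ρ'))
    (i : ι) : ∃ N ∈ intertwiners (S i).S ρ', Nᵀ * N = 1 := by
  suffices h : ∃ M ∈ intertwiners (S i).S ρ', M ≠ 0 by
    obtain ⟨M, hM, hM0⟩ := h
    exact (S i).exists_isometry h2 hG hρ' hM hM0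
  by_contra! hi
  let Φ : intertwiners ρ ρ' →ₗ[k] (∀ i, intertwiners (S i).S ρ') :=
    { toFun := fun X j => ⟨X.1 * D.N j, mul_mem_intertwiners X.2 (D.mem j)⟩
      map_add' := fun X Y => funext fun j => Subtype.ext (Matrix.add_mul _ _ _)
      map_smul' := fun c X => funext fun j => Subtype.ext (Matrix.smul_mul _ _ _) }
  have hΦ : Function.Injective Φ := by
    rw [injective_iff_map_eq_zero]
    intro X hX
    refine Subtype.ext ?_
    rw [← Matrix.mul_one X.1, ← D.sum, Matrix.mul_sum]
    refine Finset.sum_eq_zero fun j _ => ?_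
    have : X.1 * D.N j = 0 := congrArg Subtype.val (congrFun hX j)
    rw [← Matrix.mul_assoc, this, Matrix.zero_mul]
  have h := LinearMap.finrank_le_finrank_of_injective hΦ
  rw [Module.finrank_pi_fintype] at h
  have hlt : ∑ j, Module.finrank k (intertwiners (S j).S ρ') < ∑ j : ι, 1 := by
    refine Finset.sum_lt_sum (fun j _ => (S j).finrank_intertwiners_le_one h2 hG hρ' hskew) ⟨i, Finset.mem_univ i, ?_⟩
    have : intertwiners (S i).S ρ' = ⊥ := eq_bot_iff.2 fun M hM => hi M hM
    rw [this, finrank_bot]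
    exact zero_lt_one
  rw [Finset.sum_const, Finset.card_univ, smul_eq_mul, mul_one] at hlt
  omega

/-- A homomorphism with enough intertwiners from an orthogonal sum of distinct irreducible representations is conjugate
to it, in the special orthogonal group if one of the degrees is odd. -/
theorem Decomposition.exists_conj (h2 : (2 : k) ≠ 0) (hG : (Nat.card Alt5 : k) ≠ 0)
    (hS : ∀ i j, i ≠ j → ∃ x, ((S i).S x).trace ≠ ((S j).S x).trace) {ρ ρ' : Alt5 →* SO2 m k}
    (D : Decomposition (matRep ρ) S) (hskew : ∀ X ∈ intertwiners (matRep ρ') (matRep ρ'), Xᵀ = -X → X = 0)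
    (hdim : Fintype.card ι ≤ Module.finrank k (intertwiners (matRep ρ) (matRep ρ'))) (hodd : ∃ i, Odd (e i)) :
    ∃ g : SO2 m k, ∀ x, ρ' x = g * ρ x * g⁻¹ := by
  classical
  choose N hN h1 using fun i => D.exists_isometry h2 hG (matRep_orth ρ') hskew hdim i
  have hne : ∀ i j, i ≠ j → (N i)ᵀ * N j = 0 := fun i j hij =>
    (S j).intertwiner_eq_zero h2 hG (S i) (hS j i hij.symm)
      (mul_mem_intertwiners (transpose_mul_of_mem (S i).orth (matRep_orth ρ') (hN i)) (hN j))
  -- the isometry that maps each summand of `ρ` to its copy in `ρ'`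
  let g := ∑ i, N i * (D.N i)ᵀ
  have hgT : gᵀ = ∑ i, D.N i * (N i)ᵀ := by
    rw [Matrix.transpose_sum]
    simp
  have hg : gᵀ * g = 1 := by
    rw [hgT, Matrix.sum_mul, ← D.sum]
    refine Finset.sum_congr rfl fun i _ => ?_
    rw [Matrix.mul_sum, Finset.sum_eq_single i]
    · rw [Matrix.mul_assoc, ← Matrix.mul_assoc (N i)ᵀ, h1, Matrix.one_mul]
    · intro j _ hj
      rw [Matrix.mul_assoc, ← Matrix.mul_assoc (N i)ᵀ, hne i j hj.symm, Matrix.zero_mul, Matrix.mul_zero]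
    · simp
  have hgmem : g ∈ intertwiners (matRep ρ) (matRep ρ') :=
    Submodule.sum_mem _ fun i _ => mul_mem_intertwiners (hN i)
      (transpose_mul_of_mem (S i).orth (matRep_orth ρ) (D.mem i))
  have hfinish : ∀ h : Matrix (Fin (2 * m)) (Fin (2 * m)) k, h ∈ intertwiners (matRep ρ) (matRep ρ') → hᵀ * h = 1 →
      h.det = 1 → ∃ g : SO2 m k, ∀ x, ρ' x = g * ρ x * g⁻¹ := by
    intro h hmem hT hd
    refine ⟨mkSO h (mul_eq_one_comm.1 hT) hd, fun x => ?_⟩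
    rw [eq_mul_inv_iff_mul_eq]
    exact Subtype.ext (hmem x)
  have hd : g.det = 1 ∨ g.det = -1 := by
    have := congrArg Matrix.det hg
    rw [Matrix.det_mul, Matrix.det_transpose, Matrix.det_one] at this
    exact mul_self_eq_one_iff.1 this
  rcases hd with hd | hd
  · exact hfinish g hgmem hg hd
  · -- change the sign on a summand of odd degree
    obtain ⟨i, hi⟩ := hodd
    let r : Matrix (Fin (2 * m)) (Fin (2 * m)) k := 1 - (D.N i + D.N i) * (D.N i)ᵀ
    have hrT : rᵀ = r := by
      simp [r, Matrix.transpose_mul, Matrix.add_mul]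
    have hP : (D.N i * (D.N i)ᵀ) * (D.N i * (D.N i)ᵀ) = D.N i * (D.N i)ᵀ := by
      rw [Matrix.mul_assoc, ← Matrix.mul_assoc (D.N i)ᵀ, D.self, Matrix.one_mul]
    have hr : r * r = 1 := by
      simp only [r, Matrix.add_mul]
      generalize D.N i * (D.N i)ᵀ = P at hP
      simp only [sub_mul, mul_sub, one_mul, mul_one, mul_add, add_mul, hP]
      abel
    have hrd : r.det = -1 := by
      have h3 : (1 : Matrix (Fin (e i)) (Fin (e i)) k) - (1 + 1) = -1 := by abel
      rw [Matrix.det_one_sub_mul_comm, Matrix.mul_add, D.self, h3, Matrix.det_neg, Matrix.det_one, Fintype.card_fin,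
        hi.neg_one_pow, mul_one]
    have hrmem : r ∈ intertwiners (matRep ρ) (matRep ρ) := by
      refine Submodule.sub_mem _ (fun x => by rw [Matrix.mul_one, Matrix.one_mul]) ?_
      exact mul_mem_intertwiners (Submodule.add_mem _ (D.mem i) (D.mem i))
        (transpose_mul_of_mem (S i).orth (matRep_orth ρ) (D.mem i))
    refine hfinish (g * r) (mul_mem_intertwiners hgmem hrmem) ?_ ?_
    · rw [Matrix.transpose_mul, Matrix.mul_assoc, ← Matrix.mul_assoc gᵀ, hg, Matrix.one_mul, hrT, hr]
    · rw [Matrix.det_mul, hd, hrd, neg_mul_neg, one_mul]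

/-- The representation of `𝒜₅` on matrices whose invariants are the intertwiners. -/
def homRep (ρ ρ' : Alt5 →* SO2 m k) : Representation k Alt5 (Matrix (Fin (2 * m)) (Fin (2 * m)) k) where
  toFun x :=
    { toFun := fun X => matRep ρ' x * X * (matRep ρ x)ᵀ
      map_add' := fun X Y => by rw [Matrix.mul_add, Matrix.add_mul]
      map_smul' := fun c X => by rw [Matrix.mul_smul, Matrix.smul_mul]; rfl }
  map_one' := by ext X : 1; simp
  map_mul' x y := by
    ext X : 1
    simp only [map_mul, Matrix.transpose_mul, LinearMap.coe_mk, AddHom.coe_mk, Module.End.mul_apply, Matrix.mul_assoc]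

omit [IsAlgClosed k] in
theorem homRep_apply (ρ ρ' : Alt5 →* SO2 m k) (x : Alt5) (X : Matrix (Fin (2 * m)) (Fin (2 * m)) k) :
    homRep ρ ρ' x X = matRep ρ' x * X * (matRep ρ x)ᵀ := rfl

omit [IsAlgClosed k] in
theorem homRep_invariants_le (ρ ρ' : Alt5 →* SO2 m k) : (homRep ρ ρ').invariants ≤ intertwiners (matRep ρ) (matRep ρ') := by
  intro X hX x
  have := hX x
  rw [homRep_apply] at this
  conv_rhs => rw [← this]
  rw [Matrix.mul_assoc, mul_eq_one_comm.1 (matRep_orth ρ x), Matrix.mul_one]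

omit [IsAlgClosed k] in
/-- By Scott's lemma, two homomorphisms with the same regular data have many intertwiners. -/
theorem le_finrank_intertwiners (S : RootsOfUnity k) {ρ ρ' : Alt5 →* SO2 m k} {a b a' b' a'' b'' c'' : ℕ}
    (hd : IsRegularData m a b a' b' a'' b'' c'') (h₂ : IsType2 (ρ x2) a b) (h₃ : IsType3 S.ω (ρ x3) a' b')
    (h₅ : IsType5 S.ζ (ρ x5) a'' b'' c'') (h₂' : IsType2 (ρ' x2) a b) (h₃' : IsType3 S.ω (ρ' x3) a' b')
    (h₅' : IsType5 S.ζ (ρ' x5) a'' b'' c'') :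
    a' + a'' ≤ Module.finrank k (intertwiners (matRep ρ) (matRep ρ')) := by
  classical
  have hscott := scott_le (homRep ρ ρ') closure_x2_x3 (card_alt5_ne_zero S)
  rw [Module.finrank_matrix] at hscott
  have hinv := Submodule.finrank_mono (homRep_invariants_le ρ ρ')
  have hfix : ∀ {x X}, matRep ρ' x * X * (matRep ρ x)ᵀ = X → X ∈ LinearMap.ker (1 - homRep ρ ρ' x) := fun h =>
    sub_eq_zero.2 h.symm
  obtain ⟨s₂, v₂, w₂⟩ := h₂
  obtain ⟨s₃, v₃, w₃⟩ := h₃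
  obtain ⟨s₅, v₅, w₅⟩ := h₅
  obtain ⟨-, v₂', w₂'⟩ := h₂'
  obtain ⟨-, v₃', w₃'⟩ := h₃'
  obtain ⟨-, v₅', w₅'⟩ := h₅'
  have i₂ := pairCount_le_finrank w₂ w₂' (U := LinearMap.ker (1 - homRep ρ ρ' x2)) fun X hX => hfix hX
  have i₃ := pairCount_le_finrank w₃ w₃' (U := LinearMap.ker (1 - homRep ρ ρ' x3)) fun X hX => hfix hX
  have i₅ := pairCount_le_finrank w₅ w₅' (U := LinearMap.ker (1 - homRep ρ ρ' (x2 * x3))) fun X hX => by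
    have h1 : homRep ρ ρ' x5 X = X := hX
    have h3 : x2 * x3 = x5⁻¹ := by rw [x5, _root_.inv_inv]
    refine sub_eq_zero.2 ?_
    rw [h3, Module.End.one_apply]
    nth_rewrite 2 [← h1]
    rw [← Module.End.mul_apply, ← map_mul, inv_mul_cancel, map_one, Module.End.one_apply]
  rw [(counts_label2 S.two_ne a b).1] at i₂
  rw [(counts_label3 S.hω a' b').1] at i₃
  rw [(counts_label5 S.hζ a'' b'' c'').1] at i₅
  have hcount := hd.count
  simp only [Fintype.card_fin, Module.finrank_self, mul_one] at hscott
  have e : 2 * m * (2 * m) = 2 * (2 * m * m) := by ring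
  omega

/-- A regular homomorphism has no invariants in the Lie algebra. -/
theorem skew_intertwiner_eq_zero (h2 : (2 : k) ≠ 0) (hm : 2 ≤ m) {ρ : Alt5 →* SO2 m k}
    (hρ : IsRegularHom ((proj m k).comp ρ)) : ∀ X ∈ intertwiners (matRep ρ) (matRep ρ), Xᵀ = -X → X = 0 := by
  intro X hX hXT
  by_contra hX0
  have : Infinite k := IsAlgClosed.instInfinite
  refine not_isRegularHom_of_skew h2 hm hXT hX0 (fun x h hh => ?_) hρ
  have hx : (ρ x).1 * X = X * (ρ x).1 := hX x
  rcases (proj_eq_proj_iff h2 hm h (ρ x)).1 hh with e | e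
  · rw [← e]; exact hx
  · rw [eq_neg_iff_add_eq_zero, add_comm, ← eq_neg_iff_add_eq_zero] at e
    rw [e, neg_mul, mul_neg, hx]

/-- The eigenvalue data of a lift of a regular homomorphism. -/
theorem exists_data_of_lift (S : RootsOfUnity k) (hm : 4 ≤ m) {ρ : Alt5 →* SO2 m k}
    (hρ : IsRegularHom ((proj m k).comp ρ)) :
    ∃ a b a' b' a'' b'' c'', IsType2 (ρ x2) a b ∧ IsType3 S.ω (ρ x3) a' b' ∧ IsType5 S.ζ (ρ x5) a'' b'' c'' ∧
      IsRegularData m a b a' b' a'' b'' c'' := by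
  have h2m : 2 ≤ m := by omega
  obtain ⟨a, b, a', b', a'', b'', c'', ⟨g₂, g₃, g₅, t₂, t₃, t₅, hC⟩, hd⟩ := exists_data_of_isRegularHom S hm hρ
  have c2 := ConjClasses.mk_eq_mk_iff_isConj.1 (congrArg ClassTriple.C2 hC)
  have c3 := ConjClasses.mk_eq_mk_iff_isConj.1 (congrArg ClassTriple.C3 hC)
  have c5 := ConjClasses.mk_eq_mk_iff_isConj.1 (congrArg ClassTriple.C5 hC)
  obtain ⟨y₂, i₂, e₂⟩ := exists_isConj_of_isConj_proj c2.symm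
  obtain ⟨y₃, i₃, e₃⟩ := exists_isConj_of_isConj_proj c3.symm
  obtain ⟨y₅, i₅, e₅⟩ := exists_isConj_of_isConj_proj c5.symm
  replace t₂ := t₂.of_isConj i₂
  replace t₃ := t₃.of_isConj i₃
  replace t₅ := t₅.of_isConj i₅
  -- for odd order, the conjugate of the representative is the lift itself; for the involution it
  -- may be its negative
  have hodd : ∀ {y : SO2 m k} {x : Alt5} (N : ℕ), Odd N → y.1 ^ N = 1 → x ^ N = 1 → proj m k y = proj m k (ρ x) → y = ρ x := by
    intro y x N hN hy hx h
    rcases (proj_eq_proj_iff S.two_ne h2m (ρ x) y).1 h.symm with e | e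
    · exact Subtype.ext e
    · exfalso
      have h3 : (ρ x).1 ^ N = 1 := by rw [← SO2.coe_pow, ← map_pow, hx, map_one]; rfl
      rw [e, hN.neg_pow, h3] at hy
      have := congrFun (congrFun hy ⟨0, by omega⟩) ⟨0, by omega⟩
      rw [Matrix.neg_apply, Matrix.one_apply_eq] at this
      exact S.two_ne (by linear_combination -this)
  obtain ⟨-, r3, r5, -⟩ := alt5_relations
  have q₃ := hodd 3 (by decide) (t₃.pow S.hω) r3 e₃
  have q₅ := hodd 5 (by decide) (t₅.pow S.hζ) r5 e₅
  rw [q₃] at t₃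
  rw [q₅] at t₅
  rcases (proj_eq_proj_iff S.two_ne h2m y₂ (ρ x2)).1 e₂ with e | e
  · rw [show y₂ = ρ x2 from Subtype.ext e.symm] at t₂
    exact ⟨a, b, a', b', a'', b'', c'', t₂, t₃, t₅, hd⟩
  · have t₂' := t₂.neg
    rw [show negOneSO * y₂ = ρ x2 from Subtype.ext ((coe_negOneSO_mul y₂).trans e.symm)] at t₂'
    refine ⟨b, a, a', b', a'', b'', c'', t₂', t₃, t₅, ?_, hd.2.1, hd.2.2⟩
    have := hd.1
    simp only [List.mem_cons, Prod.mk.injEq, List.not_mem_nil, or_false] at this ⊢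
    omega

end Uniqueness

/-! ### Irreducible representations from doubly transitive actions -/

section PermutationIrreps

variable {k : Type*} [Field k] {d : ℕ}

/-- A matrix with orthonormal columns spanning the vectors of coordinate sum zero. -/
theorem exists_isometry_sum_zero [IsAlgClosed k] (hd : (d : k) ≠ 0) (hd1 : (d + 1 : k) ≠ 0) :
    ∃ U : Matrix (Fin (d + 1)) (Fin d) k, Uᵀ * U = 1 ∧ U * Uᵀ = 1 - (d + 1 : k)⁻¹ • Matrix.of fun _ _ => 1 := by
  -- the columns `eⱼ₊₁ + b (e₁ + ⋯ + e_d) - (1 + d b) e₀`, with `b` chosen so that they are orthonormal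
  obtain ⟨b, hb⟩ : ∃ b : k, d * (d + 1) * b ^ 2 + 2 * (d + 1) * b + 1 = 0 := by
    obtain ⟨s, hs⟩ := IsAlgClosed.exists_pow_nat_eq (d + 1 : k) (n := 2) two_pos
    refine ⟨(s - (d + 1)) / (d * (d + 1)), ?_⟩
    field_simp
    linear_combination hs
  have hb' : d * b ^ 2 + 2 * b = -(d + 1 : k)⁻¹ := by
    field_simp
    linear_combination hb
  have ha : (1 + d * b) ^ 2 = (d + 1 : k)⁻¹ := by
    field_simp
    linear_combination (d : k) * hb
  let V : Fin d → Fin d → k := fun i j => (if i = j then 1 else 0) + b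
  have hV : ∀ i j, ∑ l, V i l * V j l = (if i = j then 1 else 0) + (d * b ^ 2 + 2 * b) := by
    intro i j
    simp only [V, add_mul, mul_add, Finset.sum_add_distrib]
    simp [Finset.sum_ite_eq]
    by_cases h : i = j
    · simp [h]; ring
    · simp [h]; ring
  have hVs : ∀ i j, V i j = V j i := fun i j => by simp [V, eq_comm]
  have hV1 : ∀ i, ∑ l, V i l = 1 + d * b := by
    intro i
    simp [V, Finset.sum_add_distrib]
  obtain ⟨U, hU0, hUs⟩ : ∃ U : Matrix (Fin (d + 1)) (Fin d) k, (∀ j, U 0 j = -(1 + d * b)) ∧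
      ∀ i j, U (Fin.succ i) j = V i j :=
    ⟨Matrix.of (Fin.cons (fun _ => -(1 + d * b)) V), fun _ => rfl, fun _ _ => rfl⟩
  refine ⟨U, ?_, ?_⟩
  · ext i j
    rw [Matrix.mul_apply, Fin.sum_univ_succ]
    simp only [Matrix.transpose_apply, hU0, hUs]
    rw [Finset.sum_congr rfl fun l _ => by rw [hVs l i, hVs l j], hV, hb', Matrix.one_apply]
    linear_combination ha
  · ext i j
    rw [Matrix.mul_apply, Matrix.sub_apply, Matrix.smul_apply, smul_eq_mul, Matrix.of_apply, mul_one]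
    simp only [Matrix.transpose_apply]
    refine Fin.cases ?_ (fun i => ?_) i <;> refine Fin.cases ?_ (fun j => ?_) j <;> simp only [hU0, hUs]
    · rw [Finset.sum_const, Finset.card_univ, Fintype.card_fin, nsmul_eq_mul, Matrix.one_apply_eq, neg_mul_neg, ← pow_two, ha]
      field_simp
      ring
    · rw [← Finset.mul_sum, hV1, Matrix.one_apply_ne (Fin.succ_ne_zero j).symm]
      linear_combination -ha
    · rw [← Finset.sum_mul, hV1, Matrix.one_apply_ne (Fin.succ_ne_zero i)]
      linear_combination -ha
    · rw [hV, hb', Matrix.one_apply]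
      simp [sub_eq_add_neg]

/-- The permutation matrix of a permutation of `d + 1` letters. -/
def permMat (s : Equiv.Perm (Fin (d + 1))) : Matrix (Fin (d + 1)) (Fin (d + 1)) k :=
  Matrix.of fun i j => if i = s j then 1 else 0

theorem permMat_mul_apply (s : Equiv.Perm (Fin (d + 1))) {l : Type*} (X : Matrix (Fin (d + 1)) l k) (i j) :
    ((permMat s : Matrix _ _ k) * X : Matrix _ _ k) (s i) j = X i j := by
  simp [Matrix.mul_apply, permMat]

theorem mul_permMat_apply (s : Equiv.Perm (Fin (d + 1))) {l : Type*} (X : Matrix l (Fin (d + 1)) k) (i j) :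
    (X * (permMat s : Matrix _ _ k) : Matrix _ _ k) i j = X i (s j) := by
  simp [Matrix.mul_apply, permMat]

theorem permMat_mul (s t : Equiv.Perm (Fin (d + 1))) : (permMat (s * t) : Matrix _ _ k) = permMat s * permMat t := by
  ext i j
  rw [mul_permMat_apply]
  rfl

theorem permMat_mul_transpose (s : Equiv.Perm (Fin (d + 1))) :
    (permMat s : Matrix _ _ k) * (permMat s)ᵀ = 1 := by
  ext i j
  obtain ⟨i, rfl⟩ := s.surjective i
  rw [permMat_mul_apply]
  simp [permMat, Matrix.one_apply, eq_comm]

/-- The nontrivial constituent of a doubly transitive permutation representation of `𝒜₅`. -/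
theorem exists_permIrrep [IsAlgClosed k] (h0 : 0 < d) (hd : (d : k) ≠ 0) (hd1 : (d + 1 : k) ≠ 0)
    (f : Alt5 →* Equiv.Perm (Fin (d + 1))) (hf : ∀ i j : Fin (d + 1), i ≠ j → ∃ x, f x 0 = i ∧ f x 1 = j) :
    ∃ T : OrthIrrep k d, ∀ x, (T.S x).trace = (Finset.univ.filter fun i => f x i = i).card - 1 := by
  obtain ⟨U, hU, hQ⟩ := exists_isometry_sum_zero hd hd1
  set c : k := (d + 1 : k)⁻¹
  have hc : c ≠ 0 := inv_ne_zero hd1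
  set J : Matrix (Fin (d + 1)) (Fin (d + 1)) k := Matrix.of fun _ _ => 1
  have hUJ : Uᵀ * J = 0 := by
    have h : Uᵀ * (U * Uᵀ) = Uᵀ := by rw [← Matrix.mul_assoc, hU, Matrix.one_mul]
    rw [hQ, Matrix.mul_sub, Matrix.mul_one, Matrix.mul_smul, sub_eq_self] at h
    exact (smul_eq_zero.1 h).resolve_left hc
  let P (x : Alt5) : Matrix (Fin (d + 1)) (Fin (d + 1)) k := permMat (f x)
  have hPJ : ∀ x, P x * J = J := by
    intro x
    ext i j
    obtain ⟨i, rfl⟩ := (f x).surjective i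
    exact permMat_mul_apply (f x) J i j
  have hJP : ∀ x, J * P x = J := by
    intro x
    ext i j
    exact mul_permMat_apply (f x) J i j
  have hPQ : ∀ x, P x * (U * Uᵀ) = U * Uᵀ * P x := by
    intro x
    rw [hQ, Matrix.mul_sub, Matrix.sub_mul, Matrix.mul_one, Matrix.one_mul, Matrix.mul_smul, Matrix.smul_mul, hPJ, hJP]
  have hUQP : ∀ x, Uᵀ * P x * (U * Uᵀ) = Uᵀ * P x := by
    intro x
    rw [Matrix.mul_assoc, hPQ, Matrix.mul_assoc U, ← Matrix.mul_assoc, hU, Matrix.one_mul]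
  -- the permutation representation restricted to the vectors of coordinate sum zero
  let R : Alt5 →* Matrix (Fin d) (Fin d) k :=
    { toFun := fun x => Uᵀ * P x * U
      map_one' := by
        have : P 1 = 1 := by ext i j; simp [P, permMat, Matrix.one_apply]
        rw [this, Matrix.mul_one, hU]
      map_mul' := fun x y => by
        have : P (x * y) = P x * P y := by simp only [P, map_mul, permMat_mul]
        rw [this]
        calc Uᵀ * (P x * P y) * U = Uᵀ * P x * P y * U := by simp only [Matrix.mul_assoc]
          _ = Uᵀ * P x * (U * Uᵀ) * P y * U := by rw [hUQP]
          _ = Uᵀ * P x * U * (Uᵀ * P y * U) := by simp only [Matrix.mul_assoc] }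
  have hR : ∀ x, R x = Uᵀ * P x * U := fun _ => rfl
  refine ⟨⟨R, fun x => ?_, fun X hX => ?_, h0⟩, fun x => ?_⟩
  · rw [hR]
    calc Uᵀ * P x * U * (Uᵀ * P x * U)ᵀ = Uᵀ * P x * (U * Uᵀ) * (P x)ᵀ * U := by
          rw [Matrix.transpose_mul, Matrix.transpose_mul, Matrix.transpose_transpose]; simp only [Matrix.mul_assoc]
      _ = Uᵀ * (P x * (P x)ᵀ) * U := by rw [hUQP]; simp only [Matrix.mul_assoc]
      _ = 1 := by rw [permMat_mul_transpose, Matrix.mul_one, hU]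
  · -- the matrix `U X Uᵀ` commutes with the permutation matrices
    let Y := U * X * Uᵀ
    have hY : ∀ x, P x * Y = Y * P x := by
      intro x
      have h1 : P x * U = U * R x := by
        calc P x * U = P x * (U * (Uᵀ * U)) := by rw [hU, Matrix.mul_one]
          _ = P x * (U * Uᵀ) * U := by simp only [Matrix.mul_assoc]
          _ = U * R x := by rw [hPQ, hR]; simp only [Matrix.mul_assoc]
      have h3 : R x * Uᵀ = Uᵀ * P x := by rw [hR, Matrix.mul_assoc _ U, hUQP]
      calc P x * Y = P x * U * X * Uᵀ := by simp only [Y, Matrix.mul_assoc]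
        _ = U * (R x * X) * Uᵀ := by rw [h1]; simp only [Matrix.mul_assoc]
        _ = U * X * (R x * Uᵀ) := by rw [hX x]; simp only [Matrix.mul_assoc]
        _ = Y * P x := by rw [h3]; simp only [Y, Matrix.mul_assoc]
    have hinv : ∀ x i j, Y (f x i) (f x j) = Y i j := by
      intro x i j
      rw [← permMat_mul_apply (f x) Y i j, ← mul_permMat_apply (f x) Y (f x i) j]
      exact (congrFun (congrFun (hY x) _) _).symm
    have hdiag : ∀ i, Y i i = Y 0 0 := by
      intro i
      obtain ⟨j, hj⟩ : ∃ j, i ≠ j := by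
        have : Nontrivial (Fin (d + 1)) := Fin.nontrivial_iff_two_le.2 (by omega)
        obtain ⟨j, hj⟩ := exists_ne i
        exact ⟨j, hj.symm⟩
      obtain ⟨x, hx, -⟩ := hf i j hj
      rw [← hx, hinv]
    -- double transitivity makes the off-diagonal entries of `Y` equal
    have hoff : ∀ i j, i ≠ j → Y i j = Y 0 1 := by
      intro i j hij
      obtain ⟨x, hx, hx'⟩ := hf i j hij
      rw [← hx, ← hx', hinv]
    have hYJ : Y = (Y 0 0 - Y 0 1) • 1 + Y 0 1 • J := by
      ext i j
      rw [Matrix.add_apply, Matrix.smul_apply, Matrix.smul_apply, Matrix.one_apply]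
      by_cases h : i = j
      · rw [if_pos h, h, hdiag]
        simp [J]
      · rw [if_neg h, hoff i j h]
        simp [J]
    refine ⟨Y 0 0 - Y 0 1, ?_⟩
    calc X = (Uᵀ * U) * X * (Uᵀ * U) := by rw [hU, Matrix.one_mul, Matrix.mul_one]
      _ = Uᵀ * Y * U := by simp only [Y, Matrix.mul_assoc]
      _ = _ := by
        rw [hYJ, Matrix.mul_add, Matrix.add_mul, Matrix.mul_smul, Matrix.mul_smul, hUJ, ← hYJ, Matrix.smul_mul, Matrix.mul_one, hU]
        simp
  · change (Uᵀ * P x * U).trace = _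
    rw [Matrix.trace_mul_comm, ← Matrix.mul_assoc, Matrix.trace_mul_comm, hQ, Matrix.mul_sub, Matrix.mul_one, Matrix.mul_smul,
      hPJ, Matrix.trace_sub, Matrix.trace_smul]
    have h1 : J.trace = d + 1 := by simp [J, Matrix.trace]
    have h3 : (P x).trace = (Finset.univ.filter fun i => f x i = i).card := by
      simp [P, permMat, Matrix.trace, eq_comm]
    rw [h1, h3, smul_eq_mul, inv_mul_cancel₀ hd1]

/-- Double transitivity can be tested on words of a fixed shape in the generators, so that it
becomes decidable. -/
theorem doubly_transitive_of_words {n : ℕ} {f : Alt5 →* Equiv.Perm (Fin (n + 1))} {a c : Equiv.Perm (Fin (n + 1))}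
    (ha : f x2 = a) (hc : f (x2 * x3) = c)
    (h : ∀ i j : Fin (n + 1), i ≠ j → ∃ r s t : Fin 5, (c ^ (r : ℕ) * a * c ^ (s : ℕ) * a * c ^ (t : ℕ)) 0 = i ∧
      (c ^ (r : ℕ) * a * c ^ (s : ℕ) * a * c ^ (t : ℕ)) 1 = j) (i j : Fin (n + 1)) (hij : i ≠ j) :
    ∃ x, f x 0 = i ∧ f x 1 = j := by
  obtain ⟨r, s, t, h⟩ := h i j hij
  refine ⟨(x2 * x3) ^ (r : ℕ) * x2 * (x2 * x3) ^ (s : ℕ) * x2 * (x2 * x3) ^ (t : ℕ), ?_⟩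
  simpa only [map_mul f _ x2, map_mul f (_ * _) ((x2 * x3) ^ _), map_pow f, hc, ha] using h

/-- The traces of an orthogonal matrix and its inverse agree, and `x₅` is the inverse of `x₂x₃`. -/
theorem alt5_trace_inv {k : Type*} [Field k] {d : ℕ} (T : OrthIrrep k d) : (T.S x5).trace = (T.S (x2 * x3)).trace := by
  have h : T.S x5 = (T.S (x2 * x3))ᵀ := by
    have h1 : T.S (x2 * x3) * T.S x5 = 1 := by rw [← map_mul, x5, mul_inv_cancel, map_one]
    rw [← Matrix.mul_one (T.S (x2 * x3))ᵀ, ← h1, ← Matrix.mul_assoc, T.orth', Matrix.one_mul]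
  rw [h, Matrix.trace_transpose]

/-- The irreducible representation of degree `4`, from the permutations of `5` letters. -/
theorem exists_irrep4 [IsAlgClosed k] (S : RootsOfUnity k) : ∃ T : OrthIrrep k 4,
    (T.S x2).trace = 0 ∧ (T.S x3).trace = 1 ∧ (T.S x5).trace = -1 := by
  let f : Alt5 →* Equiv.Perm (Fin 5) := (alternatingGroup (Fin 5)).subtype
  have h4 : ((4 : ℕ) : k) ≠ 0 := by
    rw [show ((4 : ℕ) : k) = 2 * 2 by norm_num]
    exact mul_ne_zero S.two_ne S.two_ne
  have h5 : ((4 : ℕ) + 1 : k) ≠ 0 := by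
    rw [show ((4 : ℕ) + 1 : k) = 5 by norm_num]
    exact S.five_ne
  obtain ⟨T, hT⟩ := exists_permIrrep (by norm_num) h4 h5 f
    (doubly_transitive_of_words (f := f) (a := Equiv.swap 0 1 * Equiv.swap 2 3)
      (c := Equiv.swap 0 1 * Equiv.swap 2 3 * (Equiv.swap 0 2 * Equiv.swap 2 4)) rfl rfl (by decide +kernel))
  refine ⟨T, ?_, ?_, ?_⟩
  · rw [hT, show (Finset.univ.filter fun i => f x2 i = i).card = 1 by decide +kernel]; norm_num
  · rw [hT, show (Finset.univ.filter fun i => f x3 i = i).card = 2 by decide +kernel]; norm_num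
  · rw [hT, show (Finset.univ.filter fun i => f x5 i = i).card = 0 by decide +kernel]; norm_num

/-- The irreducible representation of degree `5`, from the permutations of the `6` subgroups of order `5`. -/
theorem exists_irrep5 [IsAlgClosed k] (S : RootsOfUnity k) : ∃ T : OrthIrrep k 5,
    (T.S x2).trace = 1 ∧ (T.S x3).trace = -1 ∧ (T.S x5).trace = 0 := by
  let a : Equiv.Perm (Fin 6) := Equiv.swap 0 1 * Equiv.swap 2 3
  let b : Equiv.Perm (Fin 6) := Equiv.swap 0 1 * Equiv.swap 1 2 * (Equiv.swap 3 4 * Equiv.swap 4 5)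
  obtain ⟨f, fa, fb⟩ := exists_hom_of_relations (a := a) (b := b) (by decide +kernel) (by decide +kernel) (by decide +kernel)
  have fc : f (x2 * x3) = a * b := by rw [map_mul, fa, fb]
  have h5 : ((5 : ℕ) : k) ≠ 0 := by exact_mod_cast S.five_ne
  have h6 : ((5 : ℕ) + 1 : k) ≠ 0 := by
    rw [show ((5 : ℕ) + 1 : k) = 2 * 3 by norm_num]
    exact mul_ne_zero S.two_ne S.three_ne
  obtain ⟨T, hT⟩ := exists_permIrrep (by norm_num) h5 h6 f (doubly_transitive_of_words fa fc (by decide +kernel))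
  refine ⟨T, ?_, ?_, ?_⟩
  · rw [hT, fa, show (Finset.univ.filter fun i => a i = i).card = 2 by decide +kernel]; norm_num
  · rw [hT, fb, show (Finset.univ.filter fun i => b i = i).card = 0 by decide +kernel]; norm_num
  · rw [alt5_trace_inv, hT, fc, show (Finset.univ.filter fun i => (a * b) i = i).card = 1 by decide +kernel]; norm_num

/-- The trivial representation. -/
theorem exists_irrep1 (k : Type*) [Field k] : ∃ T : OrthIrrep k 1, ∀ x, (T.S x).trace = 1 := by
  refine ⟨⟨1, fun x => by simp, fun X _ => ⟨X 0 0, ?_⟩, one_pos⟩, fun x => by simp⟩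
  ext i j
  rw [Subsingleton.elim i 0, Subsingleton.elim j 0]
  simp

end PermutationIrreps

/-! ### The icosahedral representations of degree `3` -/

section IcosahedralIrrep

variable {k : Type*} [Field k]

/-- Twice the half-turn about the axis `(1, f, f - 1)`. -/
def halfTurn (f : k) : Matrix (Fin 3) (Fin 3) k := !![-1, f, f - 1; f, f - 1, 1; f - 1, 1, -f]

variable (k) in
/-- The cyclic permutation of the coordinates. -/
def cyclicPerm : Matrix (Fin 3) (Fin 3) k := !![0, 1, 0; 0, 0, 1; 1, 0, 0]

/-- The commutant of the half-turn and the cyclic permutation is scalar: a matrix commuting with the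
latter is circulant. -/
theorem scalar_of_commute_halfTurn (h2 : (2 : k) ≠ 0) {f : k} {X : Matrix (Fin 3) (Fin 3) k}
    (hA : halfTurn f * X = X * halfTurn f) (hb : cyclicPerm k * X = X * cyclicPerm k) : ∃ c : k, X = c • 1 := by
  have hent : ∀ i j, (cyclicPerm k * X) i j = (X * cyclicPerm k) i j := fun i j => congrFun (congrFun hb i) j
  have e00 := hent 0 0
  have e01 := hent 0 1
  have e02 := hent 0 2
  have e10 := hent 1 0
  have e11 := hent 1 1
  have e12 := hent 1 2
  have d00 : (halfTurn f * X) 0 0 = (X * halfTurn f) 0 0 := by rw [hA]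
  have d01 : (halfTurn f * X) 0 1 = (X * halfTurn f) 0 1 := by rw [hA]
  simp [halfTurn, cyclicPerm, Matrix.mul_apply, Fin.sum_univ_three] at e00 e01 e02 e10 e11 e12 d00 d01
  have hqr : X 0 2 = X 0 1 := by linear_combination d00 - f * e00 - (f - 1) * (e10 + e02)
  have hq : X 0 1 = 0 := by
    refine (mul_eq_zero.1 (?_ : 2 * X 0 1 = 0)).resolve_left h2
    linear_combination -d01 + f * e01 + (f - 1) * (e11 + e00) + (f - 2) * hqr
  refine ⟨X 0 0, ?_⟩
  ext i j
  have h02 := hqr.trans hq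
  have h10 := e00.trans h02
  have h12 := e02.trans hq
  fin_cases i <;> fin_cases j <;> simp [hq, h02, h10, e01, h12, e10, e11, e12]

/-- The rotations of the icosahedron: the half-turn and the cyclic permutation satisfy the relations of `𝒜₅`. -/
theorem halfTurn_relations {f : k} (hf : f ^ 2 = f + 1) :
    halfTurn f * halfTurn f = (4 : k) • 1 ∧ (halfTurn f * cyclicPerm k) ^ 5 = (32 : k) • 1 := by
  let C : Matrix (Fin 3) (Fin 3) k := !![f - 1, -1, f; 1, f, f - 1; -f, f - 1, 1]
  let E : Matrix (Fin 3) (Fin 3) k := !![-f, 1 - f, 1; f - 1, 1, f; -1, f, 1 - f]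
  have hAb : halfTurn f * cyclicPerm k = C := by
    ext i j
    fin_cases i <;> fin_cases j <;> simp [halfTurn, cyclicPerm, C, Matrix.mul_apply, Fin.sum_univ_three]
  have hCC : C * C = (2 : k) • E := by
    ext i j
    fin_cases i <;> fin_cases j <;> simp [C, E, Matrix.mul_apply, Fin.sum_univ_three] <;> grind
  have hEE : E * E = (2 : k) • Cᵀ := by
    ext i j
    fin_cases i <;> fin_cases j <;> simp [C, E, Matrix.mul_apply, Fin.sum_univ_three] <;> grind
  have hCTC : Cᵀ * C = (4 : k) • 1 := by
    ext i j
    fin_cases i <;> fin_cases j <;> simp [C, Matrix.mul_apply, Fin.sum_univ_three] <;> grind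
  refine ⟨?_, ?_⟩
  · ext i j
    fin_cases i <;> fin_cases j <;> simp [halfTurn, Matrix.mul_apply, Fin.sum_univ_three] <;> grind
  · rw [hAb, show C ^ 5 = C * C * (C * C) * C by simp only [_root_.pow_succ, _root_.pow_zero, one_mul, mul_assoc],
      hCC, Matrix.smul_mul, Matrix.mul_smul, hEE, Matrix.smul_mul, Matrix.smul_mul, Matrix.smul_mul, hCTC]
    simp only [smul_smul]
    norm_num

theorem halfTurn_transpose (f : k) : (halfTurn f)ᵀ = halfTurn f := by
  ext i j; fin_cases i <;> fin_cases j <;> rfl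

theorem det_halfTurn {f : k} (hf : f ^ 2 = f + 1) : (halfTurn f).det = 8 := by
  simp only [halfTurn, Matrix.det_fin_three, Matrix.of_apply, Matrix.cons_val]
  grind

theorem cyclicPerm_facts : cyclicPerm k * (cyclicPerm k)ᵀ = 1 ∧ cyclicPerm k ^ 3 = 1 ∧ (cyclicPerm k).det = 1 := by
  refine ⟨?_, ?_, by simp [cyclicPerm, Matrix.det_fin_three]⟩
  · ext i j
    fin_cases i <;> fin_cases j <;> simp [cyclicPerm, Matrix.mul_apply, Fin.sum_univ_three]
  · rw [show cyclicPerm k ^ 3 = cyclicPerm k * cyclicPerm k * cyclicPerm k by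
      simp only [_root_.pow_succ, _root_.pow_zero, one_mul]]
    ext i j
    fin_cases i <;> fin_cases j <;> simp [cyclicPerm, Matrix.mul_apply, Fin.sum_univ_three]

/-- The irreducible representation of degree `3` by rotations of the icosahedron, for a given root `f` of `f² = f + 1`:
the element `x₂` acts as a half-turn and `x₃` permutes the coordinates cyclically. -/
theorem exists_irrep3 (h2 : (2 : k) ≠ 0) {f : k} (hf : f ^ 2 = f + 1) : ∃ T : OrthIrrep k 3,
    (T.S x2).trace = -1 ∧ (T.S x3).trace = 0 ∧ (T.S x5).trace = f := by
  obtain ⟨hA, hC⟩ := halfTurn_relations hf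
  obtain ⟨hb, hb3, hdb⟩ := cyclicPerm_facts (k := k)
  let a : Matrix (Fin 3) (Fin 3) k := (2⁻¹ : k) • halfTurn f
  have haa : a * a = 1 := by
    rw [Matrix.smul_mul, Matrix.mul_smul, hA, smul_smul, smul_smul,
      show (2⁻¹ : k) * 2⁻¹ * 4 = 1 by field_simp; norm_num, one_smul]
  have haT : aᵀ = a := by rw [Matrix.transpose_smul, halfTurn_transpose]
  have hda : a.det = 1 := by
    rw [Matrix.det_smul, det_halfTurn hf, Fintype.card_fin]
    field_simp
    norm_num
  have hab5 : (a * cyclicPerm k) ^ 5 = 1 := by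
    rw [Matrix.smul_mul, smul_pow, hC, smul_smul, show (2⁻¹ : k) ^ 5 * 32 = 1 by field_simp; norm_num, one_smul]
  let a' := mkSO a (by rw [haT, haa]) hda
  let b' := mkSO (cyclicPerm k) hb hdb
  have ha' : a' ^ 2 = 1 := Subtype.ext ((pow_two a).trans haa)
  have hb' : b' ^ 3 = 1 := Subtype.ext hb3
  have hab' : (a' * b') ^ 5 = 1 := Subtype.ext hab5
  obtain ⟨F, F2, F3⟩ := exists_hom_of_relations ha' hb' hab'
  have hF2 : (F x2).1 = a := congrArg Subtype.val F2
  have hF3 : (F x3).1 = cyclicPerm k := congrArg Subtype.val F3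
  let T : OrthIrrep k 3 :=
    { S := (Matrix.specialOrthogonalGroup (Fin 3) k).subtype.comp F
      orth := fun x => so_mul_transpose _
      scalar := fun X hX => by
        have h : (F x2).1 * X = X * (F x2).1 := hX x2
        have h' : (F x3).1 * X = X * (F x3).1 := hX x3
        rw [hF2, Matrix.smul_mul, Matrix.mul_smul] at h
        rw [hF3] at h'
        exact scalar_of_commute_halfTurn h2 (smul_right_injective _ (inv_ne_zero h2) h) h'
      pos := three_pos }
  have hT2 : T.S x2 = a := hF2
  have hT3 : T.S x3 = cyclicPerm k := hF3
  refine ⟨T, ?_, ?_, ?_⟩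
  · rw [hT2, Matrix.trace_smul, show (halfTurn f).trace = -2 by simp [halfTurn, Matrix.trace_fin_three]; ring, smul_eq_mul]
    field_simp
  · rw [hT3]
    simp [cyclicPerm, Matrix.trace_fin_three]
  · have h : (halfTurn f * cyclicPerm k).trace = 2 * f := by
      simp [halfTurn, cyclicPerm, Matrix.trace_fin_three]
      ring
    rw [alt5_trace_inv, map_mul, hT2, hT3, Matrix.smul_mul, Matrix.trace_smul, h, smul_eq_mul]
    field_simp

end IcosahedralIrrep

/-! ### Traces and multiplicities -/

section Traces

variable {k : Type*} [Field k] {m : ℕ}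

theorem Adapted.trace {n : ℕ} {I : Type*} [Fintype I] [DecidableEq I] {g : Matrix (Fin n) (Fin n) k}
    {v : I ⊕ I → Fin n → k} {L : I → kˣ} (h : Adapted g v L) (hI : 2 * Fintype.card I = n) :
    g.trace = ∑ i, ((L i : k) + (L i : k)⁻¹) := by
  rw [h.eq_hypMat_mul hI, Matrix.mul_assoc, Matrix.trace_mul_comm, Matrix.mul_assoc, hypDual_mul_hypMat h.1, Matrix.mul_one,
    Matrix.trace_diagonal, Fintype.sum_sum_type, Finset.sum_add_distrib]
  simp

theorem IsType2.trace {g : SO2 m k} {a b : ℕ} (h : IsType2 g a b) : g.1.trace = 2 * a - 2 * b := by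
  obtain ⟨hab, v, h⟩ := h
  rw [h.trace (by simp [hab]), Fintype.sum_sum_type]
  simp [label2]
  ring

theorem IsType3.trace {ω : kˣ} (hω : IsPrimitiveRoot ω 3) {g : SO2 m k} {a b : ℕ} (h : IsType3 ω g a b) :
    g.1.trace = 2 * a - b := by
  obtain ⟨hab, v, h⟩ := h
  have h1 : (ω : k) ^ 2 + ω + 1 = 0 := by
    have := (IsPrimitiveRoot.coe_units_iff.2 hω).geom_sum_eq_zero (by decide)
    simp only [Finset.sum_range_succ, Finset.sum_range_zero, _root_.pow_zero, pow_one] at this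
    linear_combination this
  have h3 : (ω : k) + (ω : k)⁻¹ = -1 := by
    have := ω.ne_zero
    field_simp
    linear_combination h1
  rw [h.trace (by simp [hab]), Fintype.sum_sum_type]
  simp [label3, h3]
  ring

/-- The golden ratio `-(ζ + ζ⁻¹)`. -/
def RootsOfUnity.golden (S : RootsOfUnity k) : k := -((S.ζ : k) + (S.ζ : k)⁻¹)

theorem RootsOfUnity.golden_sq (S : RootsOfUnity k) : S.golden ^ 2 = S.golden + 1 := by
  have := (IsPrimitiveRoot.coe_units_iff.2 S.hζ).geom_sum_eq_zero (by decide)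
  simp only [Finset.sum_range_succ, Finset.sum_range_zero, _root_.pow_zero, pow_one] at this
  have h0 := S.ζ.ne_zero
  rw [RootsOfUnity.golden]
  field_simp
  linear_combination this

theorem RootsOfUnity.golden_ne (S : RootsOfUnity k) : S.golden ≠ 1 - S.golden := by
  intro h
  have h1 := S.golden_sq
  apply S.five_ne
  linear_combination (2 * S.golden - 1) * h - 4 * h1

theorem IsType5.trace (S : RootsOfUnity k) {g : SO2 m k} {a b c : ℕ} (h : IsType5 S.ζ g a b c) :
    g.1.trace = 2 * a - b * S.golden + c * (S.golden - 1) := by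
  obtain ⟨hab, v, h⟩ := h
  have h1 : (S.ζ : k) + (S.ζ : k)⁻¹ = -S.golden := (neg_neg _).symm
  have h3 : (S.ζ : k) ^ 2 + ((S.ζ : k) ^ 2)⁻¹ = S.golden - 1 := by
    have h0 := S.ζ.ne_zero
    have h4 : (S.ζ : k) ^ 2 + ((S.ζ : k) ^ 2)⁻¹ = ((S.ζ : k) + (S.ζ : k)⁻¹) ^ 2 - 2 := by
      field_simp
      ring
    rw [h4, h1]
    linear_combination S.golden_sq
  rw [h.trace (by simp [hab]), Fintype.sum_sum_type, Fintype.sum_sum_type]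
  simp only [label5, Sum.elim_inl, Sum.elim_inr, Units.val_pow_eq_pow_val, h1, h3]
  simp
  ring

theorem IsType2.unique [Infinite k] (h2 : (2 : k) ≠ 0) {g : SO2 m k} {a b a' b' : ℕ} (h : IsType2 g a b)
    (h' : IsType2 g a' b') : a = a' ∧ b = b' := by
  classical
  obtain ⟨hab, v, h⟩ := h
  obtain ⟨hab', v', h'⟩ := h'
  have e := h.mult_eq (by simp [hab]) h' (by simp [hab']) 1
  have h1 : (-1 : kˣ) ≠ 1 := fun h => h2 (by
    have := congrArg Units.val h
    rw [Units.val_neg, Units.val_one] at this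
    linear_combination -this)
  rw [label2, mult_sumElim, label2, mult_sumElim, mult_const, mult_const, mult_const, mult_const] at e
  simp [h1] at e
  omega

end Traces

/-! ### Regular homomorphisms from sums of irreducible representations -/

section Models

variable {k : Type*} [Field k] [IsAlgClosed k] {m : ℕ}

/-- The degrees of the irreducible representations of `𝒜₅`. -/
def irrepDegree : Fin 5 → ℕ := ![1, 3, 3, 4, 5]

/-- The irreducible representations of `𝒜₅`, with their characters at `x₂`, `x₃`, `x₅`. -/
theorem exists_irreps (S : RootsOfUnity k) : ∃ T : ∀ κ, OrthIrrep k (irrepDegree κ),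
    ∀ κ, ((T κ).S x2).trace = ![1, -1, -1, 0, 1] κ ∧ ((T κ).S x3).trace = ![1, 0, 0, 1, -1] κ ∧
      ((T κ).S x5).trace = ![1, S.golden, 1 - S.golden, -1, 0] κ := by
  have key : ∀ κ, ∃ T : OrthIrrep k (irrepDegree κ), (T.S x2).trace = ![1, -1, -1, 0, 1] κ ∧
      (T.S x3).trace = ![1, 0, 0, 1, -1] κ ∧ (T.S x5).trace = ![1, S.golden, 1 - S.golden, -1, 0] κ := by
    intro κ
    match κ with
    | 0 =>
      obtain ⟨T, hT⟩ := exists_irrep1 k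
      exact ⟨T, hT _, hT _, hT _⟩
    | 1 => exact exists_irrep3 S.two_ne S.golden_sq
    | 2 => exact exists_irrep3 S.two_ne (f := 1 - S.golden) (by linear_combination S.golden_sq)
    | 3 => exact exists_irrep4 S
    | 4 => exact exists_irrep5 S
  choose T hT using key
  exact ⟨T, hT⟩

omit [IsAlgClosed k] in
/-- The characters of the irreducible representations are distinct. -/
theorem irreps_distinct (S : RootsOfUnity k) {κ κ' : Fin 5} (h : κ ≠ κ') :
    (![1, -1, -1, 0, 1] : Fin 5 → k) κ ≠ (![1, -1, -1, 0, 1] : Fin 5 → k) κ' ∨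
    (![1, 0, 0, 1, -1] : Fin 5 → k) κ ≠ (![1, 0, 0, 1, -1] : Fin 5 → k) κ' ∨
    ![1, S.golden, 1 - S.golden, -1, 0] κ ≠ ![1, S.golden, 1 - S.golden, -1, 0] κ' := by
  have h2 := S.two_ne
  have h3 := S.golden_ne
  have h4 : (1 : k) ≠ 0 := one_ne_zero
  fin_cases κ <;> fin_cases κ' <;> simp at h ⊢ <;> grind

/-- The eigenvalue data of the images of the generators: the types of `ρ(x₂)`, `ρ(x₃)`, `ρ(x₅)` are `(D 0, D 1)`,
`(D 2, D 3)` and `(D 4, D 5, D 6)`. -/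
def HasTypes (S : RootsOfUnity k) (ρ : Alt5 →* SO2 m k) (D : Fin 7 → ℕ) : Prop :=
  IsType2 (ρ x2) (D 0) (D 1) ∧ IsType3 S.ω (ρ x3) (D 2) (D 3) ∧ IsType5 S.ζ (ρ x5) (D 4) (D 5) (D 6)

/-- `ρ` is a regular homomorphism with the eigenvalue data `D`, the only one up to conjugacy, and it decomposes into
irreducibles of degrees `l`. -/
structure IsModel (S : RootsOfUnity k) (ρ : Alt5 →* SO2 m k) (l : List ℕ) (D : Fin 7 → ℕ) : Prop where
  regular : IsRegularHom ((proj m k).comp ρ)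
  decomposes : DecomposesAs (orthRep ρ) l
  types : HasTypes S ρ D
  conj : ∀ ρ' : Alt5 →* SO2 m k, IsRegularHom ((proj m k).comp ρ') → HasTypes S ρ' D →
    ConjHom ((proj m k).comp ρ) ((proj m k).comp ρ')

/-- The numerical data are those of a regular triple. -/
def IsRegularVector (m : ℕ) (D : Fin 7 → ℕ) : Prop := IsRegularData m (D 0) (D 1) (D 2) (D 3) (D 4) (D 5) (D 6)

/-- The traces of the images of the generators in the orthogonal sum of the irreducible representations numbered by `κ`
are those prescribed by the data `D`. -/
structure HasTraces (S : RootsOfUnity k) {d : ℕ} (κ : Fin d → Fin 5) (D : Fin 7 → ℕ) : Prop where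
  trace2 : (2 * D 0 - 2 * D 1 : k) = ∑ i, ![1, -1, -1, 0, 1] (κ i)
  trace3 : (2 * D 2 - D 3 : k) = ∑ i, ![1, 0, 0, 1, -1] (κ i)
  trace5 : 2 * D 4 - D 5 * S.golden + D 6 * (S.golden - 1) = ∑ i, ![1, S.golden, 1 - S.golden, -1, 0] (κ i)

omit [IsAlgClosed k] in
/-- Regular data are determined by the traces of the images of the generators. -/
theorem HasTraces.unique {S : RootsOfUnity k} {d : ℕ} {κ : Fin d → Fin 5} {D D' : Fin 7 → ℕ} (h : HasTraces S κ D)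
    (h' : HasTraces S κ D') (hD : IsRegularVector m D) (hD' : IsRegularVector m D') : D = D' := by
  obtain ⟨e2, e3, e5⟩ := h
  obtain ⟨e2', e3', e5'⟩ := h'
  rw [← e2'] at e2
  rw [← e3'] at e3
  rw [← e5'] at e5
  obtain ⟨a, b, a', b', a'', b'', c'', rfl⟩ : ∃ a b a' b' a'' b'' c'', D = ![a, b, a', b', a'', b'', c''] :=
    ⟨D 0, D 1, D 2, D 3, D 4, D 5, D 6, by funext i; fin_cases i <;> rfl⟩
  obtain ⟨x, y, x', y', x'', y'', z'', rfl⟩ : ∃ a b a' b' a'' b'' c'', D' = ![a, b, a', b', a'', b'', c''] :=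
    ⟨D' 0, D' 1, D' 2, D' 3, D' 4, D' 5, D' 6, by funext i; fin_cases i <;> rfl⟩
  -- the traces of different regular data differ by one of the following numbers, which are nonzero
  -- in `k`
  have h4 : (4 : k) ≠ 0 := fun h => mul_ne_zero S.two_ne S.two_ne (by linear_combination h)
  have h3 := S.three_ne
  have hg := S.golden_ne
  have hg3 : S.golden ≠ 3 := fun h => S.five_ne (by linear_combination S.golden_sq - (S.golden + 2) * h)
  have hg2 : S.golden ≠ -2 := fun h => S.five_ne (by linear_combination S.golden_sq - (S.golden - 3) * h)
  obtain ⟨d2, d3, d5⟩ := hD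
  obtain ⟨d2', d3', d5'⟩ := hD'
  simp at d2 d3 d5 d2' d3' d5' e2 e3 e5
  have k2 : a = x ∧ b = y := by
    rcases d2 with ⟨rfl, rfl, rfl⟩ | ⟨rfl, rfl, rfl⟩ | ⟨rfl, rfl, rfl⟩ | ⟨rfl, rfl, rfl⟩ | ⟨rfl, rfl, rfl⟩ <;>
      rcases d2' with ⟨h, rfl, rfl⟩ | ⟨h, rfl, rfl⟩ | ⟨h, rfl, rfl⟩ | ⟨h, rfl, rfl⟩ | ⟨h, rfl, rfl⟩ <;>
      first
      | exact ⟨rfl, rfl⟩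
      | exact absurd h (by decide)
      | (push_cast at e2; exact absurd (by linear_combination e2) h4)
      | (push_cast at e2; exact absurd (by linear_combination -e2) h4)
  have k3 : a' = x' ∧ b' = y' := by
    rcases d3 with ⟨rfl, rfl, rfl⟩ | ⟨rfl, rfl, rfl⟩ | ⟨rfl, rfl, rfl⟩ | ⟨rfl, rfl, rfl⟩ | ⟨rfl, rfl, rfl⟩ <;>
      rcases d3' with ⟨h, rfl, rfl⟩ | ⟨h, rfl, rfl⟩ | ⟨h, rfl, rfl⟩ | ⟨h, rfl, rfl⟩ | ⟨h, rfl, rfl⟩ <;>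
      first
      | exact ⟨rfl, rfl⟩
      | exact absurd h (by decide)
      | (push_cast at e3; exact absurd (by linear_combination e3) h3)
      | (push_cast at e3; exact absurd (by linear_combination -e3) h3)
  have k5 : a'' = x'' ∧ b'' = y'' ∧ c'' = z'' := by
    rcases d5 with ⟨rfl, rfl, rfl, rfl⟩ | ⟨rfl, rfl, rfl, rfl⟩ | ⟨rfl, rfl, rfl, rfl⟩ | ⟨rfl, rfl, rfl, rfl⟩ |
      ⟨rfl, rfl, rfl, rfl⟩ | ⟨rfl, rfl, rfl, rfl⟩ | ⟨rfl, rfl, rfl, rfl⟩ <;>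
      rcases d5' with ⟨h, rfl, rfl, rfl⟩ | ⟨h, rfl, rfl, rfl⟩ | ⟨h, rfl, rfl, rfl⟩ | ⟨h, rfl, rfl, rfl⟩ |
      ⟨h, rfl, rfl, rfl⟩ | ⟨h, rfl, rfl, rfl⟩ | ⟨h, rfl, rfl, rfl⟩ <;>
      first
      | exact ⟨rfl, rfl, rfl⟩
      | exact absurd h (by decide)
      | (push_cast at e5; exact absurd (by linear_combination e5) hg)
      | (push_cast at e5; exact absurd (by linear_combination -e5) hg)
      | (push_cast at e5; exact absurd (by linear_combination e5) hg2)
      | (push_cast at e5; exact absurd (by linear_combination -e5) hg2)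
      | (push_cast at e5; exact absurd (by linear_combination e5) hg3)
      | (push_cast at e5; exact absurd (by linear_combination -e5) hg3)
  obtain ⟨rfl, rfl⟩ := k2
  obtain ⟨rfl, rfl⟩ := k3
  obtain ⟨rfl, rfl, rfl⟩ := k5
  rfl

/-- The orthogonal sum of the distinct irreducible representations numbered by `κ`. Its eigenvalue data are regular, hence
determined by the traces. -/
theorem exists_model (S : RootsOfUnity k) (hm : 4 ≤ m) {l : List ℕ} (κ : Fin l.length → Fin 5)
    (hκ : Function.Injective κ) (hl : ∀ i, irrepDegree (κ i) = l.get i) (hsum : ∑ i, irrepDegree (κ i) = 2 * m)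
    (hodd : ∃ i, Odd (irrepDegree (κ i))) {D : Fin 7 → ℕ} (hD : IsRegularVector m D) (hlen : l.length ≤ D 2 + D 4)
    (htr : HasTraces S κ D) : ∃ ρ : Alt5 →* SO2 m k, IsModel S ρ l D := by
  have h2m : 2 ≤ m := by omega
  have hG := card_alt5_ne_zero S
  obtain ⟨T, hT⟩ := exists_irreps S
  obtain ⟨ρ, ⟨dec⟩⟩ := exists_decomposition (m := m) (fun i => T (κ i)) hsum
  have hS : ∀ i j, i ≠ j → ∃ x, ((T (κ i)).S x).trace ≠ ((T (κ j)).S x).trace := by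
    intro i j hij
    obtain ⟨p2, p3, p5⟩ := hT (κ i)
    obtain ⟨q2, q3, q5⟩ := hT (κ j)
    rcases irreps_distinct S (hκ.ne hij) with h | h | h
    · exact ⟨x2, by rwa [p2, q2]⟩
    · exact ⟨x3, by rwa [p3, q3]⟩
    · exact ⟨x5, by rwa [p5, q5]⟩
  have hreg := dec.isRegularHom S.two_ne h2m hG hS
  obtain ⟨a, b, a', b', a'', b'', c'', t₂, t₃, t₅, hd⟩ := exists_data_of_lift S hm hreg
  have htr' : HasTraces S κ ![a, b, a', b', a'', b'', c''] :=
    ⟨t₂.trace.symm.trans ((dec.trace x2).trans (Finset.sum_congr rfl fun i _ => (hT (κ i)).1)),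
      (t₃.trace S.hω).symm.trans ((dec.trace x3).trans (Finset.sum_congr rfl fun i _ => (hT (κ i)).2.1)),
      (t₅.trace S).symm.trans ((dec.trace x5).trans (Finset.sum_congr rfl fun i _ => (hT (κ i)).2.2))⟩
  -- the data and the prescribed ones are both regular and have the same traces
  obtain rfl := htr.unique htr' hD hd
  refine ⟨ρ, hreg, dec.decomposesAs hG hl, ⟨t₂, t₃, t₅⟩, ?_⟩
  rintro ρ' hreg' ⟨t₂', t₃', t₅'⟩
  have hdim := le_finrank_intertwiners S hd t₂ t₃ t₅ t₂' t₃' t₅'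
  obtain ⟨g, hg⟩ := dec.exists_conj S.two_ne hG hS (skew_intertwiner_eq_zero S.two_ne h2m hreg')
    (by rw [Fintype.card_fin]; exact hlen.trans hdim) hodd
  refine ⟨proj m k g, fun x => ?_⟩
  rw [MonoidHom.comp_apply, hg x, map_mul, map_mul, map_inv]
  rfl

end Models

/-! ### The ten regular homomorphisms -/

section ExplicitModels

variable {k : Type*} [Field k] [IsAlgClosed k]

/-- The sum `1 + 3 + 4`. -/
theorem exists_model_134 (S : RootsOfUnity k) : ∃ ρ : Alt5 →* SO2 4 k, IsModel S ρ [1, 3, 4] ![2, 2, 2, 2, 1, 1, 2] := by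
  refine exists_model S (by decide) (l := [1, 3, 4]) (show Fin 3 → Fin 5 from ![0, 1, 3]) (by decide) (by decide) (by decide) (by decide)
    (by unfold IsRegularVector IsRegularData; decide) (by decide) ⟨?_, ?_, ?_⟩
  all_goals
    change _ = ∑ i : Fin 3, _
    simp [Fin.sum_univ_succ]
    try ring

/-- The sum `1 + 3' + 4`, with the conjugate representation of degree `3`. -/
theorem exists_model_134' (S : RootsOfUnity k) : ∃ ρ : Alt5 →* SO2 4 k, IsModel S ρ [1, 3, 4] ![2, 2, 2, 2, 1, 2, 1] := by
  refine exists_model S (by decide) (l := [1, 3, 4]) (show Fin 3 → Fin 5 from ![0, 2, 3]) (by decide) (by decide) (by decide) (by decide)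
    (by unfold IsRegularVector IsRegularData; decide) (by decide) ⟨?_, ?_, ?_⟩
  all_goals
    change _ = ∑ i : Fin 3, _
    simp [Fin.sum_univ_succ]
    try ring

/-- The sum `3 + 5`. -/
theorem exists_model_35 (S : RootsOfUnity k) : ∃ ρ : Alt5 →* SO2 4 k, IsModel S ρ [3, 5] ![2, 2, 1, 3, 1, 1, 2] := by
  refine exists_model S (by decide) (l := [3, 5]) (show Fin 2 → Fin 5 from ![1, 4]) (by decide) (by decide) (by decide) (by decide)
    (by unfold IsRegularVector IsRegularData; decide) (by decide) ⟨?_, ?_, ?_⟩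
  all_goals
    change _ = ∑ i : Fin 2, _
    simp [Fin.sum_univ_succ]
    try ring

/-- The sum `3' + 5`. -/
theorem exists_model_35' (S : RootsOfUnity k) : ∃ ρ : Alt5 →* SO2 4 k, IsModel S ρ [3, 5] ![2, 2, 1, 3, 1, 2, 1] := by
  refine exists_model S (by decide) (l := [3, 5]) (show Fin 2 → Fin 5 from ![2, 4]) (by decide) (by decide) (by decide) (by decide)
    (by unfold IsRegularVector IsRegularData; decide) (by decide) ⟨?_, ?_, ?_⟩
  all_goals
    change _ = ∑ i : Fin 2, _
    simp [Fin.sum_univ_succ]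
    try ring

/-- The sum `3 + 3' + 4`. -/
theorem exists_model_334 (S : RootsOfUnity k) : ∃ ρ : Alt5 →* SO2 5 k, IsModel S ρ [3, 3, 4] ![2, 3, 2, 3, 1, 2, 2] := by
  refine exists_model S (by decide) (l := [3, 3, 4]) (show Fin 3 → Fin 5 from ![1, 2, 3]) (by decide) (by decide) (by decide) (by decide)
    (by unfold IsRegularVector IsRegularData; decide) (by decide) ⟨?_, ?_, ?_⟩
  all_goals
    change _ = ∑ i : Fin 3, _
    simp [Fin.sum_univ_succ]
    try ring

/-- The sum `1 + 4 + 5`. -/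
theorem exists_model_145 (S : RootsOfUnity k) : ∃ ρ : Alt5 →* SO2 5 k, IsModel S ρ [1, 4, 5] ![3, 2, 2, 3, 1, 2, 2] := by
  refine exists_model S (by decide) (l := [1, 4, 5]) (show Fin 3 → Fin 5 from ![0, 3, 4]) (by decide) (by decide) (by decide) (by decide)
    (by unfold IsRegularVector IsRegularData; decide) (by decide) ⟨?_, ?_, ?_⟩
  all_goals
    change _ = ∑ i : Fin 3, _
    simp [Fin.sum_univ_succ]
    try ring

/-- The sum `1 + 3 + 3' + 5`. -/
theorem exists_model_1335 (S : RootsOfUnity k) : ∃ ρ : Alt5 →* SO2 6 k, IsModel S ρ [1, 3, 3, 5] ![3, 3, 2, 4, 2, 2, 2] := by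
  refine exists_model S (by decide) (l := [1, 3, 3, 5]) (show Fin 4 → Fin 5 from ![0, 1, 2, 4]) (by decide) (by decide) (by decide) (by decide)
    (by unfold IsRegularVector IsRegularData; decide) (by decide) ⟨?_, ?_, ?_⟩
  all_goals
    change _ = ∑ i : Fin 4, _
    simp [Fin.sum_univ_succ]
    try ring

/-- The sum `3 + 4 + 5`. -/
theorem exists_model_345 (S : RootsOfUnity k) : ∃ ρ : Alt5 →* SO2 6 k, IsModel S ρ [3, 4, 5] ![3, 3, 2, 4, 1, 2, 3] := by
  refine exists_model S (by decide) (l := [3, 4, 5]) (show Fin 3 → Fin 5 from ![1, 3, 4]) (by decide) (by decide) (by decide) (by decide)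
    (by unfold IsRegularVector IsRegularData; decide) (by decide) ⟨?_, ?_, ?_⟩
  all_goals
    change _ = ∑ i : Fin 3, _
    simp [Fin.sum_univ_succ]
    try ring

/-- The sum `3' + 4 + 5`. -/
theorem exists_model_345' (S : RootsOfUnity k) : ∃ ρ : Alt5 →* SO2 6 k, IsModel S ρ [3, 4, 5] ![3, 3, 2, 4, 1, 3, 2] := by
  refine exists_model S (by decide) (l := [3, 4, 5]) (show Fin 3 → Fin 5 from ![2, 3, 4]) (by decide) (by decide) (by decide) (by decide)
    (by unfold IsRegularVector IsRegularData; decide) (by decide) ⟨?_, ?_, ?_⟩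
  all_goals
    change _ = ∑ i : Fin 3, _
    simp [Fin.sum_univ_succ]
    try ring

/-- The sum of all the irreducible representations. -/
theorem exists_model_13345 (S : RootsOfUnity k) : ∃ ρ : Alt5 →* SO2 8 k, IsModel S ρ [1, 3, 3, 4, 5] ![4, 4, 3, 5, 2, 3, 3] := by
  refine exists_model S (by decide) (l := [1, 3, 3, 4, 5]) (show Fin 5 → Fin 5 from ![0, 1, 2, 3, 4]) (by decide) (by decide) (by decide) (by decide)
    (by unfold IsRegularVector IsRegularData; decide) (by decide) ⟨?_, ?_, ?_⟩
  all_goals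
    change _ = ∑ i : Fin 5, _
    simp [Fin.sum_univ_succ]
    try ring

end ExplicitModels

/-! ### From eigenvalue data to classes -/

section Classification

variable {k : Type*} [Field k] [IsAlgClosed k] {m : ℕ} {S : RootsOfUnity k}

theorem ConjHom.symm {G : Type*} [Group G] {ψ ψ' : Alt5 →* G} (h : ConjHom ψ ψ') : ConjHom ψ' ψ := by
  obtain ⟨g, hg⟩ := h
  exact ⟨g⁻¹, fun x => by rw [hg]; group⟩

omit [IsAlgClosed k] in
/-- Regularity is invariant under conjugation. -/
theorem ConjHom.isRegularHom (h2 : (2 : k) ≠ 0) (hm : 2 ≤ m) {ψ ψ' : Alt5 →* PSO m k} (h : ConjHom ψ ψ')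
    (hψ : IsRegularHom ψ) : IsRegularHom ψ' := by
  rw [isRegularHom_iff_finite h2 hm] at hψ ⊢
  obtain ⟨g, hg⟩ := h.symm
  have hmem : ∀ c ∈ Subgroup.centralizer (ψ'.range : Set (PSO m k)),
      g * c * g⁻¹ ∈ Subgroup.centralizer (ψ.range : Set (PSO m k)) := by
    intro c hc
    rw [Subgroup.mem_centralizer_iff] at hc ⊢
    rintro _ ⟨x, rfl⟩
    have := hc _ ⟨x, rfl⟩
    rw [hg]
    calc g * ψ' x * g⁻¹ * (g * c * g⁻¹) = g * (ψ' x * c) * g⁻¹ := by group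
      _ = g * (c * ψ' x) * g⁻¹ := by rw [this]
      _ = _ := by group
  refine Finite.of_injective (fun c => (⟨_, hmem c.1 c.2⟩ : Subgroup.centralizer (ψ.range : Set (PSO m k)))) fun c c' h => ?_
  exact Subtype.ext ((MulAut.conj g).injective (congrArg Subtype.val h))

omit [IsAlgClosed k] in
theorem ConjHom.tripleOf_eq {ψ ψ' : Alt5 →* PSO m k} (h : ConjHom ψ ψ') : tripleOf ψ = tripleOf ψ' := by
  obtain ⟨g, hg⟩ := h
  have : ∀ x, ConjClasses.mk (ψ x) = ConjClasses.mk (ψ' x) := fun x =>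
    ConjClasses.mk_eq_mk_iff_isConj.2 (isConj_iff.2 ⟨g, (hg x).symm⟩)
  exact ClassTriple.ext (this x2) (this x3) (this x5)

omit [IsAlgClosed k] in
theorem HasTypes.hasData {ρ : Alt5 →* SO2 m k} {D : Fin 7 → ℕ} (h : HasTypes S ρ D) :
    HasData S (tripleOf ((proj m k).comp ρ)) (D 0) (D 1) (D 2) (D 3) (D 4) (D 5) (D 6) :=
  ⟨ρ x2, ρ x3, ρ x5, h.1, h.2.1, h.2.2, rfl⟩

/-- The data of a homomorphism to `SO_{2m}` are unique. -/
theorem HasTypes.unique (S : RootsOfUnity k) {ρ : Alt5 →* SO2 m k} {D D' : Fin 7 → ℕ} (h : HasTypes S ρ D)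
    (h' : HasTypes S ρ D') : D = D' := by
  have : Infinite k := IsAlgClosed.instInfinite
  obtain ⟨e0, e1⟩ := h.1.unique S.two_ne h'.1
  obtain ⟨e2, e3⟩ := h.2.1.unique S.hω h'.2.1
  obtain ⟨e4, e5, e6⟩ := h.2.2.unique S.hζ h'.2.2
  funext i
  fin_cases i <;> assumption

/-- The data of regular homomorphisms separate conjugacy classes, so that models for all the regular data represent
all the regular homomorphisms. -/
theorem allRegularHoms_of_models (hm : 4 ≤ m) {d : ℕ} {ρ : Fin d → (Alt5 →* SO2 m k)} {l : Fin d → List ℕ}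
    {D : Fin d → Fin 7 → ℕ} (hmod : ∀ i, IsModel S (ρ i) (l i) (D i)) (hD : Function.Injective D)
    (hall : ∀ a b a' b' a'' b'' c'', IsRegularData m a b a' b' a'' b'' c'' → ∃ i, D i = ![a, b, a', b', a'', b'', c'']) :
    AllRegularHoms fun i => (proj m k).comp (ρ i) := by
  have h2m : 2 ≤ m := by omega
  refine ⟨fun i j hij => hD ?_, fun ψ' => ⟨fun hreg => ?_, ?_⟩⟩
  · obtain ⟨x, hx⟩ := hij
    obtain ⟨g, rfl⟩ := proj_surjective x
    have hlift : ρ j = (MulAut.conj g).toMonoidHom.comp (ρ i) := by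
      refine lift_unique S.two_ne h2m (MonoidHom.ext fun y => (hx y).trans ?_)
      change _ = proj m k (g * ρ i y * g⁻¹)
      rw [map_mul, map_mul, map_inv]
      rfl
    have hconj : ∀ y, IsConj (ρ i y) (ρ j y) := fun y => isConj_iff.2 ⟨g, by rw [hlift]; rfl⟩
    obtain ⟨t₂, t₃, t₅⟩ := (hmod i).types
    exact HasTypes.unique S ⟨t₂.of_isConj (hconj x2), t₃.of_isConj (hconj x3), t₅.of_isConj (hconj x5)⟩ (hmod j).types
  · obtain ⟨ρ', rfl⟩ := exists_lift_of_isRegularHom S hm hreg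
    obtain ⟨a, b, a', b', a'', b'', c'', t₂, t₃, t₅, hd⟩ := exists_data_of_lift S hm hreg
    obtain ⟨i, hi⟩ := hall _ _ _ _ _ _ _ hd
    exact ⟨i, (hmod i).conj ρ' hreg (hi ▸ ⟨t₂, t₃, t₅⟩)⟩
  · rintro ⟨i, hi⟩
    exact hi.isRegularHom S.two_ne h2m (hmod i).regular

theorem IsRegularData.pos {a b a' b' a'' b'' c'' : ℕ} (h : IsRegularData m a b a' b' a'' b'' c'') : 0 < a' ∧ 0 < a'' := by
  obtain ⟨-, h3, h5⟩ := h
  simp only [List.mem_cons, Prod.mk.injEq, List.not_mem_nil, or_false] at h3 h5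
  omega

/-- Triples for all the regular data, up to the order of the eigenvalues `1` and `-1` of the involution, are all the regular
triples. -/
theorem allRegularTriples_of_data (hm : 4 ≤ m) {d : ℕ} {C : Fin d → ClassTriple m k} {D : Fin d → Fin 7 → ℕ}
    (hC : ∀ i, HasData S (C i) (D i 0) (D i 1) (D i 2) (D i 3) (D i 4) (D i 5) (D i 6))
    (hreg : ∀ i, IsRegularVector m (D i)) (hD : ∀ i j, D i 2 = D j 2 → D i 4 = D j 4 → D i 5 = D j 5 → i = j)
    (hall : ∀ a b a' b' a'' b'' c'', IsRegularData m a b a' b' a'' b'' c'' →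
      ∃ i, D i = ![a, b, a', b', a'', b'', c''] ∨ D i = ![b, a, a', b', a'', b'', c'']) : AllRegularTriples C := by
  have h2m : 2 ≤ m := by omega
  have : Infinite k := IsAlgClosed.instInfinite
  refine ⟨fun i j hij => ?_, fun C' => ⟨fun h => ?_, ?_⟩⟩
  · have h := hC i
    rw [hij] at h
    obtain ⟨e2, -, e4, e5, -⟩ := h.unique h2m (hC j)
    exact hD i j e2 e4 e5
  · obtain ⟨a, b, a', b', a'', b'', c'', h', hd⟩ := exists_data_of_isRegular S hm h
    obtain ⟨i, hi | hi⟩ := hall _ _ _ _ _ _ _ hd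
    · have hi' := hC i
      rw [hi] at hi'
      exact ⟨i, h'.eq (by omega) hd.pos.1 hd.pos.2 hi'⟩
    · have hi' := hC i
      rw [hi] at hi'
      exact ⟨i, (h'.swap h2m).eq (by omega) hd.pos.1 hd.pos.2 hi'⟩
  · rintro ⟨i, rfl⟩
    exact ((hC i).isRegular_iff h2m).2 (hreg i).count

omit [IsAlgClosed k] in
theorem triplesInterchanged_of_data (hm : 4 ≤ m) {C C' : ClassTriple m k} {a b a' b' a'' b'' c'' : ℕ}
    (hd : IsRegularData m a b a' b' a'' b'' c'') (h : HasData S C a b a' b' a'' b'' c'')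
    (h' : HasData S C' a b a' b' a'' c'' b'') : TriplesInterchanged C C' :=
  ⟨h.isTwist (by omega) hd.pos.1 hd.pos.2 h', h'.isTwist (by omega) hd.pos.1 hd.pos.2 h⟩

omit [IsAlgClosed k] in
/-- The twist of a homomorphism by `ι` twists its triple. -/
theorem isTwist_tripleOf (ψ : Alt5 →* PSO m k) {ι : MulAut Alt5} (hι : IsIota ι) {C : ClassTriple m k}
    (hC : (tripleOf ψ).IsTwist C) : tripleOf (ψ.comp ι.toMonoidHom) = C := by
  obtain ⟨-, h2, h3, h5⟩ := hι
  obtain ⟨e2, e3, e5⟩ := hC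
  have hmk : ∀ {x y : Alt5}, IsConj x y → ConjClasses.mk (ψ x) = ConjClasses.mk (ψ y) := fun h =>
    ConjClasses.mk_eq_mk_iff_isConj.2 (ψ.map_isConj h)
  refine ClassTriple.ext ((hmk h2).trans e2.symm) ((hmk h3).trans e3.symm) ((hmk h5).trans ?_)
  have hmem : ψ (x5 ^ 2) ∈ C.C5.carrier := by
    rw [e5, map_pow]
    exact ⟨ψ x5, ConjClasses.mem_carrier_mk, rfl⟩
  exact ConjClasses.mem_carrier_iff_mk_eq.1 hmem

omit [IsAlgClosed k] in
/-- If the regular homomorphisms are classified by their triples, the twist by `ι` acts on them as it does on the triples. -/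
theorem homsInterchanged_of_triples {d : ℕ} {ψ : Fin d → (Alt5 →* PSO m k)} {C : Fin d → ClassTriple m k}
    (hψ : AllRegularHoms ψ) (hC : Function.Injective C) (hψC : ∀ i, tripleOf (ψ i) = C i) {i j : Fin d}
    (hij : TriplesInterchanged (C i) (C j)) : HomsInterchanged (ψ i) (ψ j) := by
  have key : ∀ i j, (C i).IsTwist (C j) → ∀ ι : MulAut Alt5, IsIota ι → ConjHom ((ψ i).comp ι.toMonoidHom) (ψ j) := by
    intro i j h ι hι
    have hrange : ((ψ i).comp ι.toMonoidHom).range = (ψ i).range := by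
      ext x
      constructor
      · rintro ⟨y, rfl⟩; exact ⟨ι y, rfl⟩
      · rintro ⟨y, rfl⟩; exact ⟨ι.symm y, congrArg (ψ i) (ι.apply_symm_apply y)⟩
    have hreg : IsRegularHom ((ψ i).comp ι.toMonoidHom) := by
      have : IsRegularHom (ψ i) := (hψ.2 _).2 ⟨i, 1, fun x => by rw [inv_one, one_mul, mul_one]⟩
      rwa [IsRegularHom, hrange]
    obtain ⟨j', hj'⟩ := (hψ.2 _).1 hreg
    have hCj : C j' = C j := by
      rw [← hψC j', hj'.tripleOf_eq]
      exact isTwist_tripleOf (ψ i) hι ((hψC i).symm ▸ h)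
    rw [← hC hCj]
    exact hj'.symm
  exact fun ι hι => ⟨key i j hij.1 ι hι, key j i hij.2 ι hι⟩

omit [IsAlgClosed k] in
theorem IsModel.comesFrom {ρ : Alt5 →* SO2 m k} {l : List ℕ} {D : Fin 7 → ℕ} (h : IsModel S ρ l D) :
    ComesFrom ((proj m k).comp ρ) l := ⟨ρ, rfl, h.decomposes⟩

end Classification

/-! ### Roots of unity -/

section Characteristic

/-- The required roots of unity exist if the characteristic is `0` or at least `7`. -/
theorem nonempty_rootsOfUnity (k : Type*) [Field k] [IsAlgClosed k] (p : ℕ) [CharP k p] (hp : p = 0 ∨ 7 ≤ p) :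
    Nonempty (RootsOfUnity k) := by
  have hne : ∀ n : ℕ, 0 < n → n < 7 → (n : k) ≠ 0 := by
    intro n hn hn7 h
    rw [CharP.cast_eq_zero_iff k p] at h
    rcases hp with rfl | hp
    · exact hn.ne' (zero_dvd_iff.1 h)
    · exact absurd (Nat.le_of_dvd hn h) (by omega)
  have hprim : ∀ n : ℕ, 0 < n → n < 7 → ∃ ζ : kˣ, IsPrimitiveRoot ζ n := by
    intro n hn hn7
    have : NeZero (n : k) := ⟨hne n hn hn7⟩
    obtain ⟨ζ, hζ⟩ := HasEnoughRootsOfUnity.exists_primitiveRoot k n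
    have : NeZero n := ⟨hn.ne'⟩
    exact ⟨hζ.toRootsOfUnity, IsPrimitiveRoot.coe_units_iff.1 hζ⟩
  obtain ⟨ω, hω⟩ := hprim 3 (by norm_num) (by norm_num)
  obtain ⟨ζ, hζ⟩ := hprim 5 (by norm_num) (by norm_num)
  exact ⟨⟨by exact_mod_cast hne 2 (by norm_num) (by norm_num), by exact_mod_cast hne 3 (by norm_num) (by norm_num),
    by exact_mod_cast hne 5 (by norm_num) (by norm_num), ω, hω, ζ, hζ⟩⟩

end Characteristic

/-! ### Identification of the types -/

section RootSystemTypes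

theorem rootIso_D2_D2 : RootIso (rootsD 2 ⊞ rootsD 2) (rootsA 1 ⊞ rootsA 1 ⊞ rootsA 1 ⊞ rootsA 1) :=
  (rootIso_D2.rootSum rootIso_D2).trans (rootSum_assoc _ _ _)

theorem rootIso_D2_GL (b : ℕ) : RootIso (rootsD 2 ⊞ rootsGL (b + 1)) (rootsA b ⊞ rootsA 1 ⊞ rootsA 1) :=
  (rootIso_D2.rootSum (RootIso.refl _)).trans (rootSum_comm _ _)

theorem rootIso_D1 {X : Type*} [AddCommGroup X] (Ψ : Set X) : RootIso (rootsD 1 ⊞ Ψ) Ψ := by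
  rw [rootsD_one]
  exact rootSum_empty Ψ

theorem rootIso_D1_GL1 (b : ℕ) : RootIso (rootsD 1 ⊞ rootsGL 1 ⊞ rootsGL (b + 1)) (rootsA b) := by
  refine (rootIso_D1 _).trans ?_
  rw [rootsGL_one]
  exact rootSum_empty _

theorem rootIso_D1_GL1' (b : ℕ) : RootIso (rootsD 1 ⊞ rootsGL (b + 1) ⊞ rootsGL 1) (rootsA b) := by
  refine (rootIso_D1 _).trans ?_
  rw [rootsGL_one]
  exact rootSum_empty_right _

end RootSystemTypes

/-! ### The classification for each rank -/

section Cases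

variable {k : Type*} [Field k] [IsAlgClosed k]

/-- Models for all the regular data, separated by the data, classify the regular triples and the regular homomorphisms
simultaneously. -/
theorem exists_classification {m : ℕ} (S : RootsOfUnity k) (hm : 4 ≤ m) {d : ℕ} {l : Fin d → List ℕ} (D : Fin d → Fin 7 → ℕ)
    (hmod : ∀ i, ∃ ρ : Alt5 →* SO2 m k, IsModel S ρ (l i) (D i)) (hreg : ∀ i, IsRegularVector m (D i))
    (hD : ∀ i j, D i 2 = D j 2 → D i 4 = D j 4 → D i 5 = D j 5 → i = j)
    (hall : ∀ a b a' b' a'' b'' c'', IsRegularData m a b a' b' a'' b'' c'' → ∃ i, D i = ![a, b, a', b', a'', b'', c'']) :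
    ∃ (C : Fin d → ClassTriple m k) (ψ : Fin d → (Alt5 →* PSO m k)), AllRegularTriples C ∧ AllRegularHoms ψ ∧
      (∀ i, tripleOf (ψ i) = C i) ∧ (∀ i, ComesFrom (ψ i) (l i)) ∧
      (∀ i, HasData S (C i) (D i 0) (D i 1) (D i 2) (D i 3) (D i 4) (D i 5) (D i 6)) ∧
      ∀ i j, TriplesInterchanged (C i) (C j) → HomsInterchanged (ψ i) (ψ j) := by
  choose ρ hρ using hmod
  have hT : AllRegularTriples fun i => tripleOf ((proj m k).comp (ρ i)) :=
    allRegularTriples_of_data hm (fun i => (hρ i).types.hasData) hreg hD fun a b a' b' a'' b'' c'' hd =>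
      (hall _ _ _ _ _ _ _ hd).imp fun _ => Or.inl
  have hH : AllRegularHoms fun i => (proj m k).comp (ρ i) :=
    allRegularHoms_of_models hm hρ (fun i j hij => hD i j (by rw [hij]) (by rw [hij]) (by rw [hij])) hall
  exact ⟨_, _, hT, hH, fun _ => rfl, fun i => (hρ i).comesFrom, fun i => (hρ i).types.hasData,
    fun _ _ hij => homsInterchanged_of_triples hH hT.1 (fun _ => rfl) hij⟩

/-- For `m = 4` the data separate the triples, and the classification is uniform. -/
theorem classification_D4 (S : RootsOfUnity k) :
    ∃ (C : Fin 4 → ClassTriple 4 k) (ψ : Fin 4 → (Alt5 →* PSO 4 k)),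
      AllRegularTriples C ∧
      (∀ i, i = 0 ∨ i = 1 → (C i).HasType
        (rootsA 1 ⊞ rootsA 1 ⊞ rootsA 1 ⊞ rootsA 1) (rootsA 1 ⊞ rootsA 1 ⊞ rootsA 1) (rootsA 1)) ∧
      (∀ i, i = 2 ∨ i = 3 → (C i).HasType
        (rootsA 1 ⊞ rootsA 1 ⊞ rootsA 1 ⊞ rootsA 1) (rootsA 2) (rootsA 1)) ∧
      TriplesInterchanged (C 0) (C 1) ∧ TriplesInterchanged (C 2) (C 3) ∧
      AllRegularHoms ψ ∧ (∀ i, tripleOf (ψ i) = C i) ∧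
      ComesFrom (ψ 0) [1, 3, 4] ∧ ComesFrom (ψ 1) [1, 3, 4] ∧
      ComesFrom (ψ 2) [3, 5] ∧ ComesFrom (ψ 3) [3, 5] ∧
      HomsInterchanged (ψ 0) (ψ 1) ∧ HomsInterchanged (ψ 2) (ψ 3) := by
  obtain ⟨C, ψ, hT, hH, hψC, hψ, hC, hι⟩ := exists_classification (m := 4) S le_rfl
    (l := ![[1, 3, 4], [1, 3, 4], [3, 5], [3, 5]])
    ![![2, 2, 2, 2, 1, 1, 2], ![2, 2, 2, 2, 1, 2, 1], ![2, 2, 1, 3, 1, 1, 2], ![2, 2, 1, 3, 1, 2, 1]]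
    (fun
      | 0 => exists_model_134 S
      | 1 => exists_model_134' S
      | 2 => exists_model_35 S
      | 3 => exists_model_35' S)
    (by unfold IsRegularVector IsRegularData; decide) (by decide) (by
      intro a b a' b' a'' b'' c'' hd
      simp [IsRegularData] at hd
      obtain ⟨⟨rfl, rfl⟩, ⟨rfl, rfl⟩ | ⟨rfl, rfl⟩, ⟨rfl, rfl, rfl⟩ | ⟨rfl, rfl, rfl⟩⟩ := hd
      exacts [⟨2, rfl⟩, ⟨3, rfl⟩, ⟨0, rfl⟩, ⟨1, rfl⟩])
  have h₀ : HasData S (C 0) 2 2 2 2 1 1 2 := hC 0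
  have h₁ : HasData S (C 1) 2 2 2 2 1 2 1 := hC 1
  have h₂ : HasData S (C 2) 2 2 1 3 1 1 2 := hC 2
  have h₃ : HasData S (C 3) 2 2 1 3 1 2 1 := hC 3
  have t₀ := triplesInterchanged_of_data le_rfl (by unfold IsRegularData; decide) h₀ h₁
  have t₂ := triplesInterchanged_of_data le_rfl (by unfold IsRegularData; decide) h₂ h₃
  have type3 : RootIso (rootsD 1 ⊞ rootsGL 3) (rootsA 2) := rootIso_D1 _
  refine ⟨C, ψ, hT, ?_, ?_, t₀, t₂, hH, hψC, hψ 0, hψ 1, hψ 2, hψ 3, hι _ _ t₀, hι _ _ t₂⟩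
  · rintro i (rfl | rfl)
    · exact (h₀.hasType (by decide)).trans rootIso_D2_D2 (rootIso_D2_GL 1) (rootIso_D1_GL1 1)
    · exact (h₁.hasType (by decide)).trans rootIso_D2_D2 (rootIso_D2_GL 1) (rootIso_D1_GL1' 1)
  · rintro i (rfl | rfl)
    · exact (h₂.hasType (by decide)).trans rootIso_D2_D2 type3 (rootIso_D1_GL1 1)
    · exact (h₃.hasType (by decide)).trans rootIso_D2_D2 type3 (rootIso_D1_GL1' 1)

/-- For `m = 5` the two data differ by the exchange of `a` and `b` only, so that they define one
triple. -/
theorem classification_D5 (S : RootsOfUnity k) :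
    ∃ (C : Fin 1 → ClassTriple 5 k) (ψ : Fin 2 → (Alt5 →* PSO 5 k)),
      AllRegularTriples C ∧
      (C 0).HasType (rootsA 3 ⊞ rootsA 1 ⊞ rootsA 1) (rootsA 2 ⊞ rootsA 1 ⊞ rootsA 1)
        (rootsA 1 ⊞ rootsA 1) ∧
      AllRegularHoms ψ ∧ (∀ i, tripleOf (ψ i) = C 0) ∧
      ComesFrom (ψ 0) [3, 3, 4] ∧ ComesFrom (ψ 1) [1, 4, 5] := by
  obtain ⟨ρ₀, h₀⟩ := exists_model_334 S
  obtain ⟨ρ₁, h₁⟩ := exists_model_145 S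
  let ρ : Fin 2 → (Alt5 →* SO2 5 k) := ![ρ₀, ρ₁]
  let l : Fin 2 → List ℕ := ![[3, 3, 4], [1, 4, 5]]
  let D : Fin 2 → Fin 7 → ℕ := ![![2, 3, 2, 3, 1, 2, 2], ![3, 2, 2, 3, 1, 2, 2]]
  have hmod : ∀ i, IsModel S (ρ i) (l i) (D i) := by
    intro i
    match i with
    | 0 => exact h₀
    | 1 => exact h₁
  let C : Fin 1 → ClassTriple 5 k := fun _ => tripleOf ((proj 5 k).comp ρ₁)
  have hC : HasData S (C 0) 3 2 2 3 1 2 2 := h₁.types.hasData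
  -- the two homomorphisms have the same triple, the images of `x₂` in `SO₁₀` differing by the sign
  have hC0 : tripleOf ((proj 5 k).comp ρ₀) = C 0 :=
    (h₀.types.hasData.swap (by decide)).eq (by decide) two_pos one_pos hC
  have hall : ∀ a b a' b' a'' b'' c'', IsRegularData 5 a b a' b' a'' b'' c'' → ∃ i, D i = ![a, b, a', b', a'', b'', c''] := by
    intro a b a' b' a'' b'' c'' hd
    simp [IsRegularData] at hd
    obtain ⟨⟨rfl, rfl⟩ | ⟨rfl, rfl⟩, ⟨rfl, rfl⟩, ⟨rfl, rfl, rfl⟩⟩ := hd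
    exacts [⟨1, rfl⟩, ⟨0, rfl⟩]
  refine ⟨C, fun i => (proj 5 k).comp (ρ i), ?_, ?_, allRegularHoms_of_models (by decide) hmod (by decide) hall, ?_,
    h₀.comesFrom, h₁.comesFrom⟩
  · refine allRegularTriples_of_data (D := fun _ => D 1) (by decide) (fun _ => hC) (fun _ => ?_)
      (fun i j _ _ _ => Subsingleton.elim i j) fun a b a' b' a'' b'' c'' hd => ⟨0, ?_⟩
    · unfold IsRegularVector IsRegularData
      decide
    · simp [IsRegularData] at hd
      obtain ⟨⟨rfl, rfl⟩ | ⟨rfl, rfl⟩, ⟨rfl, rfl⟩, ⟨rfl, rfl, rfl⟩⟩ := hd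
      exacts [Or.inl rfl, Or.inr rfl]
  · exact (hC.hasType (by decide)).trans (rootIso_D3.rootSum rootIso_D2) (rootIso_D2_GL 2) (rootIso_D1 _)
  · intro i
    match i with
    | 0 => exact hC0
    | 1 => rfl

/-- For `m = 6` the data separate the triples, and the classification is uniform. -/
theorem classification_D6 (S : RootsOfUnity k) :
    ∃ (C : Fin 3 → ClassTriple 6 k) (ψ : Fin 3 → (Alt5 →* PSO 6 k)),
      AllRegularTriples C ∧
      (C 0).HasType (rootsA 3 ⊞ rootsA 3) (rootsA 3 ⊞ rootsA 1 ⊞ rootsA 1)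
        (rootsA 1 ⊞ rootsA 1 ⊞ rootsA 1 ⊞ rootsA 1) ∧
      (∀ i, i = 1 ∨ i = 2 → (C i).HasType (rootsA 3 ⊞ rootsA 3)
        (rootsA 3 ⊞ rootsA 1 ⊞ rootsA 1) (rootsA 2 ⊞ rootsA 1)) ∧
      TriplesInterchanged (C 1) (C 2) ∧
      AllRegularHoms ψ ∧ (∀ i, tripleOf (ψ i) = C i) ∧
      ComesFrom (ψ 0) [1, 3, 3, 5] ∧ ComesFrom (ψ 1) [3, 4, 5] ∧ ComesFrom (ψ 2) [3, 4, 5] ∧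
      HomsInterchanged (ψ 1) (ψ 2) := by
  obtain ⟨C, ψ, hT, hH, hψC, hψ, hC, hι⟩ := exists_classification (m := 6) S (by decide)
    (l := ![[1, 3, 3, 5], [3, 4, 5], [3, 4, 5]])
    ![![3, 3, 2, 4, 2, 2, 2], ![3, 3, 2, 4, 1, 2, 3], ![3, 3, 2, 4, 1, 3, 2]]
    (fun
      | 0 => exists_model_1335 S
      | 1 => exists_model_345 S
      | 2 => exists_model_345' S)
    (by unfold IsRegularVector IsRegularData; decide) (by decide) (by
      intro a b a' b' a'' b'' c'' hd
      simp [IsRegularData] at hd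
      obtain ⟨⟨rfl, rfl⟩, ⟨rfl, rfl⟩, ⟨rfl, rfl, rfl⟩ | ⟨rfl, rfl, rfl⟩ | ⟨rfl, rfl, rfl⟩⟩ := hd
      exacts [⟨0, rfl⟩, ⟨2, rfl⟩, ⟨1, rfl⟩])
  have h₀ : HasData S (C 0) 3 3 2 4 2 2 2 := hC 0
  have h₁ : HasData S (C 1) 3 3 2 4 1 2 3 := hC 1
  have h₂ : HasData S (C 2) 3 3 2 4 1 3 2 := hC 2
  have t₁ := triplesInterchanged_of_data (by decide) (by unfold IsRegularData; decide) h₁ h₂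
  have type2 := rootIso_D3.rootSum rootIso_D3
  have type5 : RootIso (rootsGL 2 ⊞ rootsGL 3) (rootsA 2 ⊞ rootsA 1) := rootSum_comm _ _
  refine ⟨C, ψ, hT, ?_, ?_, t₁, hH, hψC, hψ 0, hψ 1, hψ 2, hι _ _ t₁⟩
  · exact (h₀.hasType (by decide)).trans type2 (rootIso_D2_GL 3)
      ((rootIso_D2.rootSum (RootIso.refl _)).trans (rootSum_assoc _ _ _))
  · rintro i (rfl | rfl)
    · exact (h₁.hasType (by decide)).trans type2 (rootIso_D2_GL 3) ((rootIso_D1 _).trans type5)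
    · exact (h₂.hasType (by decide)).trans type2 (rootIso_D2_GL 3) (rootIso_D1 _)

/-- For `m = 8` there is only one datum. -/
theorem classification_D8 (S : RootsOfUnity k) :
    ∃ (C : Fin 1 → ClassTriple 8 k) (ψ : Fin 1 → (Alt5 →* PSO 8 k)),
      AllRegularTriples C ∧
      (C 0).HasType (rootsD 4 ⊞ rootsD 4) (rootsA 4 ⊞ rootsA 3)
        (rootsA 2 ⊞ rootsA 2 ⊞ rootsA 1 ⊞ rootsA 1) ∧
      AllRegularHoms ψ ∧ tripleOf (ψ 0) = C 0 ∧
      ComesFrom (ψ 0) [1, 3, 3, 4, 5] := by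
  obtain ⟨ρ, h⟩ := exists_model_13345 S
  let D : Fin 1 → Fin 7 → ℕ := fun _ => ![4, 4, 3, 5, 2, 3, 3]
  have hC := h.types.hasData
  have hall : ∀ a b a' b' a'' b'' c'', IsRegularData 8 a b a' b' a'' b'' c'' → ∃ i, D i = ![a, b, a', b', a'', b'', c''] := by
    intro a b a' b' a'' b'' c'' hd
    simp [IsRegularData] at hd
    obtain ⟨⟨rfl, rfl⟩, ⟨rfl, rfl⟩, ⟨rfl, rfl, rfl⟩⟩ := hd
    exact ⟨0, rfl⟩
  refine ⟨fun _ => tripleOf ((proj 8 k).comp ρ), fun _ => (proj 8 k).comp ρ,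
    allRegularTriples_of_data (D := D) (by decide) (fun _ => hC) (fun _ => ?_) (fun i j _ _ _ => Subsingleton.elim i j)
      fun a b a' b' a'' b'' c'' hd => (hall _ _ _ _ _ _ _ hd).imp fun _ => Or.inl, ?_,
    allRegularHoms_of_models (D := D) (by decide) (fun _ => h) (Function.injective_of_subsingleton _) hall, rfl, h.comesFrom⟩
  · unfold IsRegularVector IsRegularData
    decide
  · exact (hC.hasType (by decide)).trans (RootIso.refl _) ((rootIso_D3.rootSum (RootIso.refl _)).trans (rootSum_comm _ _))
      ((rootIso_D2.rootSum (RootIso.refl _)).trans ((rootSum_comm _ _).trans (rootSum_assoc _ _ _)))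

/-- There are no regular data for `m = 7` and `m ≥ 9`. -/
theorem not_isRegularData {m : ℕ} (hm : m = 7 ∨ 9 ≤ m) {a b a' b' a'' b'' c'' : ℕ} :
    ¬ IsRegularData m a b a' b' a'' b'' c'' := by
  rintro ⟨h, -⟩
  simp only [List.mem_cons, Prod.mk.injEq, List.not_mem_nil, or_false] at h
  omega

end Cases

theorem mainTheorem7 (k : Type*) [Field k] [IsAlgClosed k] (p : ℕ) [CharP k p]
    (hp : p = 0 ∨ 7 ≤ p) :
    -- type `D₄`
    (∃ (C : Fin 4 → ClassTriple 4 k) (ψ : Fin 4 → (Alt5 →* PSO 4 k)),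
      AllRegularTriples C ∧
      (∀ i, i = 0 ∨ i = 1 → (C i).HasType
        (rootsA 1 ⊞ rootsA 1 ⊞ rootsA 1 ⊞ rootsA 1) (rootsA 1 ⊞ rootsA 1 ⊞ rootsA 1) (rootsA 1)) ∧
      (∀ i, i = 2 ∨ i = 3 → (C i).HasType
        (rootsA 1 ⊞ rootsA 1 ⊞ rootsA 1 ⊞ rootsA 1) (rootsA 2) (rootsA 1)) ∧
      TriplesInterchanged (C 0) (C 1) ∧ TriplesInterchanged (C 2) (C 3) ∧
      AllRegularHoms ψ ∧ (∀ i, tripleOf (ψ i) = C i) ∧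
      ComesFrom (ψ 0) [1, 3, 4] ∧ ComesFrom (ψ 1) [1, 3, 4] ∧
      ComesFrom (ψ 2) [3, 5] ∧ ComesFrom (ψ 3) [3, 5] ∧
      HomsInterchanged (ψ 0) (ψ 1) ∧ HomsInterchanged (ψ 2) (ψ 3)) ∧
    -- type `D₅`
    (∃ (C : Fin 1 → ClassTriple 5 k) (ψ : Fin 2 → (Alt5 →* PSO 5 k)),
      AllRegularTriples C ∧
      (C 0).HasType (rootsA 3 ⊞ rootsA 1 ⊞ rootsA 1) (rootsA 2 ⊞ rootsA 1 ⊞ rootsA 1)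
        (rootsA 1 ⊞ rootsA 1) ∧
      AllRegularHoms ψ ∧ (∀ i, tripleOf (ψ i) = C 0) ∧
      ComesFrom (ψ 0) [3, 3, 4] ∧ ComesFrom (ψ 1) [1, 4, 5]) ∧
    -- type `D₆`
    (∃ (C : Fin 3 → ClassTriple 6 k) (ψ : Fin 3 → (Alt5 →* PSO 6 k)),
      AllRegularTriples C ∧
      (C 0).HasType (rootsA 3 ⊞ rootsA 3) (rootsA 3 ⊞ rootsA 1 ⊞ rootsA 1)
        (rootsA 1 ⊞ rootsA 1 ⊞ rootsA 1 ⊞ rootsA 1) ∧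
      (∀ i, i = 1 ∨ i = 2 → (C i).HasType (rootsA 3 ⊞ rootsA 3)
        (rootsA 3 ⊞ rootsA 1 ⊞ rootsA 1) (rootsA 2 ⊞ rootsA 1)) ∧
      TriplesInterchanged (C 1) (C 2) ∧
      AllRegularHoms ψ ∧ (∀ i, tripleOf (ψ i) = C i) ∧
      ComesFrom (ψ 0) [1, 3, 3, 5] ∧ ComesFrom (ψ 1) [3, 4, 5] ∧ ComesFrom (ψ 2) [3, 4, 5] ∧
      HomsInterchanged (ψ 1) (ψ 2)) ∧
    -- type `D₈`
    (∃ (C : Fin 1 → ClassTriple 8 k) (ψ : Fin 1 → (Alt5 →* PSO 8 k)),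
      AllRegularTriples C ∧
      (C 0).HasType (rootsD 4 ⊞ rootsD 4) (rootsA 4 ⊞ rootsA 3)
        (rootsA 2 ⊞ rootsA 2 ⊞ rootsA 1 ⊞ rootsA 1) ∧
      AllRegularHoms ψ ∧ tripleOf (ψ 0) = C 0 ∧
      ComesFrom (ψ 0) [1, 3, 3, 4, 5]) ∧
    -- type `D_m` with `m = 7` or `m ≥ 9`
    (∀ m : ℕ, m = 7 ∨ 9 ≤ m →
      (∀ C : ClassTriple m k, ¬ C.IsRegular) ∧ (∀ ψ : Alt5 →* PSO m k, ¬ IsRegularHom ψ)) ∧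
    -- every regular homomorphism comes from a homomorphism to `SO_{2m}(k)`
    (∀ m : ℕ, 4 ≤ m → ∀ ψ : Alt5 →* PSO m k, IsRegularHom ψ →
      ∃ ρ : Alt5 →* SO2 m k, ψ = (proj m k).comp ρ) := by
  obtain ⟨S⟩ := nonempty_rootsOfUnity k p hp
  refine ⟨classification_D4 S, classification_D5 S, classification_D6 S, classification_D8 S, fun m hm => ⟨fun C hC => ?_,
    fun ψ hψ => ?_⟩, fun m hm ψ hψ => exists_lift_of_isRegularHom S hm hψ⟩
  · obtain ⟨_, _, _, _, _, _, _, -, h⟩ := exists_data_of_isRegular S (by omega) hC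
    exact not_isRegularData hm h
  · obtain ⟨_, _, _, _, _, _, _, -, h⟩ := exists_data_of_isRegularHom S (by omega) hψ
    exact not_isRegularData hm h
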